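/- Work in the Clifford algebra $\mathcal C(V_2)$ (the quaternions) with basis $1,e_1,e_2,e_3$, $e_i^2=-1$, $e_ie_j=-e_je_i$ for $i\ne j$, $e_3=e_1e_2$; vectors $(x,y,z)\in\mathbb R^3$ are identified with $xe_1+ye_2+ze_3$, and $\overline\sigma=e_3\sigma e_3$. Let $K(\xi)=-\frac{2}{4\pi}\frac{\xi}{|\xi|^3}$. For a parametrized surface $\xi=\xi(\alpha,\beta)$, $(\alpha,\beta)\in\mathbb R^2$, with normal $N=\xi_\alpha\times\xi_\beta$, put $$\mathfrak H f(\alpha,\beta)=\mathrm{p.v.}\iint K(\xi'-\xi)\,N'\,f'\,d\alpha'd\beta',\qquad \overline{\mathfrak H}f=e_3\mathfrak H(e_3f),\qquad \mathfrak K=\Re\,\mathfrak H \ \text{ on real valued functions, }\qquad N\times\nabla=\xi_\beta\partial_\alpha-\xi_\alpha\partial_\beta ,$$ where primes denote values at $(\alpha',\beta')$. Let $I\subset\mathbb R$ be an interval with non-empty interior, and let $\xi=xe_1+ye_2+ze_3\in C^3(I\times\mathbb R^2)$ together with a real valued $\mathfrak a$ solve the water wave system in Lagrangian coordinates $$\xi_{tt}+e_3=\mathfrak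 aN,\qquad \xi_t=\mathfrak H\xi_t\qquad (N=\xi_\alpha\times\xi_\beta).$$ Assume that, uniformly for $t$ in each compact subset of $I$: $|\xi(\alpha,\beta,t)-\xi(\alpha',\beta',t)|\ge c\,|(\alpha,\beta)-(\alpha',\beta')|$ for some $c>0$; $\xi_\alpha,\xi_\beta,\xi_t,\xi_{t\alpha},\xi_{t\beta}$ are bounded; $z$ is bounded in $L^p(\mathbb R^2)$ for some $1\le p<\infty$; and $z_\alpha,z_\beta,\xi_t,\xi_{tt}$ are bounded in $L^2(\mathbb R^2)$. Let $$k=\xi-(I+\mathfrak H)z\,e_3+\mathfrak Kz\,e_3 ,$$ and assume that for every $t\in I$ its $(e_1,e_2)$-components define a $C^1$ diffeomorphism $k(\cdot,t)=(k_1,k_2)$ of $\mathbb R^2$ with $J(k)=\partial_\alpha k_1\partial_\beta k_2-\partial_\alpha k_2\partial_\beta k_1>0$. Define $$\zeta=\xi\circ k^{-1},\quad \mathfrak z=z\circ k^{-1},\quad u=\xi_t\circ k^{-1}=u_1e_1+u_2e_2+u_3e_3,\quad w=\xi_{tt}\circ k^{-1},\quad b=k_t\circ k^{-1},\quad A\circ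 k=\mathfrak aJ(k),$$ let $\mathcal N=\zeta_\alpha\times\zeta_\beta$, let $\mathcal H$, $\overline{\mathcal H}$, $\mathcal K=\Re\mathcal H$ be the operators above for the surface $\zeta(\cdot,t)$, let $\lambda=(I+\mathcal H)\mathfrak z e_3-\mathcal K\mathfrak z e_3$, and let $b\cdot\nabla_\bot=b_1\partial_\alpha+b_2\partial_\beta$. (1) The scalar part and the $e_3$-component of $k$ vanish, all principal values and derivatives occurring below exist, and on $I\times\mathbb R^2$ $$b=\tfrac12(\mathcal H-\overline{\mathcal H})\overline u-[\partial_t+b\cdot\nabla_\bot,\mathcal H]\mathfrak z e_3+[\partial_t+b\cdot\nabla_\bot,\mathcal K]\mathfrak z e_3+\mathcal Ku_3e_3,$$ $$\begin{aligned}(A-1)e_3={}&\tfrac12(-\mathcal H+\overline{\mathcal H})\overline w+\tfrac12\big([\partial_t+b\cdot\nabla_\bot,\mathcal H]u-\overline{[\partial_t+b\cdot\nabla_\bot,\mathcal H]u}\big)+[A\mathcal N\times\nabla,\mathcal H]\mathfrak z e_3\\&-A\zeta_\beta\times(\partial_\alpha\mathcal K\mathfrak z e_3)+A\zeta_\alpha\times(\partial_\beta\mathcal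 K\mathfrak z e_3)+A\,\partial_\alpha\lambda\times\partial_\beta\lambda ,\end{aligned}$$ where $b$ is identified with $b_1e_1+b_2e_2$. (2) $b$ and $A-1$ are of quadratic and higher order: there are absolute constants $C,\varepsilon_0>0$ such that, for every solution as above, every $t\in I$ and every $0\le\varepsilon\le\varepsilon_0$, if at time $t$ each of $\partial_\alpha\lambda,\partial_\beta\lambda,u,w$ has sup norm, Lipschitz constant and $L^2$ norm at most $\varepsilon$, and $\partial_\alpha u,\partial_\beta u$ have $L^2$ norm at most $\varepsilon$, then $$|b(\cdot,t)|\le C\varepsilon^2\quad\text{and}\quad |A(\cdot,t)-1|\le C\varepsilon^2\qquad\text{on }\mathbb R^2 .$$ -/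

import Mathlib

open MeasureTheory Filter Topology

noncomputable section

namespace WaterWave

/-! ### Clifford algebra `C(V₂)`: the quaternions, with `e₁ = i`, `e₂ = j`, `e₃ = k = e₁ e₂` -/

/-- The parameter plane `ℝ²`, with the Euclidean norm and Lebesgue measure. -/
abbrev Plane : Type := EuclideanSpace ℝ (Fin 2)

/-- The Clifford algebra `C(V₂)`. -/
abbrev Cl : Type := Quaternion ℝ

def e₁ : Cl := ⟨0, 1, 0, 0⟩
def e₂ : Cl := ⟨0, 0, 1, 0⟩
def e₃ : Cl := ⟨0, 0, 0, 1⟩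

/-- `σ̄ = e₃ σ e₃` (this is not the quaternionic conjugate). -/
def bar (σ : Cl) : Cl := e₃ * σ * e₃

/-- The cross product of (the vector parts of) two Clifford numbers. -/
def cross (σ τ : Cl) : Cl :=
  ⟨0, σ.imJ * τ.imK - σ.imK * τ.imJ, σ.imK * τ.imI - σ.imI * τ.imK,
    σ.imI * τ.imJ - σ.imJ * τ.imI⟩

/-- The pair of `e₁`, `e₂` components. -/
def toPlane (σ : Cl) : Plane := !₂[σ.imI, σ.imJ]

/-! ### Derivatives -/

/-- Partial derivatives in the plane: `pd 0 = ∂_α`, `pd 1 = ∂_β`. -/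
def pd {V : Type*} [NormedAddCommGroup V] [NormedSpace ℝ V] (i : Fin 2) (f : Plane → V)
    (x : Plane) : V :=
  fderiv ℝ f x (EuclideanSpace.single i 1)

/-- The time derivative `∂_t` of a function on `I × ℝ²`, where `I` is the time interval
(one-sided at an endpoint of `I` that belongs to `I`). -/
def dt {V : Type*} [NormedAddCommGroup V] [NormedSpace ℝ V] (I : Set ℝ) (f : ℝ → Plane → V)
    (t : ℝ) (x : Plane) : V :=
  derivWithin (fun s => f s x) I t

/-! ### Layer potentials on a parametrized surface `S : ℝ² → ℝ³ ⊂ C(V₂)` -/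

/-- The normal `S_α × S_β`. -/
def normal (S : Plane → Cl) (x : Plane) : Cl := cross (pd 0 S x) (pd 1 S x)

/-- `K(ξ) = -(2/ω₃) ξ/|ξ|³`, with `ω₃ = 4π` the area of the unit sphere of `ℝ³`. -/
def kernelK (σ : Cl) : Cl := (-(2 / (4 * Real.pi)) * (‖σ‖ ^ 3)⁻¹) • σ

/-- The integrand `K(S(y) - S(x)) (S_α × S_β)(y) f(y)` of the Hilbert transform. -/
def hilbertIntegrand (S f : Plane → Cl) (x y : Plane) : Cl :=
  kernelK (S y - S x) * normal S y * f y

/-- The integral over `|y - x| ≥ r`. -/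
def hilbertTrunc (S f : Plane → Cl) (x : Plane) (r : ℝ) : Cl :=
  ∫ y in (Metric.ball x r)ᶜ, hilbertIntegrand S f x y

/-- The Hilbert transform `(H_S f)(x)`: the principal value integral. -/
def hilbert (S f : Plane → Cl) (x : Plane) : Cl :=
  limUnder (𝓝[>] (0 : ℝ)) (hilbertTrunc S f x)

/-- The principal value integral defining `(H_S f)(x)` exists. -/
def HilbertExists (S f : Plane → Cl) (x : Plane) : Prop :=
  (∀ r : ℝ, 0 < r → IntegrableOn (hilbertIntegrand S f x) (Metric.ball x r)ᶜ) ∧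
    ∃ L : Cl, Tendsto (hilbertTrunc S f x) (𝓝[>] (0 : ℝ)) (𝓝 L)

/-- `H̄_S f = e₃ H_S (e₃ f)`. -/
def hilbertBar (S f : Plane → Cl) (x : Plane) : Cl :=
  e₃ * hilbert S (fun y => e₃ * f y) x

/-- The double layer potential operator `K_S = Re H_S` on real valued functions. -/
def doubleLayer (S : Plane → Cl) (f : Plane → ℝ) (x : Plane) : ℝ :=
  (hilbert S (fun y => (f y : Cl)) x).re

/-- The operator `c N × ∇ = c (S_β ∂_α - S_α ∂_β)`, with the Clifford product. -/
def crossNabla (S : Plane → Cl) (c : Plane → ℝ) (f : Plane → Cl) (x : Plane) : Cl :=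
  c x • (pd 1 S x * pd 0 f x - pd 0 S x * pd 1 f x)

/-- The function `f e₃`. -/
def vert (f : Plane → ℝ) (x : Plane) : Cl := f x • e₃

/-! ### The water wave system in Lagrangian coordinates, on a time interval `I` -/

/-- The height `z` of the interface. -/
def height (ξ : ℝ → Plane → Cl) (t : ℝ) (x : Plane) : ℝ := (ξ t x).imK

/-- `(ξ, 𝔞)` is a (classical) solution of `ξ_tt + e₃ = 𝔞 N`, `ξ_t = H ξ_t` on `I`. -/
structure IsSolution (I : Set ℝ) (ξ : ℝ → Plane → Cl) (𝔞 : ℝ → Plane → ℝ) : Prop where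
  smooth : ContDiffOn ℝ 3 (fun q : ℝ × Plane => ξ q.1 q.2) (I ×ˢ Set.univ)
  isVector : ∀ t ∈ I, ∀ x, (ξ t x).re = 0
  momentum : ∀ t ∈ I, ∀ x, dt I (dt I ξ) t x + e₃ = 𝔞 t x • normal (ξ t) x
  analytic : ∀ t ∈ I, ∀ x, hilbert (ξ t) (dt I ξ t) x = dt I ξ t x

/-- Locally uniformly in time, the interface is chord-arc (in particular non-self-intersecting),
the interface and its velocity have bounded first derivatives, and the height, the steepness,
the velocity and the acceleration decay at spatial infinity in an integral sense. -/
structure IsRegular (I : Set ℝ) (ξ : ℝ → Plane → Cl) : Prop where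
  bounds : ∀ J ⊆ I, IsCompact J → ∃ (p : ENNReal) (c M : ℝ), 1 ≤ p ∧ p ≠ ⊤ ∧ 0 < c ∧
    ∀ t ∈ J,
      (∀ x y, c * ‖x - y‖ ≤ ‖ξ t x - ξ t y‖) ∧
      (∀ i x, ‖pd i (ξ t) x‖ ≤ M) ∧
      (∀ x, ‖dt I ξ t x‖ ≤ M) ∧
      (∀ i x, ‖pd i (dt I ξ t) x‖ ≤ M) ∧
      eLpNorm (height ξ t) p volume ≤ ENNReal.ofReal M ∧
      (∀ i, eLpNorm (pd i (height ξ t)) 2 volume ≤ ENNReal.ofReal M) ∧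
      eLpNorm (dt I ξ t) 2 volume ≤ ENNReal.ofReal M ∧
      eLpNorm (dt I (dt I ξ) t) 2 volume ≤ ENNReal.ofReal M

/-! ### The change of coordinates -/

/-- `k = ξ - (I + H) z e₃ + (Re H) z e₃`, as a Clifford valued function. -/
def kMap (ξ : ℝ → Plane → Cl) (t : ℝ) (x : Plane) : Cl :=
  ξ t x - (vert (height ξ t) x + hilbert (ξ t) (vert (height ξ t)) x)
    + doubleLayer (ξ t) (height ξ t) x • e₃

/-- `k = (k₁, k₂)` as a map of the plane. -/
def kPlane (ξ : ℝ → Plane → Cl) (t : ℝ) (x : Plane) : Plane := toPlane (kMap ξ t x)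

/-- The Jacobian `∂_α g₁ ∂_β g₂ - ∂_α g₂ ∂_β g₁`. -/
def jacobian (g : Plane → Plane) (x : Plane) : ℝ :=
  pd 0 g x 0 * pd 1 g x 1 - pd 0 g x 1 * pd 1 g x 0

/-- At each time, `k` is a `C¹` diffeomorphism of the plane with positive Jacobian. -/
def IsCoordChange (I : Set ℝ) (ξ : ℝ → Plane → Cl) : Prop :=
  ∀ t ∈ I, Function.Bijective (kPlane ξ t) ∧ ContDiff ℝ 1 (kPlane ξ t) ∧
    ∀ x, 0 < jacobian (kPlane ξ t) x

/-- `k⁻¹(·, t)`. -/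
def kInv (ξ : ℝ → Plane → Cl) (t : ℝ) : Plane → Plane := Function.invFun (kPlane ξ t)

/-- `ζ = ξ ∘ k⁻¹`. -/
def zeta (ξ : ℝ → Plane → Cl) (t : ℝ) (x : Plane) : Cl := ξ t (kInv ξ t x)

/-- `u = ξ_t ∘ k⁻¹`. -/
def vel (I : Set ℝ) (ξ : ℝ → Plane → Cl) (t : ℝ) (x : Plane) : Cl := dt I ξ t (kInv ξ t x)

/-- `w = ξ_tt ∘ k⁻¹`. -/
def acc (I : Set ℝ) (ξ : ℝ → Plane → Cl) (t : ℝ) (x : Plane) : Cl :=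
  dt I (dt I ξ) t (kInv ξ t x)

/-- `b = k_t ∘ k⁻¹`. -/
def bCoef (I : Set ℝ) (ξ : ℝ → Plane → Cl) (t : ℝ) (x : Plane) : Plane :=
  dt I (kPlane ξ) t (kInv ξ t x)

/-- `A`, determined by `A ∘ k = 𝔞 J(k)`. -/
def aCoef (ξ : ℝ → Plane → Cl) (𝔞 : ℝ → Plane → ℝ) (t : ℝ) (x : Plane) : ℝ :=
  𝔞 t (kInv ξ t x) * jacobian (kPlane ξ t) (kInv ξ t x)

/-- The third component of `ζ`. -/
def zh (ξ : ℝ → Plane → Cl) (t : ℝ) (x : Plane) : ℝ := (zeta ξ t x).imK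

/-- `λ = (I + ℋ) 𝔷 e₃ - 𝒦 𝔷 e₃`, where `ℋ`, `𝒦` are the operators of the surface `ζ(·, t)`. -/
def lam (ξ : ℝ → Plane → Cl) (t : ℝ) (x : Plane) : Cl :=
  vert (zh ξ t) x + hilbert (zeta ξ t) (vert (zh ξ t)) x
    - doubleLayer (zeta ξ t) (zh ξ t) x • e₃

/-- The material derivative `∂_t + b · ∇_⊥`. -/
def matD {V : Type*} [NormedAddCommGroup V] [NormedSpace ℝ V] (I : Set ℝ) (ξ : ℝ → Plane → Cl)
    (f : ℝ → Plane → V) (t : ℝ) (x : Plane) : V :=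
  dt I f t x + (bCoef I ξ t x 0 • pd 0 (f t) x + bCoef I ξ t x 1 • pd 1 (f t) x)

/-- The commutator `[∂_t + b · ∇_⊥, ℋ] f`. -/
def commH (I : Set ℝ) (ξ : ℝ → Plane → Cl) (f : ℝ → Plane → Cl) (t : ℝ) (x : Plane) : Cl :=
  matD I ξ (fun s => hilbert (zeta ξ s) (f s)) t x - hilbert (zeta ξ t) (matD I ξ f t) x

/-- The commutator `[∂_t + b · ∇_⊥, 𝒦] f`, for real valued `f`. -/
def commK (I : Set ℝ) (ξ : ℝ → Plane → Cl) (f : ℝ → Plane → ℝ) (t : ℝ) (x : Plane) : ℝ :=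
  matD I ξ (fun s => doubleLayer (zeta ξ s) (f s)) t x
    - doubleLayer (zeta ξ t) (matD I ξ f t) x

/-- The commutator `[A 𝒩 × ∇, ℋ] f`. -/
def commN (ξ : ℝ → Plane → Cl) (𝔞 : ℝ → Plane → ℝ) (f : ℝ → Plane → Cl) (t : ℝ)
    (x : Plane) : Cl :=
  crossNabla (zeta ξ t) (aCoef ξ 𝔞 t) (hilbert (zeta ξ t) (f t)) x
    - hilbert (zeta ξ t) (crossNabla (zeta ξ t) (aCoef ξ 𝔞 t) (f t)) x

/-- The right hand side of the formula for `b = b₁ e₁ + b₂ e₂`. -/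
def bFormula (I : Set ℝ) (ξ : ℝ → Plane → Cl) (t : ℝ) (x : Plane) : Cl :=
  (1 / 2 : ℝ) • (hilbert (zeta ξ t) (fun y => bar (vel I ξ t y)) x
      - hilbertBar (zeta ξ t) (fun y => bar (vel I ξ t y)) x)
    - commH I ξ (fun s => vert (zh ξ s)) t x
    + commK I ξ (zh ξ) t x • e₃
    + doubleLayer (zeta ξ t) (fun y => (vel I ξ t y).imK) x • e₃

/-- The right hand side of the formula for `(A - 1) e₃`. -/
def aFormula (I : Set ℝ) (ξ : ℝ → Plane → Cl) (𝔞 : ℝ → Plane → ℝ) (t : ℝ) (x : Plane) : Cl :=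
  (1 / 2 : ℝ) • (-hilbert (zeta ξ t) (fun y => bar (acc I ξ t y)) x
      + hilbertBar (zeta ξ t) (fun y => bar (acc I ξ t y)) x)
    + (1 / 2 : ℝ) • (commH I ξ (vel I ξ) t x - bar (commH I ξ (vel I ξ) t x))
    + commN ξ 𝔞 (fun s => vert (zh ξ s)) t x
    - aCoef ξ 𝔞 t x •
        cross (pd 1 (zeta ξ t) x) (pd 0 (vert (doubleLayer (zeta ξ t) (zh ξ t))) x)
    + aCoef ξ 𝔞 t x •
        cross (pd 0 (zeta ξ t) x) (pd 1 (vert (doubleLayer (zeta ξ t) (zh ξ t))) x)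
    + aCoef ξ 𝔞 t x • cross (pd 0 (lam ξ t) x) (pd 1 (lam ξ t) x)

/-! ### Well-definedness of all terms, and smallness -/

/-- Every principal value integral in the definition of `k` and in the formulas for `b` and
`A - 1` exists at the point `x` and the time `t`. -/
def IntegralsExist (I : Set ℝ) (ξ : ℝ → Plane → Cl) (𝔞 : ℝ → Plane → ℝ) (t : ℝ)
    (x : Plane) : Prop :=
  HilbertExists (ξ t) (dt I ξ t) x ∧
  HilbertExists (ξ t) (vert (height ξ t)) x ∧
  HilbertExists (ξ t) (fun y => (height ξ t y : Cl)) x ∧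
  HilbertExists (zeta ξ t) (vert (zh ξ t)) x ∧
  HilbertExists (zeta ξ t) (fun y => (zh ξ t y : Cl)) x ∧
  HilbertExists (zeta ξ t) (matD I ξ (fun s => vert (zh ξ s)) t) x ∧
  HilbertExists (zeta ξ t) (fun y => ((matD I ξ (zh ξ) t y : ℝ) : Cl)) x ∧
  HilbertExists (zeta ξ t) (vel I ξ t) x ∧
  HilbertExists (zeta ξ t) (matD I ξ (vel I ξ) t) x ∧
  HilbertExists (zeta ξ t) (fun y => ((vel I ξ t y).imK : Cl)) x ∧
  HilbertExists (zeta ξ t) (fun y => bar (vel I ξ t y)) x ∧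
  HilbertExists (zeta ξ t) (fun y => e₃ * bar (vel I ξ t y)) x ∧
  HilbertExists (zeta ξ t) (fun y => bar (acc I ξ t y)) x ∧
  HilbertExists (zeta ξ t) (fun y => e₃ * bar (acc I ξ t y)) x ∧
  HilbertExists (zeta ξ t) (crossNabla (zeta ξ t) (aCoef ξ 𝔞 t) (vert (zh ξ t))) x

/-- `f` is differentiable in `(t, x)`, within the time interval `I`. -/
def DiffAt {V : Type*} [NormedAddCommGroup V] [NormedSpace ℝ V] (I : Set ℝ)
    (f : ℝ → Plane → V) (t : ℝ) (x : Plane) : Prop :=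
  DifferentiableWithinAt ℝ (fun q : ℝ × Plane => f q.1 q.2) (I ×ˢ Set.univ) (t, x)

/-- Every function that is differentiated in the definition of `b` and in the formulas is
differentiable. -/
def DerivativesExist (I : Set ℝ) (ξ : ℝ → Plane → Cl) (t : ℝ) (x : Plane) : Prop :=
  DiffAt I (kPlane ξ) t x ∧
  DiffAt I (zeta ξ) t x ∧
  DiffAt I (vel I ξ) t x ∧
  DiffAt I (lam ξ) t x ∧
  DiffAt I (fun s => hilbert (zeta ξ s) (vert (zh ξ s))) t x ∧
  DiffAt I (fun s => doubleLayer (zeta ξ s) (zh ξ s)) t x ∧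
  DiffAt I (fun s => hilbert (zeta ξ s) (vel I ξ s)) t x

/-- `f` is bounded by `ε` in `L^∞` and in `L²`, and `ε`-Lipschitz. -/
def SizeLE (ε : ℝ) (f : Plane → Cl) : Prop :=
  (∀ x, ‖f x‖ ≤ ε) ∧ (∀ x y, ‖f x - f y‖ ≤ ε * ‖x - y‖) ∧
    eLpNorm f 2 volume ≤ ENNReal.ofReal ε

/-- At time `t` the wave (in the new coordinates) has size at most `ε`: the derivatives of
`λ = ζ - P`, the velocity `u`, and the acceleration `w` have size at most `ε`, and the derivatives
of `u` are bounded by `ε` in `L²`. -/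
structure WaveSizeLE (I : Set ℝ) (ξ : ℝ → Plane → Cl) (t ε : ℝ) : Prop where
  slope : ∀ i, SizeLE ε (pd i (lam ξ t))
  velocity : SizeLE ε (vel I ξ t)
  velocityDeriv : ∀ i, eLpNorm (pd i (vel I ξ t)) 2 volume ≤ ENNReal.ofReal ε
  acceleration : SizeLE ε (acc I ξ t)

end WaterWave

end

/-!
The formulas rest on three facts about the layer potential `H = H_S` of a surface `S`, with kernel
`K` and normal `N`.

* *Differentiation* (`FlowOn.hilbert_deriv`, `Admissible.cslab_hilbert`, `Admissible.hasPV`). If the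
  surface moves, `H f` is differentiable in `(t, x)`, and its derivative in a direction in which
  `S(y) - S(x)` has velocity `η(y)` is the principal value of
  `K (N f_t - (η × S_β) f_α + (η × S_α) f_β)`. Indeed, since `K` is Clifford analytic away from the
  origin (`regK'_cyclic`), the derivative of the kernel can be integrated by parts. To have no
  boundary terms at the singularity this is done for the regularized kernels
  `K_δ(σ) = c σ / (|σ|² + δ²)^{3/2}`, where the failure of `K_δ` to be harmonic contributes an
  approximate identity, integrated against a density that vanishes at the base point, and this
  disappears as `δ → 0` (`tendsto_regL`). All limits are uniform in the base point because the
  integrands are odd up to a term of order `1 / |y - x|` (`PVFamily.limit`).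
* *Tangential fields* (`HasPV.re_tangential`). For `τ = N × e₃ = z_α S_β - z_β S_α` the principal
  value of `K · τ` vanishes, because `K` is the gradient of the Newtonian potential. Hence
  `H(z e₃)` is a vector (`Wave.heightPot_re`), and `k` is horizontal.
* *Invariance* (`HasPV.chart`). Principal values over discs may be replaced by principal values
  over their images under a `C¹` diffeomorphism: the images are close to ellipses, which are
  symmetric (`tendsto_integral_deformed`). So `H` commutes with the passage to the coordinates
  `k`, and the material derivative of `f ∘ k⁻¹` is `f_t ∘ k⁻¹` (`Wave.matD_pull`).

With these, the formula for `b` is the derivative in time of the definition of `k`, because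
`ξ_t = H ξ_t` turns the first term on the right into the horizontal part of
`ξ_t - H(z_t e₃)` (`Wave.b_formula`). For `A`, put `Λ = ξ - k`, so that
`J(k) e₃ = (ξ - Λ)_α × (ξ - Λ)_β`; this is expanded, multiplied by `𝔞`, and `𝔞 N = ξ_tt + e₃` is
used (`Wave.a_formula`).

For the smallness, `b` and the remainder in `A - 1` are written as principal values over `ζ` whose
integrands are visibly quadratic (`horizontal_identity`, `vertical_identity`). The term that is
linear at first sight is absorbed by a multiple of the vanishing integral of `K · τ` for `b`, and
for `A` by the fact that `𝒩` is parallel to `w + e₃`. What remains is `K · 𝒩` times `u` or `w`, or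
`K` times a difference of `u` or `w` times a first derivative of `λ` or `u`. As `ζ` is close to a
plane, `|K · 𝒩|` is at most `C ε min(|h|⁻¹, |h|⁻²)`, where `h` is the difference of the parameters,
so the integrands are bounded by `ε² / |h|` near the singularity and by `ε |h|⁻²` times a function
of size `ε` in `L²` away from it (`exists_pval_bound`).
-/

noncomputable section

namespace WaterWave

/-! ### Algebra of the Clifford numbers -/

theorem norm_sq_eq (σ : Cl) : ‖σ‖ ^ 2 = σ.re ^ 2 + σ.imI ^ 2 + σ.imJ ^ 2 + σ.imK ^ 2 := by
  rw [sq, ← Quaternion.normSq_eq_norm_mul_self, Quaternion.normSq_def']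

theorem inner_eq (σ τ : Cl) :
    inner ℝ σ τ = σ.re * τ.re + σ.imI * τ.imI + σ.imJ * τ.imJ + σ.imK * τ.imK := by
  rw [Quaternion.inner_def]; simp

theorem abs_re_le (σ : Cl) : |σ.re| ≤ ‖σ‖ :=
  abs_le_of_sq_le_sq (by rw [norm_sq_eq]; nlinarith [sq_nonneg σ.imI, sq_nonneg σ.imJ, sq_nonneg σ.imK]) (norm_nonneg _)

theorem abs_imI_le (σ : Cl) : |σ.imI| ≤ ‖σ‖ :=
  abs_le_of_sq_le_sq (by rw [norm_sq_eq]; nlinarith [sq_nonneg σ.re, sq_nonneg σ.imJ, sq_nonneg σ.imK]) (norm_nonneg _)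

theorem abs_imJ_le (σ : Cl) : |σ.imJ| ≤ ‖σ‖ :=
  abs_le_of_sq_le_sq (by rw [norm_sq_eq]; nlinarith [sq_nonneg σ.re, sq_nonneg σ.imI, sq_nonneg σ.imK]) (norm_nonneg _)

theorem abs_imK_le (σ : Cl) : |σ.imK| ≤ ‖σ‖ :=
  abs_le_of_sq_le_sq (by rw [norm_sq_eq]; nlinarith [sq_nonneg σ.re, sq_nonneg σ.imI, sq_nonneg σ.imJ]) (norm_nonneg _)

@[simp] theorem cross_re (σ τ : Cl) : (cross σ τ).re = 0 := rfl
@[simp] theorem cross_imI (σ τ : Cl) :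
    (cross σ τ).imI = σ.imJ * τ.imK - σ.imK * τ.imJ := rfl
@[simp] theorem cross_imJ (σ τ : Cl) :
    (cross σ τ).imJ = σ.imK * τ.imI - σ.imI * τ.imK := rfl
@[simp] theorem cross_imK (σ τ : Cl) :
    (cross σ τ).imK = σ.imI * τ.imJ - σ.imJ * τ.imI := rfl

theorem norm_cross_le (σ τ : Cl) : ‖cross σ τ‖ ≤ ‖σ‖ * ‖τ‖ := by
  refine abs_le_of_sq_le_sq' ?_ (by positivity) |>.2
  rw [mul_pow, norm_sq_eq, norm_sq_eq, norm_sq_eq]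
  simp only [cross_re, cross_imI, cross_imJ, cross_imK]
  nlinarith [sq_nonneg (σ.imI * τ.imI + σ.imJ * τ.imJ + σ.imK * τ.imK), sq_nonneg σ.re,
    sq_nonneg τ.re, mul_nonneg (sq_nonneg σ.re) (sq_nonneg τ.re),
    mul_nonneg (sq_nonneg σ.re) (sq_nonneg τ.imI), mul_nonneg (sq_nonneg σ.re) (sq_nonneg τ.imJ),
    mul_nonneg (sq_nonneg σ.re) (sq_nonneg τ.imK), mul_nonneg (sq_nonneg τ.re) (sq_nonneg σ.imI),
    mul_nonneg (sq_nonneg τ.re) (sq_nonneg σ.imJ), mul_nonneg (sq_nonneg τ.re) (sq_nonneg σ.imK)]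

/-- The cross product as a continuous bilinear map. -/
def crossL : Cl →L[ℝ] Cl →L[ℝ] Cl :=
  LinearMap.mkContinuous₂ (LinearMap.mk₂ ℝ cross
    (by intros; ext <;> simp <;> ring) (by intros; ext <;> simp <;> ring)
    (by intros; ext <;> simp <;> ring) (by intros; ext <;> simp <;> ring)) 1
    (by intro a b; simpa using norm_cross_le a b)

@[simp] theorem crossL_apply (σ τ : Cl) : crossL σ τ = cross σ τ := rfl

/-- The real part as a continuous linear map. -/
def reL : Cl →L[ℝ] ℝ :=
  LinearMap.mkContinuous ⟨⟨fun σ => σ.re, by intros; simp⟩, by intros; simp⟩ 1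
    (fun σ => by rw [one_mul]; exact abs_re_le σ)
/-- The `e₁` component as a continuous linear map. -/
def imIL : Cl →L[ℝ] ℝ :=
  LinearMap.mkContinuous ⟨⟨fun σ => σ.imI, by intros; simp⟩, by intros; simp⟩ 1
    (fun σ => by rw [one_mul]; exact abs_imI_le σ)
/-- The `e₂` component as a continuous linear map. -/
def imJL : Cl →L[ℝ] ℝ :=
  LinearMap.mkContinuous ⟨⟨fun σ => σ.imJ, by intros; simp⟩, by intros; simp⟩ 1
    (fun σ => by rw [one_mul]; exact abs_imJ_le σ)
/-- The `e₃` component as a continuous linear map. -/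
def imKL : Cl →L[ℝ] ℝ :=
  LinearMap.mkContinuous ⟨⟨fun σ => σ.imK, by intros; simp⟩, by intros; simp⟩ 1
    (fun σ => by rw [one_mul]; exact abs_imK_le σ)

@[simp] theorem reL_apply (σ : Cl) : reL σ = σ.re := rfl
@[simp] theorem imIL_apply (σ : Cl) : imIL σ = σ.imI := rfl
@[simp] theorem imJL_apply (σ : Cl) : imJL σ = σ.imJ := rfl
@[simp] theorem imKL_apply (σ : Cl) : imKL σ = σ.imK := rfl

/-- Multiplication of the Clifford numbers as a continuous bilinear map. -/
def mulL : Cl →L[ℝ] Cl →L[ℝ] Cl := ContinuousLinearMap.mul ℝ Cl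

@[simp] theorem mulL_apply (σ τ : Cl) : mulL σ τ = σ * τ := rfl

/-! ### The regularized kernel -/

/-- `(|σ|² + δ²)^{1/2}`. -/
def regNorm (δ : ℝ) (σ : Cl) : ℝ := √(‖σ‖ ^ 2 + δ ^ 2)

/-- The regularization `-(2/ω₃) σ (|σ|² + δ²)^{-3/2}` of the kernel `K`, smooth for `δ ≠ 0`. -/
def regK (δ : ℝ) (σ : Cl) : Cl := (-(2 / (4 * Real.pi)) * (regNorm δ σ ^ 3)⁻¹) • σ

/-- The approximate identity `δ² (|σ|² + δ²)^{-5/2}`: the Dirac derivative of `regK δ` is a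
multiple of it. -/
def regL (δ : ℝ) (σ : Cl) : ℝ := δ ^ 2 * (regNorm δ σ ^ 5)⁻¹

theorem regNorm_zero (σ : Cl) : regNorm 0 σ = ‖σ‖ := by
  simp [regNorm]

theorem regK_zero (σ : Cl) : regK 0 σ = kernelK σ := by
  simp [regK, kernelK, regNorm_zero]

theorem regK_neg (δ : ℝ) (σ : Cl) : regK δ (-σ) = -regK δ σ := by
  simp [regK, regNorm]

theorem regL_neg (δ : ℝ) (σ : Cl) : regL δ (-σ) = regL δ σ := by
  simp [regL, regNorm]

theorem regNorm_nonneg (δ : ℝ) (σ : Cl) : 0 ≤ regNorm δ σ := Real.sqrt_nonneg _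

theorem regNorm_sq (δ : ℝ) (σ : Cl) : regNorm δ σ ^ 2 = ‖σ‖ ^ 2 + δ ^ 2 :=
  Real.sq_sqrt (by positivity)

theorem norm_le_regNorm (δ : ℝ) (σ : Cl) : ‖σ‖ ≤ regNorm δ σ :=
  Real.le_sqrt_of_sq_le (by nlinarith [sq_nonneg δ])

theorem abs_le_regNorm (δ : ℝ) (σ : Cl) : |δ| ≤ regNorm δ σ :=
  Real.le_sqrt_of_sq_le (by rw [sq_abs]; nlinarith [sq_nonneg ‖σ‖])

theorem regNorm_le (δ : ℝ) (σ : Cl) : regNorm δ σ ≤ ‖σ‖ + |δ| := by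
  refine Real.sqrt_le_iff.2 ⟨by positivity, ?_⟩
  nlinarith [sq_abs δ, mul_nonneg (norm_nonneg σ) (abs_nonneg δ)]

theorem regNorm_pos {δ : ℝ} {σ : Cl} (h : δ ≠ 0 ∨ σ ≠ 0) : 0 < regNorm δ σ := by
  rcases h with h | h
  · exact (abs_pos.2 h).trans_le (abs_le_regNorm _ _)
  · exact (norm_pos_iff.2 h).trans_le (norm_le_regNorm _ _)

theorem regNorm_sub_le (δ : ℝ) (σ τ : Cl) : |regNorm δ σ - regNorm δ τ| ≤ ‖σ - τ‖ := by
  have key : ∀ σ τ : Cl, regNorm δ σ ≤ regNorm δ τ + ‖σ - τ‖ := by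
    intro σ τ
    refine Real.sqrt_le_iff.2 ⟨add_nonneg (regNorm_nonneg _ _) (norm_nonneg _), ?_⟩
    have h1 := regNorm_sq δ τ
    have h2 := norm_le_regNorm δ τ
    have h3 : ‖σ‖ ≤ ‖τ‖ + ‖σ - τ‖ := by
      calc ‖σ‖ = ‖τ + (σ - τ)‖ := by congr 1; abel
        _ ≤ _ := norm_add_le _ _
    nlinarith [norm_nonneg σ, norm_nonneg (σ - τ), norm_nonneg τ]
  rw [abs_le]
  constructor
  · have := key τ σ; rw [norm_sub_rev] at this; linarith
  · have := key σ τ; linarith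

theorem abs_inv_pow_three_sub_le {a b μ : ℝ} (hμ : 0 < μ) (ha : μ ≤ a) (hb : μ ≤ b) :
    |(a ^ 3)⁻¹ - (b ^ 3)⁻¹| * b ≤ 3 * |a - b| * (μ ^ 3)⁻¹ := by
  have ha0 := hμ.trans_le ha
  have hb0 := hμ.trans_le hb
  have e : (a ^ 3)⁻¹ - (b ^ 3)⁻¹ = (b - a) * ((a ^ 2 + a * b + b ^ 2) * (a ^ 3 * b ^ 3)⁻¹) := by
    field_simp; ring
  have hp : 0 ≤ (a ^ 2 + a * b + b ^ 2) * (a ^ 3 * b ^ 3)⁻¹ := by positivity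
  rw [e, abs_mul, abs_sub_comm b a, abs_of_nonneg hp]
  have : (a ^ 2 + a * b + b ^ 2) * (a ^ 3 * b ^ 3)⁻¹ * b
      = a⁻¹ * (b⁻¹) ^ 2 + (a⁻¹) ^ 2 * b⁻¹ + (a⁻¹) ^ 3 := by
    field_simp
  have h1 : a⁻¹ ≤ μ⁻¹ := inv_anti₀ hμ ha
  have h2 : b⁻¹ ≤ μ⁻¹ := inv_anti₀ hμ hb
  have h1' : 0 ≤ a⁻¹ := by positivity
  have h2' : 0 ≤ b⁻¹ := by positivity
  have h3 : a⁻¹ * (b⁻¹) ^ 2 ≤ μ⁻¹ * (μ⁻¹) ^ 2 := by gcongr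
  have h4 : (a⁻¹) ^ 2 * b⁻¹ ≤ (μ⁻¹) ^ 2 * μ⁻¹ := by gcongr
  have h5 : (a⁻¹) ^ 3 ≤ (μ⁻¹) ^ 3 := by gcongr
  calc |a - b| * ((a ^ 2 + a * b + b ^ 2) * (a ^ 3 * b ^ 3)⁻¹) * b
      = |a - b| * (a⁻¹ * (b⁻¹) ^ 2 + (a⁻¹) ^ 2 * b⁻¹ + (a⁻¹) ^ 3) := by rw [← this]; ring
    _ ≤ |a - b| * (3 * (μ ^ 3)⁻¹) := by
        gcongr
        rw [← inv_pow]; nlinarith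
    _ = _ := by ring

theorem abs_inv_pow_five_sub_le {a b μ : ℝ} (hμ : 0 < μ) (ha : μ ≤ a) (hb : μ ≤ b) :
    |(a ^ 5)⁻¹ - (b ^ 5)⁻¹| ≤ 5 * |a - b| * (μ ^ 6)⁻¹ := by
  have ha0 := hμ.trans_le ha
  have hb0 := hμ.trans_le hb
  have h1 : a⁻¹ ≤ μ⁻¹ := inv_anti₀ hμ ha
  have h2 : b⁻¹ ≤ μ⁻¹ := inv_anti₀ hμ hb
  have h1' : 0 ≤ a⁻¹ := by positivity
  have h2' : 0 ≤ b⁻¹ := by positivity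
  have e : (a ^ 5)⁻¹ - (b ^ 5)⁻¹ = (b - a) * (a⁻¹ * (b⁻¹) ^ 5 + (a⁻¹) ^ 2 * (b⁻¹) ^ 4
      + (a⁻¹) ^ 3 * (b⁻¹) ^ 3 + (a⁻¹) ^ 4 * (b⁻¹) ^ 2 + (a⁻¹) ^ 5 * b⁻¹) := by
    field_simp; ring
  rw [e, abs_mul, abs_sub_comm b a, abs_of_nonneg (by positivity : (0:ℝ) ≤ a⁻¹ * (b⁻¹) ^ 5 + (a⁻¹) ^ 2 * (b⁻¹) ^ 4
      + (a⁻¹) ^ 3 * (b⁻¹) ^ 3 + (a⁻¹) ^ 4 * (b⁻¹) ^ 2 + (a⁻¹) ^ 5 * b⁻¹)]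
  calc _ ≤ |a - b| * (μ⁻¹ * (μ⁻¹) ^ 5 + (μ⁻¹) ^ 2 * (μ⁻¹) ^ 4
      + (μ⁻¹) ^ 3 * (μ⁻¹) ^ 3 + (μ⁻¹) ^ 4 * (μ⁻¹) ^ 2 + (μ⁻¹) ^ 5 * μ⁻¹) := by gcongr
    _ = _ := by rw [← inv_pow]; ring

theorem const_bound : |-(2 / (4 * Real.pi))| ≤ 1 := by
  have := Real.pi_gt_three
  rw [abs_neg, abs_of_nonneg (by positivity), div_le_one (by positivity)]
  linarith

theorem norm_regK_le (δ : ℝ) (σ : Cl) : ‖regK δ σ‖ ≤ (‖σ‖ ^ 2)⁻¹ := by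
  rcases eq_or_ne σ 0 with rfl | h
  · simp [regK]
  have h0 := norm_pos_iff.2 h
  have h1 := norm_le_regNorm δ σ
  rw [regK, norm_smul, Real.norm_eq_abs, abs_mul, abs_of_nonneg (a := (regNorm δ σ ^ 3)⁻¹)
    (inv_nonneg.2 (pow_nonneg (regNorm_nonneg _ _) _))]
  calc |-(2 / (4 * Real.pi))| * (regNorm δ σ ^ 3)⁻¹ * ‖σ‖ ≤ 1 * (‖σ‖ ^ 3)⁻¹ * ‖σ‖ := by
        gcongr
        · exact inv_nonneg.2 (pow_nonneg (regNorm_nonneg _ _) _)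
        · exact const_bound
    _ = _ := by field_simp

theorem norm_regK_sub_le {δ μ : ℝ} {σ τ : Cl} (hμ : 0 < μ) (hσ : μ ≤ ‖σ‖) (hτ : μ ≤ ‖τ‖) :
    ‖regK δ σ - regK δ τ‖ ≤ 4 * ‖σ - τ‖ * (μ ^ 3)⁻¹ := by
  have h1 := hσ.trans (norm_le_regNorm δ σ)
  have h2 := hτ.trans (norm_le_regNorm δ τ)
  have e : regK δ σ - regK δ τ = (-(2 / (4 * Real.pi))) • ((regNorm δ σ ^ 3)⁻¹ • (σ - τ)
      + ((regNorm δ σ ^ 3)⁻¹ - (regNorm δ τ ^ 3)⁻¹) • τ) := by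
    simp only [regK, smul_add, smul_sub, sub_smul, mul_smul]; abel
  rw [e, norm_smul, Real.norm_eq_abs]
  calc _ ≤ 1 * (‖(regNorm δ σ ^ 3)⁻¹ • (σ - τ)‖ +
      ‖((regNorm δ σ ^ 3)⁻¹ - (regNorm δ τ ^ 3)⁻¹) • τ‖) := by
        gcongr
        · exact const_bound
        · exact norm_add_le _ _
    _ ≤ 1 * ((μ ^ 3)⁻¹ * ‖σ - τ‖ + 3 * ‖σ - τ‖ * (μ ^ 3)⁻¹) := by
        gcongr
        · rw [norm_smul, Real.norm_of_nonneg (inv_nonneg.2 (pow_nonneg (regNorm_nonneg _ _) _))]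
          gcongr
        · rw [norm_smul, Real.norm_eq_abs]
          calc _ ≤ |(regNorm δ σ ^ 3)⁻¹ - (regNorm δ τ ^ 3)⁻¹| * regNorm δ τ := by
                gcongr; exact norm_le_regNorm _ _
            _ ≤ 3 * |regNorm δ σ - regNorm δ τ| * (μ ^ 3)⁻¹ := abs_inv_pow_three_sub_le hμ h1 h2
            _ ≤ _ := by gcongr; exact regNorm_sub_le _ _ _
    _ = _ := by ring

theorem norm_regK_sub_kernelK_le {δ : ℝ} {σ : Cl} (hσ : σ ≠ 0) :
    ‖regK δ σ - kernelK σ‖ ≤ 3 * |δ| * (‖σ‖ ^ 3)⁻¹ := by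
  have h0 := norm_pos_iff.2 hσ
  have h1 := norm_le_regNorm δ σ
  have e : regK δ σ - kernelK σ = (-(2 / (4 * Real.pi)) *
      ((regNorm δ σ ^ 3)⁻¹ - (‖σ‖ ^ 3)⁻¹)) • σ := by
    simp only [regK, kernelK, ← sub_smul]; congr 1; ring
  rw [e, norm_smul, Real.norm_eq_abs, abs_mul]
  calc _ ≤ 1 * |(regNorm δ σ ^ 3)⁻¹ - (‖σ‖ ^ 3)⁻¹| * ‖σ‖ := by
        gcongr; exact const_bound
    _ ≤ 3 * |regNorm δ σ - ‖σ‖| * (‖σ‖ ^ 3)⁻¹ := by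
        rw [one_mul]; exact abs_inv_pow_three_sub_le h0 h1 le_rfl
    _ ≤ _ := by
        have : |regNorm δ σ - ‖σ‖| ≤ |δ| := by
          rw [abs_of_nonneg (by linarith)]
          linarith [regNorm_le δ σ]
        gcongr

theorem regL_nonneg (δ : ℝ) (σ : Cl) : 0 ≤ regL δ σ := by
  have := regNorm_nonneg δ σ
  unfold regL; positivity

theorem regL_le {δ μ : ℝ} {σ : Cl} (hμ : 0 < μ) (hσ : μ ≤ ‖σ‖) : regL δ σ ≤ (μ ^ 3)⁻¹ := by
  have h1 := hσ.trans (norm_le_regNorm δ σ)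
  have h0 := hμ.trans_le h1
  have h2 : δ ^ 2 ≤ regNorm δ σ ^ 2 := by rw [regNorm_sq]; nlinarith [sq_nonneg ‖σ‖]
  calc regL δ σ ≤ regNorm δ σ ^ 2 * (regNorm δ σ ^ 5)⁻¹ := by unfold regL; gcongr
    _ = (regNorm δ σ ^ 3)⁻¹ := by field_simp
    _ ≤ _ := by gcongr

theorem regL_le' {δ μ : ℝ} {σ : Cl} (hμ : 0 < μ) (hσ : μ ≤ ‖σ‖) :
    regL δ σ ≤ δ ^ 2 * (μ ^ 5)⁻¹ := by
  have h1 := hσ.trans (norm_le_regNorm δ σ)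
  unfold regL; gcongr

theorem abs_regL_sub_le {δ μ : ℝ} {σ τ : Cl} (hμ : 0 < μ) (hσ : μ ≤ ‖σ‖) (hτ : μ ≤ ‖τ‖) :
    |regL δ σ - regL δ τ| ≤ 5 * ‖σ - τ‖ * (μ ^ 4)⁻¹ := by
  set ν := √(μ ^ 2 + δ ^ 2) with hν
  have hν2 : ν ^ 2 = μ ^ 2 + δ ^ 2 := Real.sq_sqrt (by positivity)
  have hνpos : 0 < ν := Real.sqrt_pos.2 (by positivity)
  have h1 : ν ≤ regNorm δ σ := Real.sqrt_le_sqrt (by gcongr)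
  have h2 : ν ≤ regNorm δ τ := Real.sqrt_le_sqrt (by gcongr)
  have hμν : μ ≤ ν := Real.le_sqrt_of_sq_le (by nlinarith [sq_nonneg δ])
  rw [regL, regL, ← mul_sub, abs_mul, abs_of_nonneg (sq_nonneg δ)]
  have hδ : δ ^ 2 ≤ ν ^ 2 := by rw [hν2]; nlinarith [sq_nonneg μ]
  calc _ ≤ ν ^ 2 * (5 * |regNorm δ σ - regNorm δ τ| * (ν ^ 6)⁻¹) :=
        mul_le_mul hδ (abs_inv_pow_five_sub_le hνpos h1 h2) (abs_nonneg _) (sq_nonneg _)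
    _ = 5 * |regNorm δ σ - regNorm δ τ| * (ν ^ 4)⁻¹ := by field_simp
    _ ≤ _ := by gcongr; exact regNorm_sub_le _ _ _

-- shortcut instances: the general search through the operator spaces is slow
instance : Module ℝ (Cl →L[ℝ] Cl) := ContinuousLinearMap.module
instance : Module ℝ (Cl →L[ℝ] ℝ) := ContinuousLinearMap.module

/-- The derivative of `regK δ` at `σ`. -/
def regK' (δ : ℝ) (σ : Cl) : Cl →L[ℝ] Cl :=
  (-(2 / (4 * Real.pi)) * (regNorm δ σ ^ 3)⁻¹) • ContinuousLinearMap.id ℝ Cl +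
    ((2 / (4 * Real.pi)) * (3 * (regNorm δ σ ^ 5)⁻¹)) • (innerSL ℝ σ).smulRight σ

theorem regK'_apply (δ : ℝ) (σ η : Cl) : regK' δ σ η =
    (-(2 / (4 * Real.pi)) * (regNorm δ σ ^ 3)⁻¹) • η +
    ((2 / (4 * Real.pi)) * (3 * (regNorm δ σ ^ 5)⁻¹) * inner ℝ σ η) • σ := by
  simp [regK', mul_smul]

theorem hasFDerivAt_regNorm {δ : ℝ} {σ : Cl} (h : δ ≠ 0 ∨ σ ≠ 0) :
    HasFDerivAt (regNorm δ) ((regNorm δ σ)⁻¹ • innerSL ℝ σ) σ := by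
  have h0 := regNorm_pos h
  have h1 : HasFDerivAt (fun σ : Cl => ‖σ‖ ^ 2 + δ ^ 2) (2 • innerSL ℝ σ) σ :=
    ((hasStrictFDerivAt_norm_sq σ).hasFDerivAt).add_const _
  have h2 := h1.sqrt (by
    have := regNorm_sq δ σ
    have h3 : 0 < regNorm δ σ ^ 2 := by positivity
    rw [← this]; exact h3.ne')
  refine h2.congr_fderiv (ContinuousLinearMap.ext fun η => ?_)
  rw [show regNorm δ σ = √(‖σ‖ ^ 2 + δ ^ 2) from rfl]
  simp
  ring

theorem hasFDerivAt_regK {δ : ℝ} {σ : Cl} (h : δ ≠ 0 ∨ σ ≠ 0) :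
    HasFDerivAt (regK δ) (regK' δ σ) σ := by
  have h0 := regNorm_pos h
  have h1 : HasDerivAt (fun r : ℝ => -(2 / (4 * Real.pi)) * (r ^ 3)⁻¹)
      (-(2 / (4 * Real.pi)) * (-(3 * regNorm δ σ ^ 2) / (regNorm δ σ ^ 3) ^ 2)) (regNorm δ σ) := by
    simpa using (((hasDerivAt_pow 3 (regNorm δ σ)).inv (by positivity)).const_mul
      (-(2 / (4 * Real.pi))))
  have h2 := (h1.comp_hasFDerivAt σ (hasFDerivAt_regNorm h)).smul (hasFDerivAt_id σ)
  refine h2.congr_fderiv (ContinuousLinearMap.ext fun η => ?_)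
  rw [regK'_apply]
  simp only [ContinuousLinearMap.add_apply, ContinuousLinearMap.smul_apply,
    ContinuousLinearMap.id_apply, ContinuousLinearMap.smulRight_apply, innerSL_apply_apply, id,
    smul_eq_mul, ContinuousLinearMap.neg_apply]
  congr 2
  simp
  field_simp

theorem contDiffAt_regNorm {δ : ℝ} {σ : Cl} {n : WithTop ℕ∞} (h : δ ≠ 0 ∨ σ ≠ 0) :
    ContDiffAt ℝ n (regNorm δ) σ := by
  have h0 := regNorm_pos h
  refine ContDiffAt.sqrt (((contDiff_norm_sq ℝ).contDiffAt).add contDiffAt_const) ?_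
  have h3 : 0 < regNorm δ σ ^ 2 := by positivity
  rw [← regNorm_sq]; exact h3.ne'

theorem contDiffAt_regK {δ : ℝ} {σ : Cl} {n : WithTop ℕ∞} (h : δ ≠ 0 ∨ σ ≠ 0) :
    ContDiffAt ℝ n (regK δ) σ := by
  have h0 := regNorm_pos h
  exact (contDiffAt_const.mul (((contDiffAt_regNorm h).pow 3).inv (by positivity))).smul
    contDiffAt_id

theorem norm_regK'_le (δ : ℝ) {σ : Cl} (η : Cl) (hσ : σ ≠ 0) :
    ‖regK' δ σ η‖ ≤ 4 * ‖η‖ * (‖σ‖ ^ 3)⁻¹ := by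
  have h0 := norm_pos_iff.2 hσ
  have h1 := norm_le_regNorm δ σ
  have h2 : 0 < regNorm δ σ := h0.trans_le h1
  have hc := const_bound
  rw [abs_neg] at hc
  rw [regK'_apply]
  refine (norm_add_le _ _).trans ?_
  have e1 : ‖(-(2 / (4 * Real.pi)) * (regNorm δ σ ^ 3)⁻¹) • η‖ ≤ 1 * (‖σ‖ ^ 3)⁻¹ * ‖η‖ := by
    rw [norm_smul, norm_mul, Real.norm_eq_abs, Real.norm_of_nonneg (by positivity)]
    gcongr; exact const_bound
  have e2 : ‖((2 / (4 * Real.pi)) * (3 * (regNorm δ σ ^ 5)⁻¹) * inner ℝ σ η) • σ‖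
      ≤ 1 * (3 * (‖σ‖ ^ 5)⁻¹) * (‖σ‖ * ‖η‖) * ‖σ‖ := by
    rw [norm_smul, norm_mul, norm_mul, Real.norm_eq_abs,
      Real.norm_of_nonneg (by positivity : 0 ≤ 3 * (regNorm δ σ ^ 5)⁻¹)]
    gcongr
    exact norm_inner_le_norm _ _
  calc _ ≤ 1 * (‖σ‖ ^ 3)⁻¹ * ‖η‖ + 1 * (3 * (‖σ‖ ^ 5)⁻¹) * (‖σ‖ * ‖η‖) * ‖σ‖ := add_le_add e1 e2
    _ = _ := by field_simp; ring

/-- The right Dirac derivative of `regK δ` is a multiple of `regL δ`; contracted with the volume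
form of three vectors it gives the cyclic sum below. For `δ = 0` it vanishes: `K` is Clifford
analytic away from the origin. -/
theorem regK'_cyclic {δ : ℝ} {σ a b c : Cl} (h : δ ≠ 0 ∨ σ ≠ 0) (hσ : σ.re = 0) (ha : a.re = 0)
    (hb : b.re = 0) (hc : c.re = 0) :
    regK' δ σ a * cross b c + regK' δ σ b * cross c a + regK' δ σ c * cross a b =
      ((6 / (4 * Real.pi) * regL δ σ * inner ℝ a (cross b c) : ℝ) : Cl) := by
  have h0 := regNorm_pos h
  have hs := regNorm_sq δ σ
  rw [norm_sq_eq, hσ] at hs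
  have e3 : (regNorm δ σ ^ 3)⁻¹ = regNorm δ σ ^ 2 * (regNorm δ σ ^ 5)⁻¹ := by field_simp
  obtain ⟨s, hs'⟩ : ∃ s, s = 6 / (4 * Real.pi) * regL δ σ * inner ℝ a (cross b c) := ⟨_, rfl⟩
  rw [← hs']
  simp only [regK'_apply, regL, e3, hs, inner_eq] at hs' ⊢
  generalize (regNorm δ σ ^ 5)⁻¹ = m at hs' ⊢
  simp only [cross_re, cross_imI, cross_imJ, cross_imK, ha] at hs'
  subst_vars
  ext <;> simp [-Quaternion.coe_mul, -Quaternion.coe_add, ha, hb, hc, hσ] <;> ring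

/-! ### Integrals over the plane with a singularity at one point -/

/-- The area of the unit disc. -/
def discArea : ℝ := (volume : Measure Plane).real (Metric.ball 0 1)

theorem discArea_nonneg : 0 ≤ discArea := measureReal_nonneg

theorem integrableOn_norm_inv_ball (ρ : ℝ) :
    IntegrableOn (fun h : Plane => ‖h‖⁻¹) (Metric.ball 0 ρ) := by
  rw [integrableOn_fun_norm_addHaar (volume : Measure Plane) (f := fun r : ℝ => r⁻¹)]
  simp only [finrank_euclideanSpace, Fintype.card_fin]
  refine (integrableOn_const (C := (1 : ℝ)) (by simp)).congr_fun (fun y hy => ?_) measurableSet_Ioo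
  have : (0 : ℝ) < y := hy.1
  simp [this.ne']

theorem integral_norm_inv_ball {ρ : ℝ} (hρ : 0 ≤ ρ) :
    ∫ h in Metric.ball (0 : Plane) ρ, ‖h‖⁻¹ = 2 * discArea * ρ := by
  have h1 := integral_fun_norm_addHaar (volume : Measure Plane)
    (Set.indicator (Set.Iio ρ) (fun r : ℝ => r⁻¹))
  have h2 : (fun x : Plane => Set.indicator (Set.Iio ρ) (fun r : ℝ => r⁻¹) ‖x‖)
      = Set.indicator (Metric.ball 0 ρ) (fun h : Plane => ‖h‖⁻¹) := by
    classical
    ext x; simp [Set.indicator_apply]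
  rw [h2, integral_indicator measurableSet_ball] at h1
  rw [h1]
  simp only [finrank_euclideanSpace, Fintype.card_fin]
  have h3 : ∫ y in Set.Ioi (0 : ℝ), y ^ (2 - 1) • Set.indicator (Set.Iio ρ) (fun r : ℝ => r⁻¹) y
      = ∫ y in Set.Ioi (0 : ℝ), Set.indicator (Set.Iio ρ) (fun _ => (1 : ℝ)) y := by
    refine setIntegral_congr_fun measurableSet_Ioi fun y hy => ?_
    have : (0 : ℝ) < y := hy
    by_cases hy' : y < ρ <;> simp [Set.indicator_apply, hy', this.ne']
  rw [h3, setIntegral_indicator measurableSet_Iio, Set.Ioi_inter_Iio]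
  simp [discArea, hρ, mul_assoc]

theorem integral_ball_neg {V : Type*} [NormedAddCommGroup V] [NormedSpace ℝ V]
    (f : Plane → V) {U : Set Plane} (hU : MeasurableSet U) (hs : ∀ h, -h ∈ U ↔ h ∈ U) :
    ∫ h in U, f (-h) = ∫ h in U, f h := by
  rw [← integral_indicator hU, ← integral_indicator hU,
    ← integral_neg_eq_self (Set.indicator U f)]
  classical
  congr 1; ext h
  simp [Set.indicator_apply, hs]

/-- An integral over a symmetric set near the origin only sees the even part of the integrand. -/
theorem norm_integral_symm_le {V : Type*} [NormedAddCommGroup V] [NormedSpace ℝ V]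
    {f : Plane → V} {U : Set Plane} (hU : MeasurableSet U) (hs : ∀ h, -h ∈ U ↔ h ∈ U)
    {ρ C : ℝ} (hρ : 0 ≤ ρ) (hC : 0 ≤ C) (hUρ : U ⊆ Metric.ball 0 ρ) (hf : IntegrableOn f U)
    (hsym : ∀ h ∈ U, h ≠ 0 → ‖f h + f (-h)‖ ≤ C * ‖h‖⁻¹) :
    ‖∫ h in U, f h‖ ≤ C * discArea * ρ := by
  have hf' : IntegrableOn (fun h => f (-h)) U := by
    rw [← integrable_indicator_iff hU] at hf ⊢
    classical
    refine hf.comp_neg.congr (Eventually.of_forall fun h => ?_)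
    simp [Set.indicator_apply, hs]
  have h1 : (2 : ℝ) • ∫ h in U, f h = ∫ h in U, (f h + f (-h)) := by
    rw [integral_add hf hf', integral_ball_neg f hU hs, two_smul]
  have h2 : ‖∫ h in U, (f h + f (-h))‖ ≤ ∫ h in U, C * ‖h‖⁻¹ := by
    refine norm_integral_le_of_norm_le (((integrableOn_norm_inv_ball ρ).mono_set hUρ).const_mul C) ?_
    have h0 : ∀ᵐ h : Plane ∂(volume.restrict U), h ≠ 0 :=
      ae_restrict_of_ae (by simp [ae_iff, Set.setOf_eq_eq_singleton])
    filter_upwards [ae_restrict_mem hU, h0] with h hh hh0 using hsym h hh hh0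
  have h3 : ∫ h in U, C * ‖h‖⁻¹ ≤ C * (2 * discArea * ρ) := by
    rw [integral_const_mul, ← integral_norm_inv_ball hρ]
    refine mul_le_mul_of_nonneg_left ?_ hC
    exact setIntegral_mono_set (integrableOn_norm_inv_ball ρ)
      (Eventually.of_forall fun h => by simp) (HasSubset.Subset.eventuallyLE hUρ)
  rw [← h1, norm_smul, Real.norm_of_nonneg (by norm_num : (0:ℝ) ≤ 2)] at h2
  nlinarith

/-- Principal values as limits of regularized integrals, uniformly in a parameter: near the
singularity only the even part counts, away from it there is convergence in `L¹`. -/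
theorem regularized_limit {ι V : Type*} [NormedAddCommGroup V] [NormedSpace ℝ V]
    {Φ : ℝ → ι → Plane → V} {Φ₀ : ι → Plane → V} {C : ℝ} (hC : 0 ≤ C)
    (hint : ∀ δ, 0 < δ → ∀ i, Integrable (Φ δ i))
    (hint₀ : ∀ i r, 0 < r → IntegrableOn (Φ₀ i) (Metric.ball 0 r)ᶜ)
    (hsym : ∀ δ, 0 < δ → ∀ i h, h ≠ 0 → ‖h‖ < 1 → ‖Φ δ i h + Φ δ i (-h)‖ ≤ C * ‖h‖⁻¹)
    (hsym₀ : ∀ i h, h ≠ 0 → ‖h‖ < 1 → ‖Φ₀ i h + Φ₀ i (-h)‖ ≤ C * ‖h‖⁻¹)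
    (hfar : ∀ ρ, 0 < ρ → ∀ ε, 0 < ε → ∃ δ₀, 0 < δ₀ ∧ ∀ δ, 0 < δ → δ < δ₀ → ∀ i,
      ∫ h in (Metric.ball 0 ρ)ᶜ, ‖Φ δ i h - Φ₀ i h‖ ≤ ε) :
    ∀ ε, 0 < ε → ∃ r₀, 0 < r₀ ∧ ∀ δ r, 0 < δ → δ < r₀ → 0 < r → r < r₀ → ∀ i,
      ‖(∫ h, Φ δ i h) - ∫ h in (Metric.ball 0 r)ᶜ, Φ₀ i h‖ ≤ ε := by
  intro ε hε
  have hD : 0 < C * discArea + 1 := by have := mul_nonneg hC discArea_nonneg; linarith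
  -- inside the ball of radius `ρ` both integrals are at most `C * discArea * ρ ≤ ε / 3`
  set ρ := min 1 (ε / (3 * (C * discArea + 1))) with hρdef
  have hρ : 0 < ρ := lt_min one_pos (by positivity)
  have hρε : C * discArea * ρ ≤ ε / 3 := by
    have h1 : ρ ≤ ε / (3 * (C * discArea + 1)) := min_le_right _ _
    calc C * discArea * ρ ≤ (C * discArea + 1) * (ε / (3 * (C * discArea + 1))) := by
          gcongr; linarith
      _ = ε / 3 := by field_simp
  obtain ⟨δ₀, hδ₀, hδ⟩ := hfar ρ hρ (ε / 3) (by positivity)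
  refine ⟨min δ₀ ρ, lt_min hδ₀ hρ, fun δ r hδ0 hδr hr hr' i => ?_⟩
  have hrρ : r < ρ := hr'.trans_le (min_le_right _ _)
  have hsub : ∀ h : Plane, ‖h‖ < ρ → ‖h‖ < 1 := fun h hh => hh.trans_le (min_le_left _ _)
  have e1 : ∫ h, Φ δ i h = (∫ h in Metric.ball 0 ρ, Φ δ i h) + ∫ h in (Metric.ball 0 ρ)ᶜ, Φ δ i h :=
    (integral_add_compl measurableSet_ball (hint δ hδ0 i)).symm
  have e2 : ∫ h in (Metric.ball 0 r)ᶜ, Φ₀ i h = (∫ h in (Metric.ball 0 r)ᶜ ∩ Metric.ball 0 ρ, Φ₀ i h)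
      + ∫ h in (Metric.ball 0 ρ)ᶜ, Φ₀ i h := by
    rw [← integral_inter_add_sdiff (s := (Metric.ball (0 : Plane) r)ᶜ) (t := Metric.ball 0 ρ)
      measurableSet_ball (hint₀ i r hr)]
    congr 2
    rw [Set.diff_eq, Set.inter_eq_right.2]
    exact Set.compl_subset_compl.2 (Metric.ball_subset_ball hrρ.le)
  have n1 : ‖∫ h in Metric.ball 0 ρ, Φ δ i h‖ ≤ ε / 3 :=
    (norm_integral_symm_le measurableSet_ball (by simp) hρ.le hC subset_rfl
      (hint δ hδ0 i).integrableOn fun h hh h0 =>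
        hsym δ hδ0 i h h0 (hsub h (by simpa using hh))).trans hρε
  have n2 : ‖∫ h in (Metric.ball 0 r)ᶜ ∩ Metric.ball 0 ρ, Φ₀ i h‖ ≤ ε / 3 :=
    (norm_integral_symm_le (measurableSet_ball.compl.inter measurableSet_ball) (by simp) hρ.le hC
      Set.inter_subset_right ((hint₀ i r hr).mono_set Set.inter_subset_left) fun h hh h0 =>
        hsym₀ i h h0 (hsub h (by simpa using hh.2))).trans hρε
  have n3 : ‖(∫ h in (Metric.ball 0 ρ)ᶜ, Φ δ i h) - ∫ h in (Metric.ball 0 ρ)ᶜ, Φ₀ i h‖ ≤ ε / 3 := by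
    rw [← integral_sub (hint δ hδ0 i).integrableOn (hint₀ i ρ hρ)]
    exact (norm_integral_le_integral_norm _).trans
      (hδ δ hδ0 (hδr.trans_le (min_le_left _ _)) i)
  rw [e1, e2]
  calc _ = ‖(∫ h in Metric.ball 0 ρ, Φ δ i h) - (∫ h in (Metric.ball 0 r)ᶜ ∩ Metric.ball 0 ρ, Φ₀ i h)
      + ((∫ h in (Metric.ball 0 ρ)ᶜ, Φ δ i h) - ∫ h in (Metric.ball 0 ρ)ᶜ, Φ₀ i h)‖ := by
        congr 1; abel
    _ ≤ ε / 3 + ε / 3 + ε / 3 :=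
        (norm_add_le _ _).trans (add_le_add ((norm_sub_le _ _).trans (add_le_add n1 n2)) n3)
    _ = ε := by ring

/-! ### The weight `|y - x|⁻²` at infinity -/

theorem memLp_one_add_norm_rpow {p q : ENNReal} (hpq : ENNReal.HolderConjugate p q)
    (hp : p ≠ ⊤) : MemLp (fun h : Plane => (1 + ‖h‖) ^ (-(2 - (p⁻¹).toReal))) q := by
  have hpq' : p⁻¹ + q⁻¹ = 1 := hpq.inv_add_inv_eq_one
  have hp1 : 1 ≤ p := hpq.one_le
  have hp0 : 0 < (p⁻¹).toReal := ENNReal.toReal_pos (by simpa using hp)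
    (ENNReal.inv_ne_top.2 (zero_lt_one.trans_le hp1).ne')
  have hple : (p⁻¹).toReal ≤ 1 := ENNReal.toReal_le_of_le_ofReal zero_le_one (by simpa using hp1)
  have hmeas : AEStronglyMeasurable (fun h : Plane => (1 + ‖h‖) ^ (-(2 - (p⁻¹).toReal))) volume := by
    refine (Continuous.rpow_const (by fun_prop) fun x => Or.inl ?_).aestronglyMeasurable
    positivity
  by_cases hq : q = ⊤
  · subst hq
    refine memLp_top_of_bound hmeas 1 (Eventually.of_forall fun h => ?_)
    rw [Real.norm_of_nonneg (by positivity)]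
    exact Real.rpow_le_one_of_one_le_of_nonpos (by simp) (by linarith)
  · have hq0 : q ≠ 0 := (zero_lt_one.trans_le hpq.symm.one_le).ne'
    rw [← integrable_norm_rpow_iff hmeas hq0 hq]
    have hqr : 0 < q.toReal := ENNReal.toReal_pos hq0 hq
    have e : (p⁻¹).toReal + (q.toReal)⁻¹ = 1 := by
      rw [← ENNReal.toReal_inv, ← ENNReal.toReal_add, hpq', ENNReal.toReal_one]
      · exact ENNReal.inv_ne_top.2 (zero_lt_one.trans_le hp1).ne'
      · exact ENNReal.inv_ne_top.2 hq0
    have e' : (p⁻¹).toReal * q.toReal = q.toReal - 1 := by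
      have : (p⁻¹).toReal = 1 - (q.toReal)⁻¹ := by linarith
      rw [this]; field_simp
    have hq1 : 1 < q.toReal := by
      have : 0 < (p⁻¹).toReal * q.toReal := by positivity
      linarith
    refine (integrable_one_add_norm (μ := (volume : Measure Plane))
      (r := (2 - (p⁻¹).toReal) * q.toReal) ?_).congr (Eventually.of_forall fun h => ?_)
    · simp only [finrank_euclideanSpace, Fintype.card_fin, Nat.cast_ofNat]; nlinarith
    · simp only
      rw [Real.norm_of_nonneg (by positivity), ← Real.rpow_mul (by positivity)]
      congr 1; ring

theorem inv_sq_le_weight {R r a : ℝ} (hR : 0 < R) (ha : 0 ≤ a) (hr : R ≤ r) :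
    (r ^ 2)⁻¹ ≤ ((1 + R⁻¹) ^ 2 * (1 + R) ^ (-a)) * (1 + r) ^ (-(2 - a)) := by
  have hy0 : 0 < r := hR.trans_le hr
  have e1 : (1 + r) ^ (-(2 - a)) = (1 + r) ^ a * ((1 + r) ^ 2)⁻¹ := by
    rw [show -(2 - a) = a + (-2) by ring, Real.rpow_add (by positivity),
      Real.rpow_neg (by positivity)]
    norm_num
  have e2 : (r ^ 2)⁻¹ ≤ (1 + R⁻¹) ^ 2 * ((1 + r) ^ 2)⁻¹ := by
    have h3 : 1 + r ≤ (1 + R⁻¹) * r := by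
      have : 1 ≤ R⁻¹ * r := by rw [inv_mul_eq_div, le_div_iff₀ hR]; linarith
      linarith
    have h4 : (1 + r) ^ 2 ≤ (1 + R⁻¹) ^ 2 * r ^ 2 := by rw [← mul_pow]; gcongr
    rw [← div_eq_mul_inv, inv_eq_one_div, div_le_div_iff₀ (by positivity) (by positivity)]
    linarith
  have e3 : 1 ≤ (1 + R) ^ (-a) * (1 + r) ^ a := by
    rw [Real.rpow_neg (by positivity), inv_mul_eq_div, one_le_div (by positivity)]
    gcongr
  rw [e1]
  calc (r ^ 2)⁻¹ ≤ (1 + R⁻¹) ^ 2 * ((1 + r) ^ 2)⁻¹ := e2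
    _ ≤ (1 + R⁻¹) ^ 2 * ((1 + r) ^ 2)⁻¹ * ((1 + R) ^ (-a) * (1 + r) ^ a) :=
        le_mul_of_one_le_right (by positivity) e3
    _ = _ := by ring

/-- `|y - x|⁻² f` is integrable away from `x` if `f ∈ L^p`, `p < ∞`, with uniform decay of the
tails. -/
theorem integrableOn_far {p : ENNReal} (hp1 : 1 ≤ p) (hp : p ≠ ⊤) :
    ∃ C a : ℝ, 0 ≤ C ∧ 0 < a ∧ ∀ (M : ℝ), 0 ≤ M → ∀ (f : Plane → Cl),
      AEStronglyMeasurable f volume → eLpNorm f p volume ≤ ENNReal.ofReal M →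
      ∀ (x : Plane) (R : ℝ), 0 < R →
        IntegrableOn (fun y => (‖y - x‖ ^ 2)⁻¹ * ‖f y‖) (Metric.ball x R)ᶜ ∧
        ∫ y in (Metric.ball x R)ᶜ, (‖y - x‖ ^ 2)⁻¹ * ‖f y‖ ≤
          C * M * ((1 + R⁻¹) ^ 2 * (1 + R) ^ (-a)) := by
  obtain ⟨q, hpq⟩ : ∃ q, ENNReal.HolderConjugate p q :=
    ⟨_, ENNReal.HolderConjugate.conjExponent hp1⟩
  obtain ⟨W, hW⟩ : ∃ W : Plane → ℝ, W = fun h => (1 + ‖h‖) ^ (-(2 - (p⁻¹).toReal)) := ⟨_, rfl⟩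
  have hWq : MemLp W q := hW ▸ memLp_one_add_norm_rpow hpq hp
  have hp0 : 0 < (p⁻¹).toReal := ENNReal.toReal_pos (by simpa using hp)
    (ENNReal.inv_ne_top.2 (zero_lt_one.trans_le hp1).ne')
  refine ⟨(eLpNorm W q volume).toReal, (p⁻¹).toReal, ENNReal.toReal_nonneg, hp0, ?_⟩
  intro M hM f hf hfM x R hR
  have hmp : MeasurePreserving (fun y : Plane => y - x) volume volume :=
    measurePreserving_sub_right volume x
  have hWx : MemLp (fun y => W (y - x)) q := hWq.comp_measurePreserving hmp
  have hWx' : eLpNorm (fun y => W (y - x)) q volume = eLpNorm W q volume :=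
    eLpNorm_comp_measurePreserving hWq.1 hmp
  haveI : ENNReal.HolderTriple q p 1 := hpq.symm
  have hfp : MemLp f p := ⟨hf, hfM.trans_lt ENNReal.ofReal_lt_top⟩
  have hprod : MemLp ((fun y => W (y - x)) • f) 1 := hfp.smul hWx
  have hint : Integrable (fun y => W (y - x) * ‖f y‖) := by
    refine (memLp_one_iff_integrable.1 hprod).norm.congr (Eventually.of_forall fun y => ?_)
    simp only [Pi.smul_apply', norm_smul]
    rw [Real.norm_of_nonneg (by simp only [hW]; positivity)]
  have hbound : ∫ y, W (y - x) * ‖f y‖ ≤ (eLpNorm W q volume).toReal * M := by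
    have h1 : eLpNorm ((fun y => W (y - x)) • f) 1 volume ≤
        eLpNorm W q volume * ENNReal.ofReal M := by
      refine (eLpNorm_smul_le_mul_eLpNorm (p := q) (q := p) hf hWx.1).trans ?_
      rw [hWx']; gcongr
    have h2 : ∫ y, W (y - x) * ‖f y‖ = (eLpNorm ((fun y => W (y - x)) • f) 1 volume).toReal := by
      rw [eLpNorm_one_eq_lintegral_enorm, ← integral_norm_eq_lintegral_enorm hprod.1]
      refine integral_congr_ae (Eventually.of_forall fun y => ?_)
      simp only [Pi.smul_apply', norm_smul]
      rw [Real.norm_of_nonneg (by simp only [hW]; positivity)]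
    rw [h2]
    refine (ENNReal.toReal_mono (ENNReal.mul_ne_top hWq.2.ne ENNReal.ofReal_ne_top) h1).trans ?_
    rw [ENNReal.toReal_mul, ENNReal.toReal_ofReal hM]
  have hpt : ∀ y ∈ (Metric.ball x R)ᶜ, (‖y - x‖ ^ 2)⁻¹ * ‖f y‖ ≤
      ((1 + R⁻¹) ^ 2 * (1 + R) ^ (-(p⁻¹).toReal)) * (W (y - x) * ‖f y‖) := by
    intro y hy
    rw [← mul_assoc]
    rw [hW]
    exact mul_le_mul_of_nonneg_right (inv_sq_le_weight hR hp0.le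
      (by simpa [dist_eq_norm] using hy)) (norm_nonneg _)
  have hint2 := (hint.const_mul ((1 + R⁻¹) ^ 2 * (1 + R) ^ (-(p⁻¹).toReal))).integrableOn
    (s := (Metric.ball x R)ᶜ)
  have hint3 : IntegrableOn (fun y => (‖y - x‖ ^ 2)⁻¹ * ‖f y‖) (Metric.ball x R)ᶜ := by
    refine hint2.mono' ?_ ?_
    · have : Measurable fun y : Plane => (‖y - x‖ ^ 2)⁻¹ := by fun_prop
      exact (this.aestronglyMeasurable.mul hf.norm).restrict
    · filter_upwards [ae_restrict_mem measurableSet_ball.compl] with y hy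
      rw [Real.norm_of_nonneg (by positivity)]
      exact hpt y hy
  refine ⟨hint3, ?_⟩
  calc _ ≤ ∫ y in (Metric.ball x R)ᶜ, ((1 + R⁻¹) ^ 2 * (1 + R) ^ (-(p⁻¹).toReal)) *
        (W (y - x) * ‖f y‖) := setIntegral_mono_on hint3 hint2 measurableSet_ball.compl hpt
    _ = ((1 + R⁻¹) ^ 2 * (1 + R) ^ (-(p⁻¹).toReal)) *
        ∫ y in (Metric.ball x R)ᶜ, W (y - x) * ‖f y‖ := integral_const_mul _ _
    _ ≤ ((1 + R⁻¹) ^ 2 * (1 + R) ^ (-(p⁻¹).toReal)) * ∫ y, W (y - x) * ‖f y‖ := by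
        refine mul_le_mul_of_nonneg_left ?_ (by positivity)
        exact setIntegral_le_integral hint (Eventually.of_forall fun y => by
          simp only [hW, Pi.zero_apply]; positivity)
    _ ≤ ((1 + R⁻¹) ^ 2 * (1 + R) ^ (-(p⁻¹).toReal)) * ((eLpNorm W q volume).toReal * M) := by
        gcongr
    _ = _ := by ring

/-! ### Singular integrals with the regularized kernels -/

theorem integral_compl_ball_add {V : Type*} [NormedAddCommGroup V] [NormedSpace ℝ V]
    (f : Plane → V) (x : Plane) (r : ℝ) :
    ∫ h in (Metric.ball 0 r)ᶜ, f (x + h) = ∫ y in (Metric.ball x r)ᶜ, f y := by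
  classical
  rw [← integral_indicator measurableSet_ball.compl, ← integral_indicator measurableSet_ball.compl,
    ← integral_add_left_eq_self (Set.indicator (Metric.ball x r)ᶜ f) x]
  congr 1; ext h
  simp [Set.indicator_apply, dist_eq_norm]

theorem integrableOn_compl_ball_add {V : Type*} [NormedAddCommGroup V]
    {f : Plane → V} {x : Plane} {r : ℝ} :
    IntegrableOn (fun h => f (x + h)) (Metric.ball 0 r)ᶜ ↔ IntegrableOn f (Metric.ball x r)ᶜ := by
  classical
  rw [← integrable_indicator_iff measurableSet_ball.compl,
    ← integrable_indicator_iff measurableSet_ball.compl]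
  have e : Set.indicator (Metric.ball (0 : Plane) r)ᶜ (fun h => f (x + h)) =
      fun h => Set.indicator (Metric.ball x r)ᶜ f (x + h) := by
    ext h; simp [Set.indicator_apply, dist_eq_norm]
  rw [e]
  exact ⟨fun h => by simpa using h.comp_add_left (-x), fun h => h.comp_add_left x⟩

/-- `|y - x|⁻² g` is integrable away from `x`. -/
def FarInt (g : Plane → Cl) (x : Plane) : Prop :=
  ∀ ρ, 0 < ρ → IntegrableOn (fun y => (‖y - x‖ ^ 2)⁻¹ * ‖g y‖) (Metric.ball x ρ)ᶜ

/-- A family of surfaces `S` with base points `x` and densities `g` for which the singular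
integrals `∫ K(S(y) - S(x)) g(y) dy` converge, uniformly over the family. -/
structure PVFamily {ι : Type*} (x : ι → Plane) (S g : ι → Plane → Cl) (c C : ℝ) : Prop where
  c_pos : 0 < c
  C_nonneg : 0 ≤ C
  chord : ∀ i y, c * ‖y - x i‖ ≤ ‖S i y - S i (x i)‖
  second : ∀ i h, ‖h‖ < 1 →
    ‖(S i (x i + h) - S i (x i)) + (S i (x i - h) - S i (x i))‖ ≤ C * ‖h‖ ^ 2
  bdd : ∀ i h, ‖h‖ < 1 → ‖g i (x i + h)‖ ≤ C
  lip : ∀ i h, ‖h‖ < 1 → ‖g i (x i + h) - g i (x i - h)‖ ≤ C * ‖h‖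
  contS : ∀ i, Continuous (S i)
  contg : ∀ i, Continuous (g i)
  far : ∀ ρ, 0 < ρ → ∃ D, ∀ i,
    IntegrableOn (fun y => (‖y - x i‖ ^ 2)⁻¹ * ‖g i y‖) (Metric.ball (x i) ρ)ᶜ ∧
    ∫ y in (Metric.ball (x i) ρ)ᶜ, (‖y - x i‖ ^ 2)⁻¹ * ‖g i y‖ ≤ D

theorem continuous_regK {δ : ℝ} (hδ : δ ≠ 0) : Continuous (regK δ) :=
  continuous_iff_continuousAt.2 fun _ => (contDiffAt_regK (n := 1) (Or.inl hδ)).continuousAt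

theorem continuous_regNorm (δ : ℝ) : Continuous (regNorm δ) := by
  unfold regNorm; fun_prop

theorem continuous_regL {δ : ℝ} (hδ : δ ≠ 0) : Continuous (regL δ) := by
  have := continuous_regNorm δ
  unfold regL
  refine continuous_const.mul (Continuous.inv₀ (by fun_prop) fun σ => ?_)
  exact pow_ne_zero _ (regNorm_pos (Or.inl hδ)).ne'

theorem stronglyMeasurable_regK_comp (δ : ℝ) {f : Plane → Cl} (hf : Continuous f) :
    StronglyMeasurable (fun y => regK δ (f y)) := by
  unfold regK
  have h1 : Continuous fun y => regNorm δ (f y) := (continuous_regNorm δ).comp hf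
  have h2 : Measurable fun y => -(2 / (4 * Real.pi)) * (regNorm δ (f y) ^ 3)⁻¹ :=
    ((h1.measurable.pow_const 3).inv).const_mul _
  exact h2.stronglyMeasurable.smul hf.stronglyMeasurable

/-- Away from the singular point the kernel is dominated by `|y - x|⁻²`. -/
theorem integrableOn_regK_mul {S g : Plane → Cl} {x : Plane} {c ρ : ℝ} (δ : ℝ) (hc : 0 < c)
    (hρ : 0 < ρ) (chord : ∀ y, c * ‖y - x‖ ≤ ‖S y - S x‖) (hS : Continuous S)
    (hg : AEStronglyMeasurable g)
    (hfar : IntegrableOn (fun y => (‖y - x‖ ^ 2)⁻¹ * ‖g y‖) (Metric.ball x ρ)ᶜ) :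
    IntegrableOn (fun y => regK δ (S y - S x) * g y) (Metric.ball x ρ)ᶜ := by
  refine (hfar.const_mul ((c ^ 2)⁻¹)).mono' ?_ ?_
  · exact ((stronglyMeasurable_regK_comp δ (hS.sub continuous_const)).aestronglyMeasurable.mul
      hg).restrict
  · filter_upwards [ae_restrict_mem measurableSet_ball.compl] with y hy
    have hy' : ρ ≤ ‖y - x‖ := by simpa [dist_eq_norm] using hy
    rw [norm_mul, ← mul_assoc]
    gcongr
    refine (norm_regK_le δ _).trans ?_
    rw [← mul_inv, ← mul_pow]
    have := chord y
    have h0 : 0 < ‖y - x‖ := hρ.trans_le hy'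
    gcongr

theorem norm_add_regK_le {c C δ : ℝ} {A B g₁ g₂ : Cl} {r : ℝ} (hc : 0 < c) (hr : 0 < r)
    (hA : c * r ≤ ‖A‖) (hB : c * r ≤ ‖B‖) (hAB : ‖A + B‖ ≤ C * r ^ 2) (hg : ‖g₁‖ ≤ C)
    (hg' : ‖g₁ - g₂‖ ≤ C * r) :
    ‖regK δ A * g₁ + regK δ B * g₂‖ ≤ (4 * C ^ 2 * (c ^ 3)⁻¹ + C * (c ^ 2)⁻¹) * r⁻¹ := by
  have hC : 0 ≤ C := (norm_nonneg _).trans hg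
  have e : regK δ A * g₁ + regK δ B * g₂ =
      (regK δ A - regK δ (-B)) * g₁ + regK δ (-B) * (g₁ - g₂) := by
    rw [regK_neg]; noncomm_ring
  have n1 : ‖regK δ A - regK δ (-B)‖ ≤ 4 * (C * r ^ 2) * ((c * r) ^ 3)⁻¹ := by
    refine (norm_regK_sub_le (mul_pos hc hr) hA (by rwa [norm_neg])).trans ?_
    rw [sub_neg_eq_add]; gcongr
  have n2 : ‖regK δ (-B)‖ ≤ ((c * r) ^ 2)⁻¹ := by
    refine (norm_regK_le δ _).trans ?_
    rw [norm_neg]; gcongr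
  rw [e]
  calc _ ≤ ‖regK δ A - regK δ (-B)‖ * ‖g₁‖ + ‖regK δ (-B)‖ * ‖g₁ - g₂‖ := by
        refine (norm_add_le _ _).trans ?_
        rw [norm_mul, norm_mul]
    _ ≤ 4 * (C * r ^ 2) * ((c * r) ^ 3)⁻¹ * C + ((c * r) ^ 2)⁻¹ * (C * r) := by gcongr
    _ = _ := by field_simp

theorem norm_add_regL_le {c C δ : ℝ} {A B g₁ g₂ : Cl} {r : ℝ} (hc : 0 < c) (hr : 0 < r)
    (hA : c * r ≤ ‖A‖) (hB : c * r ≤ ‖B‖) (hAB : ‖A + B‖ ≤ C * r ^ 2) (hg : ‖g₁‖ ≤ C * r)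
    (hg' : ‖g₁ + g₂‖ ≤ C * r ^ 2) :
    ‖regL δ A • g₁ + regL δ B • g₂‖ ≤ (5 * C ^ 2 * (c ^ 4)⁻¹ + C * (c ^ 3)⁻¹) * r⁻¹ := by
  have hC : 0 ≤ C := nonneg_of_mul_nonneg_left ((norm_nonneg _).trans hg) hr
  have e : regL δ A • g₁ + regL δ B • g₂ =
      (regL δ A - regL δ (-B)) • g₁ + regL δ (-B) • (g₁ + g₂) := by
    rw [regL_neg, sub_smul, smul_add]; abel
  have n1 : ‖regL δ A - regL δ (-B)‖ ≤ 5 * (C * r ^ 2) * ((c * r) ^ 4)⁻¹ := by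
    refine (abs_regL_sub_le (mul_pos hc hr) hA (by rwa [norm_neg])).trans ?_
    rw [sub_neg_eq_add]; gcongr
  have n2 : ‖regL δ (-B)‖ ≤ ((c * r) ^ 3)⁻¹ := by
    rw [Real.norm_of_nonneg (regL_nonneg _ _)]
    exact regL_le (mul_pos hc hr) (by rwa [norm_neg])
  rw [e]
  calc _ ≤ ‖regL δ A - regL δ (-B)‖ * ‖g₁‖ + ‖regL δ (-B)‖ * ‖g₁ + g₂‖ := by
        refine (norm_add_le _ _).trans ?_
        rw [norm_smul, norm_smul]
    _ ≤ 5 * (C * r ^ 2) * ((c * r) ^ 4)⁻¹ * (C * r) + ((c * r) ^ 3)⁻¹ * (C * r ^ 2) := by gcongr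
    _ = _ := by field_simp

section
variable {ι : Type*} {x : ι → Plane} {S g : ι → Plane → Cl} {c C : ℝ}

theorem PVFamily.integrableOn (H : PVFamily x S g c C) (δ : ℝ) (i : ι) {r : ℝ} (hr : 0 < r) :
    IntegrableOn (fun y => regK δ (S i y - S i (x i)) * g i y) (Metric.ball (x i) r)ᶜ := by
  obtain ⟨D, hD⟩ := H.far r hr
  exact integrableOn_regK_mul δ H.c_pos hr (H.chord i) (H.contS i)
    (H.contg i).aestronglyMeasurable (hD i).1

theorem PVFamily.integrable (H : PVFamily x S g c C) {δ : ℝ} (hδ : δ ≠ 0) (i : ι) :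
    Integrable (fun y => regK δ (S i y - S i (x i)) * g i y) := by
  rw [← integrableOn_univ, ← Set.union_compl_self (Metric.ball (x i) 1)]
  refine IntegrableOn.union ?_ (H.integrableOn δ i one_pos)
  have hc : Continuous (fun y => regK δ (S i y - S i (x i)) * g i y) :=
    ((continuous_regK hδ).comp ((H.contS i).sub continuous_const)).mul (H.contg i)
  exact (hc.continuousOn.integrableOn_compact (isCompact_closedBall (x i) 1)).mono_set
    Metric.ball_subset_closedBall

theorem PVFamily.symm_le (H : PVFamily x S g c C) (δ : ℝ) (i : ι) {h : Plane} (h0 : h ≠ 0)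
    (h1 : ‖h‖ < 1) :
    ‖regK δ (S i (x i + h) - S i (x i)) * g i (x i + h) +
      regK δ (S i (x i + -h) - S i (x i)) * g i (x i + -h)‖ ≤
      (4 * C ^ 2 * (c ^ 3)⁻¹ + C * (c ^ 2)⁻¹) * ‖h‖⁻¹ := by
  have hA := H.chord i (x i + h)
  have hB := H.chord i (x i + -h)
  rw [add_sub_cancel_left] at hA hB
  rw [norm_neg] at hB
  have h2 := H.second i h h1
  have h3 := H.lip i h h1
  rw [sub_eq_add_neg (x i) h] at h2 h3
  exact norm_add_regK_le H.c_pos (norm_pos_iff.2 h0) hA hB h2 (H.bdd i h h1) h3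

/-- The regularized singular integrals converge to the principal value, uniformly over the
family. -/
theorem PVFamily.limit (H : PVFamily x S g c C) :
    ∀ ε, 0 < ε → ∃ r₀, 0 < r₀ ∧ ∀ δ r, 0 < δ → δ < r₀ → 0 < r → r < r₀ → ∀ i,
      ‖(∫ y, regK δ (S i y - S i (x i)) * g i y) -
        ∫ y in (Metric.ball (x i) r)ᶜ, regK 0 (S i y - S i (x i)) * g i y‖ ≤ ε := by
  have hc := H.c_pos
  have hC := H.C_nonneg
  have key := regularized_limit (ι := ι) (V := Cl) (C := 4 * C ^ 2 * (c ^ 3)⁻¹ + C * (c ^ 2)⁻¹)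
    (Φ := fun δ i h => regK δ (S i (x i + h) - S i (x i)) * g i (x i + h))
    (Φ₀ := fun i h => regK 0 (S i (x i + h) - S i (x i)) * g i (x i + h)) (by positivity)
    (fun δ hδ i => (H.integrable hδ.ne' i).comp_add_left (x i))
    (fun i r hr => integrableOn_compl_ball_add.2 (H.integrableOn 0 i hr))
    (fun δ _ i h => H.symm_le δ i) (fun i h => H.symm_le 0 i) ?_
  · intro ε hε
    obtain ⟨r₀, h0, h⟩ := key ε hε
    refine ⟨r₀, h0, fun δ r h1 h2 h3 h4 i => ?_⟩
    have := h δ r h1 h2 h3 h4 i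
    rwa [integral_add_left_eq_self (fun y => regK δ (S i y - S i (x i)) * g i y) (x i),
      integral_compl_ball_add (fun y => regK 0 (S i y - S i (x i)) * g i y)] at this
  · intro ρ hρ ε hε
    obtain ⟨D, hD⟩ := H.far ρ hρ
    set E := 3 * (c ^ 3)⁻¹ * ρ⁻¹ * |D| with hE
    have hE0 : 0 ≤ E := by positivity
    refine ⟨ε / (E + 1), by positivity, fun δ hδ hδ' i => ?_⟩
    rw [integral_compl_ball_add (fun y => ‖regK δ (S i y - S i (x i)) * g i y -
      regK 0 (S i y - S i (x i)) * g i y‖)]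
    have hb : ∀ y ∈ (Metric.ball (x i) ρ)ᶜ, ‖regK δ (S i y - S i (x i)) * g i y -
        regK 0 (S i y - S i (x i)) * g i y‖ ≤
        (3 * δ * (c ^ 3)⁻¹ * ρ⁻¹) * ((‖y - x i‖ ^ 2)⁻¹ * ‖g i y‖) := by
      intro y hy
      have hy' : ρ ≤ ‖y - x i‖ := by simpa [dist_eq_norm] using hy
      have hy0 : 0 < ‖y - x i‖ := hρ.trans_le hy'
      have hch := H.chord i y
      have hσ : S i y - S i (x i) ≠ 0 :=
        norm_pos_iff.1 ((mul_pos hc hy0).trans_le hch)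
      rw [← sub_mul, norm_mul, ← mul_assoc, regK_zero]
      refine mul_le_mul_of_nonneg_right ((norm_regK_sub_kernelK_le hσ).trans ?_) (norm_nonneg _)
      rw [abs_of_pos hδ]
      calc 3 * δ * (‖S i y - S i (x i)‖ ^ 3)⁻¹ ≤ 3 * δ * ((c * ‖y - x i‖) ^ 3)⁻¹ := by gcongr
        _ = 3 * δ * (c ^ 3)⁻¹ * ‖y - x i‖⁻¹ * (‖y - x i‖ ^ 2)⁻¹ := by field_simp
        _ ≤ _ := by gcongr
    calc _ ≤ ∫ y in (Metric.ball (x i) ρ)ᶜ,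
          (3 * δ * (c ^ 3)⁻¹ * ρ⁻¹) * ((‖y - x i‖ ^ 2)⁻¹ * ‖g i y‖) :=
          setIntegral_mono_on (((H.integrableOn δ i hρ).sub (H.integrableOn 0 i hρ)).norm)
            ((hD i).1.const_mul _) measurableSet_ball.compl hb
      _ ≤ (3 * δ * (c ^ 3)⁻¹ * ρ⁻¹) * |D| := by
          rw [integral_const_mul]
          gcongr
          exact (hD i).2.trans (le_abs_self _)
      _ = δ * E := by rw [hE]; ring
      _ ≤ ε / (E + 1) * (E + 1) := by gcongr; linarith
      _ = ε := by field_simp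

/-- Principal values of the kernel `K` against the densities of a family exist. -/
theorem PVFamily.exists_tendsto (H : PVFamily x S g c C) (i : ι) : ∃ L : Cl,
    Tendsto (fun r => ∫ y in (Metric.ball (x i) r)ᶜ, regK 0 (S i y - S i (x i)) * g i y)
      (𝓝[>] (0 : ℝ)) (𝓝 L) := by
  refine cauchy_map_iff_exists_tendsto.1 (Metric.cauchy_iff.2 ⟨inferInstance, fun ε hε => ?_⟩)
  obtain ⟨r₀, h0, h⟩ := H.limit (ε / 3) (by positivity)
  refine ⟨_, image_mem_map (Ioo_mem_nhdsGT h0), ?_⟩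
  rintro _ ⟨r, hr, rfl⟩ _ ⟨r', hr', rfl⟩
  have h1 := h (r₀ / 2) r (by positivity) (by linarith) hr.1 hr.2 i
  have h2 := h (r₀ / 2) r' (by positivity) (by linarith) hr'.1 hr'.2 i
  rw [dist_eq_norm]
  rw [norm_sub_rev] at h1
  refine (norm_sub_le_norm_sub_add_norm_sub _ _ _).trans_lt ((add_le_add h1 h2).trans_lt ?_)
  linarith

/-- The regularized integrals converge, uniformly over the family, to the principal value. -/
theorem PVFamily.tendsto_reg (H : PVFamily x S g c C) {L : ι → Cl}
    (hL : ∀ i, Tendsto (fun r => ∫ y in (Metric.ball (x i) r)ᶜ, regK 0 (S i y - S i (x i)) * g i y)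
      (𝓝[>] (0 : ℝ)) (𝓝 (L i))) :
    ∀ ε, 0 < ε → ∃ r₀, 0 < r₀ ∧ ∀ δ, 0 < δ → δ < r₀ → ∀ i,
      ‖(∫ y, regK δ (S i y - S i (x i)) * g i y) - L i‖ ≤ ε := by
  intro ε hε
  obtain ⟨r₀, h0, h⟩ := H.limit ε hε
  refine ⟨r₀, h0, fun δ h1 h2 i => ?_⟩
  refine le_of_tendsto (((tendsto_const_nhds).sub (hL i)).norm) ?_
  filter_upwards [Ioo_mem_nhdsGT h0] with r hr using h δ r h1 h2 hr.1 hr.2 i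

/-- The error terms produced by the approximate identity `regL` disappear in the limit, for
densities that vanish at the base point. -/
theorem tendsto_regL (hc : 0 < c) (hC : 0 ≤ C)
    (chord : ∀ i y, c * ‖y - x i‖ ≤ ‖S i y - S i (x i)‖)
    (second : ∀ i h, ‖h‖ < 1 →
      ‖(S i (x i + h) - S i (x i)) + (S i (x i - h) - S i (x i))‖ ≤ C * ‖h‖ ^ 2)
    (hg : ∀ i h, ‖h‖ < 1 → ‖g i (x i + h)‖ ≤ C * ‖h‖)
    (hg' : ∀ i h, ‖h‖ < 1 → ‖g i (x i + h) + g i (x i - h)‖ ≤ C * ‖h‖ ^ 2)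
    (contS : ∀ i, Continuous (S i)) (contg : ∀ i, Continuous (g i))
    (far : ∀ ρ, 0 < ρ → ∃ D, ∀ i,
      IntegrableOn (fun y => (‖y - x i‖ ^ 2)⁻¹ * ‖g i y‖) (Metric.ball (x i) ρ)ᶜ ∧
      ∫ y in (Metric.ball (x i) ρ)ᶜ, (‖y - x i‖ ^ 2)⁻¹ * ‖g i y‖ ≤ D) :
    ∀ ε, 0 < ε → ∃ r₀, 0 < r₀ ∧ ∀ δ, 0 < δ → δ < r₀ → ∀ i,
      ‖∫ y, regL δ (S i y - S i (x i)) • g i y‖ ≤ ε := by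
  have hb : ∀ δ i ρ, 0 < ρ → ∀ y ∈ (Metric.ball (x i) ρ)ᶜ,
      ‖regL δ (S i y - S i (x i)) • g i y‖ ≤
      (δ ^ 2 * (c ^ 5)⁻¹ * (ρ ^ 3)⁻¹) * ((‖y - x i‖ ^ 2)⁻¹ * ‖g i y‖) := by
    intro δ i ρ hρ y hy
    have hy' : ρ ≤ ‖y - x i‖ := by simpa [dist_eq_norm] using hy
    have hy0 : 0 < ‖y - x i‖ := hρ.trans_le hy'
    have hch := chord i y
    rw [norm_smul, ← mul_assoc, Real.norm_of_nonneg (regL_nonneg _ _)]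
    refine mul_le_mul_of_nonneg_right ((regL_le' (mul_pos hc hy0) hch).trans ?_) (norm_nonneg _)
    calc δ ^ 2 * ((c * ‖y - x i‖) ^ 5)⁻¹ =
          δ ^ 2 * (c ^ 5)⁻¹ * (‖y - x i‖ ^ 3)⁻¹ * (‖y - x i‖ ^ 2)⁻¹ := by field_simp
      _ ≤ _ := by gcongr
  have hcont : ∀ δ, 0 < δ → ∀ i, Continuous fun y => regL δ (S i y - S i (x i)) • g i y :=
    fun δ hδ i => ((continuous_regL hδ.ne').comp ((contS i).sub continuous_const)).smul (contg i)
  have hint : ∀ δ, 0 < δ → ∀ i, Integrable fun y => regL δ (S i y - S i (x i)) • g i y := by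
    intro δ hδ i
    rw [← integrableOn_univ, ← Set.union_compl_self (Metric.ball (x i) 1)]
    refine IntegrableOn.union ?_ ?_
    · exact ((hcont δ hδ i).continuousOn.integrableOn_compact
        (isCompact_closedBall (x i) 1)).mono_set Metric.ball_subset_closedBall
    · obtain ⟨D, hD⟩ := far 1 one_pos
      refine ((hD i).1.const_mul (δ ^ 2 * (c ^ 5)⁻¹ * (1 ^ 3)⁻¹)).mono' (hcont δ hδ i).aestronglyMeasurable ?_
      filter_upwards [ae_restrict_mem measurableSet_ball.compl] with y hy
        using hb δ i 1 one_pos y hy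
  have key := regularized_limit (ι := ι) (V := Cl) (C := 5 * C ^ 2 * (c ^ 4)⁻¹ + C * (c ^ 3)⁻¹)
    (Φ := fun δ i h => regL δ (S i (x i + h) - S i (x i)) • g i (x i + h))
    (Φ₀ := fun i h => 0) (by positivity)
    (fun δ hδ i => (hint δ hδ i).comp_add_left (x i))
    (fun i r hr => integrableOn_zero)
    (fun δ _ i h h0 h1 => ?_) (fun i h _ _ => by simp; positivity) ?_
  · intro ε hε
    obtain ⟨r₀, h0, h⟩ := key ε hε
    refine ⟨r₀, h0, fun δ h1 h2 i => ?_⟩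
    have := h δ (r₀ / 2) h1 h2 (by positivity) (by linarith) i
    rwa [integral_add_left_eq_self (fun y => regL δ (S i y - S i (x i)) • g i y) (x i),
      integral_zero, sub_zero] at this
  · have hA := chord i (x i + h)
    have hB := chord i (x i + -h)
    rw [add_sub_cancel_left] at hA hB
    rw [norm_neg] at hB
    have h2 := second i h h1
    have h3 := hg' i h h1
    rw [sub_eq_add_neg (x i) h] at h2 h3
    exact norm_add_regL_le hc (norm_pos_iff.2 h0) hA hB h2 (hg i h h1) h3
  · intro ρ hρ ε hε
    obtain ⟨D, hD⟩ := far ρ hρ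
    set E := (c ^ 5)⁻¹ * (ρ ^ 3)⁻¹ * |D| with hE
    have hE0 : 0 ≤ E := by positivity
    refine ⟨min 1 (ε / (E + 1)), by positivity, fun δ hδ hδ' i => ?_⟩
    have hδ1 : δ < 1 := hδ'.trans_le (min_le_left _ _)
    have hδ2 : δ < ε / (E + 1) := hδ'.trans_le (min_le_right _ _)
    simp only [sub_zero]
    rw [integral_compl_ball_add (fun y => ‖regL δ (S i y - S i (x i)) • g i y‖)]
    calc _ ≤ ∫ y in (Metric.ball (x i) ρ)ᶜ,
          (δ ^ 2 * (c ^ 5)⁻¹ * (ρ ^ 3)⁻¹) * ((‖y - x i‖ ^ 2)⁻¹ * ‖g i y‖) :=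
          setIntegral_mono_on (hint δ hδ i).norm.integrableOn
            ((hD i).1.const_mul _) measurableSet_ball.compl (hb δ i ρ hρ)
      _ ≤ (δ ^ 2 * (c ^ 5)⁻¹ * (ρ ^ 3)⁻¹) * |D| := by
          rw [integral_const_mul]
          gcongr
          exact (hD i).2.trans (le_abs_self _)
      _ = δ * δ * E := by rw [hE]; ring
      _ ≤ 1 * (ε / (E + 1)) * (E + 1) := by gcongr; linarith
      _ = ε := by field_simp
end

/-! ### Differentiation of limits and of parametric integrals on convex sets -/

section
variable {E V : Type*} [NormedAddCommGroup E] [NormedSpace ℝ E] [NormedAddCommGroup V]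
  [NormedSpace ℝ V]

/-- A function with derivatives on a convex set that tend uniformly to `f'` is differentiable
in the limit. -/
theorem hasFDerivWithinAt_of_tendstoUniformlyOn {s : Set E} (hs : Convex ℝ s)
    {F : ℕ → E → V} {F' : ℕ → E → E →L[ℝ] V} {f : E → V} {f' : E → E →L[ℝ] V}
    (hF : ∀ n, ∀ p ∈ s, HasFDerivWithinAt (F n) (F' n p) s p)
    (hc : ∀ n, ContinuousOn (F' n) s)
    (hlim : ∀ p ∈ s, Tendsto (fun n => F n p) atTop (𝓝 (f p)))
    (hu : TendstoUniformlyOn F' f' atTop s) :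
    (∀ p ∈ s, HasFDerivWithinAt f (f' p) s p) ∧ ContinuousOn f' s := by
  have hf' : ContinuousOn f' s := hu.continuousOn (Frequently.of_forall hc)
  refine ⟨fun p hp => ?_, hf'⟩
  rw [hasFDerivWithinAt_iff_isLittleO, Asymptotics.isLittleO_iff]
  intro ε hε
  have h1 := Metric.continuousWithinAt_iff.1 (hf' p hp) (ε / 2) (by positivity)
  obtain ⟨δ, hδ, hδ'⟩ := h1
  rw [Metric.tendstoUniformlyOn_iff] at hu
  have hmem : Metric.ball p δ ∩ s ∈ 𝓝[s] p := by
    rw [Set.inter_comm]; exact inter_mem_nhdsWithin s (Metric.ball_mem_nhds p hδ)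
  filter_upwards [hmem] with q hq
  have hconv : Convex ℝ (Metric.ball p δ ∩ s) := (convex_ball p δ).inter hs
  have hbound : ∀ᶠ n in atTop, ‖F n q - F n p - f' p (q - p)‖ ≤ ε * ‖q - p‖ := by
    filter_upwards [hu (ε / 2) (by positivity)] with n hn
    refine hconv.norm_image_sub_le_of_norm_hasFDerivWithin_le' (f' := F' n)
      (fun z hz => (hF n z hz.2).mono Set.inter_subset_right) (fun z hz => ?_)
      ⟨Metric.mem_ball_self hδ, hp⟩ hq
    have a1 := hn z hz.2
    have a2 := hδ' hz.2 hz.1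
    rw [dist_eq_norm] at a1 a2
    rw [norm_sub_rev] at a1
    exact (norm_sub_le_norm_sub_add_norm_sub _ (f' z) _).trans (by linarith)
  exact le_of_tendsto ((((hlim q hq.2).sub (hlim p hp)).sub tendsto_const_nhds).norm) hbound

/-- Differentiation under the integral sign over a compact set, within a convex set of
parameters. -/
theorem hasFDerivWithinAt_integral_compact [CompleteSpace V] {s : Set E} (hs : Convex ℝ s)
    {Kc : Set Plane} (hK : IsCompact Kc) {φ : E → Plane → V} {φ' : E → Plane → E →L[ℝ] V}
    (hφ : ∀ y ∈ Kc, ∀ p ∈ s, HasFDerivWithinAt (fun p => φ p y) (φ' p y) s p)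
    (hc : ∀ p ∈ s, ContinuousOn (φ p) Kc)
    (hc' : ContinuousOn (Function.uncurry φ') (s ×ˢ Kc)) :
    (∀ p ∈ s, HasFDerivWithinAt (fun p => ∫ y in Kc, φ p y) (∫ y in Kc, φ' p y) s p) ∧
      ContinuousOn (fun p => ∫ y in Kc, φ' p y) s := by
  have hc1 : ∀ p ∈ s, ContinuousOn (φ' p) Kc := fun p hp =>
    hc'.comp (Continuous.continuousOn (by fun_prop : Continuous fun y : Plane => (p, y)))
      fun y hy => ⟨hp, hy⟩
  have hi : ∀ p ∈ s, IntegrableOn (φ p) Kc := fun p hp => (hc p hp).integrableOn_compact hK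
  have hi' : ∀ p ∈ s, IntegrableOn (φ' p) Kc := fun p hp => (hc1 p hp).integrableOn_compact hK
  have hKfin : volume.real Kc < volume.real Kc + 1 := by linarith
  have hK0 : 0 ≤ volume.real Kc := measureReal_nonneg
  have key : ∀ p ∈ s, ∀ ε, 0 < ε → ∃ δ, 0 < δ ∧ ∀ q ∈ Metric.ball p δ ∩ s, ∀ y ∈ Kc,
      ‖φ' q y - φ' p y‖ ≤ ε := by
    intro p hp ε hε
    obtain ⟨v, hv, hv'⟩ := hK.mem_uniformity_of_prod hc' hp (Metric.dist_mem_uniformity hε)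
    obtain ⟨δ, hδ, hδ'⟩ := Metric.mem_nhdsWithin_iff.1 hv
    refine ⟨δ, hδ, fun q hq y hy => ?_⟩
    have := hv' q (hδ' hq) y hy
    simp only [Set.mem_setOf_eq, dist_eq_norm] at this
    exact this.le
  constructor
  · intro p hp
    rw [hasFDerivWithinAt_iff_isLittleO, Asymptotics.isLittleO_iff]
    intro ε hε
    obtain ⟨δ, hδ, hδ'⟩ := key p hp (ε / (volume.real Kc + 1)) (by positivity)
    have hmem : Metric.ball p δ ∩ s ∈ 𝓝[s] p := by
      rw [Set.inter_comm]; exact inter_mem_nhdsWithin s (Metric.ball_mem_nhds p hδ)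
    filter_upwards [hmem] with q hq
    have hconv : Convex ℝ (Metric.ball p δ ∩ s) := (convex_ball p δ).inter hs
    have e : (∫ y in Kc, φ q y) - (∫ y in Kc, φ p y) - (∫ y in Kc, φ' p y) (q - p) =
        ∫ y in Kc, (φ q y - φ p y - φ' p y (q - p)) := by
      have i1 : Integrable (fun y => φ q y - φ p y) (volume.restrict Kc) :=
        (hi q hq.2).sub (hi p hp)
      rw [ContinuousLinearMap.integral_apply (hi' p hp), ← integral_sub (hi q hq.2) (hi p hp),
        ← integral_sub i1 ((hi' p hp).apply_continuousLinearMap _)]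
    rw [e]
    refine (norm_setIntegral_le_of_norm_le_const (hK.measure_lt_top)
      (C := ε / (volume.real Kc + 1) * ‖q - p‖) fun y hy => ?_).trans ?_
    · exact hconv.norm_image_sub_le_of_norm_hasFDerivWithin_le' (f' := fun z => φ' z y)
        (fun z hz => (hφ y hy z hz.2).mono Set.inter_subset_right)
        (fun z hz => hδ' z hz y hy) ⟨Metric.mem_ball_self hδ, hp⟩ hq
    · calc ε / (volume.real Kc + 1) * ‖q - p‖ * volume.real Kc
          ≤ ε / (volume.real Kc + 1) * ‖q - p‖ * (volume.real Kc + 1) := by gcongr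
        _ = _ := by field_simp
  · intro p hp
    rw [Metric.continuousWithinAt_iff]
    intro ε hε
    obtain ⟨δ, hδ, hδ'⟩ := key p hp (ε / 2 / (volume.real Kc + 1)) (by positivity)
    refine ⟨δ, hδ, fun {q} hq hqp => ?_⟩
    rw [dist_eq_norm, ← integral_sub (hi' q hq) (hi' p hp)]
    refine (norm_setIntegral_le_of_norm_le_const (hK.measure_lt_top)
      (C := ε / 2 / (volume.real Kc + 1)) fun y hy => hδ' q ⟨hqp, hq⟩ y hy).trans_lt ?_
    calc ε / 2 / (volume.real Kc + 1) * volume.real Kc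
        ≤ ε / 2 / (volume.real Kc + 1) * (volume.real Kc + 1) := by gcongr
      _ = ε / 2 := by field_simp
      _ < ε := by linarith

end

/-! ### Inverses of families of diffeomorphisms -/

/-- A linear map of the plane with trivial kernel as a continuous linear equivalence. -/
theorem exists_continuousLinearEquiv {E : Type*} [NormedAddCommGroup E] [NormedSpace ℝ E]
    [FiniteDimensional ℝ E] (L : E →L[ℝ] E) (hL : ∀ v, L v = 0 → v = 0) :
    ∃ e : E ≃L[ℝ] E, (e : E →L[ℝ] E) = L := by
  have hinj : Function.Injective (L : E →ₗ[ℝ] E) := (injective_iff_map_eq_zero _).2 hL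
  refine ⟨(LinearEquiv.ofInjectiveEndo (L : E →ₗ[ℝ] E) hinj).toContinuousLinearEquiv, ?_⟩
  ext v; simp

/-- If `k(t, ·)` are bijections of the plane, jointly `C¹` in `(t, x)` with invertible
`x`-derivative, then the inverse maps are jointly continuous. -/
theorem continuousWithinAt_invFun {I : Set ℝ} (hI : Convex ℝ I) {k : ℝ → Plane → Plane}
    {k' : ℝ × Plane → ℝ × Plane →L[ℝ] Plane}
    (hk : ∀ q ∈ I ×ˢ (Set.univ : Set Plane),
      HasFDerivWithinAt (fun q : ℝ × Plane => k q.1 q.2) (k' q) (I ×ˢ Set.univ) q)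
    (hk' : ContinuousOn k' (I ×ˢ Set.univ))
    (hbij : ∀ t ∈ I, Function.Bijective (k t))
    (hinv : ∀ t ∈ I, ∀ x v, k' (t, x) (0, v) = 0 → v = 0)
    {q₀ : ℝ × Plane} (hq₀ : q₀.1 ∈ I) :
    ContinuousWithinAt (fun q : ℝ × Plane => Function.invFun (k q.1) q.2) (I ×ˢ Set.univ) q₀ := by
  obtain ⟨t₀, y₀⟩ := q₀
  simp only at hq₀
  set g : ℝ × Plane → Plane := fun q => Function.invFun (k q.1) q.2 with hg
  have hright : ∀ t ∈ I, ∀ y, k t (g (t, y)) = y := fun t ht y =>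
    Function.rightInverse_invFun (hbij t ht).2 y
  have hleft : ∀ t ∈ I, ∀ x, g (t, k t x) = x := fun t ht x =>
    Function.leftInverse_invFun (hbij t ht).1 x
  set x₀ := g (t₀, y₀) with hx₀
  have hy₀ : k t₀ x₀ = y₀ := hright t₀ hq₀ y₀
  have hmem : ∀ {t x}, t ∈ I → ((t, x) : ℝ × Plane) ∈ I ×ˢ (Set.univ : Set Plane) :=
    fun ht => ⟨ht, Set.mem_univ _⟩
  obtain ⟨e, he⟩ := exists_continuousLinearEquiv
    ((k' (t₀, x₀)).comp (ContinuousLinearMap.inr ℝ ℝ Plane)) (fun v hv => hinv t₀ hq₀ x₀ v hv)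
  set N : NNReal := e.toNonlinearRightInverse.nnnorm with hN
  have hNpos : (0 : ℝ) < (N : ℝ)⁻¹ := by
    have : 0 < ‖(e.symm : Plane →L[ℝ] Plane)‖₊ := by
      haveI : Nontrivial Plane := inferInstance
      exact e.nnnorm_symm_pos
    exact inv_pos.2 (by exact_mod_cast this)
  set c : ℝ := (N : ℝ)⁻¹ / 2 with hc
  have hcpos : 0 < c := by positivity
  obtain ⟨η, hη, hη'⟩ := Metric.continuousWithinAt_iff.1 (hk' (t₀, x₀) (hmem hq₀)) c hcpos
  rw [Metric.continuousWithinAt_iff]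
  intro ε₀ hε₀
  set ε := min (ε₀ / 2) (η / 2) with hε
  have hεpos : 0 < ε := by positivity
  -- near `x₀` all the maps `k t` with `t` near `t₀` are approximated by one linear isomorphism, so
  -- they cover balls of a fixed size
  have happrox : ∀ t ∈ I, dist t t₀ < η →
      ApproximatesLinearOn (k t) (e : Plane →L[ℝ] Plane) (Metric.closedBall x₀ ε) ⟨c, hcpos.le⟩ := by
    intro t ht htη x hx y hy
    refine (convex_closedBall x₀ ε).norm_image_sub_le_of_norm_hasFDerivWithin_le'
      (f' := fun z => (k' (t, z)).comp (ContinuousLinearMap.inr ℝ ℝ Plane)) (fun z _ => ?_)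
      (fun z hz => ?_) hy hx
    · have h1 : HasFDerivWithinAt (fun z : Plane => ((t, z) : ℝ × Plane))
          (ContinuousLinearMap.inr ℝ ℝ Plane) (Metric.closedBall x₀ ε) z :=
        (hasFDerivAt_prodMk_right t z).hasFDerivWithinAt
      exact (hk (t, z) (hmem ht)).comp z h1 fun z _ => hmem ht
    · have h2 : dist ((t, z) : ℝ × Plane) (t₀, x₀) < η := by
        rw [Prod.dist_eq, max_lt_iff]
        refine ⟨htη, (Metric.mem_closedBall.1 hz).trans_lt ?_⟩
        exact (min_le_right _ _).trans_lt (by linarith)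
      have h3 := hη' (hmem ht) h2
      rw [he, ← ContinuousLinearMap.sub_comp]
      rw [dist_eq_norm] at h3
      refine (ContinuousLinearMap.opNorm_comp_le _ _).trans ?_
      calc _ ≤ c * 1 := by
            gcongr
            exact ContinuousLinearMap.norm_inr_le_one ℝ ℝ Plane
        _ = _ := mul_one c
  have hcont : ContinuousWithinAt (fun t => k t x₀) I t₀ := by
    have h1 : ContinuousWithinAt (fun t : ℝ => ((t, x₀) : ℝ × Plane)) I t₀ := by fun_prop
    exact ContinuousWithinAt.comp (f := fun t : ℝ => ((t, x₀) : ℝ × Plane)) (x := t₀)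
      ((hk (t₀, x₀) (hmem hq₀)).continuousWithinAt) h1 fun t ht => hmem ht
  have hr : 0 < ((N : ℝ)⁻¹ - c) * ε / 2 := by
    have : (N : ℝ)⁻¹ - c = c := by rw [hc]; ring
    rw [this]; positivity
  obtain ⟨θ, hθ, hθ'⟩ := Metric.continuousWithinAt_iff.1 hcont _ hr
  refine ⟨min (min η θ) (((N : ℝ)⁻¹ - c) * ε / 2), lt_min (lt_min hη hθ) hr, ?_⟩
  rintro ⟨t, y⟩ ⟨ht, -⟩ hty
  simp only at ht
  rw [Prod.dist_eq, max_lt_iff] at hty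
  simp only at hty
  have ht1 : dist t t₀ < η := hty.1.trans_le ((min_le_left _ _).trans (min_le_left _ _))
  have ht2 : dist t t₀ < θ := hty.1.trans_le ((min_le_left _ _).trans (min_le_right _ _))
  have hy1 : dist y y₀ < ((N : ℝ)⁻¹ - c) * ε / 2 := hty.2.trans_le (min_le_right _ _)
  have h4 := hθ' ht ht2
  simp only [hy₀] at h4
  have hsurj := (happrox t ht ht1).surjOn_closedBall_of_nonlinearRightInverse
    e.toNonlinearRightInverse hεpos.le subset_rfl
  have hy2 : y ∈ Metric.closedBall (k t x₀) (((N : ℝ)⁻¹ - c) * ε) := by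
    rw [Metric.mem_closedBall]
    refine (dist_triangle_right y (k t x₀) y₀).trans ?_
    linarith
  obtain ⟨x, hx, hxy⟩ := hsurj hy2
  have : g (t, y) = x := by rw [← hxy]; exact hleft t ht x
  rw [this]
  refine (Metric.mem_closedBall.1 hx).trans_lt ((min_le_left _ _).trans_lt (by linarith))

/-- If `k(t, ·)` are bijections of the plane, jointly `C¹` in `(t, x)` with invertible
`x`-derivative, then the inverse maps are jointly differentiable. -/
theorem differentiableWithinAt_invFun {I : Set ℝ} (hI : Convex ℝ I) {k : ℝ → Plane → Plane}
    {k' : ℝ × Plane → ℝ × Plane →L[ℝ] Plane}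
    (hk : ∀ q ∈ I ×ˢ (Set.univ : Set Plane),
      HasFDerivWithinAt (fun q : ℝ × Plane => k q.1 q.2) (k' q) (I ×ˢ Set.univ) q)
    (hk' : ContinuousOn k' (I ×ˢ Set.univ))
    (hbij : ∀ t ∈ I, Function.Bijective (k t))
    (hinv : ∀ t ∈ I, ∀ x v, k' (t, x) (0, v) = 0 → v = 0)
    {q₀ : ℝ × Plane} (hq₀ : q₀.1 ∈ I) :
    DifferentiableWithinAt ℝ (fun q : ℝ × Plane => Function.invFun (k q.1) q.2)
      (I ×ˢ Set.univ) q₀ := by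
  have hcont := continuousWithinAt_invFun hI hk hk' hbij hinv hq₀
  set s := I ×ˢ (Set.univ : Set Plane) with hs
  have hq₀s : q₀ ∈ s := ⟨hq₀, Set.mem_univ _⟩
  set g : ℝ × Plane → Plane := fun q => Function.invFun (k q.1) q.2 with hg
  have hGs : ∀ q ∈ s, (q.1, g q) ∈ s := fun q hq => ⟨hq.1, Set.mem_univ _⟩
  -- `(t, y) ↦ (t, k t y)` has an invertible derivative and the continuous inverse `(t, g (t, y))`
  have hΨ : HasFDerivWithinAt (fun q : ℝ × Plane => (q.1, k q.1 q.2))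
      ((ContinuousLinearMap.fst ℝ ℝ Plane).prod (k' (q₀.1, g q₀))) s (q₀.1, g q₀) :=
    hasFDerivWithinAt_fst.prodMk (hk _ (hGs q₀ hq₀s))
  obtain ⟨e, he⟩ := exists_continuousLinearEquiv
    ((ContinuousLinearMap.fst ℝ ℝ Plane).prod (k' (q₀.1, g q₀))) (by
      rintro ⟨τ, v⟩ hv
      simp only [ContinuousLinearMap.prod_apply, ContinuousLinearMap.coe_fst', Prod.mk_eq_zero] at hv
      obtain ⟨rfl, hv⟩ := hv
      rw [hinv q₀.1 hq₀ _ v hv]; rfl)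
  rw [← he] at hΨ
  have htend : Tendsto (fun q : ℝ × Plane => (q.1, g q)) (𝓝[s] q₀) (𝓝[s] (q₀.1, g q₀)) := by
    refine tendsto_nhdsWithin_iff.2 ⟨?_, ?_⟩
    · exact (continuousWithinAt_fst.prodMk hcont)
    · filter_upwards [self_mem_nhdsWithin] with q hq using hGs q hq
  have := HasFDerivWithinAt.of_local_left_inverse (g := fun q : ℝ × Plane => (q.1, g q))
    htend hΨ hq₀s (by
      filter_upwards [self_mem_nhdsWithin] with q hq
      exact Prod.ext rfl (Function.rightInverse_invFun (hbij q.1 hq.1).2 q.2))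
  exact this.differentiableWithinAt.snd

/-! ### Partial derivatives -/

/-- The coordinate vectors of the plane. -/
abbrev unitVec (i : Fin 2) : Plane := EuclideanSpace.single i 1

theorem plane_eq (v : Plane) : v = v 0 • unitVec 0 + v 1 • unitVec 1 := by
  ext i; fin_cases i <;> simp [unitVec]

theorem norm_unitVec (i : Fin 2) : ‖unitVec i‖ = 1 := by simp [unitVec]

section
variable {V : Type*} [NormedAddCommGroup V] [NormedSpace ℝ V]

theorem pd_eq_fderiv (i : Fin 2) (f : Plane → V) (x : Plane) :
    pd i f x = fderiv ℝ f x (unitVec i) := rfl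

theorem _root_.HasFDerivAt.pd {f : Plane → V} {f' : Plane →L[ℝ] V} {x : Plane} (h : HasFDerivAt f f' x)
    (i : Fin 2) : WaterWave.pd i f x = f' (unitVec i) := by
  rw [pd_eq_fderiv, h.fderiv]

theorem norm_pd_le (i : Fin 2) (f : Plane → V) (x : Plane) : ‖pd i f x‖ ≤ ‖fderiv ℝ f x‖ := by
  have := (fderiv ℝ f x).le_opNorm (unitVec i)
  rwa [norm_unitVec, mul_one] at this

theorem fderiv_apply_eq (f : Plane → V) (x v : Plane) :
    fderiv ℝ f x v = v 0 • pd 0 f x + v 1 • pd 1 f x := by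
  conv_lhs => rw [plane_eq v]
  rw [map_add, map_smul, map_smul]; rfl

theorem norm_fderiv_le {f : Plane → V} {x : Plane} {M : ℝ} (h : ∀ i, ‖pd i f x‖ ≤ M) :
    ‖fderiv ℝ f x‖ ≤ 2 * M := by
  have hM : 0 ≤ M := (norm_nonneg _).trans (h 0)
  refine ContinuousLinearMap.opNorm_le_bound _ (by positivity) fun v => ?_
  rw [fderiv_apply_eq]
  have h0 : |v 0| ≤ ‖v‖ := by simpa using PiLp.norm_apply_le v 0
  have h1 : |v 1| ≤ ‖v‖ := by simpa using PiLp.norm_apply_le v 1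
  calc _ ≤ |v 0| * ‖pd 0 f x‖ + |v 1| * ‖pd 1 f x‖ := by
        refine (norm_add_le _ _).trans ?_
        rw [norm_smul, norm_smul]; rfl
    _ ≤ ‖v‖ * M + ‖v‖ * M := by gcongr <;> exact h _
    _ = _ := by ring

theorem _root_.ContDiff.pd {f : Plane → V} {n m : WithTop ℕ∞} (hf : ContDiff ℝ n f) (h : m + 1 ≤ n) (i : Fin 2) :
    ContDiff ℝ m (WaterWave.pd i f) :=
  (hf.fderiv_right h).clm_apply contDiff_const

theorem pd_add {f g : Plane → V} {x : Plane} (hf : DifferentiableAt ℝ f x)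
    (hg : DifferentiableAt ℝ g x) (i : Fin 2) :
    pd i (fun y => f y + g y) x = pd i f x + pd i g x :=
  (hf.hasFDerivAt.add hg.hasFDerivAt).pd i

theorem pd_sub {f g : Plane → V} {x : Plane} (hf : DifferentiableAt ℝ f x)
    (hg : DifferentiableAt ℝ g x) (i : Fin 2) :
    pd i (fun y => f y - g y) x = pd i f x - pd i g x :=
  (hf.hasFDerivAt.sub hg.hasFDerivAt).pd i

theorem pd_smul {c : Plane → ℝ} {f : Plane → V} {x : Plane} (hc : DifferentiableAt ℝ c x)
    (hf : DifferentiableAt ℝ f x) (i : Fin 2) :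
    pd i (fun y => c y • f y) x = c x • pd i f x + pd i c x • f x := by
  have h := (hc.hasFDerivAt.smul hf.hasFDerivAt).pd i
  refine h.trans ?_
  simp [pd]

theorem pd_comp_clm {W : Type*} [NormedAddCommGroup W] [NormedSpace ℝ W] (L : V →L[ℝ] W)
    {f : Plane → V} {x : Plane} (hf : DifferentiableAt ℝ f x) (i : Fin 2) :
    pd i (fun y => L (f y)) x = L (pd i f x) := by
  exact (L.hasFDerivAt.comp x hf.hasFDerivAt).pd i

theorem pd_comm {f : Plane → V} (hf : ContDiff ℝ 2 f) (i j : Fin 2) (x : Plane) :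
    pd i (pd j f) x = pd j (pd i f) x := by
  have hd : DifferentiableAt ℝ (fderiv ℝ f) x :=
    ((hf.fderiv_right (m := 1) (by norm_num)).differentiable (by norm_num)) x
  have key : ∀ i j, pd i (pd j f) x = fderiv ℝ (fderiv ℝ f) x (unitVec i) (unitVec j) := by
    intro i j
    exact pd_comp_clm (ContinuousLinearMap.apply ℝ V (unitVec j)) hd i
  rw [key, key]
  exact (hf.contDiffAt.isSymmSndFDerivAt (by simp)) _ _

/-- The integral of a partial derivative of a compactly supported function vanishes. -/
theorem integral_pd_eq_zero [CompleteSpace V] {f : Plane → V} (hf : ContDiff ℝ 1 f)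
    (hc : HasCompactSupport f) (i : Fin 2) : ∫ y, pd i f y = 0 := by
  have hd : Continuous (pd i f) := (hf.pd (m := 0) (by norm_num) i).continuous
  have hpc : HasCompactSupport (pd i f) := by
    refine (hc.fderiv ℝ).mono fun y hy => ?_
    contrapose! hy
    simp only [Function.mem_support, not_not] at hy ⊢
    rw [pd_eq_fderiv, hy]; rfl
  have iP : Integrable (fun y => fderiv ℝ f y (unitVec i)) :=
    hd.integrable_of_hasCompactSupport hpc
  have iF : Integrable f := hf.continuous.integrable_of_hasCompactSupport hc
  have h := integral_smul_fderiv_eq_neg_fderiv_smul_of_integrable (𝕜 := ℝ)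
    (μ := (volume : Measure Plane)) (f := fun _ => (1 : ℝ)) (g := f) (v := unitVec i)
    (by simp) (by simpa only [one_smul] using iP) (by simpa only [one_smul] using iF)
    (by simp) (fun x _ => (hf.differentiable (by norm_num)) x)
  simp only [one_smul, fderiv_fun_const, Pi.zero_apply, ContinuousLinearMap.zero_apply, zero_smul,
    integral_zero, neg_zero] at h
  exact h
end

theorem pd_mul {f g : Plane → Cl} {x : Plane} (hf : DifferentiableAt ℝ f x)
    (hg : DifferentiableAt ℝ g x) (i : Fin 2) :
    pd i (fun y => f y * g y) x = pd i f x * g x + f x * pd i g x := by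
  have h := mulL.isBoundedBilinearMap.hasFDerivAt (f x, g x)
  have h2 := (h.comp x (hf.hasFDerivAt.prodMk hg.hasFDerivAt)).pd i
  simp only [Function.comp_def, mulL_apply] at h2
  rw [h2]
  simp [IsBoundedBilinearMap.deriv, pd, add_comm]

theorem pd_cross {f g : Plane → Cl} {x : Plane} (hf : DifferentiableAt ℝ f x)
    (hg : DifferentiableAt ℝ g x) (i : Fin 2) :
    pd i (fun y => cross (f y) (g y)) x = cross (pd i f x) (g x) + cross (f x) (pd i g x) := by
  have h := crossL.isBoundedBilinearMap.hasFDerivAt (f x, g x)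
  have h2 := (h.comp x (hf.hasFDerivAt.prodMk hg.hasFDerivAt)).pd i
  simp only [Function.comp_def, crossL_apply] at h2
  rw [h2]
  simp [IsBoundedBilinearMap.deriv, pd, add_comm]

theorem _root_.ContDiff.cross {E : Type*} [NormedAddCommGroup E] [NormedSpace ℝ E] {n : WithTop ℕ∞}
    {f g : E → Cl} (hf : ContDiff ℝ n f) (hg : ContDiff ℝ n g) :
    ContDiff ℝ n (fun y => WaterWave.cross (f y) (g y)) :=
  crossL.isBoundedBilinearMap.contDiff.comp (hf.prodMk hg)

theorem _root_.Continuous.cross {E : Type*} [TopologicalSpace E]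
    {f g : E → Cl} (hf : Continuous f) (hg : Continuous g) :
    Continuous (fun y => WaterWave.cross (f y) (g y)) :=
  crossL.isBoundedBilinearMap.continuous.comp (hf.prodMk hg)

/-! ### Stokes' theorem for the kernel -/

theorem contDiff_of_tsupport {n : WithTop ℕ∞} {f : Plane → Cl}
    (hf : ∀ x ∈ tsupport f, ContDiffAt ℝ n f x) : ContDiff ℝ n f :=
  contDiff_iff_contDiffAt.2 fun x => by
    by_cases hx : x ∈ tsupport f
    · exact hf x hx
    · exact contDiffAt_const.congr_of_eventuallyEq (notMem_tsupport_iff_eventuallyEq.1 hx)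

/-- `a × (S_β ∂_α - S_α ∂_β) f`. -/
def crossT (S : Plane → Cl) (a : Cl) (f : Plane → Cl) (y : Plane) : Cl :=
  cross a (pd 1 S y) * pd 0 f y - cross a (pd 0 S y) * pd 1 f y

/-- The integrand of the first variation of `∫ K(S(y) - S(x)) N(y) F(y) dy` when the relative
position `S(y) - S(x)` moves with velocity `η(y)` and `F` is fixed. -/
def variation (δ : ℝ) (S η F : Plane → Cl) (x y : Plane) : Cl :=
  (regK' δ (S y - S x) (η y) * normal S y + regK δ (S y - S x) *
    (cross (pd 0 η y) (pd 1 S y) + cross (pd 0 S y) (pd 1 η y))) * F y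

theorem pd_eq_zero_of_notMem_tsupport {V : Type*} [NormedAddCommGroup V] [NormedSpace ℝ V]
    {F : Plane → V} {y : Plane} (hy : y ∉ tsupport F) (i : Fin 2) : pd i F y = 0 := by
  have : fderiv ℝ F y = 0 := by
    by_contra h
    exact hy (support_fderiv_subset ℝ h)
  rw [pd_eq_fderiv, this]; rfl

theorem pd_regK {δ : ℝ} {S : Plane → Cl} {x y : Plane} (hS : DifferentiableAt ℝ S y)
    (h : δ ≠ 0 ∨ S y - S x ≠ 0) (i : Fin 2) :
    pd i (fun y => regK δ (S y - S x)) y = regK' δ (S y - S x) (pd i S y) := by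
  exact ((hasFDerivAt_regK h).comp y (hS.hasFDerivAt.sub_const (S x))).pd i

/-- Integrating the first variation by parts moves the derivative off the kernel; the error is
the approximate identity `regL`, since the kernel is Clifford analytic up to that term. -/
theorem integral_variation {δ : ℝ} {S η F : Plane → Cl} {x : Plane} (hS : ContDiff ℝ 2 S)
    (hη : ContDiff ℝ 1 η) (hF : ContDiff ℝ 1 F) (hFc : HasCompactSupport F)
    (hSre : ∀ y, (S y).re = 0) (hηre : ∀ y, (η y).re = 0)
    (hδ : δ ≠ 0 ∨ x ∉ tsupport F) (hinj : ∀ y, y ≠ x → S y ≠ S x) :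
    ∫ y, variation δ S η F x y =
      (∫ y, regL δ (S y - S x) • ((6 / (4 * Real.pi) * inner ℝ (η y) (normal S y)) • F y)) -
      ∫ y, regK δ (S y - S x) * crossT S (η y) F y := by
  have hreg : ∀ y ∈ tsupport F, δ ≠ 0 ∨ S y - S x ≠ 0 := by
    intro y hy
    rcases hδ with h | h
    · exact Or.inl h
    · refine Or.inr (sub_ne_zero.2 (hinj y ?_))
      rintro rfl; exact h hy
  have hSd : ∀ y, DifferentiableAt ℝ S y := fun y => (hS.differentiable (by norm_num)) y
  have hηd : ∀ y, DifferentiableAt ℝ η y := fun y => (hη.differentiable (by norm_num)) y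
  have hFd : ∀ y, DifferentiableAt ℝ F y := fun y => (hF.differentiable (by norm_num)) y
  have hSi : ∀ i, ContDiff ℝ 1 (pd i S) := fun i => hS.pd (by norm_num) i
  have hSid : ∀ i y, DifferentiableAt ℝ (pd i S) y :=
    fun i y => ((hSi i).differentiable (by norm_num)) y
  have hκ : ∀ y ∈ tsupport F, ContDiffAt ℝ 1 (fun y => regK δ (S y - S x)) y := fun y hy =>
    (contDiffAt_regK (hreg y hy)).comp y
      ((hS.of_le (by norm_num)).contDiffAt.sub contDiffAt_const)
  have hFi : ∀ i, Continuous (pd i F) := fun i => (hF.pd (m := 0) (by norm_num) i).continuous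
  have hSre' : ∀ i y, (pd i S y).re = 0 := by
    intro i y
    have h1 := pd_comp_clm reL (hSd y) i
    simp only [reL_apply] at h1
    rw [← h1]
    have : (fun y => (S y).re) = fun _ => 0 := funext hSre
    rw [this]; simp [pd]
  -- the two compactly supported fields whose divergence is integrated
  have main : ∀ B : Plane → Cl, ContDiff ℝ 1 B →
      ContDiff ℝ 1 (fun y => regK δ (S y - S x) * B y * F y) ∧
      HasCompactSupport (fun y => regK δ (S y - S x) * B y * F y) := by
    intro B hB
    constructor
    · refine contDiff_of_tsupport fun y hy => ?_
      have hy' : y ∈ tsupport F := tsupport_mul_subset_right hy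
      exact ((hκ y hy').mul hB.contDiffAt).mul hF.contDiffAt
    · exact HasCompactSupport.mul_left hFc
  have hB0 : ContDiff ℝ 1 (fun y => cross (η y) (pd 1 S y)) := hη.cross (hSi 1)
  have hB1 : ContDiff ℝ 1 (fun y => cross (pd 0 S y) (η y)) := (hSi 0).cross hη
  obtain ⟨c0, k0⟩ := main _ hB0
  obtain ⟨c1, k1⟩ := main _ hB1
  have z0 := integral_pd_eq_zero c0 k0 0
  have z1 := integral_pd_eq_zero c1 k1 1
  have int_pd : ∀ {f : Plane → Cl}, ContDiff ℝ 1 f → HasCompactSupport f → ∀ i,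
      Integrable (pd i f) := by
    intro f hf hc i
    refine (hf.pd (m := 0) (by norm_num) i).continuous.integrable_of_hasCompactSupport
      ((hc.fderiv ℝ).mono fun y hy => ?_)
    contrapose! hy
    simp only [Function.mem_support, not_not] at hy ⊢
    rw [pd_eq_fderiv, hy]; rfl
  have hsupp : ∀ G : Plane → Cl, (∀ y, y ∉ tsupport F → G y = 0) →
      (∀ y ∈ tsupport F, ContinuousAt G y) → Integrable G := by
    intro G h0 hc
    have hsub : tsupport G ⊆ tsupport F := closure_minimal
      (fun y hy => by by_contra h; exact hy (h0 y h)) (isClosed_tsupport F)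
    exact (continuous_of_tsupport fun y hy => hc y (hsub hy)).integrable_of_hasCompactSupport
      (hFc.isCompact.of_isClosed_subset (isClosed_tsupport G) hsub)
  have hF0 : ∀ y, y ∉ tsupport F → F y = 0 := fun y hy => image_eq_zero_of_notMem_tsupport hy
  have iL : Integrable fun y =>
      regL δ (S y - S x) • ((6 / (4 * Real.pi) * inner ℝ (η y) (normal S y)) • F y) := by
    refine hsupp _ (fun y hy => by simp [hF0 y hy]) fun y hy => ?_
    have hn : Continuous (normal S) := ((hSi 0).continuous).cross (hSi 1).continuous
    have h1 : ContinuousAt (fun y => regL δ (S y - S x)) y := by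
      unfold regL
      have h2 : ContinuousAt (fun y => regNorm δ (S y - S x)) y :=
        ((continuous_regNorm δ).comp (hS.continuous.sub continuous_const)).continuousAt
      exact continuousAt_const.mul ((h2.pow 5).inv₀ (pow_ne_zero _ (regNorm_pos (hreg y hy)).ne'))
    have h3 : Continuous fun y => (6 / (4 * Real.pi) * inner ℝ (η y) (normal S y)) • F y :=
      Continuous.smul (f := fun y => 6 / (4 * Real.pi) * inner ℝ (η y) (normal S y))
        (Continuous.mul continuous_const (hη.continuous.inner hn)) hF.continuous
    exact h1.smul h3.continuousAt
  have iT : Integrable fun y => regK δ (S y - S x) * crossT S (η y) F y := by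
    refine hsupp _ (fun y hy => ?_) fun y hy => ?_
    · simp [crossT, pd_eq_zero_of_notMem_tsupport hy]
    · refine (hκ y hy).continuousAt.mul ?_
      exact (((hη.continuous.cross (hSi 1).continuous).mul (hFi 0)).sub
        ((hη.continuous.cross (hSi 0).continuous).mul (hFi 1))).continuousAt
  have pt : ∀ y, variation δ S η F x y =
      (pd 0 (fun y => regK δ (S y - S x) * cross (η y) (pd 1 S y) * F y) y +
        pd 1 (fun y => regK δ (S y - S x) * cross (pd 0 S y) (η y) * F y) y) +
      (regL δ (S y - S x) • ((6 / (4 * Real.pi) * inner ℝ (η y) (normal S y)) • F y) -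
        regK δ (S y - S x) * crossT S (η y) F y) := by
    intro y
    by_cases hy : y ∈ tsupport F
    · have hκd := (hκ y hy).differentiableAt (by norm_num)
      have d0 := (hB0.differentiable (by norm_num)) y
      have d1 := (hB1.differentiable (by norm_num)) y
      rw [pd_mul (f := fun y => regK δ (S y - S x) * cross (η y) (pd 1 S y)) (hκd.mul d0) (hFd y),
        pd_mul (f := fun y => regK δ (S y - S x) * cross (pd 0 S y) (η y)) (hκd.mul d1) (hFd y),
        pd_mul hκd d0, pd_mul hκd d1,
        pd_regK (hSd y) (hreg y hy), pd_regK (hSd y) (hreg y hy), pd_cross (hηd y) (hSid 1 y),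
        pd_cross (hSid 0 y) (hηd y), pd_comm hS 0 1]
      have hcyc := regK'_cyclic (hreg y hy) (by simp [hSre]) (hηre y) (hSre' 0 y) (hSre' 1 y)
      have e1 : regL δ (S y - S x) • ((6 / (4 * Real.pi) * inner ℝ (η y) (normal S y)) • F y) =
          ((6 / (4 * Real.pi) * regL δ (S y - S x) * inner ℝ (η y) (normal S y) : ℝ) : Cl) * F y := by
        rw [Quaternion.coe_mul_eq_smul, smul_smul]; congr 1; ring
      have e2 : ∀ a b : Cl, cross a b = -cross b a := by
        intro a b; ext <;> simp <;> ring
      rw [e1, show normal S y = cross (pd 0 S y) (pd 1 S y) from rfl, ← hcyc]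
      simp only [variation, crossT, normal]
      rw [e2 (pd 1 (pd 0 S) y) (η y), e2 (pd 1 S y) (η y), e2 (pd 0 S y) (η y)]
      noncomm_ring
    · have hsub : ∀ B : Plane → Cl, y ∉ tsupport (fun y => regK δ (S y - S x) * B y * F y) :=
        fun B h => hy (tsupport_mul_subset_right h)
      rw [pd_eq_zero_of_notMem_tsupport (hsub _), pd_eq_zero_of_notMem_tsupport (hsub _)]
      simp [variation, crossT, hF0 y hy, pd_eq_zero_of_notMem_tsupport hy]
  simp_rw [pt]
  have i0 := int_pd c0 k0 0
  have i1 := int_pd c1 k1 1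
  refine (integral_add (i0.add i1) (iL.sub iT)).trans ?_
  have e0 := integral_add i0 i1
  have e1 := integral_sub iL iT
  rw [z0, z1] at e0
  refine (congrArg₂ (· + ·) e0 e1).trans ?_
  simp

/-! ### Families of functions with uniform Lipschitz bounds at their base points -/

section
variable {ι V W U : Type*} [NormedAddCommGroup V] [NormedSpace ℝ V] [NormedAddCommGroup W]
  [NormedSpace ℝ W] [NormedAddCommGroup U] [NormedSpace ℝ U] {x : ι → Plane}

/-- The functions `g i` are bounded and Lipschitz at `x i`, uniformly in `i`. -/
def LipFam (x : ι → Plane) (g : ι → Plane → V) : Prop :=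
  ∃ C, 0 ≤ C ∧ ∀ i h, ‖h‖ < 1 → ‖g i (x i + h)‖ ≤ C ∧ ‖g i (x i + h) - g i (x i)‖ ≤ C * ‖h‖

/-- The functions `g i` are bounded and Lipschitz at `x i`, with second differences of second
order, uniformly in `i`. -/
def SmoothFam (x : ι → Plane) (g : ι → Plane → V) : Prop :=
  LipFam x g ∧ ∃ C, 0 ≤ C ∧ ∀ i h, ‖h‖ < 1 →
    ‖(g i (x i + h) - g i (x i)) + (g i (x i - h) - g i (x i))‖ ≤ C * ‖h‖ ^ 2

theorem lipFam_const {a : ι → V} {C : ℝ} (h : ∀ i, ‖a i‖ ≤ C) : LipFam x (fun i _ => a i) :=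
  ⟨|C|, abs_nonneg _, fun i h' _ => ⟨(h i).trans (le_abs_self C), by simp; positivity⟩⟩

theorem smoothFam_const {a : ι → V} {C : ℝ} (h : ∀ i, ‖a i‖ ≤ C) :
    SmoothFam x (fun i _ => a i) :=
  ⟨lipFam_const h, 0, le_rfl, fun i h' _ => by simp⟩

theorem LipFam.add {f g : ι → Plane → V} (hf : LipFam x f) (hg : LipFam x g) :
    LipFam x (fun i y => f i y + g i y) := by
  obtain ⟨C, hC, h1⟩ := hf
  obtain ⟨D, hD, h2⟩ := hg
  refine ⟨C + D, by positivity, fun i h hh => ⟨?_, ?_⟩⟩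
  · exact (norm_add_le _ _).trans (add_le_add (h1 i h hh).1 (h2 i h hh).1)
  · rw [add_sub_add_comm, add_mul]
    exact (norm_add_le _ _).trans (add_le_add (h1 i h hh).2 (h2 i h hh).2)

theorem SmoothFam.add {f g : ι → Plane → V} (hf : SmoothFam x f) (hg : SmoothFam x g) :
    SmoothFam x (fun i y => f i y + g i y) := by
  refine ⟨hf.1.add hg.1, ?_⟩
  obtain ⟨C, hC, h1⟩ := hf.2
  obtain ⟨D, hD, h2⟩ := hg.2
  refine ⟨C + D, by positivity, fun i h hh => ?_⟩
  rw [add_mul]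
  refine le_trans (le_of_eq ?_) ((norm_add_le _ _).trans (add_le_add (h1 i h hh) (h2 i h hh)))
  congr 1; module

theorem LipFam.clm {f : ι → Plane → V} (hf : LipFam x f) (L : V →L[ℝ] W) :
    LipFam x (fun i y => L (f i y)) := by
  obtain ⟨C, hC, h1⟩ := hf
  refine ⟨‖L‖ * C, by positivity, fun i h hh => ⟨?_, ?_⟩⟩
  · exact (L.le_opNorm _).trans (by gcongr; exact (h1 i h hh).1)
  · rw [← map_sub, mul_assoc]
    exact (L.le_opNorm _).trans (by gcongr; exact (h1 i h hh).2)

theorem SmoothFam.clm {f : ι → Plane → V} (hf : SmoothFam x f) (L : V →L[ℝ] W) :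
    SmoothFam x (fun i y => L (f i y)) := by
  refine ⟨hf.1.clm L, ?_⟩
  obtain ⟨C, hC, h1⟩ := hf.2
  refine ⟨‖L‖ * C, by positivity, fun i h hh => ?_⟩
  rw [← map_sub, ← map_sub, ← map_add, mul_assoc]
  exact (L.le_opNorm _).trans (by gcongr; exact h1 i h hh)

theorem LipFam.neg {f : ι → Plane → V} (hf : LipFam x f) : LipFam x (fun i y => -f i y) :=
  hf.clm (-ContinuousLinearMap.id ℝ V)

theorem SmoothFam.neg {f : ι → Plane → V} (hf : SmoothFam x f) : SmoothFam x (fun i y => -f i y) :=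
  hf.clm (-ContinuousLinearMap.id ℝ V)

theorem LipFam.sub {f g : ι → Plane → V} (hf : LipFam x f) (hg : LipFam x g) :
    LipFam x (fun i y => f i y - g i y) := by
  simpa only [sub_eq_add_neg] using hf.add hg.neg

theorem SmoothFam.sub {f g : ι → Plane → V} (hf : SmoothFam x f) (hg : SmoothFam x g) :
    SmoothFam x (fun i y => f i y - g i y) := by
  simpa only [sub_eq_add_neg] using hf.add hg.neg

theorem LipFam.bilin {f : ι → Plane → V} {g : ι → Plane → W} (hf : LipFam x f) (hg : LipFam x g)
    (B : V →L[ℝ] W →L[ℝ] U) : LipFam x (fun i y => B (f i y) (g i y)) := by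
  obtain ⟨C, hC, h1⟩ := hf
  obtain ⟨D, hD, h2⟩ := hg
  refine ⟨2 * ‖B‖ * C * D, by positivity, fun i h hh => ⟨?_, ?_⟩⟩
  · refine (B.le_opNorm₂ _ _).trans ?_
    have a1 := (h1 i h hh).1
    have a2 := (h2 i h hh).1
    calc _ ≤ ‖B‖ * C * D := by gcongr
      _ ≤ _ := by nlinarith [mul_nonneg (mul_nonneg (norm_nonneg B) hC) hD]
  · have e : B (f i (x i + h)) (g i (x i + h)) - B (f i (x i)) (g i (x i)) =
        B (f i (x i + h) - f i (x i)) (g i (x i + h)) + B (f i (x i)) (g i (x i + h) - g i (x i)) := by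
      simp
    have b1 := (h1 i 0 (by simp)).1
    rw [add_zero] at b1
    have a1 := (h1 i h hh).2
    have a2 := (h2 i h hh).1
    have a3 := (h2 i h hh).2
    rw [e]
    calc _ ≤ ‖B‖ * (C * ‖h‖) * D + ‖B‖ * C * (D * ‖h‖) := by
          refine (norm_add_le _ _).trans (add_le_add ?_ ?_)
          · exact (B.le_opNorm₂ _ _).trans (by gcongr)
          · exact (B.le_opNorm₂ _ _).trans (by gcongr)
      _ = _ := by ring

theorem SmoothFam.bilin {f : ι → Plane → V} {g : ι → Plane → W} (hf : SmoothFam x f)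
    (hg : SmoothFam x g) (B : V →L[ℝ] W →L[ℝ] U) :
    SmoothFam x (fun i y => B (f i y) (g i y)) := by
  refine ⟨hf.1.bilin hg.1 B, ?_⟩
  obtain ⟨C, hC, h1⟩ := hf.1
  obtain ⟨D, hD, h2⟩ := hg.1
  obtain ⟨C', hC', h1'⟩ := hf.2
  obtain ⟨D', hD', h2'⟩ := hg.2
  refine ⟨‖B‖ * (C' * D + C * D' + 2 * (C * D)), by positivity, fun i h hh => ?_⟩
  have hh' : ‖-h‖ < 1 := by rwa [norm_neg]
  have e : (B (f i (x i + h)) (g i (x i + h)) - B (f i (x i)) (g i (x i))) +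
      (B (f i (x i - h)) (g i (x i - h)) - B (f i (x i)) (g i (x i))) =
      B ((f i (x i + h) - f i (x i)) + (f i (x i - h) - f i (x i))) (g i (x i)) +
      B (f i (x i)) ((g i (x i + h) - g i (x i)) + (g i (x i - h) - g i (x i))) +
      (B (f i (x i + h) - f i (x i)) (g i (x i + h) - g i (x i)) +
        B (f i (x i - h) - f i (x i)) (g i (x i - h) - g i (x i))) := by
    simp; abel
  have b1 := (h1 i 0 (by simp)).1
  have b2 := (h2 i 0 (by simp)).1
  rw [add_zero] at b1 b2
  have a1 := (h1 i h hh).2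
  have a2 := (h2 i h hh).2
  have a3 := (h1 i (-h) hh').2
  have a4 := (h2 i (-h) hh').2
  rw [← sub_eq_add_neg, norm_neg] at a3 a4
  have a5 := h1' i h hh
  have a6 := h2' i h hh
  rw [e]
  calc _ ≤ ‖B‖ * (C' * ‖h‖ ^ 2) * D + ‖B‖ * C * (D' * ‖h‖ ^ 2) +
        (‖B‖ * (C * ‖h‖) * (D * ‖h‖) + ‖B‖ * (C * ‖h‖) * (D * ‖h‖)) := by
        refine (norm_add₃_le).trans (add_le_add (add_le_add ?_ ?_) ((norm_add_le _ _).trans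
          (add_le_add ?_ ?_)))
        all_goals exact (B.le_opNorm₂ _ _).trans (by gcongr)
    _ = _ := by ring

theorem LipFam.mul {f g : ι → Plane → Cl} (hf : LipFam x f) (hg : LipFam x g) :
    LipFam x (fun i y => f i y * g i y) := hf.bilin hg mulL

theorem LipFam.cross {f g : ι → Plane → Cl} (hf : LipFam x f) (hg : LipFam x g) :
    LipFam x (fun i y => WaterWave.cross (f i y) (g i y)) := hf.bilin hg crossL

theorem LipFam.smul {f : ι → Plane → ℝ} {g : ι → Plane → Cl} (hf : LipFam x f)
    (hg : LipFam x g) : LipFam x (fun i y => f i y • g i y) :=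
  hf.bilin hg (ContinuousLinearMap.lsmul ℝ ℝ)

theorem SmoothFam.smul {f : ι → Plane → ℝ} {g : ι → Plane → Cl} (hf : SmoothFam x f)
    (hg : SmoothFam x g) : SmoothFam x (fun i y => f i y • g i y) :=
  hf.bilin hg (ContinuousLinearMap.lsmul ℝ ℝ)

theorem SmoothFam.inner {f g : ι → Plane → Cl} (hf : SmoothFam x f) (hg : SmoothFam x g) :
    SmoothFam x (fun i y => Inner.inner ℝ (f i y) (g i y)) := hf.bilin hg (innerSL ℝ)

theorem LipFam.symm {g : ι → Plane → V} (hg : LipFam x g) : ∃ C, 0 ≤ C ∧ ∀ i h, ‖h‖ < 1 →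
    ‖g i (x i + h) - g i (x i - h)‖ ≤ C * ‖h‖ := by
  obtain ⟨C, hC, h1⟩ := hg
  refine ⟨2 * C, by positivity, fun i h hh => ?_⟩
  have a1 := (h1 i h hh).2
  have a2 := (h1 i (-h) (by rwa [norm_neg])).2
  rw [← sub_eq_add_neg, norm_neg] at a2
  rw [norm_sub_rev] at a2
  refine (norm_sub_le_norm_sub_add_norm_sub _ (g i (x i)) _).trans ?_
  linarith
end

/-! ### Uniform bounds on compact sets of times and points -/

theorem uniqueDiffOn_slab {I : Set ℝ} (hI : Convex ℝ I) (hI' : (interior I).Nonempty) :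
    UniqueDiffOn ℝ (I ×ˢ (Set.univ : Set Plane)) :=
  (uniqueDiffOn_convex hI hI').prod uniqueDiffOn_univ

section
variable {V : Type*} [NormedAddCommGroup V] [NormedSpace ℝ V]
  {I : Set ℝ} {f : ℝ → Plane → V}

theorem hasFDerivAt_slice (hI : Convex ℝ I) (hI' : (interior I).Nonempty) (hf : ContDiffOn ℝ 1 (fun q : ℝ × Plane => f q.1 q.2) (I ×ˢ Set.univ))
    {t : ℝ} (ht : t ∈ I) (y : Plane) : HasFDerivAt (f t)
      ((fderivWithin ℝ (fun q : ℝ × Plane => f q.1 q.2) (I ×ˢ Set.univ) (t, y)).comp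
        (ContinuousLinearMap.inr ℝ ℝ Plane)) y := by
  have h1 := ((hf.differentiableOn (by norm_num)) (t, y) ⟨ht, Set.mem_univ _⟩).hasFDerivWithinAt
  have h2 : HasFDerivWithinAt (fun z : Plane => ((t, z) : ℝ × Plane))
      (ContinuousLinearMap.inr ℝ ℝ Plane) Set.univ y :=
    (hasFDerivAt_prodMk_right t y).hasFDerivWithinAt
  exact (h1.comp y h2 fun z _ => ⟨ht, Set.mem_univ _⟩).hasFDerivAt_of_univ

theorem exists_lipschitz_slab (hI : Convex ℝ I) (hI' : (interior I).Nonempty)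
    (hf : ContDiffOn ℝ 1 (fun q : ℝ × Plane => f q.1 q.2) (I ×ˢ Set.univ))
    {J : Set ℝ} (hJ : IsCompact J) (hJI : J ⊆ I) (x₀ : Plane) (R : ℝ) :
    ∃ C, 0 ≤ C ∧ ∀ t ∈ J, ∀ y ∈ Metric.closedBall x₀ R, ‖f t y‖ ≤ C ∧
      ∀ y' ∈ Metric.closedBall x₀ R, ‖f t y - f t y'‖ ≤ C * ‖y - y'‖ := by
  have hK : IsCompact (J ×ˢ Metric.closedBall x₀ R) := hJ.prod (isCompact_closedBall _ _)
  have hsub : J ×ˢ Metric.closedBall x₀ R ⊆ I ×ˢ Set.univ :=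
    Set.prod_mono hJI (Set.subset_univ _)
  have hs := uniqueDiffOn_slab hI hI'
  obtain ⟨C₁, h1⟩ := hK.exists_bound_of_continuousOn (hf.continuousOn.mono hsub)
  obtain ⟨C₂, h2⟩ := hK.exists_bound_of_continuousOn
    ((hf.continuousOn_fderivWithin hs le_rfl).mono hsub)
  refine ⟨|C₁| + |C₂|, by positivity, fun t ht y hy => ⟨?_, fun y' hy' => ?_⟩⟩
  · exact (h1 (t, y) ⟨ht, hy⟩).trans ((le_abs_self _).trans (by linarith [abs_nonneg C₂]))
  · refine (convex_closedBall x₀ R).norm_image_sub_le_of_norm_hasFDerivWithin_le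
      (fun z _ => (hasFDerivAt_slice hI hI' hf (hJI ht) z).hasFDerivWithinAt) (fun z hz => ?_) hy' hy
    refine (ContinuousLinearMap.opNorm_comp_le _ _).trans ?_
    calc _ ≤ C₂ * 1 := by
          have := h2 (t, z) ⟨ht, hz⟩
          have h0 : 0 ≤ C₂ := (norm_nonneg _).trans this
          gcongr
          exact ContinuousLinearMap.norm_inr_le_one ℝ ℝ Plane
      _ ≤ _ := by linarith [le_abs_self C₂, abs_nonneg C₁]

theorem lipFam_slab (hI : Convex ℝ I) (hI' : (interior I).Nonempty)
    (hf : ContDiffOn ℝ 1 (fun q : ℝ × Plane => f q.1 q.2) (I ×ˢ Set.univ))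
    {J : Set ℝ} (hJ : IsCompact J) (hJI : J ⊆ I) (x₀ : Plane) {ι : Type*} {T : ι → ℝ}
    {x : ι → Plane} (hT : ∀ i, T i ∈ J) (hx : ∀ i, x i ∈ Metric.closedBall x₀ 1) :
    LipFam x (fun i y => f (T i) y) := by
  obtain ⟨C, hC, h⟩ := exists_lipschitz_slab hI hI' hf hJ hJI x₀ 2
  have hmem : ∀ i (h : Plane), ‖h‖ < 1 → x i + h ∈ Metric.closedBall x₀ 2 := by
    intro i h hh
    have := hx i
    rw [Metric.mem_closedBall, dist_eq_norm] at this ⊢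
    calc _ = ‖(x i - x₀) + h‖ := by congr 1; abel
      _ ≤ 2 := (norm_add_le _ _).trans (by linarith)
  refine ⟨C, hC, fun i h' hh => ?_⟩
  have h1 := h (T i) (hT i) (x i + h') (hmem i h' hh)
  have h0 := hmem i 0 (by simp)
  rw [add_zero] at h0
  refine ⟨h1.1, ?_⟩
  have := h1.2 (x i) h0
  rwa [add_sub_cancel_left] at this

theorem smoothFam_slab (hI : Convex ℝ I) (hI' : (interior I).Nonempty)
    (hf : ContDiffOn ℝ 2 (fun q : ℝ × Plane => f q.1 q.2) (I ×ˢ Set.univ))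
    {J : Set ℝ} (hJ : IsCompact J) (hJI : J ⊆ I) (x₀ : Plane) {ι : Type*} {T : ι → ℝ}
    {x : ι → Plane} (hT : ∀ i, T i ∈ J) (hx : ∀ i, x i ∈ Metric.closedBall x₀ 1) :
    SmoothFam x (fun i y => f (T i) y) := by
  have hf1 : ContDiffOn ℝ 1 (fun q : ℝ × Plane => f q.1 q.2) (I ×ˢ Set.univ) :=
    hf.of_le (by norm_num)
  refine ⟨lipFam_slab hI hI' hf1 hJ hJI x₀ hT hx, ?_⟩
  have hs := uniqueDiffOn_slab hI hI'
  have hD : ContDiffOn ℝ 1 (fun q : ℝ × Plane =>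
      (fun t y => fderivWithin ℝ (fun q : ℝ × Plane => f q.1 q.2) (I ×ˢ Set.univ) (t, y)) q.1 q.2)
      (I ×ˢ Set.univ) := hf.fderivWithin hs (by norm_num)
  obtain ⟨C, hC, h⟩ := exists_lipschitz_slab hI hI' (f := fun t y =>
    fderivWithin ℝ (fun q : ℝ × Plane => f q.1 q.2) (I ×ˢ Set.univ) (t, y)) hD hJ hJI x₀ 2
  have hmem : ∀ i (h : Plane), ‖h‖ < 1 → x i + h ∈ Metric.closedBall x₀ 2 := by
    intro i h hh
    have := hx i
    rw [Metric.mem_closedBall, dist_eq_norm] at this ⊢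
    calc _ = ‖(x i - x₀) + h‖ := by congr 1; abel
      _ ≤ 2 := (norm_add_le _ _).trans (by linarith)
  have taylor : ∀ i (h' : Plane), ‖h'‖ < 1 → ‖f (T i) (x i + h') - f (T i) (x i) -
      (fderivWithin ℝ (fun q : ℝ × Plane => f q.1 q.2) (I ×ˢ Set.univ) (T i, x i)).comp
        (ContinuousLinearMap.inr ℝ ℝ Plane) h'‖ ≤ C * ‖h'‖ ^ 2 := by
    intro i h' hh
    have := (convex_closedBall (x i) ‖h'‖).norm_image_sub_le_of_norm_hasFDerivWithin_le'
      (f := f (T i)) (x := x i) (y := x i + h') (C := C * ‖h'‖)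
      (φ := (fderivWithin ℝ (fun q : ℝ × Plane => f q.1 q.2) (I ×ˢ Set.univ) (T i, x i)).comp
        (ContinuousLinearMap.inr ℝ ℝ Plane))
      (fun z _ => (hasFDerivAt_slice hI hI' hf1 (hJI (hT i)) z).hasFDerivWithinAt)
      (fun z hz => ?_) (Metric.mem_closedBall_self (norm_nonneg _)) (by simp)
    · rw [add_sub_cancel_left] at this
      exact this.trans (le_of_eq (by ring))
    · rw [Metric.mem_closedBall, dist_eq_norm] at hz
      have hz' := hmem i (z - x i) (hz.trans_lt hh)
      rw [add_sub_cancel] at hz'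
      have h0 := hmem i 0 (by simp)
      rw [add_zero] at h0
      have h2 := (h (T i) (hT i) z hz').2 (x i) h0
      rw [← ContinuousLinearMap.sub_comp]
      refine (ContinuousLinearMap.opNorm_comp_le _ _).trans ?_
      calc _ ≤ C * ‖z - x i‖ * 1 := by
            gcongr
            exact ContinuousLinearMap.norm_inr_le_one ℝ ℝ Plane
        _ ≤ C * ‖h'‖ := by rw [mul_one]; gcongr
  refine ⟨2 * C, by positivity, fun i h' hh => ?_⟩
  have a1 := taylor i h' hh
  have a2 := taylor i (-h') (by rwa [norm_neg])
  rw [norm_neg, ← sub_eq_add_neg, map_neg] at a2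
  calc _ = ‖(f (T i) (x i + h') - f (T i) (x i) -
      (fderivWithin ℝ (fun q : ℝ × Plane => f q.1 q.2) (I ×ˢ Set.univ) (T i, x i)).comp
        (ContinuousLinearMap.inr ℝ ℝ Plane) h') + (f (T i) (x i - h') - f (T i) (x i) -
      -(fderivWithin ℝ (fun q : ℝ × Plane => f q.1 q.2) (I ×ˢ Set.univ) (T i, x i)).comp
        (ContinuousLinearMap.inr ℝ ℝ Plane) h')‖ := by congr 1; abel
    _ ≤ C * ‖h'‖ ^ 2 + C * ‖h'‖ ^ 2 := (norm_add_le _ _).trans (add_le_add a1 a2)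
    _ = _ := by ring
end

/-! ### Principal values on a fixed surface -/

/-- A principal value integral of the kernel on a fixed `C²` surface, against a `C¹` density,
is a family of one element. -/
theorem pvFamily_of_contDiff {S g : Plane → Cl} {x : Plane} {c : ℝ} (hS : ContDiff ℝ 2 S)
    (hg : ContDiff ℝ 1 g) (hc : 0 < c) (chord : ∀ y, c * ‖y - x‖ ≤ ‖S y - S x‖)
    (hfar : FarInt g x) :
    ∃ C, PVFamily (fun _ : Unit => x) (fun _ => S) (fun _ => g) c C := by
  have h1 : SmoothFam (fun _ : Unit => x) (fun _ y => S y) :=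
    smoothFam_slab (I := Set.univ) convex_univ (by simp) (f := fun _ => S)
      (hS.comp contDiff_snd).contDiffOn (J := {0}) isCompact_singleton (Set.subset_univ _) x
      (T := fun _ => 0) (fun _ => rfl) (fun _ => by simp)
  have h2 : LipFam (fun _ : Unit => x) (fun _ y => g y) :=
    lipFam_slab (I := Set.univ) convex_univ (by simp) (f := fun _ => g)
      (hg.comp contDiff_snd).contDiffOn (J := {0}) isCompact_singleton (Set.subset_univ _) x
      (T := fun _ => 0) (fun _ => rfl) (fun _ => by simp)
  obtain ⟨C₁, hC₁, k1⟩ := h1.2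
  obtain ⟨C₂, hC₂, k2⟩ := h2
  obtain ⟨C₃, hC₃, k3⟩ := LipFam.symm ⟨C₂, hC₂, k2⟩
  refine ⟨C₁ + C₂ + C₃, hc, by positivity, fun _ y => chord y, fun i h hh => ?_, fun i h hh => ?_,
    fun i h hh => ?_, fun _ => hS.continuous, fun _ => hg.continuous, fun ρ hρ => ?_⟩
  · exact (k1 i h hh).trans (by gcongr; linarith)
  · exact (k2 i h hh).1.trans (by linarith)
  · exact (k3 i h hh).trans (by gcongr; linarith)
  · exact ⟨_, fun _ => ⟨hfar ρ hρ, le_rfl⟩⟩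

/-! ### Stokes' theorem on the whole plane -/

/-- Smooth cutoff functions exhausting the plane. -/
theorem exists_cutoff : ∃ (χ : ℕ → Plane → ℝ) (B : ℝ), 0 ≤ B ∧ (∀ n, ContDiff ℝ 1 (χ n)) ∧
    (∀ n, HasCompactSupport (χ n)) ∧ (∀ n y, |χ n y| ≤ 1) ∧
    (∀ y, Tendsto (fun n => χ n y) atTop (𝓝 1)) ∧ (∀ n i y, |pd i (χ n) y| ≤ B / (n + 1)) ∧
    (∀ n i y, |pd i (χ n) y| * (1 + ‖y‖) ≤ 3 * B) := by
  let β : ContDiffBump (0 : Plane) := ⟨1, 2, one_pos, one_lt_two⟩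
  have hβ : ContDiff ℝ 1 β := β.contDiff
  obtain ⟨B, hB⟩ := (β.hasCompactSupport.fderiv ℝ).exists_bound_of_continuous
    (hβ.continuous_fderiv (by norm_num))
  have hB0 : 0 ≤ B := (norm_nonneg _).trans (hB 0)
  have hn0 : ∀ n : ℕ, (0 : ℝ) < n + 1 := fun n => by positivity
  set χ : ℕ → Plane → ℝ := fun n y => β (((n : ℝ) + 1)⁻¹ • y) with hχ
  have hfd : ∀ n i y, pd i (χ n) y = ((n : ℝ) + 1)⁻¹ * pd i β (((n : ℝ) + 1)⁻¹ • y) := by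
    intro n i y
    have h1 : HasFDerivAt (fun y : Plane => ((n : ℝ) + 1)⁻¹ • y)
        (((n : ℝ) + 1)⁻¹ • ContinuousLinearMap.id ℝ Plane) y :=
      (((n : ℝ) + 1)⁻¹ • ContinuousLinearMap.id ℝ Plane).hasFDerivAt
    have h2 := (hβ.differentiable (by norm_num) (((n : ℝ) + 1)⁻¹ • y)).hasFDerivAt
    have := (h2.comp y h1).pd i
    refine this.trans ?_
    simp [pd]
  have hpdβ : ∀ i z, |pd i β z| ≤ B := fun i z => (norm_pd_le i β z).trans (hB z)
  refine ⟨χ, B, hB0, fun n => hβ.comp (contDiff_const_smul _), fun n => ?_, fun n y => ?_,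
    fun y => ?_, fun n i y => ?_, fun n i y => ?_⟩
  · exact β.hasCompactSupport.comp_smul (inv_ne_zero (hn0 n).ne')
  · rw [abs_of_nonneg β.nonneg]; exact β.le_one
  · refine tendsto_const_nhds.congr' ?_
    filter_upwards [eventually_ge_atTop ⌈‖y‖⌉₊] with n hn
    refine (β.one_of_mem_closedBall ?_).symm
    have : ‖y‖ ≤ n := (Nat.le_ceil _).trans (by exact_mod_cast hn)
    rw [mem_closedBall_zero_iff, norm_smul, Real.norm_of_nonneg (by positivity),
      inv_mul_le_iff₀ (hn0 n)]
    change ‖y‖ ≤ (n + 1) * 1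
    linarith
  · rw [hfd, abs_mul, abs_of_pos (inv_pos.2 (hn0 n)), div_eq_inv_mul]
    gcongr
    exact hpdβ i _
  · rw [hfd, abs_mul, abs_of_pos (inv_pos.2 (hn0 n))]
    by_cases hz : ((n : ℝ) + 1)⁻¹ • y ∈ tsupport β
    · rw [β.tsupport_eq, mem_closedBall_zero_iff, norm_smul,
        Real.norm_of_nonneg (by positivity), inv_mul_le_iff₀ (hn0 n)] at hz
      have hz' : ‖y‖ ≤ (n + 1) * 2 := hz
      have h1 : 1 + ‖y‖ ≤ 3 * (n + 1) := by
        have : (0 : ℝ) ≤ n := Nat.cast_nonneg n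
        linarith
      calc _ ≤ ((n : ℝ) + 1)⁻¹ * B * (3 * (n + 1)) := by
            refine mul_le_mul ?_ h1 (by positivity) (by have := hn0 n; positivity)
            exact mul_le_mul_of_nonneg_left (hpdβ i _) (inv_pos.2 (hn0 n)).le
        _ = 3 * B := by have := (hn0 n).ne'; field_simp
    · rw [pd_eq_zero_of_notMem_tsupport hz]
      simp; positivity

theorem pd_re_eq_zero {S : Plane → Cl} (hS : Differentiable ℝ S) (hSre : ∀ y, (S y).re = 0)
    (i : Fin 2) (y : Plane) : (pd i S y).re = 0 := by
  have h1 := pd_comp_clm reL (hS y) i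
  simp only [reL_apply] at h1
  rw [← h1]
  have : (fun y => (S y).re) = fun _ => 0 := funext hSre
  rw [this]; simp [pd]

theorem ne_of_chord {S : Plane → Cl} {x y : Plane} {c : ℝ} (hc : 0 < c)
    (chord : ∀ y, c * ‖y - x‖ ≤ ‖S y - S x‖) (h : y ≠ x) : S y ≠ S x := by
  intro he
  have := chord y
  rw [he, sub_self, norm_zero] at this
  have h2 : 0 < c * ‖y - x‖ := mul_pos hc (norm_pos_iff.2 (sub_ne_zero.2 h))
  linarith

theorem norm_regK_le_far {S : Plane → Cl} {x y : Plane} {c : ℝ} (δ : ℝ) (hc : 0 < c)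
    (chord : ∀ y, c * ‖y - x‖ ≤ ‖S y - S x‖) (hy : y ≠ x) :
    ‖regK δ (S y - S x)‖ ≤ (c ^ 2)⁻¹ * (‖y - x‖ ^ 2)⁻¹ := by
  refine (norm_regK_le δ _).trans ?_
  rw [← mul_inv, ← mul_pow]
  have := chord y
  have h0 : 0 < ‖y - x‖ := norm_pos_iff.2 (sub_ne_zero.2 hy)
  gcongr

theorem norm_regK'_le_far {S : Plane → Cl} {x y : Plane} {c : ℝ} (δ : ℝ) (η : Cl) (hc : 0 < c)
    (chord : ∀ y, c * ‖y - x‖ ≤ ‖S y - S x‖) (hy : y ≠ x) :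
    ‖regK' δ (S y - S x) η‖ ≤ 4 * ‖η‖ * ((c ^ 3)⁻¹ * (‖y - x‖ ^ 3)⁻¹) := by
  refine (norm_regK'_le δ η (sub_ne_zero.2 (ne_of_chord hc chord hy))).trans ?_
  rw [← mul_inv, ← mul_pow]
  have := chord y
  have h0 : 0 < ‖y - x‖ := norm_pos_iff.2 (sub_ne_zero.2 hy)
  gcongr

theorem norm_normal_le {S : Plane → Cl} {M : ℝ} (hSM : ∀ i y, ‖pd i S y‖ ≤ M) (y : Plane) :
    ‖normal S y‖ ≤ M * M := by
  have hM : 0 ≤ M := (norm_nonneg _).trans (hSM 0 y)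
  exact (norm_cross_le _ _).trans (mul_le_mul (hSM 0 y) (hSM 1 y) (norm_nonneg _) hM)

/-- Pointwise bound for the first variation away from the singular point. -/
theorem norm_variation_le {S η F : Plane → Cl} {x y : Plane} {c M ρ : ℝ} (hc : 0 < c)
    (hρ : 0 < ρ) (chord : ∀ y, c * ‖y - x‖ ≤ ‖S y - S x‖) (hSM : ∀ i y, ‖pd i S y‖ ≤ M)
    (hηM : ∀ y, ‖η y‖ ≤ M) (hηM' : ∀ i y, ‖pd i η y‖ ≤ M) (hy : ρ ≤ ‖y - x‖) :
    ‖variation 0 S η F x y‖ ≤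
      (4 * M ^ 3 * (c ^ 3)⁻¹ * ρ⁻¹ + 2 * M ^ 2 * (c ^ 2)⁻¹) * ((‖y - x‖ ^ 2)⁻¹ * ‖F y‖) := by
  have hM : 0 ≤ M := (norm_nonneg _).trans (hηM y)
  have hy0 : 0 < ‖y - x‖ := hρ.trans_le hy
  have hyx : y ≠ x := sub_ne_zero.1 (norm_pos_iff.1 hy0)
  have n1 : ‖regK' 0 (S y - S x) (η y) * normal S y‖ ≤
      4 * M * ((c ^ 3)⁻¹ * (‖y - x‖ ^ 3)⁻¹) * (M * M) := by
    rw [norm_mul]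
    refine mul_le_mul ((norm_regK'_le_far 0 (η y) hc chord hyx).trans ?_) (norm_normal_le hSM y)
      (norm_nonneg _) (by positivity)
    gcongr; exact hηM y
  have n2 : ‖cross (pd 0 η y) (pd 1 S y) + cross (pd 0 S y) (pd 1 η y)‖ ≤ M * M + M * M := by
    refine (norm_add_le _ _).trans (add_le_add ?_ ?_)
    · exact (norm_cross_le _ _).trans (mul_le_mul (hηM' 0 y) (hSM 1 y) (norm_nonneg _) hM)
    · exact (norm_cross_le _ _).trans (mul_le_mul (hSM 0 y) (hηM' 1 y) (norm_nonneg _) hM)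
  have n3 := norm_regK_le_far 0 hc chord hyx
  rw [variation, norm_mul, ← mul_assoc]
  refine mul_le_mul_of_nonneg_right ?_ (norm_nonneg _)
  calc _ ≤ 4 * M * ((c ^ 3)⁻¹ * (‖y - x‖ ^ 3)⁻¹) * (M * M) +
        (c ^ 2)⁻¹ * (‖y - x‖ ^ 2)⁻¹ * (M * M + M * M) := by
        refine (norm_add_le _ _).trans (add_le_add n1 ?_)
        rw [norm_mul]
        gcongr
    _ = (4 * M ^ 3 * (c ^ 3)⁻¹ * ‖y - x‖⁻¹ + 2 * M ^ 2 * (c ^ 2)⁻¹) * (‖y - x‖ ^ 2)⁻¹ := by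
        field_simp; ring
    _ ≤ _ := by gcongr

/-- The integrated first variation for a density supported away from the singular point. -/
theorem integral_variation_far {S η F : Plane → Cl} {x : Plane} {c M : ℝ} (hS : ContDiff ℝ 2 S)
    (hη : ContDiff ℝ 1 η) (hF : ContDiff ℝ 1 F)
    (hSre : ∀ y, (S y).re = 0) (hηre : ∀ y, (η y).re = 0)
    (hx : x ∉ tsupport F) (hc : 0 < c) (chord : ∀ y, c * ‖y - x‖ ≤ ‖S y - S x‖)
    (hSM : ∀ i y, ‖pd i S y‖ ≤ M) (hηM : ∀ y, ‖η y‖ ≤ M) (hηM' : ∀ i y, ‖pd i η y‖ ≤ M)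
    (hfar : FarInt F x) (hT : Integrable fun y => regK 0 (S y - S x) * crossT S (η y) F y) :
    Integrable (variation 0 S η F x) ∧
    ∫ y, variation 0 S η F x y = -∫ y, regK 0 (S y - S x) * crossT S (η y) F y := by
  have hM : 0 ≤ M := (norm_nonneg _).trans (hηM x)
  obtain ⟨ρ, hρ, hρ'⟩ : ∃ ρ, 0 < ρ ∧ ∀ y, ‖y - x‖ < ρ → y ∉ tsupport F := by
    obtain ⟨ρ, hρ, h⟩ := Metric.isOpen_iff.1 (isClosed_tsupport F).isOpen_compl x hx
    exact ⟨ρ, hρ, fun y hy => h (by rwa [Metric.mem_ball, dist_eq_norm])⟩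
  have hF0 : ∀ y, ‖y - x‖ < ρ → F y = 0 := fun y hy =>
    image_eq_zero_of_notMem_tsupport (hρ' y hy)
  have hSi : ∀ i, ContDiff ℝ 1 (pd i S) := fun i => hS.pd (by norm_num) i
  have hηi : ∀ i, Continuous (pd i η) := fun i => (hη.pd (m := 0) (by norm_num) i).continuous
  set D := 4 * M ^ 3 * (c ^ 3)⁻¹ * ρ⁻¹ + 2 * M ^ 2 * (c ^ 2)⁻¹ with hD
  set E := (c ^ 2)⁻¹ with hE
  -- the dominating function
  set w : Plane → ℝ := Set.indicator (Metric.ball x ρ)ᶜ (fun y => (‖y - x‖ ^ 2)⁻¹ * ‖F y‖) with hw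
  have hwint : Integrable w := (integrable_indicator_iff measurableSet_ball.compl).2 (hfar ρ hρ)
  have hwfar : ∀ y, ρ ≤ ‖y - x‖ → w y = (‖y - x‖ ^ 2)⁻¹ * ‖F y‖ := fun y hy =>
    Set.indicator_of_mem (by simpa [dist_eq_norm] using hy) _
  have hwnn : ∀ y, 0 ≤ w y := fun y => Set.indicator_nonneg (fun z _ => by positivity) y
  have hvar : ∀ y, ‖variation 0 S η F x y‖ ≤ D * w y := by
    intro y
    by_cases hy : ρ ≤ ‖y - x‖
    · rw [hwfar y hy]; exact norm_variation_le hc hρ chord hSM hηM hηM' hy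
    · rw [variation, hF0 y (not_le.1 hy), mul_zero, norm_zero]
      exact mul_nonneg (by positivity) (hwnn y)
  have hKmeas : ∀ {G : Plane → Cl}, Continuous G →
      AEStronglyMeasurable (fun y => regK 0 (S y - S x) * G y) volume := fun hG =>
    (stronglyMeasurable_regK_comp 0 (hS.continuous.sub continuous_const)).aestronglyMeasurable.mul
      hG.aestronglyMeasurable
  have hvc : Continuous (variation 0 S η F x) := by
    have hsub : tsupport (variation 0 S η F x) ⊆ tsupport F := tsupport_mul_subset_right
    refine continuous_of_tsupport fun y hy => ?_
    have hyx : S y - S x ≠ 0 := by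
      refine sub_ne_zero.2 (ne_of_chord hc chord ?_)
      rintro rfl; exact hx (hsub hy)
    have k1 : ContinuousAt (fun y => regK 0 (S y - S x)) y :=
      ((contDiffAt_regK (n := 1) (Or.inr hyx)).continuousAt).comp (f := fun y => S y - S x)
        (hS.continuous.sub continuous_const).continuousAt
    have k0 : ContinuousAt (fun y => (regNorm 0 (S y - S x))) y :=
      ((continuous_regNorm 0).comp (hS.continuous.sub continuous_const)).continuousAt
    have hp := regNorm_pos (δ := 0) (Or.inr hyx)
    have hSc : ContinuousAt (fun y => S y - S x) y :=
      (hS.continuous.sub continuous_const).continuousAt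
    have k2 : ContinuousAt (fun y => regK' 0 (S y - S x) (η y)) y := by
      simp only [regK'_apply]
      have i3 := (k0.pow 3).inv₀ (pow_ne_zero _ hp.ne')
      have i5 := (k0.pow 5).inv₀ (pow_ne_zero _ hp.ne')
      exact ((continuousAt_const.mul i3).smul hη.continuous.continuousAt).add
        (((continuousAt_const.mul (continuousAt_const.mul i5)).mul
          (hSc.inner hη.continuous.continuousAt)).smul hSc)
    have k3 : Continuous (normal S) := (hSi 0).continuous.cross (hSi 1).continuous
    have k4 : Continuous fun y => cross (pd 0 η y) (pd 1 S y) + cross (pd 0 S y) (pd 1 η y) :=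
      ((hηi 0).cross (hSi 1).continuous).add ((hSi 0).continuous.cross (hηi 1))
    exact ((k2.mul k3.continuousAt).add (k1.mul k4.continuousAt)).mul hF.continuous.continuousAt
  have hvint : Integrable (variation 0 S η F x) :=
    (hwint.const_mul D).mono' hvc.aestronglyMeasurable (Eventually.of_forall hvar)
  refine ⟨hvint, ?_⟩
  obtain ⟨χ, B, hB, hχ1, hχc, hχle, hχlim, hχd, -⟩ := exists_cutoff
  have hR : ∀ (n : ℕ) y, ‖regK 0 (S y - S x) * ((pd 0 (χ n) y • cross (η y) (pd 1 S y) -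
      pd 1 (χ n) y • cross (η y) (pd 0 S y)) * F y)‖ ≤
      E * (2 * (B / ((n : ℝ) + 1)) * M ^ 2) * w y := by
    intro n y
    by_cases hy : ρ ≤ ‖y - x‖
    · have hyx : y ≠ x := by
        rintro rfl
        simp at hy; linarith
      have hcr : ∀ i, ‖cross (η y) (pd i S y)‖ ≤ M * M := fun i =>
        (norm_cross_le _ _).trans (mul_le_mul (hηM y) (hSM i y) (norm_nonneg _) hM)
      have hb : 0 ≤ B / ((n : ℝ) + 1) := by positivity
      have hsm : ∀ i j, ‖pd i (χ n) y • cross (η y) (pd j S y)‖ ≤ B / ((n : ℝ) + 1) * (M * M) := by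
        intro i j
        rw [norm_smul]
        exact mul_le_mul (hχd n i y) (hcr j) (norm_nonneg _) hb
      rw [hwfar y hy, norm_mul, norm_mul]
      calc _ ≤ (E * (‖y - x‖ ^ 2)⁻¹) * ((B / ((n : ℝ) + 1) * (M * M) +
            B / ((n : ℝ) + 1) * (M * M)) * ‖F y‖) :=
            mul_le_mul (norm_regK_le_far 0 hc chord hyx) (mul_le_mul_of_nonneg_right
              ((norm_sub_le _ _).trans (add_le_add (hsm 0 1) (hsm 1 0))) (norm_nonneg _))
              (by positivity) (by positivity)
        _ = _ := by ring
    · rw [hF0 y (not_le.1 hy)]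
      simp only [mul_zero, norm_zero]
      exact mul_nonneg (by positivity) (hwnn y)
  -- the identity for the truncated densities
  have step : ∀ n, ∫ y, χ n y • variation 0 S η F x y =
      -((∫ y, χ n y • (regK 0 (S y - S x) * crossT S (η y) F y)) +
        ∫ y, regK 0 (S y - S x) * ((pd 0 (χ n) y • cross (η y) (pd 1 S y) -
          pd 1 (χ n) y • cross (η y) (pd 0 S y)) * F y)) := by
    intro n
    have hsub : tsupport (fun y => χ n y • F y) ⊆ tsupport F := tsupport_smul_subset_right _ _
    have h1 := integral_variation (δ := 0) (F := fun y => χ n y • F y) hS hη ((hχ1 n).smul hF)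
      ((hχc n).smul_right) hSre hηre (Or.inr fun h => hx (hsub h))
      (fun y hy => ne_of_chord hc chord hy)
    have h2 : ∀ y, variation 0 S η (fun y => χ n y • F y) x y = χ n y • variation 0 S η F x y := by
      intro y; simp only [variation]; rw [mul_smul_comm]
    have h3 : ∀ y, regK 0 (S y - S x) * crossT S (η y) (fun y => χ n y • F y) y =
        χ n y • (regK 0 (S y - S x) * crossT S (η y) F y) +
        regK 0 (S y - S x) * ((pd 0 (χ n) y • cross (η y) (pd 1 S y) -
          pd 1 (χ n) y • cross (η y) (pd 0 S y)) * F y) := by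
      intro y
      have d1 := (hχ1 n).differentiable (by norm_num) y
      have d2 := hF.differentiable (by norm_num) y
      simp only [crossT]
      rw [pd_smul d1 d2, pd_smul d1 d2]
      simp only [mul_add, mul_sub, sub_mul, mul_smul_comm, smul_mul_assoc, smul_sub]
      abel
    simp only [h2] at h1
    rw [h1]
    have h4 : ∀ y, regL 0 (S y - S x) = 0 := fun y => by simp [regL]
    simp only [h4, zero_smul, integral_zero, zero_sub, h3]
    congr 1
    refine integral_add ?_ ?_
    · refine hT.norm.mono' ((hχ1 n).continuous.aestronglyMeasurable.smul hT.1)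
        (Eventually.of_forall fun y => ?_)
      rw [norm_smul]
      exact mul_le_of_le_one_left (norm_nonneg _) (hχle n y)
    · refine (hwint.const_mul (E * (2 * B * M ^ 2))).mono' (hKmeas ?_)
        (Eventually.of_forall fun y => ?_)
      · exact ((((hχ1 n).pd (m := 0) (by norm_num) 0).continuous.smul
          (hη.continuous.cross (hSi 1).continuous)).sub
          (((hχ1 n).pd (m := 0) (by norm_num) 1).continuous.smul
          (hη.continuous.cross (hSi 0).continuous))).mul hF.continuous
      · refine (hR n y).trans (mul_le_mul_of_nonneg_right ?_ (hwnn y))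
        have : B / ((n : ℝ) + 1) ≤ B := div_le_self hB (by
          have : (0 : ℝ) ≤ n := Nat.cast_nonneg n
          linarith)
        gcongr
  have hone : ∀ n y, ‖χ n y‖ ≤ 1 := hχle
  have lim : ∀ {G : Plane → Cl}, Integrable G →
      Tendsto (fun n => ∫ y, χ n y • G y) atTop (𝓝 (∫ y, G y)) := by
    intro G hG
    refine tendsto_integral_of_dominated_convergence (fun y => ‖G y‖)
      (fun n => (hχ1 n).continuous.aestronglyMeasurable.smul hG.1) hG.norm
      (fun n => Eventually.of_forall fun y => ?_) (Eventually.of_forall fun y => ?_)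
    · rw [norm_smul]
      exact mul_le_of_le_one_left (norm_nonneg _) (hone n y)
    · simpa using (hχlim y).smul_const (G y)
  have hlast : Tendsto (fun n => ∫ y, regK 0 (S y - S x) * ((pd 0 (χ n) y • cross (η y) (pd 1 S y) -
      pd 1 (χ n) y • cross (η y) (pd 0 S y)) * F y)) atTop (𝓝 0) := by
    have hb : Tendsto (fun n : ℕ => E * (2 * (B / ((n : ℝ) + 1)) * M ^ 2) * ∫ y, w y) atTop
        (𝓝 0) := by
      have h0 : Tendsto (fun n : ℕ => B / ((n : ℝ) + 1)) atTop (𝓝 0) := by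
        have := (tendsto_one_div_add_atTop_nhds_zero_nat (𝕜 := ℝ)).const_mul B
        simpa [div_eq_mul_inv] using this
      have := (((h0.const_mul 2).mul_const (M ^ 2)).const_mul E).mul_const (∫ y, w y)
      simpa using this
    refine squeeze_zero_norm (fun n => ?_) hb
    rw [← integral_const_mul]
    exact norm_integral_le_of_norm_le (hwint.const_mul _) (Eventually.of_forall (hR n))
  refine tendsto_nhds_unique (lim hvint) ?_
  have := ((lim hT).add hlast).neg
  rw [add_zero] at this
  exact this.congr fun n => (step n).symm

/-! ### Principal values -/

/-- The principal value integral `p.v. ∫ K(S(y) - S(x)) g(y) dy` exists and is equal to `L`. -/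
def HasPV (S g : Plane → Cl) (x : Plane) (L : Cl) : Prop :=
  (∀ r : ℝ, 0 < r → IntegrableOn (fun y => kernelK (S y - S x) * g y) (Metric.ball x r)ᶜ) ∧
    Tendsto (fun r => ∫ y in (Metric.ball x r)ᶜ, kernelK (S y - S x) * g y) (𝓝[>] (0 : ℝ)) (𝓝 L)

section
variable {S g g₁ g₂ f : Plane → Cl} {x : Plane} {L L₁ L₂ : Cl}

theorem HasPV.congr (h : HasPV S g₁ x L) (he : ∀ y, g₁ y = g₂ y) : HasPV S g₂ x L := by
  rwa [funext he] at h

theorem HasPV.add (h₁ : HasPV S g₁ x L₁) (h₂ : HasPV S g₂ x L₂) :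
    HasPV S (fun y => g₁ y + g₂ y) x (L₁ + L₂) := by
  simp only [HasPV, mul_add]
  refine ⟨fun r hr => (h₁.1 r hr).add (h₂.1 r hr), (h₁.2.add h₂.2).congr' ?_⟩
  filter_upwards [self_mem_nhdsWithin] with r hr
  exact (integral_add (h₁.1 r hr) (h₂.1 r hr)).symm

theorem HasPV.map (h : HasPV S g x L) (T : Cl →L[ℝ] Cl)
    (hT : ∀ y, T (kernelK (S y - S x) * g y) = kernelK (S y - S x) * T (g y)) :
    HasPV S (fun y => T (g y)) x (T L) := by
  simp only [HasPV, ← hT]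
  refine ⟨fun r hr => T.integrable_comp (h.1 r hr),
    ((T.continuous.tendsto _).comp h.2).congr' ?_⟩
  filter_upwards [self_mem_nhdsWithin] with r hr
  exact (T.integral_comp_comm (h.1 r hr)).symm

theorem HasPV.smul (h : HasPV S g x L) (c : ℝ) : HasPV S (fun y => c • g y) x (c • L) :=
  h.map (c • ContinuousLinearMap.id ℝ Cl) fun y => by simp

theorem HasPV.neg (h : HasPV S g x L) : HasPV S (fun y => -g y) x (-L) := by
  simpa using h.smul (-1)

theorem HasPV.sub (h₁ : HasPV S g₁ x L₁) (h₂ : HasPV S g₂ x L₂) :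
    HasPV S (fun y => g₁ y - g₂ y) x (L₁ - L₂) := by
  simpa [sub_eq_add_neg] using h₁.add h₂.neg

theorem HasPV.mul_right (h : HasPV S g x L) (c : Cl) : HasPV S (fun y => g y * c) x (L * c) :=
  h.map (mulL.flip c) fun y => by simp [mul_assoc]

theorem HasPV.hilbertExists (h : HasPV S (fun y => normal S y * f y) x L) :
    HilbertExists S f x := by
  simp only [HasPV, ← mul_assoc] at h
  exact ⟨h.1, L, h.2⟩

theorem HasPV.hilbert_eq (h : HasPV S (fun y => normal S y * f y) x L) :
    hilbert S f x = L := by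
  simp only [HasPV, ← mul_assoc] at h
  exact h.2.limUnder_eq

theorem HilbertExists.hasPV (h : HilbertExists S f x) :
    HasPV S (fun y => normal S y * f y) x (hilbert S f x) := by
  obtain ⟨h1, L, h2⟩ := h
  have : HasPV S (fun y => normal S y * f y) x L := by
    simp only [HasPV, ← mul_assoc]
    exact ⟨h1, h2⟩
  rwa [this.hilbert_eq]

variable {c : ℝ}

theorem exists_hasPV (hS : ContDiff ℝ 2 S) (hg : ContDiff ℝ 1 g) (hc : 0 < c)
    (chord : ∀ y, c * ‖y - x‖ ≤ ‖S y - S x‖) (hfar : FarInt g x) : ∃ L, HasPV S g x L := by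
  obtain ⟨C, H⟩ := pvFamily_of_contDiff hS hg hc chord hfar
  obtain ⟨L, hL⟩ := H.exists_tendsto ()
  simp only [regK_zero] at hL
  refine ⟨L, fun r hr => ?_, hL⟩
  have := H.integrableOn 0 () hr
  simpa only [regK_zero] using this

/-- The regularized integrals converge to the principal value. -/
theorem HasPV.tendsto_regK (h : HasPV S g x L) (hS : ContDiff ℝ 2 S) (hg : ContDiff ℝ 1 g)
    (hc : 0 < c) (chord : ∀ y, c * ‖y - x‖ ≤ ‖S y - S x‖) (hfar : FarInt g x) :
    Tendsto (fun δ => ∫ y, regK δ (S y - S x) * g y) (𝓝[>] 0) (𝓝 L) := by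
  obtain ⟨C, H⟩ := pvFamily_of_contDiff hS hg hc chord hfar
  have hl := h.2
  simp only [← regK_zero] at hl
  have := H.tendsto_reg (L := fun _ => L) (fun _ => hl)
  rw [Metric.tendsto_nhds]
  intro ε hε
  obtain ⟨r₀, h0, h1⟩ := this (ε / 2) (by positivity)
  filter_upwards [Ioo_mem_nhdsGT h0] with δ hδ
  rw [dist_eq_norm]
  have := h1 δ hδ.1 hδ.2 ()
  linarith

end

theorem coe_eq_smul (r : ℝ) : (r : Cl) = r • (1 : Cl) := by
  simpa using (Quaternion.coe_mul_eq_smul r (1 : Cl))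

theorem re_mul_of_vector {σ τ : Cl} (hσ : σ.re = 0) : (σ * τ).re = -inner ℝ σ τ := by
  rw [inner_eq, hσ, Quaternion.re_mul, hσ]; ring

theorem regK_re {δ : ℝ} {σ : Cl} (hσ : σ.re = 0) : (regK δ σ).re = 0 := by
  simp [regK, hσ]

/-- The tangential field `N × e₃ = z_α S_β - z_β S_α`, the rotated gradient of the height. -/
def tang (S : Plane → Cl) (y : Plane) : Cl :=
  (pd 0 S y).imK • pd 1 S y - (pd 1 S y).imK • pd 0 S y

theorem contDiff_regNorm_inv {δ : ℝ} (hδ : δ ≠ 0) {S : Plane → Cl} (hS : ContDiff ℝ 2 S)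
    (x : Plane) : ContDiff ℝ 2 fun y => 2 / (4 * Real.pi) * (regNorm δ (S y - S x))⁻¹ := by
  refine contDiff_const.mul (ContDiff.inv ?_ fun y => (regNorm_pos (Or.inl hδ)).ne')
  refine contDiff_iff_contDiffAt.2 fun y => ?_
  exact (contDiffAt_regNorm (Or.inl hδ)).comp (f := fun y => S y - S x) y
    (hS.sub contDiff_const).contDiffAt

theorem pd_regNorm_inv {δ : ℝ} (hδ : δ ≠ 0) {S : Plane → Cl} (hS : ContDiff ℝ 2 S)
    (x y : Plane) (i : Fin 2) :
    pd i (fun y => 2 / (4 * Real.pi) * (regNorm δ (S y - S x))⁻¹) y =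
      inner ℝ (regK δ (S y - S x)) (pd i S y) := by
  have h0 := (hS.differentiable (by norm_num) y).hasFDerivAt.sub_const (S x)
  have hp := regNorm_pos (δ := δ) (σ := S y - S x) (Or.inl hδ)
  have h1 := (hasFDerivAt_regNorm (δ := δ) (σ := S y - S x) (Or.inl hδ)).comp
    (f := fun y => S y - S x) y h0
  have h2 := (((hasDerivAt_inv hp.ne').comp_hasFDerivAt y h1).const_mul (2 / (4 * Real.pi))).pd i
  refine h2.trans ?_
  rw [regK, real_inner_smul_left]
  simp [pd, innerSL_apply_apply]
  field_simp
  rw [inner_sub_left]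

/-- The gradient of the Newtonian potential along a tangential field that is a rotated gradient
has vanishing principal value: `p.v. ∫ K · (ψ_α S_β - ψ_β S_α) = 0`. -/
theorem HasPV.re_tangential {S : Plane → Cl} {x : Plane} {c M D : ℝ} {φ ψ : Plane → ℝ} {L : Cl}
    (hS : ContDiff ℝ 2 S) (hSre : ∀ y, (S y).re = 0) (hc : 0 < c)
    (chord : ∀ y, c * ‖y - x‖ ≤ ‖S y - S x‖) (hSM : ∀ i y, ‖pd i S y‖ ≤ M)
    (hφ : ContDiff ℝ 1 φ) (hψ : ContDiff ℝ 1 ψ)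
    (hψφ : ∀ i y, pd i ψ y = φ y * (pd i S y).imK)
    (hD : ∀ y, |ψ y| ≤ D * (1 + ‖y‖) * |(S y).imK|)
    (hz : FarInt (fun y => (((S y).imK : ℝ) : Cl)) x)
    (hfar : FarInt (fun y => φ y • tang S y) x)
    (hL : HasPV S (fun y => φ y • tang S y) x L) : L.re = 0 := by
  have hM : 0 ≤ M := (norm_nonneg _).trans (hSM 0 x)
  have hD0 : 0 ≤ |D| := abs_nonneg _
  have hSi : ∀ i, ContDiff ℝ 1 (pd i S) := fun i => hS.pd (by norm_num) i
  have him : ∀ i, ContDiff ℝ 1 fun y => (pd i S y).imK := fun i => imKL.contDiff.comp (hSi i)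
  have hg : ContDiff ℝ 1 (fun y => φ y • tang S y) :=
    hφ.smul (((him 0).smul (hSi 1)).sub ((him 1).smul (hSi 0)))
  have hzc : ContDiff ℝ 1 (fun y => (((S y).imK : ℝ) : Cl)) := by
    have h1 : ContDiff ℝ 1 fun y => (S y).imK := imKL.contDiff.comp (hS.of_le (by norm_num))
    simp only [coe_eq_smul]
    exact h1.smul contDiff_const
  obtain ⟨C, H⟩ := pvFamily_of_contDiff hS hg hc chord hfar
  obtain ⟨C', H'⟩ := pvFamily_of_contDiff hS hzc hc chord hz
  obtain ⟨χ, B, hB, hχ1, hχc, hχle, hχlim, hχd, hχd'⟩ := exists_cutoff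
  have main : ∀ δ, 0 < δ → (∫ y, regK δ (S y - S x) * (φ y • tang S y)).re = 0 := by
    intro δ hδ
    have hint := H.integrable hδ.ne' ()
    have hint' := H'.integrable hδ.ne' ()
    -- the regularized Newtonian potential along the surface; its gradient is the kernel
    obtain ⟨Γ, hΓ⟩ : ∃ Γ : Plane → ℝ, Γ = fun y => 2 / (4 * Real.pi) * (regNorm δ (S y - S x))⁻¹ :=
      ⟨_, rfl⟩
    have hΓ2 : ContDiff ℝ 2 Γ := hΓ ▸ contDiff_regNorm_inv hδ.ne' hS x
    have hΓ1 : ∀ i, ContDiff ℝ 1 (pd i Γ) := fun i => hΓ2.pd (by norm_num) i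
    have hΓd : ∀ i y, pd i Γ y = inner ℝ (regK δ (S y - S x)) (pd i S y) := fun i y => by
      rw [hΓ]; exact pd_regNorm_inv hδ.ne' hS x y i
    have hΓM : ∀ i y, |pd i Γ y| ≤ ‖regK δ (S y - S x)‖ * M := fun i y => by
      rw [hΓd]
      exact (abs_real_inner_le_norm _ _).trans
        (mul_le_mul_of_nonneg_left (hSM i y) (norm_nonneg _))
    -- the scalar part of the integrand is a Jacobian of `ψ` and `Γ`, hence a divergence
    have hre : ∀ y, (regK δ (S y - S x) * (φ y • tang S y)).re =
        -(pd 0 ψ y * pd 1 Γ y - pd 1 ψ y * pd 0 Γ y) := by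
      intro y
      rw [re_mul_of_vector (regK_re (by simp [hSre])), hΓd, hΓd, hψφ, hψφ, tang,
        real_inner_smul_right, inner_sub_right, real_inner_smul_right, real_inner_smul_right]
      ring
    set F : Plane → ℝ := fun y => (regK δ (S y - S x) * (φ y • tang S y)).re with hF
    have hFint : Integrable F := reL.integrable_comp hint
    have hFe : (∫ y, regK δ (S y - S x) * (φ y • tang S y)).re = ∫ y, F y :=
      (reL.integral_comp_comm hint).symm
    rw [hFe]
    have hcut : ∀ n, ∫ y, χ n y * F y =
        ∫ y, ψ y * (pd 0 (χ n) y * pd 1 Γ y - pd 1 (χ n) y * pd 0 Γ y) := by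
      intro n
      have hcs : ∀ i, HasCompactSupport fun y => χ n y * (ψ y * pd i Γ y) := fun i =>
        (hχc n).mul_right
      have hcd : ∀ i, ContDiff ℝ 1 fun y => χ n y * (ψ y * pd i Γ y) := fun i =>
        (hχ1 n).mul (hψ.mul (hΓ1 i))
      have e1 := integral_pd_eq_zero (hcd 1) (hcs 1) 0
      have e2 := integral_pd_eq_zero (hcd 0) (hcs 0) 1
      have hpi : ∀ i j, Integrable fun y => pd j (fun y => χ n y * (ψ y * pd i Γ y)) y := by
        intro i j
        refine Continuous.integrable_of_hasCompactSupport
          ((hcd i).pd (m := 0) (by norm_num) j).continuous ?_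
        exact (hcs i).fderiv_apply ℝ _
      have hexp : ∀ i j y, pd j (fun y => χ n y * (ψ y * pd i Γ y)) y =
          χ n y * (ψ y * pd j (pd i Γ) y + pd j ψ y * pd i Γ y) +
            pd j (χ n) y * (ψ y * pd i Γ y) := by
        intro i j y
        have d1 := (hχ1 n).differentiable (by norm_num) y
        have d2 := hψ.differentiable (by norm_num) y
        have d3 := (hΓ1 i).differentiable (by norm_num) y
        have := pd_smul (V := ℝ) d1 (d2.mul d3) j
        have h' := pd_smul (V := ℝ) d2 d3 j
        simp only [smul_eq_mul] at this h'
        refine this.trans ?_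
        have h2 : pd j (ψ * pd i Γ) y = _ := h'
        rw [h2]
        simp
      have e3 : ∫ y, (pd 0 (fun y => χ n y * (ψ y * pd 1 Γ y)) y -
          pd 1 (fun y => χ n y * (ψ y * pd 0 Γ y)) y) = 0 := by
        rw [integral_sub (hpi 1 0) (hpi 0 1), e1, e2, sub_zero]
      have hi1 : Integrable fun y => χ n y * F y := by
        refine hFint.norm.mono' ((hχ1 n).continuous.aestronglyMeasurable.mul hFint.1)
          (Eventually.of_forall fun y => ?_)
        rw [norm_mul]
        exact mul_le_of_le_one_left (norm_nonneg _) (hχle n y)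
      rw [← sub_eq_zero]
      have hi2 : Integrable fun y =>
          ψ y * (pd 0 (χ n) y * pd 1 Γ y - pd 1 (χ n) y * pd 0 Γ y) := by
        refine (((hpi 1 0).sub (hpi 0 1)).add hi1).congr (Eventually.of_forall fun y => ?_)
        simp only [Pi.add_apply, Pi.sub_apply, hexp, hF, hre, pd_comm hΓ2 0 1 y]
        ring
      rw [← integral_sub hi1 hi2, ← neg_eq_zero, ← integral_neg, ← e3]
      refine integral_congr_ae (Eventually.of_forall fun y => ?_)
      simp only [hexp, hF, hre, pd_comm hΓ2 0 1 y]
      ring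
    have l1 : Tendsto (fun n => ∫ y, χ n y * F y) atTop (𝓝 (∫ y, F y)) := by
      refine tendsto_integral_of_dominated_convergence (fun y => ‖F y‖)
        (fun n => (hχ1 n).continuous.aestronglyMeasurable.mul hFint.1) hFint.norm
        (fun n => Eventually.of_forall fun y => ?_) (Eventually.of_forall fun y => ?_)
      · rw [norm_mul]
        exact mul_le_of_le_one_left (norm_nonneg _) (hχle n y)
      · simpa using (hχlim y).mul_const (F y)
    -- `ψ ∇χₙ` is bounded by a multiple of `|z|`, since `(1 + |y|) |∇χₙ|` is bounded
    have l2 : Tendsto (fun n => ∫ y, ψ y * (pd 0 (χ n) y * pd 1 Γ y - pd 1 (χ n) y * pd 0 Γ y))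
        atTop (𝓝 (∫ y : Plane, (0 : ℝ))) := by
      refine tendsto_integral_of_dominated_convergence
        (fun y => (6 * B * |D| * M) * ‖regK δ (S y - S x) * (((S y).imK : ℝ) : Cl)‖)
        (fun n => ?_) (hint'.norm.const_mul _)
        (fun n => Eventually.of_forall fun y => ?_) (Eventually.of_forall fun y => ?_)
      · have hpc : ∀ i, Continuous (pd i (χ n)) := fun i =>
          ((hχ1 n).pd (m := 0) (by norm_num) i).continuous
        exact (hψ.continuous.mul (((hpc 0).mul (hΓ1 1).continuous).sub
          ((hpc 1).mul (hΓ1 0).continuous))).aestronglyMeasurable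
      · rw [norm_mul, norm_mul, Quaternion.norm_coe, Real.norm_eq_abs, Real.norm_eq_abs,
          Real.norm_eq_abs]
        have hy : 0 < 1 + ‖y‖ := by positivity
        have hterm : ∀ i j, |pd i (χ n) y * pd j Γ y| ≤
            3 * B / (1 + ‖y‖) * (‖regK δ (S y - S x)‖ * M) := fun i j => by
          rw [abs_mul]
          exact mul_le_mul ((le_div_iff₀ hy).2 (hχd' n i y)) (hΓM j y) (abs_nonneg _)
            (by positivity)
        have hψ' : |ψ y| ≤ |D| * (1 + ‖y‖) * |(S y).imK| := (hD y).trans (by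
          gcongr; exact le_abs_self D)
        calc _ ≤ (|D| * (1 + ‖y‖) * |(S y).imK|) *
              (3 * B / (1 + ‖y‖) * (‖regK δ (S y - S x)‖ * M) +
               3 * B / (1 + ‖y‖) * (‖regK δ (S y - S x)‖ * M)) :=
              mul_le_mul hψ' ((abs_sub _ _).trans (add_le_add (hterm 0 1) (hterm 1 0)))
                (abs_nonneg _) (by positivity)
          _ = _ := by field_simp; ring
      · have h0 : ∀ i, Tendsto (fun n => pd i (χ n) y) atTop (𝓝 0) := fun i => by
          refine squeeze_zero_norm (fun n => hχd n i y) ?_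
          have := (tendsto_one_div_add_atTop_nhds_zero_nat (𝕜 := ℝ)).const_mul B
          simpa [div_eq_mul_inv] using this
        have := ((h0 0).mul_const (pd 1 Γ y)).sub ((h0 1).mul_const (pd 0 Γ y))
        simpa using this.const_mul (ψ y)
    rw [integral_zero] at l2
    exact tendsto_nhds_unique l1 (by simpa only [hcut] using l2)
  have h1 := hL.tendsto_regK hS hg hc chord hfar
  have h2 : Tendsto (fun δ => (∫ y, regK δ (S y - S x) * (φ y • tang S y)).re) (𝓝[>] 0)
      (𝓝 L.re) := (reL.continuous.tendsto _).comp h1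
  refine tendsto_nhds_unique h2 (tendsto_const_nhds.congr' ?_)
  filter_upwards [self_mem_nhdsWithin] with δ hδ using (main δ hδ).symm

/-! ### Derivatives on `I × ℝ²` -/

section
variable {V : Type*} [NormedAddCommGroup V] [NormedSpace ℝ V]
  {I : Set ℝ} {f g : ℝ → Plane → V} {n m : WithTop ℕ∞} {t : ℝ}

/-- `f` is of class `C^n` on `I × ℝ²`. -/
def CSlab (n : WithTop ℕ∞) (I : Set ℝ) (f : ℝ → Plane → V) : Prop :=
  ContDiffOn ℝ n (fun q : ℝ × Plane => f q.1 q.2) (I ×ˢ Set.univ)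

/-- The derivative in `(t, x)`, within the slab `I × ℝ²`. -/
def slabD (I : Set ℝ) (f : ℝ → Plane → V) (t : ℝ) (x : Plane) : ℝ × Plane →L[ℝ] V :=
  fderivWithin ℝ (fun q : ℝ × Plane => f q.1 q.2) (I ×ˢ Set.univ) (t, x)

theorem CSlab.of_le (hf : CSlab n I f) (h : m ≤ n) : CSlab m I f := ContDiffOn.of_le hf h

theorem CSlab.hasFDerivWithinAt (hf : CSlab 1 I f) (ht : t ∈ I) (x : Plane) :
    HasFDerivWithinAt (fun q : ℝ × Plane => f q.1 q.2) (slabD I f t x) (I ×ˢ Set.univ) (t, x) :=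
  ((ContDiffOn.differentiableOn hf (by norm_num)) (t, x) ⟨ht, Set.mem_univ _⟩).hasFDerivWithinAt

theorem CSlab.continuousOn_slabD (hI : Convex ℝ I) (hI' : (interior I).Nonempty)
    (hf : CSlab 1 I f) :
    ContinuousOn (fun q : ℝ × Plane => slabD I f q.1 q.2) (I ×ˢ Set.univ) :=
  ContDiffOn.continuousOn_fderivWithin hf (uniqueDiffOn_slab hI hI') le_rfl

theorem CSlab.slice (hf : CSlab n I f) (ht : t ∈ I) : ContDiff ℝ n (f t) := by
  rw [← contDiffOn_univ]
  exact ContDiffOn.comp (g := fun q : ℝ × Plane => f q.1 q.2) (f := fun y : Plane => (t, y)) hf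
    (contDiff_prodMk_right t).contDiffOn fun z _ => ⟨ht, Set.mem_univ _⟩

theorem hasFDerivAt_of_slab {f' : ℝ × Plane →L[ℝ] V} {x : Plane} (ht : t ∈ I)
    (hf : HasFDerivWithinAt (fun q : ℝ × Plane => f q.1 q.2) f' (I ×ˢ Set.univ) (t, x)) :
    HasFDerivAt (f t) (f'.comp (ContinuousLinearMap.inr ℝ ℝ Plane)) x := by
  have h2 : HasFDerivWithinAt (fun z : Plane => ((t, z) : ℝ × Plane))
      (ContinuousLinearMap.inr ℝ ℝ Plane) Set.univ x :=
    (hasFDerivAt_prodMk_right t x).hasFDerivWithinAt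
  exact (hf.comp x h2 fun z _ => ⟨ht, Set.mem_univ _⟩).hasFDerivAt_of_univ

theorem pd_of_slab {f' : ℝ × Plane →L[ℝ] V} {x : Plane} (ht : t ∈ I)
    (hf : HasFDerivWithinAt (fun q : ℝ × Plane => f q.1 q.2) f' (I ×ˢ Set.univ) (t, x))
    (i : Fin 2) : pd i (f t) x = f' (0, unitVec i) :=
  (hasFDerivAt_of_slab ht hf).pd i

theorem hasDerivWithinAt_of_slab {f' : ℝ × Plane →L[ℝ] V} {x : Plane}
    (hf : HasFDerivWithinAt (fun q : ℝ × Plane => f q.1 q.2) f' (I ×ˢ Set.univ) (t, x)) :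
    HasDerivWithinAt (fun s => f s x) (f' (1, 0)) I t := by
  have h2 : HasDerivWithinAt (fun s : ℝ => ((s, x) : ℝ × Plane)) ((1, 0) : ℝ × Plane) I t :=
    ((hasDerivAt_id t).prodMk (hasDerivAt_const t x)).hasDerivWithinAt
  exact HasFDerivWithinAt.comp_hasDerivWithinAt (t := I ×ˢ Set.univ) t hf h2
    fun z hz => Set.mk_mem_prod hz (Set.mem_univ x)

theorem dt_of_slab (hI : Convex ℝ I) (hI' : (interior I).Nonempty) {f' : ℝ × Plane →L[ℝ] V}
    {x : Plane} (ht : t ∈ I)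
    (hf : HasFDerivWithinAt (fun q : ℝ × Plane => f q.1 q.2) f' (I ×ˢ Set.univ) (t, x)) :
    dt I f t x = f' (1, 0) :=
  (hasDerivWithinAt_of_slab hf).derivWithin (uniqueDiffOn_convex hI hI' t ht)

theorem CSlab.hasDerivWithinAt (hI : Convex ℝ I) (hI' : (interior I).Nonempty)
    (hf : CSlab 1 I f) (ht : t ∈ I) (x : Plane) :
    HasDerivWithinAt (fun s => f s x) (WaterWave.dt I f t x) I t := by
  rw [dt_of_slab hI hI' ht (hf.hasFDerivWithinAt ht x)]
  exact hasDerivWithinAt_of_slab (hf.hasFDerivWithinAt ht x)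

theorem CSlab.dt_eq (hI : Convex ℝ I) (hI' : (interior I).Nonempty) (hf : CSlab 1 I f)
    (ht : t ∈ I) (x : Plane) : WaterWave.dt I f t x = slabD I f t x (1, 0) :=
  dt_of_slab hI hI' ht (hf.hasFDerivWithinAt ht x)

theorem CSlab.pd_eq (hf : CSlab 1 I f) (ht : t ∈ I) (x : Plane) (i : Fin 2) :
    WaterWave.pd i (f t) x = slabD I f t x (0, unitVec i) :=
  pd_of_slab ht (hf.hasFDerivWithinAt ht x) i

theorem CSlab.slabD_apply (hI : Convex ℝ I) (hI' : (interior I).Nonempty) (hf : CSlab 1 I f)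
    (ht : t ∈ I) (x : Plane) (τ : ℝ) (h : Plane) :
    slabD I f t x (τ, h) = τ • WaterWave.dt I f t x + fderiv ℝ (f t) x h := by
  rw [hf.dt_eq hI hI' ht, (hasFDerivAt_of_slab ht (hf.hasFDerivWithinAt ht x)).fderiv,
    ← map_smul, ContinuousLinearMap.comp_apply, ← map_add]
  simp

theorem CSlab.dt (hI : Convex ℝ I) (hI' : (interior I).Nonempty) (hf : CSlab n I f)
    (h : m + 1 ≤ n) : CSlab m I (WaterWave.dt I f) := by
  have h1 : ContDiffOn ℝ m (fun q : ℝ × Plane => slabD I f q.1 q.2 (1, 0)) (I ×ˢ Set.univ) :=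
    (ContDiffOn.fderivWithin hf (uniqueDiffOn_slab hI hI') h).clm_apply contDiffOn_const
  refine h1.congr fun q hq => ?_
  exact CSlab.dt_eq hI hI' (hf.of_le (le_trans (by simp) h)) hq.1 _

theorem CSlab.pd (hI : Convex ℝ I) (hI' : (interior I).Nonempty) (hf : CSlab n I f)
    (h : m + 1 ≤ n) (i : Fin 2) : CSlab m I (fun t => WaterWave.pd i (f t)) := by
  have h1 : ContDiffOn ℝ m (fun q : ℝ × Plane => slabD I f q.1 q.2 (0, unitVec i))
      (I ×ˢ Set.univ) :=
    (ContDiffOn.fderivWithin hf (uniqueDiffOn_slab hI hI') h).clm_apply contDiffOn_const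
  refine h1.congr fun q hq => ?_
  exact CSlab.pd_eq (hf.of_le (le_trans (by simp) h)) hq.1 _ _

/-- Time and space derivatives commute. -/
theorem CSlab.pd_dt (hI : Convex ℝ I) (hI' : (interior I).Nonempty) (hf : CSlab 2 I f)
    (ht : t ∈ I) (x : Plane) (i : Fin 2) :
    WaterWave.pd i (WaterWave.dt I f t) x = WaterWave.dt I (fun s => WaterWave.pd i (f s)) t x := by
  have hs := uniqueDiffOn_slab hI hI'
  have hmem : (t, x) ∈ I ×ˢ (Set.univ : Set Plane) := ⟨ht, Set.mem_univ _⟩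
  have hcl : (t, x) ∈ closure (interior (I ×ˢ (Set.univ : Set Plane))) := by
    rw [interior_prod_eq, interior_univ, closure_prod_eq, closure_univ]
    refine ⟨?_, Set.mem_univ _⟩
    rw [hI.closure_interior_eq_closure_of_nonempty_interior hI']
    exact subset_closure ht
  have hsym := ContDiffWithinAt.isSymmSndFDerivWithinAt (hf (t, x) hmem)
    (by simp [minSmoothness]) hs hcl hmem
  have hd : DifferentiableWithinAt ℝ (fun q : ℝ × Plane =>
      fderivWithin ℝ (fun q : ℝ × Plane => f q.1 q.2) (I ×ˢ Set.univ) q) (I ×ˢ Set.univ) (t, x) :=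
    ((ContDiffOn.fderivWithin hf hs (m := 1) (by norm_num)).differentiableOn (by norm_num)) _ hmem
  have key : ∀ v : ℝ × Plane, HasFDerivWithinAt (fun q : ℝ × Plane => slabD I f q.1 q.2 v)
      ((fderivWithin ℝ (fun q : ℝ × Plane => fderivWithin ℝ (fun q : ℝ × Plane => f q.1 q.2)
        (I ×ˢ Set.univ) q) (I ×ˢ Set.univ) (t, x)).flip v) (I ×ˢ Set.univ) (t, x) := by
    intro v
    have := hd.hasFDerivWithinAt.clm_apply (hasFDerivWithinAt_const v (t, x) _)
    refine this.congr_fderiv ?_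
    ext <;> simp
  have e1 : HasFDerivWithinAt (fun q : ℝ × Plane => WaterWave.dt I f q.1 q.2) _ _ _ :=
    (key (1, 0)).congr (fun q hq => CSlab.dt_eq hI hI' (hf.of_le (by norm_num)) hq.1 _)
      (CSlab.dt_eq hI hI' (hf.of_le (by norm_num)) ht _)
  have e2 : HasFDerivWithinAt (fun q : ℝ × Plane => WaterWave.pd i (f q.1) q.2) _ _ _ :=
    (key (0, unitVec i)).congr (fun q hq => CSlab.pd_eq (hf.of_le (by norm_num)) hq.1 _ _)
      (CSlab.pd_eq (hf.of_le (by norm_num)) ht _ _)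
  rw [pd_of_slab ht e1, dt_of_slab hI hI' ht e2]
  exact hsym _ _

theorem CSlab.clm {W : Type*} [NormedAddCommGroup W] [NormedSpace ℝ W] (hf : CSlab n I f)
    (L : V →L[ℝ] W) : CSlab n I (fun t y => L (f t y)) := L.contDiff.comp_contDiffOn hf

theorem dt_clm {W : Type*} [NormedAddCommGroup W] [NormedSpace ℝ W] (hI : Convex ℝ I)
    (hI' : (interior I).Nonempty) (hf : CSlab 1 I f) (ht : t ∈ I) (x : Plane)
    (L : V →L[ℝ] W) : WaterWave.dt I (fun t y => L (f t y)) t x = L (WaterWave.dt I f t x) :=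
  ((L.hasFDerivAt.comp_hasDerivWithinAt t (hf.hasDerivWithinAt hI hI' ht x)).derivWithin
    (uniqueDiffOn_convex hI hI' t ht))

theorem CSlab.sub (hf : CSlab n I f) (hg : CSlab n I g) : CSlab n I (fun t y => f t y - g t y) :=
  ContDiffOn.sub hf hg

theorem CSlab.mul {f g : ℝ → Plane → Cl} (hf : CSlab n I f) (hg : CSlab n I g) :
    CSlab n I (fun t y => f t y * g t y) := ContDiffOn.mul hf hg

theorem CSlab.cross {f g : ℝ → Plane → Cl} (hf : CSlab n I f) (hg : CSlab n I g) :
    CSlab n I (fun t y => WaterWave.cross (f t y) (g t y)) :=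
  crossL.isBoundedBilinearMap.contDiff.comp_contDiffOn (ContDiffOn.prodMk hf hg)

theorem CSlab.const_smul {χ : Plane → ℝ} (hf : CSlab n I f) (hχ : ContDiff ℝ n χ) :
    CSlab n I (fun t y => χ y • f t y) :=
  (hχ.comp contDiff_snd).contDiffOn.smul hf

theorem dt_const_smul (hI : Convex ℝ I) (hI' : (interior I).Nonempty) (hf : CSlab 1 I f)
    (ht : t ∈ I) (x : Plane) (χ : Plane → ℝ) :
    WaterWave.dt I (fun t y => χ y • f t y) t x = χ x • WaterWave.dt I f t x :=
  ((hf.hasDerivWithinAt hI hI' ht x).const_smul (χ x)).derivWithin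
    (uniqueDiffOn_convex hI hI' t ht)
end

theorem dt_normal_mul {I : Set ℝ} {ξ f : ℝ → Plane → Cl} {t : ℝ} (hI : Convex ℝ I)
    (hI' : (interior I).Nonempty) (hξ : CSlab 2 I ξ) (hf : CSlab 1 I f) (ht : t ∈ I) (x : Plane) :
    dt I (fun t y => normal (ξ t) y * f t y) t x =
      (cross (pd 0 (dt I ξ t) x) (pd 1 (ξ t) x) + cross (pd 0 (ξ t) x) (pd 1 (dt I ξ t) x)) * f t x
        + normal (ξ t) x * dt I f t x := by
  have hp : ∀ i, HasDerivWithinAt (fun s => pd i (ξ s) x) (pd i (dt I ξ t) x) I t := fun i => by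
    rw [hξ.pd_dt hI hI' ht]
    exact CSlab.hasDerivWithinAt hI hI' (hξ.pd hI hI' (by norm_num) i) ht x
  have h1 : HasDerivWithinAt (fun s => cross (pd 0 (ξ s) x) (pd 1 (ξ s) x))
      (cross (pd 0 (dt I ξ t) x) (pd 1 (ξ t) x) + cross (pd 0 (ξ t) x) (pd 1 (dt I ξ t) x)) I t := by
    have := crossL.hasFDerivWithinAt_of_bilinear (hp 0).hasFDerivWithinAt (hp 1).hasFDerivWithinAt
    refine this.hasDerivWithinAt.congr_deriv ?_
    simp [add_comm]
  exact (h1.mul (hf.hasDerivWithinAt hI hI' ht x)).derivWithin (uniqueDiffOn_convex hI hI' t ht)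

theorem CSlab.normal {I : Set ℝ} {ξ : ℝ → Plane → Cl} {m n : WithTop ℕ∞} (hI : Convex ℝ I)
    (hI' : (interior I).Nonempty) (hξ : CSlab n I ξ) (h : m + 1 ≤ n) :
    CSlab m I (fun t => WaterWave.normal (ξ t)) :=
  CSlab.cross (hξ.pd hI hI' h 0) (hξ.pd hI hI' h 1)

/-! ### Differentiating integrals of the kernel over compact sets -/

/-- The projection `(τ, h) ↦ (τ, 0)`. -/
def timeProj : ℝ × Plane →L[ℝ] ℝ × Plane :=
  (ContinuousLinearMap.inl ℝ ℝ Plane).comp (ContinuousLinearMap.fst ℝ ℝ Plane)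

@[simp] theorem timeProj_apply (v : ℝ × Plane) : timeProj v = (v.1, 0) := rfl

/-- The derivative in `q = (t, x)` of `K_δ(ξ(t,y) - ξ(t,x)) g(t,y)`. -/
def kernelDeriv (I : Set ℝ) (δ : ℝ) (ξ g : ℝ → Plane → Cl) (q : ℝ × Plane) (y : Plane) :
    ℝ × Plane →L[ℝ] Cl :=
  (mulL.flip (g q.1 y)).comp ((regK' δ (ξ q.1 y - ξ q.1 q.2)).comp
      ((slabD I ξ q.1 y).comp timeProj - slabD I ξ q.1 q.2)) +
    (mulL (regK δ (ξ q.1 y - ξ q.1 q.2))).comp ((slabD I g q.1 y).comp timeProj)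

/-- The displacement `τ ξ_t(y) - (τ ξ_t(x) + Dξ(x) h)` of `ξ(y) - ξ(x)`, when the base point
`(t, x)` moves in the direction `(τ, h)`. -/
def displ (I : Set ℝ) (ξ : ℝ → Plane → Cl) (q v : ℝ × Plane) (y : Plane) : Cl :=
  v.1 • dt I ξ q.1 y - (v.1 • dt I ξ q.1 q.2 + fderiv ℝ (ξ q.1) q.2 v.2)

section
variable {I : Set ℝ} {ξ g : ℝ → Plane → Cl} {q : ℝ × Plane} {y : Plane} {δ : ℝ}

theorem kernelDeriv_apply (hI : Convex ℝ I) (hI' : (interior I).Nonempty) (hξ : CSlab 1 I ξ)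
    (hg : CSlab 1 I g) (hq : q.1 ∈ I) (v : ℝ × Plane) :
    kernelDeriv I δ ξ g q y v =
      regK' δ (ξ q.1 y - ξ q.1 q.2) (displ I ξ q v y) * g q.1 y +
      regK δ (ξ q.1 y - ξ q.1 q.2) * (v.1 • dt I g q.1 y) := by
  have h1 := hξ.slabD_apply hI hI' hq y v.1 0
  have h2 := hξ.slabD_apply hI hI' hq q.2 v.1 v.2
  have h3 := hg.slabD_apply hI hI' hq y v.1 0
  rw [map_zero, add_zero] at h1 h3
  rw [Prod.mk.eta] at h2
  simp only [kernelDeriv, ContinuousLinearMap.add_apply, ContinuousLinearMap.comp_apply,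
    ContinuousLinearMap.sub_apply, timeProj_apply, ContinuousLinearMap.flip_apply, mulL_apply, h1,
    h2, h3, displ]

theorem pd_displ (hI : Convex ℝ I) (hI' : (interior I).Nonempty) (hξ : CSlab 2 I ξ)
    (hq : q.1 ∈ I) (v : ℝ × Plane) (i : Fin 2) :
    pd i (displ I ξ q v) y = v.1 • pd i (dt I ξ q.1) y := by
  have h1 : Differentiable ℝ (dt I ξ q.1) :=
    (CSlab.slice (hξ.dt hI hI' (m := 1) (by norm_num)) hq).differentiable (by norm_num)
  exact (((h1 y).hasFDerivAt.const_smul v.1).sub_const _).pd i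

theorem contDiff_displ (hI : Convex ℝ I) (hI' : (interior I).Nonempty) (hξ : CSlab 2 I ξ)
    (hq : q.1 ∈ I) (v : ℝ × Plane) : ContDiff ℝ 1 (displ I ξ q v) :=
  ((CSlab.slice (hξ.dt hI hI' (m := 1) (by norm_num)) hq).const_smul v.1).sub contDiff_const

theorem kernelDeriv_normal_apply (hI : Convex ℝ I) (hI' : (interior I).Nonempty)
    (hξ : CSlab 2 I ξ) {f : ℝ → Plane → Cl} (hf : CSlab 1 I f) (hq : q.1 ∈ I) (v : ℝ × Plane) :
    kernelDeriv I δ ξ (fun t y => normal (ξ t) y * f t y) q y v =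
      variation δ (ξ q.1) (displ I ξ q v) (f q.1) q.2 y +
      regK δ (ξ q.1 y - ξ q.1 q.2) * (normal (ξ q.1) y * (v.1 • dt I f q.1 y)) := by
  rw [kernelDeriv_apply hI hI' (hξ.of_le (by norm_num))
    (CSlab.mul (CSlab.normal hI hI' hξ (by norm_num)) hf) hq, variation,
    dt_normal_mul hI hI' hξ hf hq, pd_displ hI hI' hξ hq, pd_displ hI hI' hξ hq]
  have e1 : ∀ a b : Cl, cross (v.1 • a) b = v.1 • cross a b := fun a b => by
    rw [← crossL_apply, ← crossL_apply]; simp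
  have e2 : ∀ a b : Cl, cross a (v.1 • b) = v.1 • cross a b := fun a b => by
    rw [← crossL_apply, ← crossL_apply]; simp
  rw [e1, e2]
  simp only [smul_add, mul_add, add_mul, mul_smul_comm, smul_mul_assoc, mul_assoc]
  abel

theorem continuousOn_regK' {X : Type*} [TopologicalSpace X] {s : Set X} {σ : X → Cl}
    (hσ : ContinuousOn σ s) (h : ∀ p ∈ s, δ ≠ 0 ∨ σ p ≠ 0) :
    ContinuousOn (fun p => regK' δ (σ p)) s := by
  intro p hp
  have h1 : ContinuousAt (fun τ => fderiv ℝ (regK δ) τ) (σ p) :=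
    (contDiffAt_regK (n := 1) (h p hp)).continuousAt_fderiv (by norm_num)
  have h2 := h1.comp_continuousWithinAt (hσ p hp)
  exact h2.congr (fun z hz => (hasFDerivAt_regK (h z hz)).fderiv.symm)
    (hasFDerivAt_regK (h p hp)).fderiv.symm

theorem continuousOn_regK {X : Type*} [TopologicalSpace X] {s : Set X} {σ : X → Cl}
    (hσ : ContinuousOn σ s) (h : ∀ p ∈ s, δ ≠ 0 ∨ σ p ≠ 0) :
    ContinuousOn (fun p => regK δ (σ p)) s := fun p hp =>
  ((contDiffAt_regK (n := 1) (h p hp)).continuousAt).comp_continuousWithinAt (hσ p hp)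

theorem continuousOn_kernelDeriv (hI : Convex ℝ I) (hI' : (interior I).Nonempty)
    (hξ : CSlab 1 I ξ) (hg : CSlab 1 I g) {U : Set (ℝ × Plane)} (hU : U ⊆ I ×ˢ Set.univ)
    {Kc : Set Plane} (hσ : ∀ q ∈ U, ∀ y ∈ Kc, δ ≠ 0 ∨ ξ q.1 y - ξ q.1 q.2 ≠ 0) :
    ContinuousOn (Function.uncurry (kernelDeriv I δ ξ g)) (U ×ˢ Kc) := by
  have m1 : Set.MapsTo (fun p : (ℝ × Plane) × Plane => ((p.1.1, p.2) : ℝ × Plane)) (U ×ˢ Kc)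
      (I ×ˢ Set.univ) := fun p hp => ⟨(hU hp.1).1, Set.mem_univ _⟩
  have m2 : Set.MapsTo (fun p : (ℝ × Plane) × Plane => p.1) (U ×ˢ Kc)
      (I ×ˢ Set.univ) := fun p hp => hU hp.1
  have c1 : ContinuousOn (fun p : (ℝ × Plane) × Plane => ((p.1.1, p.2) : ℝ × Plane)) (U ×ˢ Kc) := by
    fun_prop
  have c2 : ContinuousOn (fun p : (ℝ × Plane) × Plane => p.1) (U ×ˢ Kc) := by fun_prop
  have x1 := (ContDiffOn.continuousOn hξ).comp c1 m1
  have x2 := (ContDiffOn.continuousOn hξ).comp c2 m2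
  have g1 := (ContDiffOn.continuousOn hg).comp c1 m1
  have dx1 := (hξ.continuousOn_slabD hI hI').comp c1 m1
  have dx2 := (hξ.continuousOn_slabD hI hI').comp c2 m2
  have dg1 := (hg.continuousOn_slabD hI hI').comp c1 m1
  have hs : ContinuousOn (fun p : (ℝ × Plane) × Plane => ξ p.1.1 p.2 - ξ p.1.1 p.1.2) (U ×ˢ Kc) :=
    x1.sub x2
  have k1 := continuousOn_regK (δ := δ) hs fun p hp => hσ p.1 hp.1 p.2 hp.2
  have k2 := continuousOn_regK' (δ := δ) hs fun p hp => hσ p.1 hp.1 p.2 hp.2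
  exact (((mulL.flip.continuous.comp_continuousOn g1)).clm_comp
    (k2.clm_comp ((dx1.clm_comp continuousOn_const).sub dx2))).add
    ((mulL.continuous.comp_continuousOn k1).clm_comp (dg1.clm_comp continuousOn_const))

theorem integral_apply_of_continuousOn {E V : Type*} [NormedAddCommGroup E] [NormedSpace ℝ E]
    [NormedAddCommGroup V] [NormedSpace ℝ V] [CompleteSpace V] {φ : Plane → E →L[ℝ] V}
    {Kc : Set Plane} (hK : IsCompact Kc) (hφ : ContinuousOn φ Kc) (v : E) :
    (∫ y in Kc, φ y) v = ∫ y in Kc, φ y v :=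
  ContinuousLinearMap.integral_apply (hφ.integrableOn_compact hK) v

theorem hasFDerivWithinAt_kernel_integral (hI : Convex ℝ I) (hI' : (interior I).Nonempty)
    (hξ : CSlab 1 I ξ) (hg : CSlab 1 I g) {U : Set (ℝ × Plane)} (hUc : Convex ℝ U)
    (hU : U ⊆ I ×ˢ Set.univ) {Kc : Set Plane} (hK : IsCompact Kc)
    (hσ : ∀ q ∈ U, ∀ y ∈ Kc, δ ≠ 0 ∨ ξ q.1 y - ξ q.1 q.2 ≠ 0) :
    (∀ q ∈ U, HasFDerivWithinAt
      (fun q : ℝ × Plane => ∫ y in Kc, regK δ (ξ q.1 y - ξ q.1 q.2) * g q.1 y)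
      (∫ y in Kc, kernelDeriv I δ ξ g q y) U q) ∧
    ContinuousOn (fun q => ∫ y in Kc, kernelDeriv I δ ξ g q y) U := by
  refine hasFDerivWithinAt_integral_compact hUc hK (φ := fun q y =>
    regK δ (ξ q.1 y - ξ q.1 q.2) * g q.1 y) (fun y hy q hq => ?_) (fun q hq => ?_)
    (continuousOn_kernelDeriv hI hI' hξ hg hU hσ)
  · have hmap : HasFDerivWithinAt (fun q : ℝ × Plane => ((q.1, y) : ℝ × Plane)) timeProj U q :=
      ((hasFDerivAt_fst.prodMk (hasFDerivAt_const y q)).congr_fderiv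
        (by ext <;> simp)).hasFDerivWithinAt
    have hm : Set.MapsTo (fun q : ℝ × Plane => ((q.1, y) : ℝ × Plane)) U (I ×ˢ Set.univ) :=
      fun q hq => ⟨(hU hq).1, Set.mem_univ _⟩
    have d1 := (hξ.hasFDerivWithinAt (hU hq).1 y).comp q hmap hm
    have d2 := (hξ.hasFDerivWithinAt (hU hq).1 q.2).mono hU
    have d3 := (hg.hasFDerivWithinAt (hU hq).1 y).comp q hmap hm
    have d4 := (hasFDerivAt_regK (hσ q hq y hy)).comp_hasFDerivWithinAt
      (f := fun q : ℝ × Plane => ξ q.1 y - ξ q.1 q.2) q (d1.sub d2)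
    have := mulL.hasFDerivWithinAt_of_bilinear d4 d3
    refine this.congr_fderiv (ContinuousLinearMap.ext fun v => ?_)
    rw [ContinuousLinearMap.add_apply, kernelDeriv, ContinuousLinearMap.add_apply, add_comm]
    rfl
  · have hxs := (hξ.slice (hU hq).1).continuous
    have hgs := (hg.slice (hU hq).1).continuous
    exact (continuousOn_regK (hxs.sub continuous_const).continuousOn fun y hy =>
      hσ q hq y hy).mul hgs.continuousOn

theorem integral_kernelDeriv_apply (hI : Convex ℝ I) (hI' : (interior I).Nonempty)
    (hξ : CSlab 1 I ξ) (hg : CSlab 1 I g) (hq : q.1 ∈ I) {Kc : Set Plane} (hK : IsCompact Kc)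
    (hσ : ∀ y ∈ Kc, δ ≠ 0 ∨ ξ q.1 y - ξ q.1 q.2 ≠ 0) (v : ℝ × Plane) :
    (∫ y in Kc, kernelDeriv I δ ξ g q y) v = ∫ y in Kc, kernelDeriv I δ ξ g q y v := by
  have h := continuousOn_kernelDeriv (U := {q}) (Kc := Kc) (δ := δ) hI hI' hξ hg
    (by rintro _ rfl; exact ⟨hq, Set.mem_univ _⟩) (by rintro _ rfl; exact hσ)
  have h1 : ContinuousOn (fun y => kernelDeriv I δ ξ g q y) Kc :=
    h.comp (f := fun y => (q, y)) (by fun_prop) fun y hy => ⟨rfl, hy⟩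
  exact integral_apply_of_continuousOn hK h1 v

end

/-! ### The contribution of the singularity to the derivative of a layer potential -/

/-- A smooth moving surface that is uniformly chord-arc, with bounded slope, velocity and gradient
of the velocity, for times in the compact interval `J`. -/
structure FlowOn (I J : Set ℝ) (ξ : ℝ → Plane → Cl) (c M : ℝ) : Prop where
  convI : Convex ℝ I
  neI : (interior I).Nonempty
  smooth : CSlab 3 I ξ
  re : ∀ t ∈ I, ∀ x, (ξ t x).re = 0
  sub : J ⊆ I
  comp : IsCompact J
  conv : Convex ℝ J
  c_pos : 0 < c
  M_nonneg : 0 ≤ M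
  chord : ∀ t ∈ J, ∀ x y, c * ‖y - x‖ ≤ ‖ξ t y - ξ t x‖
  slope : ∀ t ∈ J, ∀ i x, ‖pd i (ξ t) x‖ ≤ M
  vel : ∀ t ∈ J, ∀ x, ‖dt I ξ t x‖ ≤ M
  velSlope : ∀ t ∈ J, ∀ i x, ‖pd i (dt I ξ t) x‖ ≤ M

section
variable {I J : Set ℝ} {ξ F : ℝ → Plane → Cl} {c M : ℝ} {q v : ℝ × Plane} {y : Plane}

theorem FlowOn.norm_base_le (H : FlowOn I J ξ c M) (hq : q.1 ∈ J) (hv : ‖v‖ ≤ 1) :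
    ‖v.1 • dt I ξ q.1 q.2 + fderiv ℝ (ξ q.1) q.2 v.2‖ ≤ 3 * M := by
  have hM := H.M_nonneg
  have h1 : ‖v.1‖ ≤ 1 := (norm_fst_le v).trans hv
  have h2 : ‖v.2‖ ≤ 1 := (norm_snd_le v).trans hv
  calc _ ≤ 1 * M + 2 * M * 1 := by
        refine (norm_add_le _ _).trans (add_le_add ?_ ?_)
        · rw [norm_smul]
          exact mul_le_mul h1 (H.vel _ hq _) (norm_nonneg _) zero_le_one
        · refine (ContinuousLinearMap.le_opNorm _ _).trans ?_
          exact mul_le_mul (norm_fderiv_le fun i => H.slope _ hq i _) h2 (norm_nonneg _)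
            (by positivity)
    _ = _ := by ring

theorem FlowOn.norm_displ_le (H : FlowOn I J ξ c M) (hq : q.1 ∈ J) (hv : ‖v‖ ≤ 1) :
    ‖displ I ξ q v y‖ ≤ 4 * M := by
  have h1 : ‖v.1‖ ≤ 1 := (norm_fst_le v).trans hv
  calc _ ≤ 1 * M + 3 * M := by
        refine (norm_sub_le _ _).trans (add_le_add ?_ (H.norm_base_le hq hv))
        rw [norm_smul]
        exact mul_le_mul h1 (H.vel _ hq _) (norm_nonneg _) zero_le_one
    _ = _ := by ring

theorem FlowOn.displ_re (H : FlowOn I J ξ c M) (hq : q.1 ∈ I) : (displ I ξ q v y).re = 0 := by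
  have h1 : ∀ z, (dt I ξ q.1 z).re = 0 := fun z => by
    have := dt_clm H.convI H.neI (H.smooth.of_le (by norm_num)) hq z reL
    simp only [reL_apply] at this
    rw [← this]
    have h0 : ∀ s ∈ I, (ξ s z).re = 0 := fun s hs => H.re s hs z
    rw [dt, derivWithin_congr (f := fun _ => (0 : ℝ)) h0 (h0 _ hq)]
    simp
  have hd := (H.smooth.slice hq).differentiable (by norm_num)
  have h2 : (fderiv ℝ (ξ q.1) q.2 v.2).re = 0 := by
    rw [fderiv_apply_eq]
    simp [pd_re_eq_zero hd (H.re _ hq)]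
  simp [displ, h1, h2]

theorem FlowOn.inner_displ_self (H : FlowOn I J ξ c M) (hq : q.1 ∈ I) :
    inner ℝ (displ I ξ q v q.2) (normal (ξ q.1) q.2) = (0 : ℝ) := by
  have e : displ I ξ q v q.2 = -(v.2 0 • pd 0 (ξ q.1) q.2 + v.2 1 • pd 1 (ξ q.1) q.2) := by
    rw [displ, fderiv_apply_eq]; abel
  rw [e, inner_eq, normal]
  simp
  ring

theorem far_of_compact {ι : Type*} {x : ι → Plane} {g : ι → Plane → Cl} {x₀ : Plane} {G : ℝ}
    (hg : ∀ i, Continuous (g i)) (h0 : ∀ i y, y ∉ Metric.closedBall x₀ 2 → g i y = 0)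
    (hG : ∀ i y, y ∈ Metric.closedBall x₀ 2 → ‖g i y‖ ≤ G) {ρ : ℝ} (hρ : 0 < ρ) :
    ∃ D, ∀ i, IntegrableOn (fun y => (‖y - x i‖ ^ 2)⁻¹ * ‖g i y‖) (Metric.ball (x i) ρ)ᶜ ∧
      ∫ y in (Metric.ball (x i) ρ)ᶜ, (‖y - x i‖ ^ 2)⁻¹ * ‖g i y‖ ≤ D := by
  set w : Plane → ℝ := Set.indicator (Metric.closedBall x₀ 2) (fun _ => (ρ ^ 2)⁻¹ * |G|) with hw
  have hwi : Integrable w := (integrable_indicator_iff measurableSet_closedBall).2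
    (integrableOn_const (isCompact_closedBall x₀ 2).measure_lt_top.ne)
  have hw0 : ∀ y, 0 ≤ w y := fun y => Set.indicator_nonneg (fun _ _ => by positivity) y
  have hb : ∀ i, ∀ y ∈ (Metric.ball (x i) ρ)ᶜ, (‖y - x i‖ ^ 2)⁻¹ * ‖g i y‖ ≤ w y := by
    intro i y hy
    have hy' : ρ ≤ ‖y - x i‖ := by simpa [dist_eq_norm] using hy
    by_cases hm : y ∈ Metric.closedBall x₀ 2
    · rw [hw, Set.indicator_of_mem hm]
      have := (hG i y hm).trans (le_abs_self G)
      gcongr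
    · rw [h0 i y hm, norm_zero, mul_zero]; exact hw0 y
  have hm : ∀ i, AEStronglyMeasurable (fun y => (‖y - x i‖ ^ 2)⁻¹ * ‖g i y‖) volume := fun i =>
    ((((continuous_id.sub continuous_const).norm.pow 2).measurable.inv).mul
      (hg i).norm.measurable).aestronglyMeasurable
  have hint : ∀ i, IntegrableOn (fun y => (‖y - x i‖ ^ 2)⁻¹ * ‖g i y‖) (Metric.ball (x i) ρ)ᶜ := by
    intro i
    refine hwi.integrableOn.mono' (hm i).restrict ?_
    filter_upwards [ae_restrict_mem measurableSet_ball.compl] with y hy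
    rw [Real.norm_of_nonneg (by positivity)]
    exact hb i y hy
  refine ⟨∫ y, w y, fun i => ⟨hint i, ?_⟩⟩
  exact (setIntegral_mono_on (hint i) hwi.integrableOn measurableSet_ball.compl (hb i)).trans
    (setIntegral_le_integral hwi (Eventually.of_forall hw0))

theorem norm_crossT_le {S f : Plane → Cl} {a : Cl} (hS : ∀ i, ‖pd i S y‖ ≤ M) :
    ‖crossT S a f y‖ ≤ ‖a‖ * M * (‖pd 0 f y‖ + ‖pd 1 f y‖) := by
  have h : ∀ i j, ‖cross a (pd i S y) * pd j f y‖ ≤ ‖a‖ * M * ‖pd j f y‖ := fun i j => by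
    rw [norm_mul]
    refine mul_le_mul_of_nonneg_right ((norm_cross_le _ _).trans ?_) (norm_nonneg _)
    exact mul_le_mul_of_nonneg_left (hS i) (norm_nonneg _)
  refine (norm_sub_le _ _).trans ((add_le_add (h 1 0) (h 0 1)).trans (le_of_eq (by ring)))

theorem dt_eq_zero {V : Type*} [NormedAddCommGroup V] [NormedSpace ℝ V] {f : ℝ → Plane → V}
    {t : ℝ} (ht : t ∈ I) (h : ∀ s ∈ I, f s y = 0) : dt I f t y = 0 := by
  rw [dt, derivWithin_congr (f := fun _ => (0 : V)) h (h t ht)]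
  simp

/-- The contribution of a density supported near the base points. The integral of the derivative of
the regularized kernel tends to a principal value, uniformly in the base point `q = (t, x)` and in
the direction `v`: integration by parts leaves a regularized principal value and an error with the
kernel `regL`, whose density vanishes at the base point. -/
theorem near_part (H : FlowOn I J ξ c M) (hF : CSlab 2 I F) (x₀ : Plane)
    (hsupp : ∀ t ∈ I, ∀ y, y ∉ Metric.closedBall x₀ 2 → F t y = 0) :
    ∃ ℓ : ℝ × Plane → ℝ × Plane → Cl,
      (∀ q v : ℝ × Plane, q.1 ∈ J → q.2 ∈ Metric.closedBall x₀ 1 → ‖v‖ ≤ 1 →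
        HasPV (ξ q.1) (fun y => normal (ξ q.1) y * (v.1 • dt I F q.1 y) -
          crossT (ξ q.1) (displ I ξ q v y) (F q.1) y) q.2 (ℓ q v)) ∧
      ∀ ε, 0 < ε → ∃ r₀, 0 < r₀ ∧ ∀ δ, 0 < δ → δ < r₀ → ∀ q v : ℝ × Plane, q.1 ∈ J →
        q.2 ∈ Metric.closedBall x₀ 1 → ‖v‖ ≤ 1 →
        ‖(∫ y in Metric.closedBall x₀ 3,
          kernelDeriv I δ ξ (fun t y => normal (ξ t) y * F t y) q y v) - ℓ q v‖ ≤ ε := by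
  have hI := H.convI
  have hI' := H.neI
  have hM := H.M_nonneg
  have hξ2 : CSlab 2 I ξ := H.smooth.of_le (by norm_num)
  have hξ1 : CSlab 1 I ξ := H.smooth.of_le (by norm_num)
  have hF1 : CSlab 1 I F := hF.of_le (by norm_num)
  have hFt : CSlab 1 I (dt I F) := hF.dt hI hI' (by norm_num)
  have hFp : ∀ j, CSlab 1 I (fun t => pd j (F t)) := fun j => hF.pd hI hI' (by norm_num) j
  have hξp : ∀ j, CSlab 2 I (fun t => pd j (ξ t)) := fun j => H.smooth.pd hI hI' (by norm_num) j
  have hξt : CSlab 2 I (dt I ξ) := H.smooth.dt hI hI' (by norm_num)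
  have hN : CSlab 2 I (fun t => normal (ξ t)) := CSlab.normal hI hI' H.smooth (by norm_num)
  have hFt0 : ∀ t ∈ I, ∀ y, y ∉ Metric.closedBall x₀ 2 → dt I F t y = 0 := fun t ht y hy =>
    dt_eq_zero ht fun s hs => hsupp s hs y hy
  have hts : ∀ t ∈ I, tsupport (F t) ⊆ Metric.closedBall x₀ 2 := fun t ht =>
    closure_minimal (fun y hy => by_contra fun h => hy (hsupp t ht y h)) Metric.isClosed_closedBall
  have hFp0 : ∀ t ∈ I, ∀ j y, y ∉ Metric.closedBall x₀ 2 → pd j (F t) y = 0 := fun t ht j y hy =>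
    pd_eq_zero_of_notMem_tsupport (fun h => hy (hts t ht h)) j
  obtain ⟨C₀, hC₀, b0⟩ := exists_lipschitz_slab hI hI' hF1 H.comp H.sub x₀ 2
  obtain ⟨C₁, hC₁, b1⟩ := exists_lipschitz_slab hI hI' hFt H.comp H.sub x₀ 2
  obtain ⟨C₂, hC₂, b2⟩ := exists_lipschitz_slab hI hI' (f := fun t => pd 0 (F t)) (hFp 0) H.comp H.sub x₀ 2
  obtain ⟨C₃, hC₃, b3⟩ := exists_lipschitz_slab hI hI' (f := fun t => pd 1 (F t)) (hFp 1) H.comp H.sub x₀ 2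
  -- the family is indexed by base points and directions, so that its limits are uniform in both
  let ι := {p : (ℝ × Plane) × (ℝ × Plane) //
    p.1.1 ∈ J ∧ p.1.2 ∈ Metric.closedBall x₀ 1 ∧ ‖p.2‖ ≤ 1}
  let T : ι → ℝ := fun i => i.1.1.1
  let x : ι → Plane := fun i => i.1.1.2
  have hT : ∀ i, T i ∈ J := fun i => i.2.1
  have hTI : ∀ i, T i ∈ I := fun i => H.sub i.2.1
  have hx : ∀ i, x i ∈ Metric.closedBall x₀ 1 := fun i => i.2.2.1
  have hv1 : ∀ i : ι, ‖i.1.2.1‖ ≤ 1 := fun i => (norm_fst_le _).trans i.2.2.2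
  let g : ι → Plane → Cl := fun i y => normal (ξ (T i)) y * (i.1.2.1 • dt I F (T i) y) -
    crossT (ξ (T i)) (displ I ξ i.1.1 i.1.2 y) (F (T i)) y
  let d : ι → Plane → Cl := fun i y =>
    (6 / (4 * Real.pi) * inner ℝ (displ I ξ i.1.1 i.1.2 y) (normal (ξ (T i)) y)) • F (T i) y
  have smT : SmoothFam x (fun i y => ξ (T i) y) := smoothFam_slab hI hI' hξ2 H.comp H.sub x₀ hT hx
  have smN : SmoothFam x (fun i y => normal (ξ (T i)) y) :=
    smoothFam_slab hI hI' (f := fun t => normal (ξ t)) hN H.comp H.sub x₀ hT hx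
  have smF : SmoothFam x (fun i y => F (T i) y) := smoothFam_slab hI hI' hF H.comp H.sub x₀ hT hx
  have smη : SmoothFam x (fun i y => displ I ξ i.1.1 i.1.2 y) :=
    ((smoothFam_const (V := ℝ) (a := fun i : ι => i.1.2.1) hv1).smul
      (smoothFam_slab hI hI' hξt H.comp H.sub x₀ hT hx)).sub
      (smoothFam_const fun i : ι => H.norm_base_le (hT i) i.2.2.2)
  have lpS : ∀ j, LipFam x (fun i y => pd j (ξ (T i)) y) := fun j =>
    lipFam_slab hI hI' (f := fun t => pd j (ξ t)) ((hξp j).of_le (by norm_num)) H.comp H.sub x₀ hT hx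
  have lpF : ∀ j, LipFam x (fun i y => pd j (F (T i)) y) := fun j =>
    lipFam_slab hI hI' (f := fun t => pd j (F t)) (hFp j) H.comp H.sub x₀ hT hx
  have lpg : LipFam x g :=
    (smN.1.mul ((lipFam_const (V := ℝ) (a := fun i : ι => i.1.2.1) hv1).smul
      (lipFam_slab hI hI' hFt H.comp H.sub x₀ hT hx))).sub
      (((smη.1.cross (lpS 1)).mul (lpF 0)).sub ((smη.1.cross (lpS 0)).mul (lpF 1)))
  have smd : SmoothFam x d :=
    ((smoothFam_const (V := ℝ) (a := fun _ : ι => 6 / (4 * Real.pi)) fun _ => le_rfl).bilin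
      (smη.inner smN) (ContinuousLinearMap.mul ℝ ℝ)).smul smF
  have contN : ∀ i, Continuous (normal (ξ (T i))) := fun i => (hN.slice (hTI i)).continuous
  have contη : ∀ i : ι, Continuous (displ I ξ i.1.1 i.1.2) := fun i =>
    (contDiff_displ hI hI' hξ2 (hTI i) _).continuous
  have contFt : ∀ i, Continuous (dt I F (T i)) := fun i => (hFt.slice (hTI i)).continuous
  have contct : ∀ i : ι, Continuous fun y =>
      crossT (ξ (T i)) (displ I ξ i.1.1 i.1.2 y) (F (T i)) y := fun i =>
    (((contη i).cross ((hξp 1).slice (hTI i)).continuous).mul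
      ((hFp 0).slice (hTI i)).continuous).sub
    (((contη i).cross ((hξp 0).slice (hTI i)).continuous).mul
      ((hFp 1).slice (hTI i)).continuous)
  have contB : ∀ i : ι, Continuous fun y => normal (ξ (T i)) y * (i.1.2.1 • dt I F (T i) y) :=
    fun i => (contN i).mul (Continuous.smul (f := fun _ => i.1.2.1) continuous_const (contFt i))
  have contg : ∀ i, Continuous (g i) := fun i => (contB i).sub (contct i)
  have contd : ∀ i, Continuous (d i) := fun i =>
    Continuous.smul (f := fun y => 6 / (4 * Real.pi) *
      inner ℝ (displ I ξ i.1.1 i.1.2 y) (normal (ξ (T i)) y))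
      (continuous_const.mul ((contη i).inner (contN i))) (hF.slice (hTI i)).continuous
  have ct0 : ∀ (i : ι) y, y ∉ Metric.closedBall x₀ 2 →
      crossT (ξ (T i)) (displ I ξ i.1.1 i.1.2 y) (F (T i)) y = 0 := fun i y hy => by
    simp [crossT, hFp0 _ (hTI i) _ y hy]
  have B0 : ∀ (i : ι) y, y ∉ Metric.closedBall x₀ 2 →
      normal (ξ (T i)) y * (i.1.2.1 • dt I F (T i) y) = 0 := fun i y hy => by
    rw [hFt0 _ (hTI i) y hy]; simp
  have g0 : ∀ i y, y ∉ Metric.closedBall x₀ 2 → g i y = 0 := fun i y hy => by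
    simp only [g, ct0 i y hy, B0 i y hy, sub_zero]
  have d0 : ∀ i y, y ∉ Metric.closedBall x₀ 2 → d i y = 0 := fun i y hy => by
    simp only [d, hsupp _ (hTI i) y hy, smul_zero]
  have chord : ∀ i y, c * ‖y - x i‖ ≤ ‖ξ (T i) y - ξ (T i) (x i)‖ := fun i y =>
    H.chord _ (hT i) _ _
  have gG : ∀ i y, y ∈ Metric.closedBall x₀ 2 →
      ‖g i y‖ ≤ M * M * (1 * C₁) + 4 * M * M * (C₂ + C₃) := by
    intro i y hy
    refine (norm_sub_le _ _).trans (add_le_add ?_ ?_)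
    · rw [norm_mul, norm_smul]
      exact mul_le_mul (norm_normal_le (H.slope _ (hT i)) y)
        (mul_le_mul (hv1 i) (b1 _ (hT i) y hy).1 (norm_nonneg _) zero_le_one) (by positivity)
        (by positivity)
    · refine (norm_crossT_le (fun j => H.slope _ (hT i) j y)).trans ?_
      exact mul_le_mul (mul_le_mul_of_nonneg_right (H.norm_displ_le (hT i) i.2.2.2) hM)
        (add_le_add (b2 _ (hT i) y hy).1 (b3 _ (hT i) y hy).1) (by positivity) (by positivity)
  have dG : ∀ i y, y ∈ Metric.closedBall x₀ 2 →
      ‖d i y‖ ≤ |6 / (4 * Real.pi)| * (4 * M * (M * M)) * C₀ := by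
    intro i y hy
    rw [norm_smul, norm_mul]
    refine mul_le_mul (mul_le_mul_of_nonneg_left ((norm_inner_le_norm _ _).trans ?_)
      (abs_nonneg _)) (b0 _ (hT i) y hy).1 (norm_nonneg _) (by positivity)
    exact mul_le_mul (H.norm_displ_le (hT i) i.2.2.2) (norm_normal_le (H.slope _ (hT i)) y)
      (norm_nonneg _) (by positivity)
  obtain ⟨K₁, hK₁, s1⟩ := smT.2
  obtain ⟨K₂, hK₂, s2⟩ := lpg
  obtain ⟨K₃, hK₃, s3⟩ := LipFam.symm ⟨K₂, hK₂, s2⟩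
  obtain ⟨⟨K₄, hK₄, s4⟩, K₅, hK₅, s5⟩ := smd
  set C := K₁ + K₂ + K₃ + K₄ + K₅ with hC
  have hC0 : 0 ≤ C := by positivity
  have second : ∀ i h, ‖h‖ < 1 → ‖(ξ (T i) (x i + h) - ξ (T i) (x i)) +
      (ξ (T i) (x i - h) - ξ (T i) (x i))‖ ≤ C * ‖h‖ ^ 2 := fun i h hh =>
    (s1 i h hh).trans (by gcongr; linarith)
  have PV : PVFamily x (fun i => ξ (T i)) g c C :=
    { c_pos := H.c_pos
      C_nonneg := hC0
      chord := chord
      second := second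
      bdd := fun i h hh => (s2 i h hh).1.trans (by linarith)
      lip := fun i h hh => (s3 i h hh).trans (by gcongr; linarith)
      contS := fun i => (H.smooth.slice (hTI i)).continuous
      contg := contg
      far := fun ρ hρ => far_of_compact contg g0 gG hρ }
  -- at the base point the displacement is tangential for `v = (0, h)`, and zero for `v = (1, 0)`
  have dx0 : ∀ i, d i (x i) = 0 := fun i => by
    simp only [d, T, x]
    rw [H.inner_displ_self (hTI i)]; simp
  have err := tendsto_regL (x := x) (S := fun i => ξ (T i)) (g := d) H.c_pos hC0 chord second
    (fun i h hh => by
      have := (s4 i h hh).2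
      rw [dx0, sub_zero] at this
      exact this.trans (by gcongr; linarith))
    (fun i h hh => by
      have := s5 i h hh
      rw [dx0, sub_zero, sub_zero] at this
      exact this.trans (by gcongr; linarith))
    (fun i => (H.smooth.slice (hTI i)).continuous) contd
    (fun ρ hρ => far_of_compact contd d0 dG hρ)
  choose L hL using fun i => PV.exists_tendsto i
  have conv := PV.tendsto_reg hL
  classical
  refine ⟨fun q v => if h : q.1 ∈ J ∧ q.2 ∈ Metric.closedBall x₀ 1 ∧ ‖v‖ ≤ 1 then
    L ⟨(q, v), h⟩ else 0, fun q v h1 h2 h3 => ?_, fun ε hε => ?_⟩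
  · beta_reduce
    rw [dif_pos ⟨h1, h2, h3⟩]
    let i : ι := ⟨(q, v), h1, h2, h3⟩
    have a1 := hL i
    have a2 := fun r (hr : 0 < r) => PV.integrableOn 0 i hr
    simp only [regK_zero] at a1 a2
    exact ⟨a2, a1⟩
  · obtain ⟨r₁, hr₁, e1⟩ := err (ε / 2) (by positivity)
    obtain ⟨r₂, hr₂, e2⟩ := conv (ε / 2) (by positivity)
    refine ⟨min r₁ r₂, lt_min hr₁ hr₂, fun δ hδ hδ' q v h1 h2 h3 => ?_⟩
    beta_reduce
    rw [dif_pos ⟨h1, h2, h3⟩]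
    let i : ι := ⟨(q, v), h1, h2, h3⟩
    have hqI : q.1 ∈ I := H.sub h1
    have a1 := e1 δ hδ (hδ'.trans_le (min_le_left _ _)) i
    have a2 := e2 δ hδ (hδ'.trans_le (min_le_right _ _)) i
    have key : (∫ y in Metric.closedBall x₀ 3,
        kernelDeriv I δ ξ (fun t y => normal (ξ t) y * F t y) q y v) =
        (∫ y, regL δ (ξ (T i) y - ξ (T i) (x i)) • d i y) +
        ∫ y, regK δ (ξ (T i) y - ξ (T i) (x i)) * g i y := by
      have contR : Continuous fun y => regK δ (ξ q.1 y - ξ q.1 q.2) :=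
        (continuous_regK hδ.ne').comp ((H.smooth.slice hqI).continuous.sub continuous_const)
      have iB : Integrable fun y => regK δ (ξ q.1 y - ξ q.1 q.2) *
          (normal (ξ q.1) y * (v.1 • dt I F q.1 y)) :=
        (contR.mul (contB i)).integrable_of_hasCompactSupport
          (HasCompactSupport.intro (isCompact_closedBall x₀ 2) fun y hy =>
            (congrArg (fun z => regK δ (ξ q.1 y - ξ q.1 q.2) * z) (B0 i y hy)).trans (mul_zero _))
      have iC : Integrable fun y => regK δ (ξ q.1 y - ξ q.1 q.2) *
          crossT (ξ q.1) (displ I ξ q v y) (F q.1) y :=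
        (contR.mul (contct i)).integrable_of_hasCompactSupport
          (HasCompactSupport.intro (isCompact_closedBall x₀ 2) fun y hy =>
            (congrArg (fun z => regK δ (ξ q.1 y - ξ q.1 q.2) * z) (ct0 i y hy)).trans (mul_zero _))
      have iK : IntegrableOn (fun y => kernelDeriv I δ ξ (fun t y => normal (ξ t) y * F t y) q y v)
          (Metric.closedBall x₀ 3) := by
        have h := continuousOn_kernelDeriv (U := {q}) (Kc := Metric.closedBall x₀ 3) (δ := δ)
          hI hI' hξ1 (CSlab.mul (hN.of_le (by norm_num)) hF1)
          (by rintro _ rfl; exact ⟨hqI, Set.mem_univ _⟩) (fun _ _ _ _ => Or.inl hδ.ne')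
        have h' : ContinuousOn (fun y =>
            kernelDeriv I δ ξ (fun t y => normal (ξ t) y * F t y) q y) (Metric.closedBall x₀ 3) :=
          h.comp (f := fun y => (q, y)) (by fun_prop) fun y hy => ⟨rfl, hy⟩
        exact (h'.clm_apply continuousOn_const).integrableOn_compact (isCompact_closedBall x₀ 3)
      have hexp := fun y => kernelDeriv_normal_apply (δ := δ) (y := y) (q := q) hI hI' hξ2 hF1 hqI v
      have iV : IntegrableOn (variation δ (ξ q.1) (displ I ξ q v) (F q.1) q.2)
          (Metric.closedBall x₀ 3) := by
        refine (iK.sub iB.integrableOn).congr (Eventually.of_forall fun y => ?_)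
        simp only [Pi.sub_apply, hexp, add_sub_cancel_right]
      have out : ∀ y, y ∉ Metric.closedBall x₀ 3 → y ∉ Metric.closedBall x₀ 2 := fun y hy h =>
        hy (Metric.closedBall_subset_closedBall (by norm_num) h)
      simp only [hexp]
      rw [integral_add iV iB.integrableOn,
        setIntegral_eq_integral_of_forall_compl_eq_zero (f := variation _ _ _ _ _) fun y hy => by
          rw [variation, hsupp _ hqI y (out y hy), mul_zero],
        setIntegral_eq_integral_of_forall_compl_eq_zero (f := fun y => regK δ _ * _) fun y hy => by
          have : normal (ξ q.1) y * (v.1 • dt I F q.1 y) = 0 := B0 i y (out y hy)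
          rw [this, mul_zero],
        integral_variation (H.smooth.slice hqI |>.of_le (by norm_num))
          (contDiff_displ hI hI' hξ2 hqI v) (hF1.slice hqI)
          (HasCompactSupport.intro (isCompact_closedBall x₀ 2) fun y hy => hsupp _ hqI y hy)
          (H.re _ hqI) (fun y => H.displ_re hqI) (Or.inl hδ.ne')
          (fun y hy => ne_of_chord H.c_pos (H.chord _ h1 q.2) hy)]
      have e3 : (∫ y, regK δ (ξ (T i) y - ξ (T i) (x i)) * g i y) =
          (∫ y, regK δ (ξ q.1 y - ξ q.1 q.2) * (normal (ξ q.1) y * (v.1 • dt I F q.1 y))) -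
          ∫ y, regK δ (ξ q.1 y - ξ q.1 q.2) * crossT (ξ q.1) (displ I ξ q v y) (F q.1) y := by
        rw [← integral_sub iB iC]
        simp only [← mul_sub]
        rfl
      rw [e3]
      change ((∫ y, regL δ (ξ (T i) y - ξ (T i) (x i)) • d i y) - _) + _ = _
      abel
    rw [key, add_sub_assoc]
    calc _ ≤ ε / 2 + ε / 2 := (norm_add_le _ _).trans (add_le_add a1 a2)
      _ = ε := by ring
end

/-! ### The contribution of infinity to the derivative of a layer potential -/

/-- `|y - x|⁻² f(t, y)` is integrable at infinity, uniformly in `x` and in `t ∈ J`. -/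
def UnifFar (J : Set ℝ) (f : ℝ → Plane → Cl) : Prop :=
  ∃ E : ℝ → ℝ, Tendsto E atTop (𝓝 0) ∧ ∀ t ∈ J, ∀ (x : Plane) (R : ℝ), 0 < R →
    IntegrableOn (fun y => (‖y - x‖ ^ 2)⁻¹ * ‖f t y‖) (Metric.ball x R)ᶜ ∧
    ∫ y in (Metric.ball x R)ᶜ, (‖y - x‖ ^ 2)⁻¹ * ‖f t y‖ ≤ E R

theorem UnifFar.farInt {J : Set ℝ} {f : ℝ → Plane → Cl} (h : UnifFar J f) {t : ℝ} (ht : t ∈ J)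
    (x : Plane) : FarInt (f t) x := by
  obtain ⟨E, -, hE⟩ := h
  exact fun ρ hρ => (hE t ht x ρ hρ).1

theorem aestronglyMeasurable_weight {x : Plane} {g : Plane → Cl} (hg : Continuous g) :
    AEStronglyMeasurable (fun y => (‖y - x‖ ^ 2)⁻¹ * ‖g y‖) volume :=
  ((((continuous_id.sub continuous_const).norm.pow 2).measurable.inv).mul
    hg.norm.measurable).aestronglyMeasurable

theorem FarInt.mono {f g : Plane → Cl} {x : Plane} (h : FarInt f x) (hg : Continuous g) {C : ℝ}
    (hfg : ∀ y, ‖g y‖ ≤ C * ‖f y‖) : FarInt g x := fun ρ hρ => by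
  refine ((h ρ hρ).const_mul C).mono' (aestronglyMeasurable_weight hg).restrict
    (Eventually.of_forall fun y => ?_)
  rw [Real.norm_of_nonneg (by positivity)]
  calc _ ≤ (‖y - x‖ ^ 2)⁻¹ * (C * ‖f y‖) := by
        have := hfg y
        gcongr
    _ = _ := by ring

theorem FarInt.add {f g : Plane → Cl} {x : Plane} (hf : FarInt f x) (hg : FarInt g x)
    (hfc : Continuous f) (hgc : Continuous g) : FarInt (fun y => f y + g y) x := fun ρ hρ => by
  refine ((hf ρ hρ).add (hg ρ hρ)).mono' (aestronglyMeasurable_weight (hfc.add hgc)).restrict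
    (Eventually.of_forall fun y => ?_)
  rw [Real.norm_of_nonneg (by positivity), Pi.add_apply, ← mul_add]
  gcongr
  exact norm_add_le _ _

theorem FarInt.of_compact {g : Plane → Cl} {x x₀ : Plane} (hg : Continuous g)
    (h0 : ∀ y, y ∉ Metric.closedBall x₀ 2 → g y = 0) : FarInt g x := fun ρ hρ => by
  obtain ⟨G, hG⟩ := (isCompact_closedBall x₀ 2).exists_bound_of_continuousOn hg.continuousOn
  obtain ⟨D, hD⟩ := far_of_compact (ι := Unit) (x := fun _ => x) (g := fun _ => g) (x₀ := x₀)
    (fun _ => hg) (fun _ => h0) (fun _ => hG) hρ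
  exact (hD ()).1

theorem UnifFar.mono {J : Set ℝ} {f g : ℝ → Plane → Cl} (h : UnifFar J f)
    (hg : ∀ t ∈ J, Continuous (g t)) (hfg : ∀ t ∈ J, ∀ y, ‖g t y‖ ≤ ‖f t y‖) : UnifFar J g := by
  obtain ⟨E, hE, h1⟩ := h
  refine ⟨E, hE, fun t ht x R hR => ?_⟩
  have h2 : IntegrableOn (fun y => (‖y - x‖ ^ 2)⁻¹ * ‖g t y‖) (Metric.ball x R)ᶜ :=
    FarInt.mono (C := 1) (f := f t) (fun ρ hρ => (h1 t ht x ρ hρ).1) (hg t ht)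
      (fun y => by simpa using hfg t ht y) R hR
  refine ⟨h2, (setIntegral_mono_on h2 (h1 t ht x R hR).1 measurableSet_ball.compl
    fun y _ => ?_).trans (h1 t ht x R hR).2⟩
  have := hfg t ht y
  gcongr

theorem unifFar_of_eLpNorm {J : Set ℝ} {f : ℝ → Plane → Cl} {p : ENNReal} (hp1 : 1 ≤ p)
    (hp : p ≠ ⊤) {M : ℝ} (hM : 0 ≤ M) (hc : ∀ t ∈ J, Continuous (f t))
    (hf : ∀ t ∈ J, eLpNorm (f t) p volume ≤ ENNReal.ofReal M) : UnifFar J f := by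
  obtain ⟨C, a, hC, ha, h⟩ := integrableOn_far hp1 hp
  refine ⟨fun R => C * M * ((1 + R⁻¹) ^ 2 * (1 + R) ^ (-a)), ?_, fun t ht x R hR =>
    h M hM (f t) (hc t ht).aestronglyMeasurable (hf t ht) x R hR⟩
  have h1 : Tendsto (fun R : ℝ => (1 + R⁻¹) ^ 2) atTop (𝓝 ((1 + 0) ^ 2)) :=
    (tendsto_const_nhds.add tendsto_inv_atTop_zero).pow 2
  have h2 : Tendsto (fun R : ℝ => (1 + R) ^ (-a)) atTop (𝓝 0) :=
    (tendsto_rpow_neg_atTop ha).comp (tendsto_atTop_add_const_left _ _ tendsto_id)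
  have := (h1.mul h2).const_mul (C * M)
  simpa using this

/-- A density that vanishes near the base point needs no principal value. -/
theorem hasPV_of_integrable {S g : Plane → Cl} {x : Plane} {ρ : ℝ} (hρ : 0 < ρ)
    (h0 : ∀ y, ‖y - x‖ < ρ → g y = 0) (hint : Integrable fun y => kernelK (S y - S x) * g y) :
    HasPV S g x (∫ y, kernelK (S y - S x) * g y) := by
  refine ⟨fun r _ => hint.integrableOn, tendsto_const_nhds.congr' ?_⟩
  filter_upwards [Ioo_mem_nhdsGT hρ] with r hr
  refine (setIntegral_eq_integral_of_forall_compl_eq_zero fun y hy => ?_).symm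
  rw [Set.notMem_compl_iff, Metric.mem_ball, dist_eq_norm] at hy
  rw [h0 y (hy.trans hr.2), mul_zero]

theorem norm_integral_diff_le {G : Plane → Cl} {w : Plane → ℝ} {A K : Set Plane} {x : Plane}
    {R e : ℝ} (hA : MeasurableSet A) (hK : MeasurableSet K) (hKA : K ⊆ A)
    (hsub : A \ K ⊆ (Metric.ball x R)ᶜ) (hG : IntegrableOn G A) (hGw : ∀ y ∈ A, ‖G y‖ ≤ w y)
    (hw0 : ∀ y, 0 ≤ w y) (hw : IntegrableOn w (Metric.ball x R)ᶜ)
    (he : ∫ y in (Metric.ball x R)ᶜ, w y ≤ e) :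
    ‖(∫ y in K, G y) - ∫ y in A, G y‖ ≤ e := by
  rw [norm_sub_rev, ← setIntegral_sdiff hK hG hKA]
  calc _ ≤ ∫ y in A \ K, w y :=
        norm_integral_le_of_norm_le (hw.mono_set hsub) ((ae_restrict_iff' (hA.diff hK)).2
          (Eventually.of_forall fun y hy => hGw y hy.1))
    _ ≤ ∫ y in (Metric.ball x R)ᶜ, w y :=
        setIntegral_mono_set hw (Eventually.of_forall hw0) (HasSubset.Subset.eventuallyLE hsub)
    _ ≤ e := he

/-- The annulus `1 ≤ |y - x₀| ≤ n + 3`. -/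
def annulus (x₀ : Plane) (n : ℕ) : Set Plane :=
  Metric.closedBall x₀ (n + 3) ∩ (Metric.ball x₀ 1)ᶜ

theorem isCompact_annulus (x₀ : Plane) (n : ℕ) : IsCompact (annulus x₀ n) :=
  (isCompact_closedBall _ _).inter_right Metric.isOpen_ball.isClosed_compl

theorem annulus_diff {x₀ x : Plane} (hx : x ∈ Metric.ball x₀ (1 / 2)) (n : ℕ) :
    (Metric.ball x₀ 1)ᶜ \ annulus x₀ n ⊆ (Metric.ball x (n + 2))ᶜ := by
  intro y hy hy'
  refine hy.2 ⟨?_, hy.1⟩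
  rw [Metric.mem_ball] at hx hy'
  rw [Metric.mem_closedBall]
  linarith [dist_triangle y x x₀]

theorem half_le_of_mem {x₀ x y : Plane} (hx : x ∈ Metric.ball x₀ (1 / 2))
    (hy : y ∈ (Metric.ball x₀ 1)ᶜ) : 1 / 2 ≤ ‖y - x‖ := by
  rw [Metric.mem_ball] at hx
  rw [Set.mem_compl_iff, Metric.mem_ball, not_lt] at hy
  rw [← dist_eq_norm]
  linarith [dist_triangle y x x₀]

theorem mem_ball_one {x₀ x y : Plane} (hx : x ∈ Metric.ball x₀ (1 / 2))
    (hy : ‖y - x‖ < 1 / 2) : y ∈ Metric.ball x₀ 1 := by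
  rw [← dist_eq_norm] at hy
  rw [Metric.mem_ball] at hx ⊢
  linarith [dist_triangle y x x₀]

section
variable {I J : Set ℝ} {ξ F : ℝ → Plane → Cl} {c M : ℝ}

theorem FlowOn.ne_of_far (H : FlowOn I J ξ c M) {q : ℝ × Plane} {x₀ y : Plane} (hq : q.1 ∈ J)
    (hx : q.2 ∈ Metric.ball x₀ (1 / 2)) (hy : y ∈ (Metric.ball x₀ 1)ᶜ) :
    ξ q.1 y - ξ q.1 q.2 ≠ 0 := by
  refine sub_ne_zero.2 (ne_of_chord H.c_pos (H.chord _ hq q.2) ?_)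
  have := half_le_of_mem hx hy
  refine sub_ne_zero.1 (norm_pos_iff.1 (by linarith))

/-- The layer potential of a density away from the base point as a limit of integrals over compact
annuli. -/
theorem FlowOn.integral_annulus_tendsto (H : FlowOn I J ξ c M) {F : ℝ → Plane → Cl}
    (hF : CSlab 1 I F) (x₀ : Plane) (hu : UnifFar J F) {q : ℝ × Plane} (hq : q.1 ∈ J)
    (hx : q.2 ∈ Metric.ball x₀ (1 / 2)) :
    IntegrableOn (fun y => regK 0 (ξ q.1 y - ξ q.1 q.2) * (normal (ξ q.1) y * F q.1 y))
      (Metric.ball x₀ 1)ᶜ ∧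
    Tendsto (fun n => ∫ y in annulus x₀ n,
      regK 0 (ξ q.1 y - ξ q.1 q.2) * (normal (ξ q.1) y * F q.1 y)) atTop
      (𝓝 (∫ y in (Metric.ball x₀ 1)ᶜ,
        regK 0 (ξ q.1 y - ξ q.1 q.2) * (normal (ξ q.1) y * F q.1 y))) := by
  obtain ⟨E, hE, h1⟩ := hu
  have hM := H.M_nonneg
  have hqI := H.sub hq
  have hN : CSlab 2 I (fun t => normal (ξ t)) := CSlab.normal H.convI H.neI H.smooth (by norm_num)
  have hcont : Continuous fun y => normal (ξ q.1) y * F q.1 y :=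
    (hN.slice hqI).continuous.mul (hF.slice hqI).continuous
  have hb : ∀ y ∈ (Metric.ball x₀ 1)ᶜ,
      ‖regK 0 (ξ q.1 y - ξ q.1 q.2) * (normal (ξ q.1) y * F q.1 y)‖ ≤
      ((c ^ 2)⁻¹ * (M * M)) * ((‖y - q.2‖ ^ 2)⁻¹ * ‖F q.1 y‖) := by
    intro y hy
    have h2 := half_le_of_mem hx hy
    have hyx : y ≠ q.2 := sub_ne_zero.1 (norm_pos_iff.1 (by linarith))
    rw [norm_mul, norm_mul]
    calc _ ≤ ((c ^ 2)⁻¹ * (‖y - q.2‖ ^ 2)⁻¹) * ((M * M) * ‖F q.1 y‖) :=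
          mul_le_mul (norm_regK_le_far 0 H.c_pos (H.chord _ hq q.2) hyx)
            (mul_le_mul_of_nonneg_right (norm_normal_le (H.slope _ hq) y) (norm_nonneg _))
            (by positivity) (by have := H.c_pos; positivity)
      _ = _ := by ring
  have hsub : (Metric.ball x₀ 1)ᶜ ⊆ (Metric.ball q.2 (1 / 2))ᶜ := fun y hy => by
    have := half_le_of_mem hx hy
    simpa [dist_eq_norm] using this
  have hint : IntegrableOn
      (fun y => regK 0 (ξ q.1 y - ξ q.1 q.2) * (normal (ξ q.1) y * F q.1 y))
      (Metric.ball x₀ 1)ᶜ := by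
    refine (((h1 _ hq q.2 (1 / 2) (by norm_num)).1.mono_set hsub).const_mul
      ((c ^ 2)⁻¹ * (M * M))).mono' ?_ ((ae_restrict_iff' measurableSet_ball.compl).2
        (Eventually.of_forall hb))
    exact ((stronglyMeasurable_regK_comp 0 ((H.smooth.slice hqI).continuous.sub
      continuous_const)).aestronglyMeasurable.mul hcont.aestronglyMeasurable).restrict
  refine ⟨hint, ?_⟩
  rw [tendsto_iff_norm_sub_tendsto_zero]
  have hlim : Tendsto (fun n : ℕ => ((c ^ 2)⁻¹ * (M * M)) * E (n + 2)) atTop (𝓝 0) := by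
    have : Tendsto (fun n : ℕ => (n : ℝ) + 2) atTop atTop :=
      tendsto_atTop_add_const_right _ _ tendsto_natCast_atTop_atTop
    simpa using (hE.comp this).const_mul ((c ^ 2)⁻¹ * (M * M))
  refine squeeze_zero (fun _ => norm_nonneg _) (fun n => ?_) hlim
  have h2 := h1 _ hq q.2 (n + 2) (by positivity)
  refine norm_integral_diff_le measurableSet_ball.compl (isCompact_annulus x₀ n).measurableSet
    Set.inter_subset_right (annulus_diff hx n) hint hb
    (fun y => by have := H.c_pos; positivity) (h2.1.const_mul _) ?_
  rw [integral_const_mul]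
  have := H.c_pos
  exact mul_le_mul_of_nonneg_left h2.2 (by positivity)

theorem FlowOn.norm_kernelDeriv_le (H : FlowOn I J ξ c M) (hF : CSlab 1 I F) :
    ∃ D, 0 ≤ D ∧ ∀ (q v : ℝ × Plane) y, q.1 ∈ J → ‖v‖ ≤ 1 → 1 / 2 ≤ ‖y - q.2‖ →
      ‖kernelDeriv I 0 ξ (fun t y => normal (ξ t) y * F t y) q y v‖ ≤
      D * ((‖y - q.2‖ ^ 2)⁻¹ * ‖F q.1 y‖ + (‖y - q.2‖ ^ 2)⁻¹ * ‖dt I F q.1 y‖) := by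
  have hM := H.M_nonneg
  have hc := H.c_pos
  set D₁ := 4 * (4 * M) ^ 3 * (c ^ 3)⁻¹ * (1 / 2 : ℝ)⁻¹ + 2 * (4 * M) ^ 2 * (c ^ 2)⁻¹ with hD₁
  set D₂ := (c ^ 2)⁻¹ * (M * M) with hD₂
  have h1 : 0 ≤ D₁ := by positivity
  have h2 : 0 ≤ D₂ := by positivity
  refine ⟨D₁ + D₂, by positivity, fun q v y hq hv hy => ?_⟩
  have hqI := H.sub hq
  have hξ2 : CSlab 2 I ξ := H.smooth.of_le (by norm_num)
  have hv1 : ‖v.1‖ ≤ 1 := (norm_fst_le v).trans hv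
  have hyx : y ≠ q.2 := sub_ne_zero.1 (norm_pos_iff.1 (by linarith))
  rw [kernelDeriv_normal_apply H.convI H.neI hξ2 hF hqI]
  have n1 : ‖variation 0 (ξ q.1) (displ I ξ q v) (F q.1) q.2 y‖ ≤
      D₁ * ((‖y - q.2‖ ^ 2)⁻¹ * ‖F q.1 y‖) := by
    refine norm_variation_le hc (by norm_num) (H.chord _ hq q.2)
      (fun i z => (H.slope _ hq i z).trans (by linarith)) (fun z => H.norm_displ_le hq hv)
      (fun i z => ?_) hy
    rw [pd_displ H.convI H.neI hξ2 hqI, norm_smul]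
    calc _ ≤ 1 * M := mul_le_mul hv1 (H.velSlope _ hq i z) (norm_nonneg _) zero_le_one
      _ ≤ _ := by linarith
  have n2 : ‖regK 0 (ξ q.1 y - ξ q.1 q.2) * (normal (ξ q.1) y * (v.1 • dt I F q.1 y))‖ ≤
      D₂ * ((‖y - q.2‖ ^ 2)⁻¹ * ‖dt I F q.1 y‖) := by
    rw [norm_mul, norm_mul, norm_smul]
    calc _ ≤ ((c ^ 2)⁻¹ * (‖y - q.2‖ ^ 2)⁻¹) * ((M * M) * (1 * ‖dt I F q.1 y‖)) :=
          mul_le_mul (norm_regK_le_far 0 hc (H.chord _ hq q.2) hyx)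
            (mul_le_mul (norm_normal_le (H.slope _ hq) y)
              (mul_le_mul_of_nonneg_right hv1 (norm_nonneg _)) (by positivity) (by positivity))
            (by positivity) (by positivity)
      _ = _ := by ring
  refine (norm_add_le _ _).trans ((add_le_add n1 n2).trans ?_)
  rw [mul_add]
  gcongr <;> linarith

/-- The contribution of a density that vanishes near the base points. The integrals of the derivative
of the kernel over annuli converge uniformly; this uses decay of `F` and `∂_t F` only. Where the
gradient of `F` decays as well, integration by parts gives the limit as a principal value. -/
theorem far_part (H : FlowOn I J ξ c M) (hF : CSlab 2 I F) (x₀ : Plane)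
    (h0 : ∀ t ∈ I, ∀ y ∈ Metric.closedBall x₀ 1, F t y = 0) (hu : UnifFar J F)
    (hut : UnifFar J (dt I F)) :
    (∃ e : ℕ → ℝ, Tendsto e atTop (𝓝 0) ∧ ∀ n, ∀ q v : ℝ × Plane, q.1 ∈ J →
      q.2 ∈ Metric.ball x₀ (1 / 2) → ‖v‖ ≤ 1 →
      ‖(∫ y in annulus x₀ n, kernelDeriv I 0 ξ (fun t y => normal (ξ t) y * F t y) q y v) -
        ∫ y in (Metric.ball x₀ 1)ᶜ,
          kernelDeriv I 0 ξ (fun t y => normal (ξ t) y * F t y) q y v‖ ≤ e n) ∧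
    ∀ q v : ℝ × Plane, q.1 ∈ J → q.2 ∈ Metric.ball x₀ (1 / 2) → ‖v‖ ≤ 1 →
      FarInt (fun y => crossT (ξ q.1) (displ I ξ q v y) (F q.1) y) q.2 →
      HasPV (ξ q.1) (fun y => normal (ξ q.1) y * (v.1 • dt I F q.1 y) -
          crossT (ξ q.1) (displ I ξ q v y) (F q.1) y) q.2
        (∫ y in (Metric.ball x₀ 1)ᶜ,
          kernelDeriv I 0 ξ (fun t y => normal (ξ t) y * F t y) q y v) := by
  have hI := H.convI
  have hI' := H.neI
  have hM := H.M_nonneg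
  have hξ2 : CSlab 2 I ξ := H.smooth.of_le (by norm_num)
  have hξ1 : CSlab 1 I ξ := H.smooth.of_le (by norm_num)
  have hF1 : CSlab 1 I F := hF.of_le (by norm_num)
  have hFt : CSlab 1 I (dt I F) := hF.dt hI hI' (by norm_num)
  have hN : CSlab 2 I (fun t => normal (ξ t)) := CSlab.normal hI hI' H.smooth (by norm_num)
  have hFp : ∀ j, CSlab 1 I (fun t => pd j (F t)) := fun j => hF.pd hI hI' (by norm_num) j
  have hξp : ∀ j, CSlab 2 I (fun t => pd j (ξ t)) := fun j => H.smooth.pd hI hI' (by norm_num) j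
  constructor
  · obtain ⟨D, hD, hb⟩ := H.norm_kernelDeriv_le hF1
    obtain ⟨E, hE, h1⟩ := hu
    obtain ⟨E', hE', h1'⟩ := hut
    refine ⟨fun n => D * (E (n + 2) + E' (n + 2)), ?_, fun n q v hq hx hv => ?_⟩
    · have : Tendsto (fun n : ℕ => (n : ℝ) + 2) atTop atTop :=
        tendsto_atTop_add_const_right _ _ tendsto_natCast_atTop_atTop
      simpa using ((hE.comp this).add (hE'.comp this)).const_mul D
    · have hqI := H.sub hq
      have h2 := h1 _ hq q.2 (n + 2) (by positivity)
      have h3 := h1' _ hq q.2 (n + 2) (by positivity)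
      have hsub : (Metric.ball x₀ 1)ᶜ ⊆ (Metric.ball q.2 (1 / 2))ᶜ := fun y hy => by
        have := half_le_of_mem hx hy
        simpa [dist_eq_norm] using this
      have hGw : ∀ y ∈ (Metric.ball x₀ 1)ᶜ,
          ‖kernelDeriv I 0 ξ (fun t y => normal (ξ t) y * F t y) q y v‖ ≤
          D * ((‖y - q.2‖ ^ 2)⁻¹ * ‖F q.1 y‖ + (‖y - q.2‖ ^ 2)⁻¹ * ‖dt I F q.1 y‖) :=
        fun y hy => hb q v y hq hv (half_le_of_mem hx hy)
      have hint : IntegrableOn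
          (fun y => kernelDeriv I 0 ξ (fun t y => normal (ξ t) y * F t y) q y v)
          (Metric.ball x₀ 1)ᶜ := by
        refine ((((h1 _ hq q.2 (1 / 2) (by norm_num)).1.add
          (h1' _ hq q.2 (1 / 2) (by norm_num)).1).mono_set hsub).const_mul D).mono' ?_
          ((ae_restrict_iff' measurableSet_ball.compl).2 (Eventually.of_forall hGw))
        have h := continuousOn_kernelDeriv (U := {q}) (Kc := (Metric.ball x₀ 1)ᶜ) (δ := 0)
          hI hI' hξ1 (CSlab.mul (hN.of_le (by norm_num)) hF1)
          (by rintro _ rfl; exact ⟨hqI, Set.mem_univ _⟩)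
          (by rintro _ rfl y hy; exact Or.inr (H.ne_of_far hq hx hy))
        have h' : ContinuousOn (fun y =>
            kernelDeriv I 0 ξ (fun t y => normal (ξ t) y * F t y) q y) (Metric.ball x₀ 1)ᶜ :=
          h.comp (f := fun y => (q, y)) (by fun_prop) fun y hy => ⟨rfl, hy⟩
        exact (h'.clm_apply continuousOn_const).aestronglyMeasurable measurableSet_ball.compl
      refine norm_integral_diff_le measurableSet_ball.compl (isCompact_annulus x₀ n).measurableSet
        Set.inter_subset_right (annulus_diff hx n) hint hGw (fun y => by positivity)
        ((h2.1.add h3.1).const_mul D) ?_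
      rw [integral_const_mul]
      refine mul_le_mul_of_nonneg_left ?_ hD
      exact (integral_add h2.1 h3.1).trans_le (add_le_add h2.2 h3.2)
  · intro q v hq hx hv hfar
    have hqI := H.sub hq
    have hF0 : ∀ y ∈ Metric.ball x₀ 1, y ∉ tsupport (F q.1) := fun y hy => by
      rw [notMem_tsupport_iff_eventuallyEq]
      filter_upwards [Metric.isOpen_ball.mem_nhds hy] with z hz
      exact h0 _ hqI z (Metric.ball_subset_closedBall hz)
    have hxs : q.2 ∉ tsupport (F q.1) :=
      hF0 _ (Metric.ball_subset_ball (by norm_num) hx)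
    have ct0 : ∀ y ∈ Metric.ball x₀ 1, crossT (ξ q.1) (displ I ξ q v y) (F q.1) y = 0 :=
      fun y hy => by simp [crossT, pd_eq_zero_of_notMem_tsupport (hF0 y hy)]
    have B0 : ∀ y ∈ Metric.ball x₀ 1, normal (ξ q.1) y * (v.1 • dt I F q.1 y) = 0 := fun y hy => by
      rw [dt_eq_zero hqI fun s hs => h0 s hs y (Metric.ball_subset_closedBall hy)]; simp
    have contη := (contDiff_displ hI hI' hξ2 hqI v).continuous
    have contct : Continuous fun y => crossT (ξ q.1) (displ I ξ q v y) (F q.1) y :=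
      ((contη.cross ((hξp 1).slice hqI).continuous).mul ((hFp 0).slice hqI).continuous).sub
      ((contη.cross ((hξp 0).slice hqI).continuous).mul ((hFp 1).slice hqI).continuous)
    have contB : Continuous fun y => normal (ξ q.1) y * (v.1 • dt I F q.1 y) :=
      (hN.slice hqI).continuous.mul
        (Continuous.smul (f := fun _ => v.1) continuous_const (hFt.slice hqI).continuous)
    have ext : ∀ {G : Plane → Cl}, Continuous G → (∀ y ∈ Metric.ball x₀ 1, G y = 0) →
        FarInt G q.2 → Integrable fun y => regK 0 (ξ q.1 y - ξ q.1 q.2) * G y := by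
      intro G hG hG0 hGf
      have := integrableOn_regK_mul 0 H.c_pos (by norm_num : (0 : ℝ) < 1 / 2) (H.chord _ hq q.2)
        (H.smooth.slice hqI).continuous hG.aestronglyMeasurable (hGf (1 / 2) (by norm_num))
      refine (integrableOn_iff_integrable_of_support_subset fun y hy => ?_).1 this
      by_contra hn
      rw [Set.notMem_compl_iff, Metric.mem_ball, dist_eq_norm] at hn
      exact hy (by beta_reduce; rw [hG0 y (mem_ball_one hx hn), mul_zero])
    have hv1 : ‖v.1‖ ≤ 1 := (norm_fst_le v).trans hv
    have farB : FarInt (fun y => normal (ξ q.1) y * (v.1 • dt I F q.1 y)) q.2 := by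
      refine (hut.farInt hq q.2).mono contB (C := M * M * 1) fun y => ?_
      rw [norm_mul, norm_smul, mul_assoc (M * M)]
      exact mul_le_mul (norm_normal_le (H.slope _ hq) y)
        (mul_le_mul_of_nonneg_right hv1 (norm_nonneg _)) (by positivity) (by positivity)
    have iC := ext contct ct0 hfar
    have iB := ext contB B0 farB
    obtain ⟨iV, eV⟩ := integral_variation_far (M := 4 * M) ((H.smooth.slice hqI).of_le (by norm_num))
      (contDiff_displ hI hI' hξ2 hqI v) (hF1.slice hqI) (H.re _ hqI) (fun y => H.displ_re hqI) hxs
      H.c_pos (H.chord _ hq q.2) (fun i z => (H.slope _ hq i z).trans (by linarith))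
      (fun z => H.norm_displ_le hq hv) (fun i z => by
        rw [pd_displ hI hI' hξ2 hqI, norm_smul]
        calc _ ≤ 1 * M := mul_le_mul hv1 (H.velSlope _ hq i z) (norm_nonneg _) zero_le_one
          _ ≤ _ := by linarith) (hu.farInt hq q.2) iC
    have hexp := fun y => kernelDeriv_normal_apply (δ := 0) (y := y) (q := q) hI hI' hξ2 hF1 hqI v
    have key : (∫ y in (Metric.ball x₀ 1)ᶜ,
          kernelDeriv I 0 ξ (fun t y => normal (ξ t) y * F t y) q y v) =
        ∫ y, kernelK (ξ q.1 y - ξ q.1 q.2) * (normal (ξ q.1) y * (v.1 • dt I F q.1 y) -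
          crossT (ξ q.1) (displ I ξ q v y) (F q.1) y) := by
      simp only [hexp]
      rw [integral_add iV.integrableOn iB.integrableOn,
        setIntegral_eq_integral_of_forall_compl_eq_zero (f := variation _ _ _ _ _) fun y hy => by
          rw [variation, h0 _ hqI y (Metric.ball_subset_closedBall (Set.notMem_compl_iff.1 hy)),
            mul_zero],
        setIntegral_eq_integral_of_forall_compl_eq_zero (f := fun y => regK 0 _ * _) fun y hy => by
          rw [B0 y (Set.notMem_compl_iff.1 hy), mul_zero], eV]
      simp only [mul_sub, ← regK_zero]
      rw [integral_sub iB iC]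
      abel
    rw [key]
    refine hasPV_of_integrable (ρ := 1 / 2) (by norm_num) (fun y hy => ?_) ?_
    · rw [ct0 y (mem_ball_one hx hy), B0 y (mem_ball_one hx hy), sub_zero]
    · simp only [mul_sub, ← regK_zero]
      exact iB.sub iC
end

/-! ### Differentiability of layer potentials in time and space -/

/-- Linear maps that converge uniformly on the unit ball converge in the operator norm. -/
theorem exists_tendstoUniformlyOn_clm {X E V : Type*} [NormedAddCommGroup E] [NormedSpace ℝ E]
    [NormedAddCommGroup V] [NormedSpace ℝ V] [CompleteSpace V] {U : Set X}
    {F : ℕ → X → E →L[ℝ] V} {ℓ : X → E → V}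
    (h : ∀ ε, 0 < ε → ∃ n₀, ∀ n, n₀ ≤ n → ∀ q ∈ U, ∀ v, ‖v‖ ≤ 1 → ‖F n q v - ℓ q v‖ ≤ ε) :
    ∃ f' : X → E →L[ℝ] V, TendstoUniformlyOn F f' atTop U ∧
      ∀ q ∈ U, ∀ v, ‖v‖ ≤ 1 → f' q v = ℓ q v := by
  have hC : UniformCauchySeqOn F atTop U := by
    rw [Metric.uniformCauchySeqOn_iff]
    intro ε hε
    obtain ⟨n₀, h0⟩ := h (ε / 4) (by positivity)
    refine ⟨n₀, fun m hm n hn q hq => ?_⟩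
    rw [dist_eq_norm]
    have : ‖F m q - F n q‖ ≤ ε / 2 := by
      refine ContinuousLinearMap.opNorm_le_of_unit_norm (by positivity) fun v hv => ?_
      have h1 := h0 m hm q hq v hv.le
      have h2 := h0 n hn q hq v hv.le
      rw [norm_sub_rev] at h2
      rw [ContinuousLinearMap.sub_apply]
      refine (norm_sub_le_norm_sub_add_norm_sub _ (ℓ q v) _).trans ?_
      linarith
    linarith
  have hlim : ∀ q ∈ U, ∃ L, Tendsto (fun n => F n q) atTop (𝓝 L) := fun q hq =>
    cauchySeq_tendsto_of_complete (hC.cauchySeq hq)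
  choose! f' hf' using hlim
  refine ⟨f', hC.tendstoUniformlyOn_of_tendsto hf', fun q hq v hv => ?_⟩
  have h1 : Tendsto (fun n => F n q v) atTop (𝓝 (f' q v)) :=
    ((ContinuousLinearMap.apply ℝ V v).continuous.tendsto _).comp (hf' q hq)
  refine tendsto_nhds_unique h1 ?_
  rw [Metric.tendsto_atTop]
  intro ε hε
  obtain ⟨n₀, h0⟩ := h (ε / 2) (by positivity)
  refine ⟨n₀, fun n hn => ?_⟩
  rw [dist_eq_norm]
  linarith [h0 n hn q hq v hv]

section
variable {I J : Set ℝ} {ξ f : ℝ → Plane → Cl} {c M : ℝ}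

theorem crossT_const_smul {S F : Plane → Cl} {χ : Plane → ℝ} {a : Cl} {y : Plane}
    (hχ : DifferentiableAt ℝ χ y) (hF : DifferentiableAt ℝ F y) :
    crossT S a (fun y => χ y • F y) y = χ y • crossT S a F y +
      (pd 0 χ y • cross a (pd 1 S y) - pd 1 χ y • cross a (pd 0 S y)) * F y := by
  simp only [crossT]
  rw [pd_smul hχ hF, pd_smul hχ hF]
  simp only [mul_add, sub_mul, mul_smul_comm, smul_mul_assoc, smul_sub]
  abel

/-- The Hilbert transform exists, and is differentiable in `(t, x)`. In the direction `(τ, h)` its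
derivative is a principal value: an integration by parts removes the derivative from the kernel. -/
theorem FlowOn.hilbert_deriv (H : FlowOn I J ξ c M) (hf : CSlab 2 I f) (hu : UnifFar J f)
    (hut : UnifFar J (dt I f)) (x₀ : Plane) :
    ∃ f' : ℝ × Plane → ℝ × Plane →L[ℝ] Cl, ContinuousOn f' (J ×ˢ Metric.ball x₀ (1 / 2)) ∧
      ∀ q ∈ J ×ˢ Metric.ball x₀ (1 / 2),
        HasFDerivWithinAt (fun q : ℝ × Plane => hilbert (ξ q.1) (f q.1) q.2) (f' q)
          (J ×ˢ Metric.ball x₀ (1 / 2)) q ∧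
        ∀ v, ‖v‖ ≤ 1 → FarInt (fun y => crossT (ξ q.1) (displ I ξ q v y) (f q.1) y) q.2 →
          HasPV (ξ q.1) (fun y => normal (ξ q.1) y * (v.1 • dt I f q.1 y) -
            crossT (ξ q.1) (displ I ξ q v y) (f q.1) y) q.2 (f' q v) := by
  have hI := H.convI
  have hI' := H.neI
  have hM := H.M_nonneg
  have hξ2 : CSlab 2 I ξ := H.smooth.of_le (by norm_num)
  have hξ1 : CSlab 1 I ξ := H.smooth.of_le (by norm_num)
  have hf1 : CSlab 1 I f := hf.of_le (by norm_num)
  have hN : CSlab 2 I (fun t => normal (ξ t)) := CSlab.normal hI hI' H.smooth (by norm_num)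
  have hξp : ∀ j, CSlab 2 I (fun t => pd j (ξ t)) := fun j => H.smooth.pd hI hI' (by norm_num) j
  have hfp : ∀ j, CSlab 1 I (fun t => pd j (f t)) := fun j => hf.pd hI hI' (by norm_num) j
  -- `f = A + B` with `A` supported near the base points and `B` away from them
  let β : ContDiffBump x₀ := ⟨1, 2, one_pos, one_lt_two⟩
  let χ : Plane → ℝ := fun y => 1 - β y
  have hβ : ContDiff ℝ 2 β := β.contDiff
  have hχ : ContDiff ℝ 2 χ := contDiff_const.sub hβ
  have hβ1 : ∀ y, ‖β y‖ ≤ 1 := fun y => by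
    rw [Real.norm_of_nonneg β.nonneg]; exact β.le_one
  have hχ1 : ∀ y, ‖χ y‖ ≤ 1 := fun y => by
    rw [Real.norm_of_nonneg (sub_nonneg.2 β.le_one)]; simp [χ, β.nonneg]
  let A : ℝ → Plane → Cl := fun t y => β y • f t y
  let B : ℝ → Plane → Cl := fun t y => χ y • f t y
  have hA : CSlab 2 I A := hf.const_smul hβ
  have hB : CSlab 2 I B := hf.const_smul hχ
  have hA1 : CSlab 1 I A := hA.of_le (by norm_num)
  have hB1 : CSlab 1 I B := hB.of_le (by norm_num)
  have hAB : ∀ t y, A t y + B t y = f t y := fun t y => by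
    simp only [A, B, χ, ← add_smul]; simp
  have hA0 : ∀ t ∈ I, ∀ y, y ∉ Metric.closedBall x₀ 2 → A t y = 0 := fun t _ y hy => by
    have : β y = 0 := β.zero_of_le_dist (not_le.1 hy).le
    simp [A, this]
  have hB0 : ∀ t ∈ I, ∀ y ∈ Metric.closedBall x₀ 1, B t y = 0 := fun t _ y hy => by
    have : β y = 1 := β.one_of_mem_closedBall hy
    simp [B, χ, this]
  have hdA : ∀ t ∈ I, ∀ y, dt I A t y = β y • dt I f t y := fun t ht y =>
    dt_const_smul hI hI' hf1 ht y β
  have hdB : ∀ t ∈ I, ∀ y, dt I B t y = χ y • dt I f t y := fun t ht y =>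
    dt_const_smul hI hI' hf1 ht y χ
  have huB : UnifFar J B := hu.mono (fun t ht => (hB.slice (H.sub ht)).continuous) fun t _ y => by
    rw [norm_smul]; exact mul_le_of_le_one_left (norm_nonneg _) (hχ1 y)
  have hutB : UnifFar J (dt I B) :=
    hut.mono (fun t ht => ((hB.dt hI hI' (m := 1) (by norm_num)).slice (H.sub ht)).continuous)
      fun t ht y => by
        rw [hdB t (H.sub ht), norm_smul]; exact mul_le_of_le_one_left (norm_nonneg _) (hχ1 y)
  obtain ⟨ℓ, hℓ, hnear⟩ := near_part H hA x₀ hA0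
  obtain ⟨⟨e, he, hfare⟩, hfar⟩ := far_part H hB x₀ hB0 huB hutB
  obtain ⟨δ, hδ⟩ : ∃ δ : ℕ → ℝ, δ = fun n : ℕ => 1 / ((n : ℝ) + 1) := ⟨_, rfl⟩
  have hδ0 : ∀ n, 0 < δ n := fun n => by rw [hδ]; positivity
  have hδt : Tendsto δ atTop (𝓝 0) := hδ ▸ tendsto_one_div_add_atTop_nhds_zero_nat
  let GA : ℝ → Plane → Cl := fun t y => normal (ξ t) y * A t y
  let GB : ℝ → Plane → Cl := fun t y => normal (ξ t) y * B t y
  have hGA : CSlab 1 I GA := CSlab.mul (hN.of_le (by norm_num)) hA1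
  have hGB : CSlab 1 I GB := CSlab.mul (hN.of_le (by norm_num)) hB1
  set U := J ×ˢ Metric.ball x₀ (1 / 2) with hU
  have hUI : U ⊆ I ×ˢ Set.univ := Set.prod_mono H.sub (Set.subset_univ _)
  have hUc : Convex ℝ U := H.conv.prod (convex_ball _ _)
  have hsA : ∀ n, ∀ q ∈ U, ∀ y ∈ Metric.closedBall x₀ 3, δ n ≠ 0 ∨ ξ q.1 y - ξ q.1 q.2 ≠ 0 :=
    fun n _ _ _ _ => Or.inl (hδ0 n).ne'
  have hsB : ∀ n, ∀ q ∈ U, ∀ y ∈ annulus x₀ n, (0 : ℝ) ≠ 0 ∨ ξ q.1 y - ξ q.1 q.2 ≠ 0 :=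
    fun n q hq y hy => Or.inr (H.ne_of_far hq.1 hq.2 hy.2)
  have dA := fun n => hasFDerivWithinAt_kernel_integral hI hI' hξ1 hGA hUc hUI
    (isCompact_closedBall x₀ 3) (hsA n)
  have dB := fun n => hasFDerivWithinAt_kernel_integral hI hI' hξ1 hGB hUc hUI
    (isCompact_annulus x₀ n) (hsB n)
  -- approximations by integrals of smooth integrands over compact sets
  let Fn : ℕ → ℝ × Plane → Cl := fun n q =>
    (∫ y in Metric.closedBall x₀ 3, regK (δ n) (ξ q.1 y - ξ q.1 q.2) * GA q.1 y) +
    ∫ y in annulus x₀ n, regK 0 (ξ q.1 y - ξ q.1 q.2) * GB q.1 y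
  let Fn' : ℕ → ℝ × Plane → ℝ × Plane →L[ℝ] Cl := fun n q =>
    (∫ y in Metric.closedBall x₀ 3, kernelDeriv I (δ n) ξ GA q y) +
    ∫ y in annulus x₀ n, kernelDeriv I 0 ξ GB q y
  have hmem : ∀ q ∈ U, q.2 ∈ Metric.closedBall x₀ 1 := fun q hq =>
    Metric.ball_subset_closedBall (Metric.ball_subset_ball (by norm_num) hq.2)
  obtain ⟨f', hunif, hf'⟩ := exists_tendstoUniformlyOn_clm (U := U) (F := Fn')
    (ℓ := fun q v => ℓ q v + ∫ y in (Metric.ball x₀ 1)ᶜ, kernelDeriv I 0 ξ GB q y v) (by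
      intro ε hε
      obtain ⟨r₀, hr₀, h1⟩ := hnear (ε / 2) (by positivity)
      obtain ⟨n₁, hn₁⟩ := eventually_atTop.1 (hδt.eventually (gt_mem_nhds hr₀))
      obtain ⟨n₂, hn₂⟩ := eventually_atTop.1 (he.eventually (gt_mem_nhds (half_pos hε)))
      refine ⟨max n₁ n₂, fun n hn q hq v hv => ?_⟩
      have a1 := h1 (δ n) (hδ0 n) (hn₁ n ((le_max_left _ _).trans hn)) q v hq.1 (hmem q hq) hv
      have a2 := hfare n q v hq.1 hq.2 hv
      have a3 := hn₂ n ((le_max_right _ _).trans hn)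
      have hqI := H.sub hq.1
      simp only [Fn', ContinuousLinearMap.add_apply]
      rw [integral_kernelDeriv_apply hI hI' hξ1 hGA hqI (isCompact_closedBall x₀ 3) (hsA n q hq),
        integral_kernelDeriv_apply hI hI' hξ1 hGB hqI (isCompact_annulus x₀ n) (hsB n q hq),
        add_sub_add_comm]
      refine (norm_add_le _ _).trans ((add_le_add a1 a2).trans ?_)
      linarith)
  have hval : ∀ q ∈ U, Tendsto (fun n => Fn n q) atTop (𝓝 (hilbert (ξ q.1) (f q.1) q.2)) := by
    intro q hq
    have hqI := H.sub hq.1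
    have hS : ContDiff ℝ 2 (ξ q.1) := (H.smooth.slice hqI).of_le (by norm_num)
    have chord := H.chord _ hq.1 q.2
    have hGA0 : ∀ y, y ∉ Metric.closedBall x₀ 2 → GA q.1 y = 0 := fun y hy => by
      simp only [GA, hA0 _ hqI y hy, mul_zero]
    have farA : FarInt (GA q.1) q.2 := FarInt.of_compact (hGA.slice hqI).continuous hGA0
    obtain ⟨L, hL⟩ := exists_hasPV hS (hGA.slice hqI) H.c_pos chord farA
    have l1 := (hL.tendsto_regK hS (hGA.slice hqI) H.c_pos chord farA).comp
      (tendsto_nhdsWithin_iff.2 ⟨hδt, Eventually.of_forall hδ0⟩)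
    obtain ⟨iB, l2⟩ := H.integral_annulus_tendsto hB1 x₀ huB hq.1 hq.2
    have hBz : ∀ y ∈ Metric.ball x₀ 1,
        regK 0 (ξ q.1 y - ξ q.1 q.2) * (normal (ξ q.1) y * B q.1 y) = 0 := fun y hy => by
      rw [hB0 _ hqI y (Metric.ball_subset_closedBall hy)]; simp
    have iB' : Integrable fun y => regK 0 (ξ q.1 y - ξ q.1 q.2) * (normal (ξ q.1) y * B q.1 y) :=
      (integrableOn_iff_integrable_of_support_subset fun y hy hn => hy (hBz y hn)).1 iB
    have hL2 : HasPV (ξ q.1) (GB q.1) q.2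
        (∫ y, kernelK (ξ q.1 y - ξ q.1 q.2) * GB q.1 y) := by
      refine hasPV_of_integrable (ρ := 1 / 2) (by norm_num) (fun y hy => ?_) ?_
      · simp only [GB, hB0 _ hqI y (Metric.ball_subset_closedBall (mem_ball_one hq.2 hy)), mul_zero]
      · simpa only [← regK_zero] using iB'
    have hsum : HasPV (ξ q.1) (fun y => normal (ξ q.1) y * f q.1 y) q.2 _ :=
      (hL.add hL2).congr fun y => by simp only [GA, GB, ← mul_add, hAB]
    rw [hsum.hilbert_eq]
    refine Tendsto.add (l1.congr fun n => ?_) ?_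
    · refine (setIntegral_eq_integral_of_forall_compl_eq_zero fun y hy => ?_).symm
      rw [hGA0 y fun h => hy (Metric.closedBall_subset_closedBall (by norm_num) h), mul_zero]
    · have e1 : (∫ y, kernelK (ξ q.1 y - ξ q.1 q.2) * GB q.1 y) = ∫ y in (Metric.ball x₀ 1)ᶜ,
          regK 0 (ξ q.1 y - ξ q.1 q.2) * (normal (ξ q.1) y * B q.1 y) := by
        rw [setIntegral_eq_integral_of_forall_compl_eq_zero fun y hy =>
          hBz y (Set.notMem_compl_iff.1 hy)]
        simp only [regK_zero]
        rfl
      rw [e1]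
      exact l2
  obtain ⟨r1, r2⟩ := hasFDerivWithinAt_of_tendstoUniformlyOn hUc (F := Fn) (F' := Fn')
    (fun n q hq => ((dA n).1 q hq).add ((dB n).1 q hq)) (fun n => (dA n).2.add (dB n).2) hval hunif
  refine ⟨f', r2, fun q hq => ⟨r1 q hq, fun v hv hct => ?_⟩⟩
  have hqI := H.sub hq.1
  have contη := (contDiff_displ hI hI' hξ2 hqI v).continuous
  have contct : ∀ {F : ℝ → Plane → Cl}, CSlab 2 I F →
      Continuous fun y => crossT (ξ q.1) (displ I ξ q v y) (F q.1) y := fun hF =>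
    ((contη.cross ((hξp 1).slice hqI).continuous).mul
      ((hF.pd hI hI' (m := 1) (by norm_num) 0).slice hqI).continuous).sub
    ((contη.cross ((hξp 0).slice hqI).continuous).mul
      ((hF.pd hI hI' (m := 1) (by norm_num) 1).slice hqI).continuous)
  have dff : Differentiable ℝ (f q.1) := (hf1.slice hqI).differentiable (by norm_num)
  have eA : ∀ y, crossT (ξ q.1) (displ I ξ q v y) (A q.1) y =
      crossT (ξ q.1) (displ I ξ q v y) (f q.1) y -
      crossT (ξ q.1) (displ I ξ q v y) (B q.1) y := fun y => by
    rw [eq_sub_iff_add_eq]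
    change crossT _ _ (fun y => β y • f q.1 y) y + crossT _ _ (fun y => χ y • f q.1 y) y = _
    rw [crossT_const_smul (hβ.differentiable (by norm_num) y) (dff y),
      crossT_const_smul (hχ.differentiable (by norm_num) y) (dff y)]
    have : ∀ i, pd i χ y = -pd i β y := fun i =>
      (((hβ.differentiable (by norm_num) y).hasFDerivAt.const_sub 1).pd i).trans rfl
    simp only [this, χ]
    simp only [neg_smul, sub_smul, one_smul, sub_mul, neg_mul, mul_sub]
    abel
  have farA : FarInt (fun y => crossT (ξ q.1) (displ I ξ q v y) (A q.1) y) q.2 :=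
    FarInt.of_compact (x₀ := x₀) (contct hA) fun y hy => by
      have hts : tsupport (A q.1) ⊆ Metric.closedBall x₀ 2 := closure_minimal (fun z hz =>
        by_contra fun h' => hz (hA0 _ hqI z h')) Metric.isClosed_closedBall
      simp [crossT, pd_eq_zero_of_notMem_tsupport fun h => hy (hts h)]
  have farB : FarInt (fun y => crossT (ξ q.1) (displ I ξ q v y) (B q.1) y) q.2 := by
    have := FarInt.add hct (farA.mono (contct hA).neg (C := 1) fun y => by simp)
      (contct hf) (contct hA).neg
    refine this.mono (contct hB) (C := 1) fun y => ?_
    rw [one_mul, Pi.neg_apply, eA y]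
    refine le_of_eq (congrArg _ ?_)
    abel
  have p1 := (hℓ q v hq.1 (hmem q hq) hv).add (hfar q v hq.1 hq.2 hv farB)
  rw [hf' q hq v hv]
  refine p1.congr fun y => ?_
  have e2 : normal (ξ q.1) y * (v.1 • (β y • dt I f q.1 y)) +
      normal (ξ q.1) y * (v.1 • (χ y • dt I f q.1 y)) =
      normal (ξ q.1) y * (v.1 • dt I f q.1 y) := by
    rw [← mul_add, ← smul_add, ← add_smul]
    simp [χ]
  rw [hdA _ hqI, hdB _ hqI, eA, ← e2]
  abel

end

/-! ### Layer potentials on the moving interface -/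

theorem exists_Icc_mem_nhdsWithin {I : Set ℝ} (hI : Convex ℝ I) {t : ℝ} (ht : t ∈ I) :
    ∃ a b, a ≤ t ∧ t ≤ b ∧ Set.Icc a b ⊆ I ∧ Set.Icc a b ∈ 𝓝[I] t := by
  have h1 : ∃ a ∈ I, a ≤ t ∧ Set.Ici a ∈ 𝓝[I] t := by
    by_cases h : ∃ s ∈ I, s < t
    · obtain ⟨s, hs, hst⟩ := h
      exact ⟨s, hs, hst.le, mem_nhdsWithin_of_mem_nhds (Ici_mem_nhds hst)⟩
    · push Not at h
      exact ⟨t, ht, le_rfl, mem_of_superset self_mem_nhdsWithin h⟩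
  have h2 : ∃ b ∈ I, t ≤ b ∧ Set.Iic b ∈ 𝓝[I] t := by
    by_cases h : ∃ s ∈ I, t < s
    · obtain ⟨s, hs, hst⟩ := h
      exact ⟨s, hs, hst.le, mem_nhdsWithin_of_mem_nhds (Iic_mem_nhds hst)⟩
    · push Not at h
      exact ⟨t, ht, le_rfl, mem_of_superset self_mem_nhdsWithin h⟩
  obtain ⟨a, ha, hat, ha'⟩ := h1
  obtain ⟨b, hb, hbt, hb'⟩ := h2
  exact ⟨a, b, hat, hbt, hI.ordConnected.out ha hb, inter_mem ha' hb'⟩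

/-- The assumptions on the density `f` for which the Hilbert transform on the moving surface is
differentiable, locally in time. -/
def Admissible (I : Set ℝ) (ξ f : ℝ → Plane → Cl) : Prop :=
  CSlab 2 I f ∧ ∀ t ∈ I, ∃ J c M, FlowOn I J ξ c M ∧ t ∈ J ∧ J ∈ 𝓝[I] t ∧ UnifFar J f ∧
    UnifFar J (dt I f)

section
variable {I : Set ℝ} {ξ f : ℝ → Plane → Cl}

theorem Admissible.local_deriv (hI : Convex ℝ I) (hI' : (interior I).Nonempty)
    (H : Admissible I ξ f) {q₀ : ℝ × Plane} (hq₀ : q₀.1 ∈ I) :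
    ∃ f' : ℝ × Plane → ℝ × Plane →L[ℝ] Cl, ContinuousWithinAt f' (I ×ˢ Set.univ) q₀ ∧
      ∀ᶠ q in 𝓝[I ×ˢ Set.univ] q₀,
        HasFDerivWithinAt (fun q : ℝ × Plane => hilbert (ξ q.1) (f q.1) q.2) (f' q)
          (I ×ˢ Set.univ) q ∧
        ∀ v, ‖v‖ ≤ 1 → FarInt (fun y => crossT (ξ q.1) (displ I ξ q v y) (f q.1) y) q.2 →
          HasPV (ξ q.1) (fun y => normal (ξ q.1) y * (v.1 • dt I f q.1 y) -
            crossT (ξ q.1) (displ I ξ q v y) (f q.1) y) q.2 (f' q v) := by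
  obtain ⟨J, c, M, HF, htJ, hJ, hu, hut⟩ := H.2 _ hq₀
  obtain ⟨f', hc, hf'⟩ := HF.hilbert_deriv H.1 hu hut q₀.2
  have hU : J ×ˢ Metric.ball q₀.2 (1 / 2) ∈ 𝓝[I ×ˢ Set.univ] q₀ := by
    rw [show q₀ = (q₀.1, q₀.2) from rfl, nhdsWithin_prod_eq, nhdsWithin_univ]
    exact prod_mem_prod hJ (Metric.ball_mem_nhds _ (by norm_num))
  have hq₀U : q₀ ∈ J ×ˢ Metric.ball q₀.2 (1 / 2) := ⟨htJ, Metric.mem_ball_self (by norm_num)⟩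
  refine ⟨f', (hc q₀ hq₀U).mono_of_mem_nhdsWithin hU, ?_⟩
  filter_upwards [hU, eventually_eventually_nhdsWithin.2 hU] with q hq hqU
  exact ⟨(hf' q hq).1.mono_of_mem_nhdsWithin hqU, (hf' q hq).2⟩

/-- The Hilbert transform of an admissible density is continuously differentiable. -/
theorem Admissible.cslab_hilbert (hI : Convex ℝ I) (hI' : (interior I).Nonempty)
    (H : Admissible I ξ f) : CSlab 1 I (fun t x => hilbert (ξ t) (f t) x) := by
  have hs := uniqueDiffOn_slab hI hI'
  unfold CSlab
  rw [← zero_add (1 : WithTop ℕ∞), contDiffOn_succ_iff_fderivWithin hs]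
  refine ⟨fun q hq => ?_, by simp, contDiffOn_zero.2 fun q hq => ?_⟩
  · obtain ⟨f', -, h⟩ := H.local_deriv hI hI' hq.1
    exact (h.self_of_nhdsWithin hq).1.differentiableWithinAt
  · obtain ⟨f', hc, h⟩ := H.local_deriv hI hI' hq.1
    refine hc.congr_of_eventuallyEq ?_ ((h.self_of_nhdsWithin hq).1.fderivWithin (hs q hq))
    filter_upwards [h, self_mem_nhdsWithin] with z hz hzs
    exact hz.1.fderivWithin (hs z hzs)

/-- The derivative of the Hilbert transform, as a principal value. -/
theorem Admissible.hasPV (hI : Convex ℝ I) (hI' : (interior I).Nonempty)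
    (H : Admissible I ξ f) {t : ℝ} (ht : t ∈ I) (x : Plane) {v : ℝ × Plane} (hv : ‖v‖ ≤ 1)
    (hfar : FarInt (fun y => crossT (ξ t) (displ I ξ (t, x) v y) (f t) y) x) :
    HasPV (ξ t) (fun y => normal (ξ t) y * (v.1 • dt I f t y) -
      crossT (ξ t) (displ I ξ (t, x) v y) (f t) y) x
      (slabD I (fun t x => hilbert (ξ t) (f t) x) t x v) := by
  obtain ⟨f', -, h⟩ := H.local_deriv (q₀ := (t, x)) hI hI' ht
  have h1 := h.self_of_nhdsWithin ⟨ht, Set.mem_univ _⟩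
  have e : slabD I (fun t x => hilbert (ξ t) (f t) x) t x = f' (t, x) :=
    h1.1.fderivWithin (uniqueDiffOn_slab hI hI' _ ⟨ht, Set.mem_univ _⟩)
  rw [e]
  exact h1.2 v hv hfar

theorem FlowOn.exists_hasPV {J : Set ℝ} {c M : ℝ} (H : FlowOn I J ξ c M) {t : ℝ} (ht : t ∈ J)
    {g : Plane → Cl} (hg : ContDiff ℝ 1 g) {x : Plane} (hfar : FarInt g x) :
    ∃ L, HasPV (ξ t) g x L :=
  WaterWave.exists_hasPV ((H.smooth.slice (H.sub ht)).of_le (by norm_num)) hg H.c_pos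
    (H.chord _ ht x) hfar

theorem FlowOn.hilbertExists {J : Set ℝ} {c M : ℝ} (H : FlowOn I J ξ c M) {t : ℝ} (ht : t ∈ J)
    {g : Plane → Cl} (hg : ContDiff ℝ 1 g) {x : Plane} (hfar : FarInt g x) :
    HilbertExists (ξ t) g x := by
  have hN : ContDiff ℝ 1 (normal (ξ t)) :=
    ((CSlab.normal H.convI H.neI H.smooth (m := 2) (by norm_num)).slice (H.sub ht)).of_le
      (by norm_num)
  obtain ⟨L, hL⟩ := H.exists_hasPV ht (hN.mul hg) (x := x)
    (hfar.mono (hN.mul hg).continuous (C := M * M) fun y => by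
      rw [norm_mul]
      exact mul_le_mul_of_nonneg_right (norm_normal_le (H.slope _ ht) y) (norm_nonneg _))
  exact hL.hilbertExists

end

/-! ### The regularity of a water wave -/

section
variable {I : Set ℝ} {ξ : ℝ → Plane → Cl} {𝔞 : ℝ → Plane → ℝ}

theorem vert_eq (f : Plane → ℝ) (x : Plane) : vert f x = f x • e₃ := rfl

theorem norm_e₃ : ‖e₃‖ = 1 := by
  have : ‖e₃‖ ^ 2 = 1 := by rw [norm_sq_eq]; simp [e₃]
  nlinarith [norm_nonneg e₃]

/-- `σ ↦ σ₃ e₃`. -/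
def vertL : Cl →L[ℝ] Cl := imKL.smulRight e₃

@[simp] theorem vertL_apply (σ : Cl) : vertL σ = σ.imK • e₃ := rfl

theorem norm_vertL_le (σ : Cl) : ‖vertL σ‖ ≤ ‖σ‖ := by
  rw [vertL_apply, norm_smul, norm_e₃, mul_one]; exact abs_imK_le σ

/-- Near every time a solution is a moving surface with uniform bounds, and all the densities that
occur decay at infinity. -/
theorem exists_flowOn (hI : Convex ℝ I) (hI' : (interior I).Nonempty) (hs : IsSolution I ξ 𝔞)
    (hr : IsRegular I ξ) {t : ℝ} (ht : t ∈ I) :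
    ∃ J c M, FlowOn I J ξ c M ∧ t ∈ J ∧ J ∈ 𝓝[I] t ∧
      UnifFar J (fun t => vert (height ξ t)) ∧
      (∀ i, UnifFar J (fun t => pd i (vert (height ξ t)))) ∧
      UnifFar J (dt I ξ) ∧ UnifFar J (dt I (dt I ξ)) := by
  obtain ⟨a, b, hat, htb, hab, hJ⟩ := exists_Icc_mem_nhdsWithin hI ht
  obtain ⟨p, c, M, hp1, hp, hc, h⟩ := hr.bounds _ hab isCompact_Icc
  have htJ : t ∈ Set.Icc a b := ⟨hat, htb⟩
  have hM : 0 ≤ M := (norm_nonneg _).trans ((h t htJ).2.2.1 0)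
  have hξ : CSlab 3 I ξ := hs.smooth
  have hz : CSlab 3 I (fun t => vert (height ξ t)) := hξ.clm vertL
  have hzn : ∀ t y, ‖vert (height ξ t) y‖ = ‖height ξ t y‖ := fun t y => by
    rw [vert_eq, norm_smul, norm_e₃, mul_one]
  have hzp : ∀ i, ∀ t ∈ I, ∀ y, ‖pd i (vert (height ξ t)) y‖ = ‖pd i (height ξ t) y‖ := by
    intro i t ht y
    have hd : DifferentiableAt ℝ (ξ t) y := (hξ.slice ht).differentiable (by norm_num) y
    have e1 : pd i (vert (height ξ t)) y = vertL (pd i (ξ t) y) := pd_comp_clm vertL hd i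
    have e2 : pd i (height ξ t) y = imKL (pd i (ξ t) y) := pd_comp_clm imKL hd i
    rw [e1, e2, vertL_apply, norm_smul, norm_e₃, mul_one]
    rfl
  refine ⟨Set.Icc a b, c, M, ⟨hI, hI', hξ, hs.isVector, hab, isCompact_Icc, convex_Icc a b, hc, hM,
    fun t ht x y => (h t ht).1 y x, fun t ht => (h t ht).2.1, fun t ht => (h t ht).2.2.1,
    fun t ht => (h t ht).2.2.2.1⟩, htJ, hJ, ?_, fun i => ?_, ?_, ?_⟩
  · refine unifFar_of_eLpNorm hp1 hp hM (fun t ht => (hz.slice (hab ht)).continuous) fun t ht => ?_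
    rw [eLpNorm_congr_norm_ae (Eventually.of_forall (hzn t))]
    exact (h t ht).2.2.2.2.1
  · refine unifFar_of_eLpNorm (p := 2) (by norm_num) (by norm_num) hM (fun t ht =>
      ((hz.pd hI hI' (m := 2) (by norm_num) i).slice (hab ht)).continuous) fun t ht => ?_
    rw [eLpNorm_congr_norm_ae (Eventually.of_forall (hzp i t (hab ht)))]
    exact (h t ht).2.2.2.2.2.1 i
  · exact unifFar_of_eLpNorm (p := 2) (by norm_num) (by norm_num) hM (fun t ht =>
      ((hξ.dt hI hI' (m := 2) (by norm_num)).slice (hab ht)).continuous)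
      fun t ht => (h t ht).2.2.2.2.2.2.1
  · exact unifFar_of_eLpNorm (p := 2) (by norm_num) (by norm_num) hM (fun t ht =>
      (((hξ.dt hI hI' (m := 2) (by norm_num)).dt hI hI' (m := 1)
        (by norm_num)).slice (hab ht)).continuous)
      fun t ht => (h t ht).2.2.2.2.2.2.2

theorem dt_vert_height (hI : Convex ℝ I) (hI' : (interior I).Nonempty) (hξ : CSlab 1 I ξ) {t : ℝ}
    (ht : t ∈ I) (y : Plane) : dt I (fun t => vert (height ξ t)) t y = vertL (dt I ξ t y) :=
  dt_clm hI hI' hξ ht y vertL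

theorem admissible_vert (hI : Convex ℝ I) (hI' : (interior I).Nonempty) (hs : IsSolution I ξ 𝔞)
    (hr : IsRegular I ξ) : Admissible I ξ (fun t => vert (height ξ t)) := by
  have hξ : CSlab 3 I ξ := hs.smooth
  refine ⟨(hξ.clm vertL).of_le (by norm_num), fun t ht => ?_⟩
  obtain ⟨J, c, M, H, htJ, hJ, h1, -, h2, -⟩ := exists_flowOn hI hI' hs hr ht
  refine ⟨J, c, M, H, htJ, hJ, h1, h2.mono (fun t ht => ?_) fun t ht y => ?_⟩
  · exact ((CSlab.clm hξ vertL).dt hI hI' (m := 2) (by norm_num)).slice (H.sub ht) |>.continuous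
  · rw [dt_vert_height hI hI' (hξ.of_le (by norm_num)) (H.sub ht)]
    exact norm_vertL_le _

theorem admissible_vel (hI : Convex ℝ I) (hI' : (interior I).Nonempty) (hs : IsSolution I ξ 𝔞)
    (hr : IsRegular I ξ) : Admissible I ξ (dt I ξ) := by
  have hξ : CSlab 3 I ξ := hs.smooth
  refine ⟨hξ.dt hI hI' (by norm_num), fun t ht => ?_⟩
  obtain ⟨J, c, M, H, htJ, hJ, -, -, h1, h2⟩ := exists_flowOn hI hI' hs hr ht
  exact ⟨J, c, M, H, htJ, hJ, h1, h2⟩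

end

/-! ### The height potential and the change of coordinates -/

@[simp] theorem e₃_re : e₃.re = 0 := rfl
@[simp] theorem e₃_imI : e₃.imI = 0 := rfl
@[simp] theorem e₃_imJ : e₃.imJ = 0 := rfl
@[simp] theorem e₃_imK : e₃.imK = 1 := rfl

theorem e₃_mul_e₃ : e₃ * e₃ = -1 := by
  have h : e₃ * e₃ = ((-1 : ℝ) : Cl) := by ext <;> simp <;> rfl
  rw [h]; simp

theorem crossT_vertL {S f : Plane → Cl} {a : Cl} {y : Plane}
    (hf : ∀ i, pd i f y = vertL (pd i S y)) : crossT S a f y = cross a (tang S y) * e₃ := by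
  rw [crossT, hf, hf]
  ext <;> simp [tang] <;> ring

/-- Principal values inherit linear relations between their integrands. -/
theorem HasPV.relation {S g₁ g₂ g₃ : Plane → Cl} {x : Plane} {L₁ L₂ L₃ : Cl}
    (h₁ : HasPV S g₁ x L₁) (h₂ : HasPV S g₂ x L₂) (h₃ : HasPV S g₃ x L₃) (T₁ T₂ T₃ : Cl →L[ℝ] ℝ)
    (h : ∀ y, T₁ (kernelK (S y - S x) * g₁ y) + T₂ (kernelK (S y - S x) * g₂ y) =
      T₃ (kernelK (S y - S x) * g₃ y)) : T₁ L₁ + T₂ L₂ = T₃ L₃ := by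
  have l1 := (T₁.continuous.tendsto _).comp h₁.2
  have l2 := (T₂.continuous.tendsto _).comp h₂.2
  have l3 := (T₃.continuous.tendsto _).comp h₃.2
  refine tendsto_nhds_unique ((l1.add l2).congr' ?_) l3
  filter_upwards [self_mem_nhdsWithin] with r hr
  have i1 : IntegrableOn (fun y => T₁ (kernelK (S y - S x) * g₁ y)) (Metric.ball x r)ᶜ :=
    T₁.integrable_comp (h₁.1 r hr)
  have i2 : IntegrableOn (fun y => T₂ (kernelK (S y - S x) * g₂ y)) (Metric.ball x r)ᶜ :=
    T₂.integrable_comp (h₂.1 r hr)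
  simp only [Function.comp]
  rw [← T₁.integral_comp_comm (h₁.1 r hr), ← T₂.integral_comp_comm (h₂.1 r hr),
    ← T₃.integral_comp_comm (h₃.1 r hr), ← integral_add i1 i2]
  simp only [h]

theorem kernelK_re {σ : Cl} (hσ : σ.re = 0) : (kernelK σ).re = 0 := by simp [kernelK, hσ]

theorem HasPV.mul_right_iff_exists {S f : Plane → Cl} {x : Plane} (c : Cl)
    (h : HilbertExists S f x) : HasPV S (fun y => normal S y * (f y * c)) x (hilbert S f x * c) :=
  (h.hasPV.mul_right c).congr fun y => by rw [mul_assoc]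

theorem vert_eq_coe_mul (f : Plane → ℝ) (x : Plane) : vert f x = (f x : Cl) * e₃ := by
  rw [vert_eq, Quaternion.coe_mul_eq_smul]

theorem hilbertExists_coe {S : Plane → Cl} {f : Plane → ℝ} {x : Plane}
    (h : HilbertExists S (vert f) x) : HilbertExists S (fun y => (f y : Cl)) x := by
  refine HasPV.hilbertExists ((HasPV.mul_right_iff_exists (-e₃) h).congr fun y => ?_)
  rw [vert_eq_coe_mul, mul_assoc, mul_neg e₃ e₃, e₃_mul_e₃, neg_neg, mul_one]

/-- `𝒦 f = (ℋ (f e₃))₃`. -/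
theorem doubleLayer_eq {S : Plane → Cl} {f : Plane → ℝ} {x : Plane}
    (h : HilbertExists S (vert f) x) : doubleLayer S f x = (hilbert S (vert f) x).imK := by
  have h1 := (HasPV.mul_right_iff_exists e₃ (hilbertExists_coe h)).congr
    (g₂ := fun y => normal S y * vert f y) fun y => by rw [vert_eq_coe_mul]
  rw [h1.hilbert_eq, doubleLayer]
  simp

section
variable {I : Set ℝ} {ξ : ℝ → Plane → Cl} {𝔞 : ℝ → Plane → ℝ}

/-- The Hilbert transform of `z e₃`. -/
def heightPot (ξ : ℝ → Plane → Cl) (t : ℝ) (x : Plane) : Cl :=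
  hilbert (ξ t) (vert (height ξ t)) x

/-- The assumptions on a water wave. -/
structure Wave (I : Set ℝ) (ξ : ℝ → Plane → Cl) (𝔞 : ℝ → Plane → ℝ) : Prop where
  convI : Convex ℝ I
  neI : (interior I).Nonempty
  sol : IsSolution I ξ 𝔞
  reg : IsRegular I ξ

theorem Wave.smooth (W : Wave I ξ 𝔞) : CSlab 3 I ξ := W.sol.smooth

theorem Wave.pd_vert (W : Wave I ξ 𝔞) {t : ℝ} (ht : t ∈ I) (i : Fin 2) (y : Plane) :
    pd i (vert (height ξ t)) y = vertL (pd i (ξ t) y) :=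
  pd_comp_clm vertL ((W.smooth.slice ht).differentiable (by norm_num) y) i

theorem Wave.pd_re (W : Wave I ξ 𝔞) {t : ℝ} (ht : t ∈ I) (i : Fin 2) (y : Plane) :
    (pd i (ξ t) y).re = 0 :=
  pd_re_eq_zero ((W.smooth.slice ht).differentiable (by norm_num)) (W.sol.isVector t ht) i y

theorem dt_re {f : ℝ → Plane → Cl} (hI : Convex ℝ I) (hI' : (interior I).Nonempty)
    (hf : CSlab 1 I f) (h0 : ∀ t ∈ I, ∀ x, (f t x).re = 0) {t : ℝ} (ht : t ∈ I) (x : Plane) :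
    (dt I f t x).re = 0 := by
  rw [← reL_apply, ← dt_clm hI hI' hf ht x reL]
  exact dt_eq_zero ht fun s hs => h0 s hs x

theorem Wave.contDiff_tang (W : Wave I ξ 𝔞) {t : ℝ} (ht : t ∈ I) :
    ContDiff ℝ 2 (tang (ξ t)) := by
  have hp : ∀ i, ContDiff ℝ 2 (pd i (ξ t)) := fun i => (W.smooth.slice ht).pd (by norm_num) i
  exact ((imKL.contDiff.comp (hp 0)).smul (hp 1)).sub ((imKL.contDiff.comp (hp 1)).smul (hp 0))

theorem norm_tang_le {S f : Plane → Cl} {y : Plane} {M : ℝ} (hf : ∀ i, pd i f y = vertL (pd i S y))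
    (hM : ∀ i, ‖pd i S y‖ ≤ M) : ‖tang S y‖ ≤ M * (‖pd 0 f y‖ + ‖pd 1 f y‖) := by
  have h : ∀ i j, ‖(pd i S y).imK • pd j S y‖ ≤ M * ‖pd i f y‖ := fun i j => by
    rw [hf, vertL_apply, norm_smul, norm_smul, norm_e₃, mul_one, mul_comm]
    exact mul_le_mul_of_nonneg_right (hM j) (norm_nonneg _)
  exact (norm_sub_le _ _).trans ((add_le_add (h 0 1) (h 1 0)).trans (le_of_eq (by ring)))

theorem Wave.exists_flow (W : Wave I ξ 𝔞) {t : ℝ} (ht : t ∈ I) :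
    ∃ J c M, FlowOn I J ξ c M ∧ t ∈ J ∧ J ∈ 𝓝[I] t ∧
      UnifFar J (fun t => vert (height ξ t)) ∧
      (∀ i, UnifFar J (fun t => pd i (vert (height ξ t)))) ∧
      UnifFar J (dt I ξ) ∧ UnifFar J (dt I (dt I ξ)) :=
  exists_flowOn W.convI W.neI W.sol W.reg ht

theorem Wave.farInt_tang (W : Wave I ξ 𝔞) {t : ℝ} (ht : t ∈ I) (x : Plane) :
    FarInt (tang (ξ t)) x := by
  obtain ⟨J, c, M, H, htJ, -, -, hp, -, -⟩ := W.exists_flow ht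
  have hz : ContDiff ℝ 3 (vert (height ξ t)) := (W.smooth.clm vertL).slice ht
  have hc : ∀ i, Continuous (pd i (vert (height ξ t))) := fun i =>
    (hz.pd (m := 2) (by norm_num) i).continuous
  have h0 : ∀ {g : Plane → Cl}, Continuous g → FarInt g x → FarInt (fun y => (‖g y‖ : Cl)) x :=
    fun hg h => h.mono (Quaternion.continuous_coe.comp hg.norm) (C := 1) fun y => by
      rw [Quaternion.norm_coe, norm_norm, one_mul]
  have h1 := FarInt.add (h0 (hc 0) ((hp 0).farInt htJ x)) (h0 (hc 1) ((hp 1).farInt htJ x))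
    (Quaternion.continuous_coe.comp (hc 0).norm) (Quaternion.continuous_coe.comp (hc 1).norm)
  refine h1.mono (W.contDiff_tang ht).continuous (C := M) fun y => ?_
  refine (norm_tang_le (W.pd_vert ht · y) (H.slope t htJ · y)).trans (le_of_eq ?_)
  rw [← Quaternion.coe_add, Quaternion.norm_coe, Real.norm_of_nonneg (by positivity)]

theorem Wave.hilbertExists_vert (W : Wave I ξ 𝔞) {t : ℝ} (ht : t ∈ I) (x : Plane) :
    HilbertExists (ξ t) (vert (height ξ t)) x := by
  obtain ⟨J, c, M, H, htJ, -, h1, -, -, -⟩ := W.exists_flow ht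
  exact H.hilbertExists htJ (((W.smooth.clm vertL).slice ht).of_le (by norm_num))
    (h1.farInt htJ x)

theorem Wave.exists_hasPV_tang (W : Wave I ξ 𝔞) {t : ℝ} (ht : t ∈ I) (x : Plane) :
    ∃ L, HasPV (ξ t) (tang (ξ t)) x L ∧ L.re = 0 := by
  obtain ⟨J, c, M, H, htJ, -, h1, -, -, -⟩ := W.exists_flow ht
  obtain ⟨L, hL⟩ := H.exists_hasPV htJ ((W.contDiff_tang ht).of_le (by norm_num))
    (W.farInt_tang ht x)
  refine ⟨L, hL, ?_⟩
  have hS := W.smooth.slice ht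
  have hd := hS.differentiable (by norm_num)
  have hz : ContDiff ℝ 1 fun y => (ξ t y).imK := imKL.contDiff.comp (hS.of_le (by norm_num))
  have hfar : FarInt (fun y => (((ξ t y).imK : ℝ) : Cl)) x :=
    (h1.farInt htJ x).mono (C := 1) (Quaternion.continuous_coe.comp hz.continuous) fun y => by
      rw [Quaternion.norm_coe, vert_eq, norm_smul, norm_e₃, mul_one, one_mul]; rfl
  refine HasPV.re_tangential (φ := fun _ => 1) (ψ := fun y => (ξ t y).imK) (D := 1) (x := x)
    (hS.of_le (by norm_num)) (W.sol.isVector t ht) H.c_pos (H.chord t htJ x) (H.slope t htJ)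
    contDiff_const hz (fun i y => ?_) (fun y => ?_) hfar ?_ (hL.congr fun y => by simp)
  · rw [one_mul]; exact pd_comp_clm imKL (hd y) i
  · rw [one_mul]
    exact le_mul_of_one_le_left (abs_nonneg _) (by linarith [norm_nonneg y])
  · simpa using W.farInt_tang ht x

theorem HasPV.re_eq_zero_of_coe {S : Plane → Cl} {r : Plane → ℝ} {x : Plane} {L : Cl}
    (hS : ∀ y, (S y).re = 0) (h : HasPV S (fun y => (r y : Cl)) x L) : L.re = 0 := by
  have := h.relation h h reL 0 0 fun y => by simp [kernelK_re, hS]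
  simpa using this

/-- The layer potential of `z e₃` is a vector. -/
theorem Wave.heightPot_re (W : Wave I ξ 𝔞) {t : ℝ} (ht : t ∈ I) (x : Plane) :
    (heightPot ξ t x).re = 0 := by
  obtain ⟨J, c, M, H, htJ, -, h1, -, -, -⟩ := W.exists_flow ht
  have hS := W.smooth.slice ht
  have hd := hS.differentiable (by norm_num)
  have hz : ContDiff ℝ 1 fun y => (ξ t y).imK := imKL.contDiff.comp (hS.of_le (by norm_num))
  have hfar : FarInt (fun y => (((ξ t y).imK : ℝ) : Cl)) x :=
    (h1.farInt htJ x).mono (C := 1) (Quaternion.continuous_coe.comp hz.continuous) fun y => by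
      rw [Quaternion.norm_coe, vert_eq, norm_smul, norm_e₃, mul_one, one_mul]; rfl
  have hM := H.M_nonneg
  have htM : ∀ y, ‖tang (ξ t) y‖ ≤ M * M + M * M := fun y => by
    have h : ∀ i j, ‖(pd i (ξ t) y).imK • pd j (ξ t) y‖ ≤ M * M := fun i j => by
      rw [norm_smul]
      exact mul_le_mul ((abs_imK_le _).trans (H.slope t htJ i y)) (H.slope t htJ j y)
        (norm_nonneg _) hM
    exact (norm_sub_le _ _).trans (add_le_add (h 0 1) (h 1 0))
  have hg : ContDiff ℝ 1 fun y => (ξ t y).imK • tang (ξ t) y :=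
    hz.smul ((W.contDiff_tang ht).of_le (by norm_num))
  have hgf : FarInt (fun y => (ξ t y).imK • tang (ξ t) y) x :=
    hfar.mono hg.continuous (C := M * M + M * M) fun y => by
      rw [norm_smul, Quaternion.norm_coe, mul_comm]
      exact mul_le_mul_of_nonneg_right (htM y) (norm_nonneg _)
  obtain ⟨L, hL⟩ := H.exists_hasPV htJ hg hgf
  -- `z ≤ C (1 + |y|)`, because the slope is bounded
  have hlin : ∀ y, |(ξ t y).imK| ≤ (‖ξ t 0‖ + 2 * M) * (1 + ‖y‖) := fun y => by
    have h2 : ‖ξ t y - ξ t 0‖ ≤ 2 * M * ‖y - 0‖ :=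
      (convex_univ).norm_image_sub_le_of_norm_fderiv_le (fun z _ => hd z)
        (fun z _ => norm_fderiv_le (H.slope t htJ · z)) (Set.mem_univ _) (Set.mem_univ _)
    rw [sub_zero] at h2
    have h3 := norm_le_norm_add_norm_sub' (ξ t y) (ξ t 0)
    have h4 : 0 ≤ ‖ξ t 0‖ * ‖y‖ := by positivity
    nlinarith [abs_imK_le (ξ t y), norm_nonneg y, norm_nonneg (ξ t 0)]
  have hLre : L.re = 0 := by
    refine HasPV.re_tangential (φ := fun y => (ξ t y).imK)
      (ψ := fun y => (1 / 2 : ℝ) * ((ξ t y).imK * (ξ t y).imK)) (D := ‖ξ t 0‖ + 2 * M) (x := x)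
      (hS.of_le (by norm_num)) (W.sol.isVector t ht) H.c_pos (H.chord t htJ x) (H.slope t htJ)
      hz (contDiff_const.mul (hz.mul hz)) (fun i y => ?_) (fun y => ?_) hfar hgf hL
    · have h5 : HasFDerivAt (fun y => (ξ t y).imK) (imKL.comp (fderiv ℝ (ξ t) y)) y :=
        imKL.hasFDerivAt.comp y (hd y).hasFDerivAt
      refine (((h5.mul h5).const_mul (1 / 2)).pd i).trans ?_
      have e : fderiv ℝ (ξ t) y (unitVec i) = pd i (ξ t) y := rfl
      simp [e]
      ring
    · rw [abs_mul, abs_mul, abs_of_pos (by norm_num : (0 : ℝ) < 1 / 2)]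
      have := mul_le_mul_of_nonneg_right (hlin y) (abs_nonneg (ξ t y).imK)
      nlinarith [mul_nonneg (abs_nonneg (ξ t y).imK) (abs_nonneg (ξ t y).imK)]
  have hG := (W.hilbertExists_vert ht x).hasPV
  have h2 := hL.sub hG
  have h3 : (L - heightPot ξ t x).re = 0 := by
    refine HasPV.re_eq_zero_of_coe (r := fun y => (ξ t y).imK * (normal (ξ t) y).imK)
      (W.sol.isVector t ht) (h2.congr fun y => ?_)
    have a := W.pd_re ht 0 y
    have b := W.pd_re ht 1 y
    ext <;> simp [vert_eq, height, normal, tang, a, b] <;> first | ring1 | (right; ring1)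
  simpa [hLre] using h3

/-- The spatial derivatives of the layer potential of `z e₃`. -/
theorem Wave.hasPV_pd_heightPot (W : Wave I ξ 𝔞) {t : ℝ} (ht : t ∈ I) (x : Plane) (i : Fin 2) :
    HasPV (ξ t) (fun y => cross (pd i (ξ t) x) (tang (ξ t) y) * e₃) x
      (pd i (heightPot ξ t) x) := by
  have hA := admissible_vert W.convI W.neI W.sol W.reg
  have hG := hA.cslab_hilbert W.convI W.neI
  have hdis : ∀ y, displ I ξ (t, x) (0, unitVec i) y = -pd i (ξ t) x := fun y => by
    simp [displ, pd_eq_fderiv]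
  have hct : ∀ y, crossT (ξ t) (displ I ξ (t, x) (0, unitVec i) y) (vert (height ξ t)) y =
      -(cross (pd i (ξ t) x) (tang (ξ t) y) * e₃) := fun y => by
    rw [crossT_vertL (W.pd_vert ht · y), hdis, ← crossL_apply, map_neg]
    simp
  have hcont : Continuous fun y => -(cross (pd i (ξ t) x) (tang (ξ t) y) * e₃) :=
    ((continuous_const.cross (W.contDiff_tang ht).continuous).mul continuous_const).neg
  have hfar : FarInt (fun y => crossT (ξ t) (displ I ξ (t, x) (0, unitVec i) y)
      (vert (height ξ t)) y) x := by
    simp only [hct]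
    refine (W.farInt_tang ht x).mono hcont (C := ‖pd i (ξ t) x‖) fun y => ?_
    rw [norm_neg, norm_mul, norm_e₃, mul_one]
    exact norm_cross_le _ _
  have h1 := hA.hasPV W.convI W.neI ht x (v := (0, unitVec i)) (by simp [norm_unitVec]) hfar
  have e : pd i (heightPot ξ t) x = slabD I (heightPot ξ) t x (0, unitVec i) :=
    CSlab.pd_eq hG ht x i
  rw [e]
  exact h1.congr fun y => by rw [hct]; simp

/-- The time derivative of the layer potential of `z e₃`. -/
theorem Wave.hasPV_dt_heightPot (W : Wave I ξ 𝔞) {t : ℝ} (ht : t ∈ I) (x : Plane) :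
    HasPV (ξ t) (fun y => normal (ξ t) y * vertL (dt I ξ t y) -
      cross (dt I ξ t y - dt I ξ t x) (tang (ξ t) y) * e₃) x (dt I (heightPot ξ) t x) := by
  have hA := admissible_vert W.convI W.neI W.sol W.reg
  have hG := hA.cslab_hilbert W.convI W.neI
  have hξ1 : CSlab 1 I ξ := W.smooth.of_le (by norm_num)
  obtain ⟨J, c, M, H, htJ, -, -⟩ := W.exists_flow ht
  have hdis : ∀ y, displ I ξ (t, x) (1, 0) y = dt I ξ t y - dt I ξ t x := fun y => by
    simp [displ]
  have hct : ∀ y, crossT (ξ t) (displ I ξ (t, x) (1, 0) y) (vert (height ξ t)) y =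
      cross (dt I ξ t y - dt I ξ t x) (tang (ξ t) y) * e₃ := fun y => by
    rw [crossT_vertL (W.pd_vert ht · y), hdis]
  have hvc : Continuous (dt I ξ t) :=
    ((W.smooth.dt W.convI W.neI (m := 2) (by norm_num)).slice ht).continuous
  have hcont : Continuous fun y => cross (dt I ξ t y - dt I ξ t x) (tang (ξ t) y) * e₃ :=
    ((hvc.sub continuous_const).cross (W.contDiff_tang ht).continuous).mul continuous_const
  have hfar : FarInt (fun y => crossT (ξ t) (displ I ξ (t, x) (1, 0) y)
      (vert (height ξ t)) y) x := by
    simp only [hct]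
    refine (W.farInt_tang ht x).mono hcont (C := M + M) fun y => ?_
    rw [norm_mul, norm_e₃, mul_one]
    refine (norm_cross_le _ _).trans (mul_le_mul_of_nonneg_right ?_ (norm_nonneg _))
    exact (norm_sub_le _ _).trans (add_le_add (H.vel t htJ y) (H.vel t htJ x))
  have h1 := hA.hasPV W.convI W.neI ht x (v := (1, 0)) (by simp) hfar
  have e : dt I (heightPot ξ) t x = slabD I (heightPot ξ) t x (1, 0) :=
    CSlab.dt_eq W.convI W.neI hG ht x
  rw [e]
  refine h1.congr fun y => ?_
  rw [hct, dt_vert_height W.convI W.neI hξ1 ht]; simp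

/-- `Re (N × ∇) H(z e₃) = 0`. -/
theorem Wave.re_crossNabla_heightPot (W : Wave I ξ 𝔞) {t : ℝ} (ht : t ∈ I) (x : Plane) :
    (pd 1 (ξ t) x * pd 0 (heightPot ξ t) x - pd 0 (ξ t) x * pd 1 (heightPot ξ t) x).re = 0 := by
  -- the scalar part of the integrand is `- N₃(x) Re (K τ')`, with `τ'` the tangential field
  obtain ⟨L, hL, hLre⟩ := W.exists_hasPV_tang ht x
  have h := (W.hasPV_pd_heightPot ht x 0).relation (W.hasPV_pd_heightPot ht x 1) hL
    (reL.comp (mulL (pd 1 (ξ t) x))) (-(reL.comp (mulL (pd 0 (ξ t) x))))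
    (-(normal (ξ t) x).imK • reL) fun y => by
      have a := W.pd_re ht 0 x
      have b := W.pd_re ht 1 x
      have k := kernelK_re (σ := ξ t y - ξ t x) (by simp [W.sol.isVector t ht])
      simp only [ContinuousLinearMap.comp_apply, ContinuousLinearMap.neg_apply,
        ContinuousLinearMap.smul_apply, reL_apply, mulL_apply, smul_eq_mul]
      have t0 : (tang (ξ t) y).re = 0 := by simp [tang, W.pd_re ht]
      have t3 : (tang (ξ t) y).imK = 0 := by simp [tang]; ring
      rw [normal]
      generalize kernelK (ξ t y - ξ t x) = K at k ⊢
      generalize pd 0 (ξ t) x = A at a ⊢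
      generalize pd 1 (ξ t) x = B at b ⊢
      generalize tang (ξ t) y = τ at t0 t3 ⊢
      simp [a, b, k, t0, t3]
      ring
  simp only [ContinuousLinearMap.comp_apply, ContinuousLinearMap.neg_apply,
    ContinuousLinearMap.smul_apply, reL_apply, mulL_apply, smul_eq_mul, hLre, mul_zero] at h
  rw [Quaternion.re_sub, sub_eq_add_neg]
  exact h

end

/-! ### Principal values and changes of coordinates -/

section
variable {V : Type*} [NormedAddCommGroup V] [NormedSpace ℝ V]

theorem norm_setIntegral_sub_le {f : Plane → V} {A B : Set Plane} (hA : MeasurableSet A)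
    (hB : MeasurableSet B) (iA : IntegrableOn f A) (iB : IntegrableOn f B) {b v : ℝ}
    (hb : 0 ≤ b) (h1 : ∀ h ∈ A \ B, ‖f h‖ ≤ b) (h2 : ∀ h ∈ B \ A, ‖f h‖ ≤ b) {T : Set Plane}
    (hT : volume T ≠ ⊤) (hTv : volume.real T ≤ v) (hAT : A \ B ⊆ T) (hBT : B \ A ⊆ T) :
    ‖(∫ h in A, f h) - ∫ h in B, f h‖ ≤ 2 * (b * v) := by
  rw [← integral_inter_add_sdiff hB iA, ← integral_inter_add_sdiff hA iB, Set.inter_comm B A,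
    add_sub_add_left_eq_sub]
  have key : ∀ {U : Set Plane}, U ⊆ T → (∀ h ∈ U, ‖f h‖ ≤ b) → ‖∫ h in U, f h‖ ≤ b * v := by
    intro U hUT hU
    have hlt : volume U < ⊤ := (measure_mono hUT).trans_lt (lt_top_iff_ne_top.2 hT)
    refine (norm_setIntegral_le_of_norm_le_const hlt hU).trans ?_
    exact mul_le_mul_of_nonneg_left ((measureReal_mono hUT hT).trans hTv) hb
  refine (norm_sub_le _ _).trans ((add_le_add (key hAT h1) (key hBT h2)).trans (le_of_eq ?_))
  ring

/-- The area of the elliptic annulus `a ≤ |E h| ≤ b`. -/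
theorem measureReal_ellipse (E : Plane ≃L[ℝ] Plane) {a b : ℝ} (ha : 0 ≤ a) (hab : a ≤ b) :
    volume {h : Plane | a ≤ ‖E h‖ ∧ ‖E h‖ ≤ b} ≠ ⊤ ∧
    volume.real {h : Plane | a ≤ ‖E h‖ ∧ ‖E h‖ ≤ b} =
      |(LinearMap.det (E : Plane →ₗ[ℝ] Plane))⁻¹| * (discArea * (b ^ 2 - a ^ 2)) := by
  have hb : 0 ≤ b := ha.trans hab
  have e : {h : Plane | a ≤ ‖E h‖ ∧ ‖E h‖ ≤ b} =
      E ⁻¹' (Metric.closedBall 0 b \ Metric.ball 0 a) := by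
    ext h; simp [and_comm]
  have hdet : LinearMap.det (E : Plane →ₗ[ℝ] Plane) ≠ 0 :=
    (LinearEquiv.isUnit_det' E.toLinearEquiv).ne_zero
  have h1 : volume (E ⁻¹' (Metric.closedBall 0 b \ Metric.ball 0 a)) =
      ENNReal.ofReal |(LinearMap.det (E : Plane →ₗ[ℝ] Plane))⁻¹| *
        volume (Metric.closedBall (0 : Plane) b \ Metric.ball 0 a) :=
    Measure.addHaar_preimage_linearMap volume hdet _
  have hfin : volume (Metric.closedBall (0 : Plane) b \ Metric.ball 0 a) ≠ ⊤ :=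
    ((measure_mono Set.diff_subset).trans_lt
      (isCompact_closedBall (0 : Plane) b).measure_lt_top).ne
  have hvol : volume.real (Metric.closedBall (0 : Plane) b \ Metric.ball 0 a) =
      discArea * (b ^ 2 - a ^ 2) := by
    have hr : Module.finrank ℝ Plane = 2 := by simp
    rw [measureReal_diff (Metric.ball_subset_closedBall.trans
      (Metric.closedBall_subset_closedBall hab)) measurableSet_ball
      (isCompact_closedBall (0 : Plane) b).measure_lt_top.ne]
    have h2 := Measure.addHaar_real_closedBall (volume : Measure Plane) 0 hb
    have h3 : volume.real (Metric.ball (0 : Plane) a) = a ^ 2 * discArea := by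
      have := Measure.addHaar_real_closedBall (volume : Measure Plane) 0 ha
      rw [hr] at this
      rw [← Measure.addHaar_real_closedBall_eq_addHaar_real_ball, this]; rfl
    rw [hr] at h2
    rw [h2, h3, discArea]
    ring
  rw [e, measureReal_def, h1]
  refine ⟨ENNReal.mul_ne_top ENNReal.ofReal_ne_top hfin, ?_⟩
  rw [ENNReal.toReal_mul, ENNReal.toReal_ofReal (abs_nonneg _), ← hvol]
  rfl

/-- Principal values may be computed by removing the sets `|p h| < r` instead of balls, for
a local diffeomorphism `p` fixing the origin. -/
theorem tendsto_integral_deformed {Ψ : Plane → V} {C : ℝ} {L : V} {p : Plane → Plane}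
    {E : Plane ≃L[ℝ] Plane} (hC : 0 ≤ C)
    (hsym : ∀ h, h ≠ 0 → ‖h‖ < 1 → ‖Ψ h + Ψ (-h)‖ ≤ C * ‖h‖⁻¹)
    (hbd : ∀ h, h ≠ 0 → ‖h‖ < 1 → ‖Ψ h‖ ≤ C * (‖h‖ ^ 2)⁻¹)
    (hint : ∀ r, 0 < r → IntegrableOn Ψ (Metric.ball 0 r)ᶜ)
    (hlim : Tendsto (fun r => ∫ h in (Metric.ball 0 r)ᶜ, Ψ h) (𝓝[>] 0) (𝓝 L))
    (hp : Continuous p) (hp0 : p 0 = 0) (hE : HasFDerivAt p (E : Plane →L[ℝ] Plane) 0)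
    (hinv : ∀ ρ, 0 < ρ → ∃ r₀, 0 < r₀ ∧ ∀ h, ‖p h‖ < r₀ → ‖h‖ < ρ) :
    (∀ r, 0 < r → IntegrableOn Ψ {h | r ≤ ‖p h‖}) ∧
      Tendsto (fun r => ∫ h in {h | r ≤ ‖p h‖}, Ψ h) (𝓝[>] 0) (𝓝 L) := by
  have hmeas : ∀ r, MeasurableSet {h | r ≤ ‖p h‖} := fun r =>
    (isClosed_le continuous_const hp.norm).measurableSet
  have hmeasE : ∀ r, MeasurableSet {h | r ≤ ‖E h‖} := fun r =>
    (isClosed_le continuous_const E.continuous.norm).measurableSet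
  have int1 : ∀ r, 0 < r → IntegrableOn Ψ {h | r ≤ ‖p h‖} := by
    intro r hr
    have : ∀ᶠ h in 𝓝 (0 : Plane), ‖p h‖ < r := by
      have h1 := hp.norm.tendsto 0
      rw [hp0, norm_zero] at h1
      exact h1.eventually (gt_mem_nhds hr)
    obtain ⟨ρ, hρ, h1⟩ := Metric.eventually_nhds_iff_ball.1 this
    refine (hint ρ hρ).mono_set fun h hh hb => ?_
    exact absurd (h1 h hb) (not_lt.2 hh)
  refine ⟨int1, ?_⟩
  obtain ⟨m, hm, hmE⟩ : ∃ m, 0 < m ∧ ∀ h, m * ‖h‖ ≤ ‖E h‖ := by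
    have hpos : 0 < ‖(E.symm : Plane →L[ℝ] Plane)‖ + 1 := by positivity
    refine ⟨(‖(E.symm : Plane →L[ℝ] Plane)‖ + 1)⁻¹, inv_pos.2 hpos, fun h => ?_⟩
    rw [inv_mul_le_iff₀ hpos]
    have := (E.symm : Plane →L[ℝ] Plane).le_opNorm (E h)
    simp only [ContinuousLinearEquiv.coe_coe, ContinuousLinearEquiv.symm_apply_apply] at this
    nlinarith [norm_nonneg (E h)]
  obtain ⟨n, hn, hnE⟩ : ∃ n, 0 < n ∧ ∀ h, ‖E h‖ ≤ n * ‖h‖ := by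
    refine ⟨‖(E : Plane →L[ℝ] Plane)‖ + 1, by positivity, fun h => ?_⟩
    have := (E : Plane →L[ℝ] Plane).le_opNorm h
    simp only [ContinuousLinearEquiv.coe_coe] at this
    nlinarith [norm_nonneg h]
  have int2 : ∀ r, 0 < r → IntegrableOn Ψ {h | r ≤ ‖E h‖} := by
    intro r hr
    refine (hint (r / n) (by positivity)).mono_set fun h hh hb => ?_
    rw [mem_ball_zero_iff, lt_div_iff₀ hn] at hb
    have h1 : r ≤ ‖E h‖ := hh
    linarith [hnE h, mul_comm n ‖h‖]
  have hDA := discArea_nonneg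
  obtain ⟨D, hD, hDE⟩ : ∃ D, 0 ≤ D ∧ D = |(LinearMap.det (E : Plane →ₗ[ℝ] Plane))⁻¹| * discArea :=
    ⟨_, by positivity, rfl⟩
  rw [Metric.tendsto_nhds]
  intro η hη
  -- the relative thickness of the region between the two level sets
  obtain ⟨ε, hε, hε1, hεη⟩ : ∃ ε, 0 < ε ∧ ε ≤ 1 / 2 ∧ 32 * C * n ^ 2 * D * ε ≤ η / 4 := by
    have hK : 0 ≤ 32 * C * n ^ 2 * D := by positivity
    refine ⟨min (1 / 2) (η / 4 / (32 * C * n ^ 2 * D + 1)), by positivity, min_le_left _ _, ?_⟩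
    calc _ ≤ (32 * C * n ^ 2 * D + 1) * (η / 4 / (32 * C * n ^ 2 * D + 1)) := by
          gcongr
          · linarith
          · exact min_le_right _ _
      _ = η / 4 := by field_simp
  have hdiff : ∀ᶠ h in 𝓝 (0 : Plane), ‖p h - E h‖ ≤ ε * m / 2 * ‖h‖ := by
    have := hE.isLittleO.def (c := ε * m / 2) (by positivity)
    simpa [hp0] using this
  obtain ⟨ρ, hρ, hρd⟩ := Metric.eventually_nhds_iff_ball.1 hdiff
  obtain ⟨r₀, hr₀, hr₀p⟩ := hinv (min ρ 1) (by positivity)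
  have hlim' : Tendsto (fun r => ∫ h in (Metric.ball 0 (r / m))ᶜ, Ψ h) (𝓝[>] 0) (𝓝 L) := by
    refine hlim.comp (tendsto_nhdsWithin_iff.2 ⟨?_, ?_⟩)
    · have : Tendsto (fun r : ℝ => r / m) (𝓝 0) (𝓝 (0 / m)) := tendsto_id.div_const m
      rw [zero_div] at this
      exact this.mono_left nhdsWithin_le_nhds
    · filter_upwards [self_mem_nhdsWithin] with r hr using div_pos hr hm
  have hr1 : 0 < min (min r₀ (m * min ρ 1)) (η / 4 * m / (C * discArea + 1)) := by positivity
  filter_upwards [hlim'.eventually (Metric.ball_mem_nhds L (show 0 < η / 4 by positivity)),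
    Ioo_mem_nhdsGT hr1] with r hrL hr
  have hr0 : 0 < r := hr.1
  have hrr₀ : r < r₀ := hr.2.trans_le ((min_le_left _ _).trans (min_le_left _ _))
  have hrm : r < m * min ρ 1 := hr.2.trans_le ((min_le_left _ _).trans (min_le_right _ _))
  have hrη : r < η / 4 * m / (C * discArea + 1) := hr.2.trans_le (min_le_right _ _)
  -- the deformed set against the ellipse
  obtain ⟨hTf, hTv⟩ := measureReal_ellipse E (a := r * (1 - ε)) (b := r * (1 + ε))
    (mul_nonneg hr0.le (by linarith)) (by nlinarith)
  have hsmall : ∀ h : Plane, ‖E h‖ < r ∨ ‖p h‖ < r → ‖h‖ < ρ ∧ ‖h‖ < 1 := by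
    rintro h (hh | hh)
    · have h1 : m * ‖h‖ < m * min ρ 1 := (hmE h).trans_lt (hh.trans hrm)
      have h2 := lt_of_mul_lt_mul_left h1 hm.le
      exact ⟨h2.trans_le (min_le_left _ _), h2.trans_le (min_le_right _ _)⟩
    · have h2 := hr₀p h (hh.trans hrr₀)
      exact ⟨h2.trans_le (min_le_left _ _), h2.trans_le (min_le_right _ _)⟩
  have hpE : ∀ h : Plane, ‖h‖ < ρ → ‖p h - E h‖ ≤ ε / 2 * ‖E h‖ := fun h hh => by
    have h1 := hρd h (mem_ball_zero_iff.2 hh)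
    have h2 := mul_le_mul_of_nonneg_left (hmE h) (by positivity : 0 ≤ ε / 2)
    linarith
  have hT1 : {h | r ≤ ‖p h‖} \ {h | r ≤ ‖E h‖} ⊆
      {h : Plane | r * (1 - ε) ≤ ‖E h‖ ∧ ‖E h‖ ≤ r * (1 + ε)} := by
    rintro h ⟨h1, h2⟩
    have h1 : r ≤ ‖p h‖ := h1
    have h2 : ‖E h‖ < r := not_le.1 h2
    have h3 := hpE h (hsmall h (Or.inl h2)).1
    have h4 := norm_le_norm_add_norm_sub' (p h) (E h)
    constructor <;> nlinarith [norm_nonneg (E h)]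
  have hT2 : {h | r ≤ ‖E h‖} \ {h | r ≤ ‖p h‖} ⊆
      {h : Plane | r * (1 - ε) ≤ ‖E h‖ ∧ ‖E h‖ ≤ r * (1 + ε)} := by
    rintro h ⟨h1, h2⟩
    have h1 : r ≤ ‖E h‖ := h1
    have h2 : ‖p h‖ < r := not_le.1 h2
    have h3 := hpE h (hsmall h (Or.inr h2)).1
    rw [norm_sub_rev] at h3
    have h4 := norm_le_norm_add_norm_sub' (E h) (p h)
    constructor
    · nlinarith
    · by_contra h5
      push Not at h5
      have h6 : ‖E h‖ * (1 - ε / 2) < r := by linarith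
      have h7 : r * (1 + ε) * (1 - ε / 2) < ‖E h‖ * (1 - ε / 2) :=
        mul_lt_mul_of_pos_right h5 (by linarith)
      nlinarith [mul_pos hr0 hε]
  have hTb : ∀ h : Plane, ‖h‖ < 1 →
      h ∈ {h : Plane | r * (1 - ε) ≤ ‖E h‖ ∧ ‖E h‖ ≤ r * (1 + ε)} →
      ‖Ψ h‖ ≤ C * (4 * n ^ 2 / r ^ 2) := by
    intro h h1 h2
    have h3 : r / 2 ≤ n * ‖h‖ := by nlinarith [h2.1, hnE h]
    have h0 : 0 < ‖h‖ := by
      by_contra h4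
      have : ‖h‖ = 0 := le_antisymm (not_lt.1 h4) (norm_nonneg h)
      rw [this] at h3; linarith
    refine (hbd h (norm_pos_iff.1 h0) h1).trans (mul_le_mul_of_nonneg_left ?_ hC)
    rw [inv_le_comm₀ (by positivity) (by positivity), inv_div, div_le_iff₀ (by positivity)]
    nlinarith
  have step1 : ‖(∫ h in {h | r ≤ ‖p h‖}, Ψ h) - ∫ h in {h | r ≤ ‖E h‖}, Ψ h‖ ≤ η / 4 := by
    refine (norm_setIntegral_sub_le (hmeas r) (hmeasE r) (int1 r hr0) (int2 r hr0)
      (b := C * (4 * n ^ 2 / r ^ 2)) (by positivity)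
      (fun h hh => hTb h (hsmall h (Or.inl (not_le.1 hh.2))).2 (hT1 hh))
      (fun h hh => hTb h (hsmall h (Or.inr (not_le.1 hh.2))).2 (hT2 hh)) hTf hTv.le hT1
      hT2).trans (le_trans (le_of_eq ?_) hεη)
    rw [hDE]
    field_simp
    ring
  -- the ellipse against the ball
  have step2 : ‖(∫ h in {h | r ≤ ‖E h‖}, Ψ h) - ∫ h in (Metric.ball 0 (r / m))ᶜ, Ψ h‖ ≤ η / 4 := by
    have hsub : (Metric.ball (0 : Plane) (r / m))ᶜ ⊆ {h | r ≤ ‖E h‖} := fun h hh => by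
      rw [Set.mem_compl_iff, mem_ball_zero_iff, not_lt, div_le_iff₀ hm] at hh
      have := hmE h
      simp only [Set.mem_setOf_eq]; linarith
    rw [← setIntegral_sdiff measurableSet_ball.compl (int2 r hr0) hsub]
    refine (norm_integral_symm_le ((hmeasE r).diff measurableSet_ball.compl) (fun h => by simp)
      (ρ := r / m) (C := C) (by positivity) hC (fun h hh => by simpa using hh.2)
      ((int2 r hr0).mono_set Set.diff_subset) fun h hh h0 => ?_).trans ?_
    · refine hsym h h0 ?_
      have h1 : ‖h‖ < r / m := by simpa using hh.2
      refine h1.trans ((div_lt_iff₀ hm).2 ?_)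
      have : m * min ρ 1 ≤ m * 1 := by gcongr; exact min_le_right _ _
      linarith
    · rw [lt_div_iff₀ (by positivity)] at hrη
      rw [mul_div_assoc', div_le_iff₀ hm]
      nlinarith
  rw [dist_eq_norm]
  have h3 : ‖(∫ h in (Metric.ball 0 (r / m))ᶜ, Ψ h) - L‖ < η / 4 := by
    rw [← dist_eq_norm]; exact hrL
  have h4 := norm_sub_le_norm_sub_add_norm_sub (∫ h in {h | r ≤ ‖p h‖}, Ψ h)
    (∫ h in {h | r ≤ ‖E h‖}, Ψ h) L
  have h5 := norm_sub_le_norm_sub_add_norm_sub (∫ h in {h | r ≤ ‖E h‖}, Ψ h)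
    (∫ h in (Metric.ball 0 (r / m))ᶜ, Ψ h) L
  linarith

end

/-! ### Charts of the plane -/

theorem det_fderiv_eq_jacobian (k : Plane → Plane) (x : Plane) :
    (fderiv ℝ k x).det = jacobian k x := by
  have h := LinearMap.det_toMatrix (EuclideanSpace.basisFun (Fin 2) ℝ).toBasis
    (fderiv ℝ k x : Plane →ₗ[ℝ] Plane)
  rw [ContinuousLinearMap.det, ← h, Matrix.det_fin_two]
  simp only [LinearMap.toMatrix_apply, OrthonormalBasis.coe_toBasis,
    OrthonormalBasis.coe_toBasis_repr_apply, EuclideanSpace.basisFun_apply,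
    EuclideanSpace.basisFun_repr, ContinuousLinearMap.coe_coe]
  unfold jacobian pd
  ring

/-- A `C¹` diffeomorphism of the plane with positive Jacobian. -/
structure Chart (k : Plane → Plane) : Prop where
  bij : Function.Bijective k
  smooth : ContDiff ℝ 1 k
  pos : ∀ x, 0 < jacobian k x

section
variable {k : Plane → Plane}

theorem Chart.left_inv (h : Chart k) (x : Plane) : Function.invFun k (k x) = x :=
  Function.leftInverse_invFun h.bij.1 x

theorem Chart.right_inv (h : Chart k) (y : Plane) : k (Function.invFun k y) = y :=
  Function.rightInverse_invFun h.bij.2 y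

theorem Chart.fderiv_injective (h : Chart k) (x v : Plane) (hv : fderiv ℝ k x v = 0) : v = 0 := by
  have h1 : LinearMap.det (fderiv ℝ k x : Plane →ₗ[ℝ] Plane) ≠ 0 := by
    have := det_fderiv_eq_jacobian k x
    rw [ContinuousLinearMap.det] at this
    rw [this]; exact (h.pos x).ne'
  have h3 : LinearMap.ker (fderiv ℝ k x : Plane →ₗ[ℝ] Plane) = ⊥ := by
    have := (LinearMap.equivOfDetNeZero _ h1).ker
    simpa using this
  exact (LinearMap.ker_eq_bot'.1 h3) v hv

theorem Chart.exists_equiv (h : Chart k) (x : Plane) :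
    ∃ E : Plane ≃L[ℝ] Plane, HasFDerivAt k (E : Plane →L[ℝ] Plane) x := by
  obtain ⟨E, hE⟩ := exists_continuousLinearEquiv (fderiv ℝ k x) (h.fderiv_injective x)
  exact ⟨E, hE ▸ ((h.smooth.differentiable (by norm_num)) x).hasFDerivAt⟩

theorem Chart.continuous_inv (h : Chart k) : Continuous (Function.invFun k) := by
  have hd := h.smooth.differentiable (by norm_num)
  refine continuous_iff_continuousAt.2 fun y => ?_
  have h1 := continuousWithinAt_invFun (I := Set.univ) convex_univ (k := fun _ => k)
    (k' := fun q => (fderiv ℝ k q.2).comp (ContinuousLinearMap.snd ℝ ℝ Plane))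
    (fun q _ => ((hd q.2).hasFDerivAt.comp q hasFDerivAt_snd).hasFDerivWithinAt)
    (Continuous.continuousOn (((h.smooth.continuous_fderiv (by norm_num)).comp
      continuous_snd).clm_comp continuous_const))
    (fun _ _ => h.bij) (fun t _ x v hv => h.fderiv_injective x v hv)
    (q₀ := ((0 : ℝ), y)) (Set.mem_univ _)
  rw [Set.univ_prod_univ, continuousWithinAt_univ] at h1
  exact h1.comp (f := fun y : Plane => ((0 : ℝ), y)) (by fun_prop)

theorem Chart.image_compl_ball (h : Chart k) (x : Plane) (r : ℝ) :
    k '' {y | r ≤ ‖k y - k x‖} = (Metric.ball (k x) r)ᶜ := by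
  ext η
  simp only [Set.mem_image, Set.mem_setOf_eq, Set.mem_compl_iff, Metric.mem_ball, not_lt,
    dist_eq_norm]
  constructor
  · rintro ⟨y, hy, rfl⟩; exact hy
  · intro hη
    exact ⟨Function.invFun k η, by rwa [h.right_inv], h.right_inv η⟩

/-- Principal values do not depend on the parametrization: balls in the new coordinates may
replace balls in the old ones. -/
theorem HasPV.chart {S g : Plane → Cl} {x : Plane} {L : Cl} {c : ℝ} (h : Chart k)
    (hL : HasPV S g x L) (hS : ContDiff ℝ 2 S) (hg : ContDiff ℝ 1 g) (hc : 0 < c)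
    (chord : ∀ y, c * ‖y - x‖ ≤ ‖S y - S x‖) (hfar : FarInt g x) :
    HasPV (fun η => S (Function.invFun k η))
      (fun η => (jacobian k (Function.invFun k η))⁻¹ • g (Function.invFun k η)) (k x) L := by
  obtain ⟨C, H⟩ := pvFamily_of_contDiff hS hg hc chord hfar
  obtain ⟨E, hE⟩ := h.exists_equiv x
  have hd := h.smooth.differentiable (by norm_num)
  set Φ : Plane → Cl := fun y => kernelK (S y - S x) * g y with hΦ
  have hΦeq : ∀ y, Φ y = regK 0 (S y - S x) * g y := fun y => by rw [hΦ, regK_zero]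
  set F : Plane → Cl := fun η => kernelK (S (Function.invFun k η) - S (Function.invFun k (k x))) *
      ((jacobian k (Function.invFun k η))⁻¹ • g (Function.invFun k η)) with hF
  have hjac : ∀ y, |(fderiv ℝ k y).det| • F (k y) = Φ y := fun y => by
    rw [det_fderiv_eq_jacobian, abs_of_pos (h.pos y)]
    simp only [hF, hΦ, h.left_inv]
    rw [mul_smul_comm, smul_smul, mul_inv_cancel₀ (h.pos y).ne', one_smul]
  have hshift : ∀ s : Set Plane, MeasurePreserving (fun h : Plane => x + h) volume volume :=
    fun _ => measurePreserving_add_left volume x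
  have hemb : MeasurableEmbedding (fun h : Plane => x + h) := measurableEmbedding_addLeft x
  have hpre : ∀ r, (fun h : Plane => x + h) ⁻¹' (Metric.ball x r)ᶜ = (Metric.ball 0 r)ᶜ := by
    intro r; ext h; simp
  have hpre' : ∀ r, (fun h : Plane => x + h) ⁻¹' {y | r ≤ ‖k y - k x‖} =
      {h | r ≤ ‖k (x + h) - k x‖} := fun r => rfl
  have key := tendsto_integral_deformed (Ψ := fun h => Φ (x + h)) (L := L)
    (C := max (4 * C ^ 2 * (c ^ 3)⁻¹ + C * (c ^ 2)⁻¹) (C * (c ^ 2)⁻¹))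
    (p := fun h => k (x + h) - k x) (E := E)
    (le_max_of_le_right (by have := H.C_nonneg; positivity))
    (fun h h0 h1 => by
      simp only [hΦeq]
      refine (H.symm_le 0 () h0 h1).trans ?_
      gcongr; exact le_max_left _ _)
    (fun h h0 h1 => by
      simp only [hΦeq]
      rw [norm_mul]
      have e1 := norm_regK_le_far (y := x + h) 0 hc chord (by simpa using h0)
      rw [add_sub_cancel_left] at e1
      have e2 := H.bdd () h h1
      calc _ ≤ ((c ^ 2)⁻¹ * (‖h‖ ^ 2)⁻¹) * C :=
            mul_le_mul e1 e2 (norm_nonneg _) (by positivity)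
        _ = C * (c ^ 2)⁻¹ * (‖h‖ ^ 2)⁻¹ := by ring
        _ ≤ _ := by gcongr; exact le_max_right _ _)
    (fun r hr => by
      rw [← hpre r]
      exact ((hshift Set.univ).integrableOn_comp_preimage hemb).2 (hL.1 r hr))
    (by
      refine hL.2.congr fun r => ?_
      rw [← hpre r, (hshift Set.univ).setIntegral_preimage_emb hemb])
    ((h.smooth.continuous.comp (by fun_prop)).sub continuous_const) (by simp)
    (by
      have e1 : HasFDerivAt (fun h : Plane => x + h) (ContinuousLinearMap.id ℝ Plane) 0 :=
        (hasFDerivAt_id _).const_add x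
      have e2 : HasFDerivAt k (E : Plane →L[ℝ] Plane) (x + 0) := by rwa [add_zero]
      have e3 := (HasFDerivAt.comp (g := k) (f := fun h : Plane => x + h) 0 e2 e1).sub_const (k x)
      rw [ContinuousLinearMap.comp_id] at e3
      exact e3)
    (fun ρ hρ => by
      have e1 := Metric.continuous_iff.1 h.continuous_inv (k x) ρ hρ
      obtain ⟨r₀, hr₀, e1⟩ := e1
      refine ⟨r₀, hr₀, fun h' hh => ?_⟩
      have := e1 (k (x + h')) (by rwa [dist_eq_norm])
      rw [h.left_inv, h.left_inv, dist_eq_norm, add_sub_cancel_left] at this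
      exact this)
  have hms : ∀ r, MeasurableSet {y | r ≤ ‖k y - k x‖} := fun r =>
    (isClosed_le continuous_const (h.smooth.continuous.sub continuous_const).norm).measurableSet
  have hder : ∀ r, ∀ y ∈ {y | r ≤ ‖k y - k x‖},
      HasFDerivWithinAt k (fderiv ℝ k y) {y | r ≤ ‖k y - k x‖} y := fun r y _ =>
    (hd y).hasFDerivAt.hasFDerivWithinAt
  refine ⟨fun r hr => ?_, ?_⟩
  · rw [← h.image_compl_ball,
      integrableOn_image_iff_integrableOn_abs_det_fderiv_smul volume (hms r) (hder r)
        h.bij.1.injOn]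
    have := key.1 r hr
    rw [← hpre' r, show (fun h => Φ (x + h)) = Φ ∘ fun h : Plane => x + h from rfl,
      (hshift Set.univ).integrableOn_comp_preimage hemb] at this
    exact this.congr_fun (fun y _ => (hjac y).symm) (hms r)
  · refine key.2.congr fun r => ?_
    rw [← h.image_compl_ball,
      integral_image_eq_integral_abs_det_fderiv_smul volume (hms r) (hder r) h.bij.1.injOn,
      ← hpre' r, (hshift Set.univ).setIntegral_preimage_emb hemb]
    exact setIntegral_congr_fun (hms r) fun y _ => (hjac y).symm

end

/-! ### Covariance of the geometric operators under a change of chart -/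

section
variable {V : Type*} [NormedAddCommGroup V] [NormedSpace ℝ V] {k : Plane → Plane}

theorem pd_comp_chart {G : Plane → V} {x : Plane} (hk : DifferentiableAt ℝ k x)
    (hG : DifferentiableAt ℝ G (k x)) (i : Fin 2) :
    pd i (fun y => G (k y)) x = pd i k x 0 • pd 0 G (k x) + pd i k x 1 • pd 1 G (k x) := by
  have h := (hG.hasFDerivAt.comp x hk.hasFDerivAt).pd i
  refine h.trans ?_
  rw [ContinuousLinearMap.comp_apply, ← pd_eq_fderiv, plane_eq (pd i k x), map_add, map_smul,
    map_smul, ← pd_eq_fderiv, ← pd_eq_fderiv]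
  simp [unitVec]

variable {Z S f F : Plane → Cl} {x : Plane}

theorem normal_chart (hk : DifferentiableAt ℝ k x) (hZ : DifferentiableAt ℝ Z (k x))
    (hS : ∀ y, S y = Z (k y)) : normal S x = jacobian k x • normal Z (k x) := by
  obtain rfl : S = fun y => Z (k y) := funext hS
  unfold normal jacobian
  rw [pd_comp_chart hk hZ, pd_comp_chart hk hZ]
  ext <;> simp [cross_re, cross_imI, cross_imJ, cross_imK] <;> ring

theorem tang_chart (hk : DifferentiableAt ℝ k x) (hZ : DifferentiableAt ℝ Z (k x))
    (hS : ∀ y, S y = Z (k y)) : tang S x = jacobian k x • tang Z (k x) := by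
  obtain rfl : S = fun y => Z (k y) := funext hS
  unfold tang jacobian
  rw [pd_comp_chart hk hZ, pd_comp_chart hk hZ]
  ext <;> simp <;> ring

theorem crossT_chart (hk : DifferentiableAt ℝ k x) (hZ : DifferentiableAt ℝ Z (k x))
    (hF : DifferentiableAt ℝ F (k x)) (hS : ∀ y, S y = Z (k y)) (hf : ∀ y, f y = F (k y)) (a : Cl) :
    crossT S a f x = jacobian k x • crossT Z a F (k x) := by
  obtain rfl : S = fun y => Z (k y) := funext hS
  obtain rfl : f = fun y => F (k y) := funext hf
  unfold crossT jacobian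
  simp only [pd_comp_chart hk hZ, pd_comp_chart hk hF]
  ext <;> simp [cross_re, cross_imI, cross_imJ, cross_imK] <;> ring

theorem crossNabla_chart (hk : DifferentiableAt ℝ k x) (hZ : DifferentiableAt ℝ Z (k x))
    (hF : DifferentiableAt ℝ F (k x)) (hS : ∀ y, S y = Z (k y)) (hf : ∀ y, f y = F (k y))
    (c : Plane → ℝ) (r : ℝ) (hc : c (k x) = r * jacobian k x) :
    crossNabla Z c F (k x) = r • (pd 1 S x * pd 0 f x - pd 0 S x * pd 1 f x) := by
  obtain rfl : S = fun y => Z (k y) := funext hS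
  obtain rfl : f = fun y => F (k y) := funext hf
  unfold crossNabla
  rw [hc]
  unfold jacobian
  simp only [pd_comp_chart hk hZ, pd_comp_chart hk hF]
  ext <;> simp <;> ring

/-- `HasPV.chart` for a density given in the new coordinates. -/
theorem HasPV.to_chart {g G : Plane → Cl} {L : Cl} {c : ℝ} (h : Chart k) (hL : HasPV S g x L)
    (hS : ContDiff ℝ 2 S) (hg : ContDiff ℝ 1 g) (hc : 0 < c)
    (chord : ∀ y, c * ‖y - x‖ ≤ ‖S y - S x‖) (hfar : FarInt g x)
    (hZ : ∀ η, Z η = S (Function.invFun k η)) (hG : ∀ y, g y = jacobian k y • G (k y)) :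
    HasPV Z G (k x) L := by
  obtain rfl : Z = fun η => S (Function.invFun k η) := funext hZ
  refine (hL.chart h hS hg hc chord hfar).congr fun η => ?_
  rw [hG, smul_smul, inv_mul_cancel₀ (h.pos _).ne', one_smul, h.right_inv]

end

/-! ### The wave in the new coordinates -/

/-- The projection `σ ↦ σ - σ₃ e₃`, which keeps the horizontal part of a vector. -/
def horL : Cl →L[ℝ] Cl := ContinuousLinearMap.id ℝ Cl - vertL

@[simp] theorem horL_apply (σ : Cl) : horL σ = σ - σ.imK • e₃ := rfl

/-- `toPlane` as a continuous linear map. -/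
def toPlaneL : Cl →L[ℝ] Plane := imIL.smulRight (unitVec 0) + imJL.smulRight (unitVec 1)

theorem toPlaneL_apply (σ : Cl) : toPlaneL σ = toPlane σ := by
  ext i; fin_cases i <;> simp [toPlaneL, toPlane, unitVec]

section
variable {I : Set ℝ} {ξ : ℝ → Plane → Cl} {𝔞 : ℝ → Plane → ℝ} {t : ℝ}

theorem Wave.heightPot_smooth (W : Wave I ξ 𝔞) : CSlab 1 I (heightPot ξ) :=
  (admissible_vert W.convI W.neI W.sol W.reg).cslab_hilbert W.convI W.neI

theorem Wave.doubleLayer_height (W : Wave I ξ 𝔞) (ht : t ∈ I) (x : Plane) :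
    doubleLayer (ξ t) (height ξ t) x = (heightPot ξ t x).imK :=
  doubleLayer_eq (W.hilbertExists_vert ht x)

theorem Wave.kMap_eq (W : Wave I ξ 𝔞) (ht : t ∈ I) (x : Plane) :
    kMap ξ t x = horL (ξ t x) - horL (heightPot ξ t x) := by
  rw [kMap, W.doubleLayer_height ht, vert_eq, height, horL_apply, horL_apply, heightPot]
  abel

theorem Wave.kMap_re (W : Wave I ξ 𝔞) (ht : t ∈ I) (x : Plane) : (kMap ξ t x).re = 0 := by
  rw [W.kMap_eq ht]
  simp [W.sol.isVector t ht, W.heightPot_re ht]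

theorem Wave.kMap_imK (W : Wave I ξ 𝔞) (ht : t ∈ I) (x : Plane) : (kMap ξ t x).imK = 0 := by
  rw [W.kMap_eq ht]
  simp

theorem Wave.kMap_smooth (W : Wave I ξ 𝔞) : CSlab 1 I (kMap ξ) :=
  ContDiffOn.congr (((W.smooth.of_le (by norm_num)).clm horL).sub (W.heightPot_smooth.clm horL))
    fun q hq => W.kMap_eq hq.1 q.2

theorem kPlane_eq (ξ : ℝ → Plane → Cl) (t : ℝ) (x : Plane) :
    kPlane ξ t x = toPlaneL (kMap ξ t x) := (toPlaneL_apply _).symm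

theorem Wave.kPlane_smooth (W : Wave I ξ 𝔞) : CSlab 1 I (kPlane ξ) :=
  ContDiffOn.congr (W.kMap_smooth.clm toPlaneL) fun q _ => kPlane_eq ξ q.1 q.2

theorem IsCoordChange.chart (K : IsCoordChange I ξ) (ht : t ∈ I) : Chart (kPlane ξ t) :=
  ⟨(K t ht).1, (K t ht).2.1, (K t ht).2.2⟩

theorem kInv_kPlane (K : IsCoordChange I ξ) (ht : t ∈ I) (x : Plane) :
    kInv ξ t (kPlane ξ t x) = x := (K.chart ht).left_inv x

theorem Wave.diffAt_kInv (W : Wave I ξ 𝔞) (K : IsCoordChange I ξ) (ht : t ∈ I) (η : Plane) :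
    DiffAt I (kInv ξ) t η := by
  refine differentiableWithinAt_invFun W.convI (k := kPlane ξ)
    (k' := fun q => slabD I (kPlane ξ) q.1 q.2)
    (fun q hq => W.kPlane_smooth.hasFDerivWithinAt hq.1 q.2)
    (W.kPlane_smooth.continuousOn_slabD W.convI W.neI) (fun t ht => (K t ht).1)
    (fun t ht x v hv => (K.chart ht).fderiv_injective x v ?_) (q₀ := (t, η)) ht
  rw [W.kPlane_smooth.slabD_apply W.convI W.neI ht] at hv
  simpa using hv

variable {V : Type*} [NormedAddCommGroup V] [NormedSpace ℝ V]

/-- The function `f ∘ k⁻¹`. -/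
def pull (ξ : ℝ → Plane → Cl) (f : ℝ → Plane → V) (t : ℝ) (η : Plane) : V := f t (kInv ξ t η)

theorem pull_kPlane (K : IsCoordChange I ξ) (ht : t ∈ I) (f : ℝ → Plane → V) (x : Plane) :
    pull ξ f t (kPlane ξ t x) = f t x := by rw [pull, kInv_kPlane K ht]

theorem Wave.diffAt_pull (W : Wave I ξ 𝔞) (K : IsCoordChange I ξ) (ht : t ∈ I)
    {f : ℝ → Plane → V} (hf : CSlab 1 I f) (η : Plane) : DiffAt I (pull ξ f) t η := by
  have h1 := (hf.hasFDerivWithinAt ht (kInv ξ t η)).differentiableWithinAt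
  have h2 : DifferentiableWithinAt ℝ (fun q : ℝ × Plane => (q.1, kInv ξ q.1 q.2))
      (I ×ˢ Set.univ) (t, η) :=
    differentiableWithinAt_fst.prodMk (W.diffAt_kInv K ht η)
  exact DifferentiableWithinAt.comp (g := fun q : ℝ × Plane => f q.1 q.2)
    (f := fun q : ℝ × Plane => (q.1, kInv ξ q.1 q.2)) (t, η) h1 h2 fun q hq => ⟨hq.1, Set.mem_univ _⟩

theorem DiffAt.differentiableAt {f : ℝ → Plane → V} {η : Plane} (h : DiffAt I f t η) (ht : t ∈ I) :
    DifferentiableAt ℝ (f t) η :=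
  (hasFDerivAt_of_slab ht h.hasFDerivWithinAt).differentiableAt

theorem DiffAt.congr {f g : ℝ → Plane → V} {η : Plane} (h : DiffAt I f t η) (ht : t ∈ I)
    (he : ∀ s ∈ I, ∀ y, g s y = f s y) : DiffAt I g t η :=
  DifferentiableWithinAt.congr h (fun q hq => he q.1 hq.1 q.2) (he t ht η)

theorem matD_congr {f g : ℝ → Plane → V} {η : Plane} (ht : t ∈ I)
    (he : ∀ s ∈ I, ∀ y, g s y = f s y) : matD I ξ g t η = matD I ξ f t η := by
  have h1 : g t = f t := funext (he t ht)
  have h2 : dt I g t η = dt I f t η :=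
    derivWithin_congr (fun s hs => he s hs η) (he t ht η)
  rw [matD, matD, h1, h2]

/-- Along the flow the material derivative is the time derivative in Lagrangian coordinates. -/
theorem Wave.matD_pull (W : Wave I ξ 𝔞) (K : IsCoordChange I ξ) (ht : t ∈ I)
    {f : ℝ → Plane → V} (hf : CSlab 1 I f) (x : Plane) :
    matD I ξ (pull ξ f) t (kPlane ξ t x) = dt I f t x := by
  have h1 := (W.diffAt_pull K ht hf (kPlane ξ t x)).hasFDerivWithinAt
  set D := fderivWithin ℝ (fun q : ℝ × Plane => pull ξ f q.1 q.2) (I ×ˢ Set.univ)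
    (t, kPlane ξ t x)
  have h2 : HasDerivWithinAt (fun s => (s, kPlane ξ s x)) (1, dt I (kPlane ξ) t x) I t :=
    (hasDerivWithinAt_id t I).prodMk (W.kPlane_smooth.hasDerivWithinAt W.convI W.neI ht x)
  have h3 := HasFDerivWithinAt.comp_hasDerivWithinAt (t := I ×ˢ Set.univ)
    (l := fun q : ℝ × Plane => pull ξ f q.1 q.2) (f := fun s => (s, kPlane ξ s x))
    t h1 h2 fun s hs => ⟨hs, Set.mem_univ _⟩
  have h4 : HasDerivWithinAt (fun s => f s x) (D (1, dt I (kPlane ξ) t x)) I t :=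
    h3.congr (fun s hs => (pull_kPlane K hs f x).symm) (pull_kPlane K ht f x).symm
  have hb : bCoef I ξ t (kPlane ξ t x) = dt I (kPlane ξ) t x := by
    rw [bCoef, kInv_kPlane K ht]
  rw [dt, h4.derivWithin (uniqueDiffOn_convex W.convI W.neI t ht), matD,
    dt_of_slab W.convI W.neI ht h1, pd_of_slab ht h1, pd_of_slab ht h1, hb, ← map_smul, ← map_smul,
    ← map_add, ← map_add]
  congr 1
  have := plane_eq (dt I (kPlane ξ) t x)
  ext1
  · simp
  · simpa using this.symm

/-- The value of the Hilbert transform is the same in both systems of coordinates. -/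
theorem Wave.hilbert_zeta (W : Wave I ξ 𝔞) (K : IsCoordChange I ξ) (ht : t ∈ I)
    {F f : Plane → Cl} (hF : ∀ y, F (kPlane ξ t y) = f y) (hf : ContDiff ℝ 1 f) {x : Plane}
    (hfar : FarInt f x) :
    HilbertExists (zeta ξ t) F (kPlane ξ t x) ∧
      hilbert (zeta ξ t) F (kPlane ξ t x) = hilbert (ξ t) f x := by
  obtain ⟨J, c, M, H, htJ, -⟩ := W.exists_flow ht
  have hN : ContDiff ℝ 1 (normal (ξ t)) :=
    ((CSlab.normal W.convI W.neI W.smooth (m := 2) (by norm_num)).slice ht).of_le (by norm_num)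
  have hfar' : FarInt (fun y => normal (ξ t) y * f y) x :=
    hfar.mono (hN.mul hf).continuous (C := M * M) fun y => by
      rw [norm_mul]
      exact mul_le_mul_of_nonneg_right (norm_normal_le (H.slope _ htJ) y) (norm_nonneg _)
  have hZ := fun y => (W.diffAt_pull K ht (W.smooth.of_le (by norm_num)) (kPlane ξ t y)).differentiableAt ht
  have key := (H.hilbertExists htJ hf hfar).hasPV.to_chart (Z := zeta ξ t)
    (G := fun η => normal (zeta ξ t) η * F η) (K.chart ht)
    ((W.smooth.slice ht).of_le (by norm_num)) (hN.mul hf) H.c_pos (H.chord t htJ x) hfar'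
    (fun _ => rfl) (fun y => by
      rw [normal_chart (Z := zeta ξ t) (((K t ht).2.1.differentiable (by norm_num)) y) (hZ y)
        (fun y => (pull_kPlane K ht ξ y).symm), hF, smul_mul_assoc])
  exact ⟨key.hilbertExists, key.hilbert_eq⟩

end

/-! ### The formulas for `b` and `A - 1` -/

theorem FarInt.clm {f : Plane → Cl} {x : Plane} (h : FarInt f x) (hf : Continuous f)
    (T : Cl →L[ℝ] Cl) : FarInt (fun y => T (f y)) x :=
  h.mono (T.continuous.comp hf) fun y => T.le_opNorm (f y)

/-- The involution `σ ↦ e₃ σ e₃` as a continuous linear map. -/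
def barL : Cl →L[ℝ] Cl := (mulL e₃).comp (mulL.flip e₃)

theorem barL_apply (σ : Cl) : barL σ = bar σ := by simp [barL, bar, mul_assoc]

theorem bar_eq_of_vector {σ : Cl} (hσ : σ.re = 0) : bar σ = σ - (2 : ℝ) • vertL σ := by
  ext <;> simp [bar, hσ] <;> ring

theorem e₃_mul_bar (σ : Cl) : e₃ * bar σ = -(σ * e₃) := by
  ext <;> simp [bar]

section
variable {S f : Plane → Cl} {x : Plane}

theorem hilbert_bar (hf : ∀ y, (f y).re = 0) (h : HilbertExists S f x)
    (h' : HilbertExists S (fun y => vertL (f y)) x) :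
    hilbert S (fun y => bar (f y)) x =
      hilbert S f x - (2 : ℝ) • hilbert S (fun y => vertL (f y)) x :=
  ((h.hasPV.sub (h'.hasPV.smul 2)).congr fun y => by
    rw [bar_eq_of_vector (hf y), mul_sub, mul_smul_comm]).hilbert_eq

theorem hilbertBar_bar (h : HilbertExists S f x) :
    hilbertBar S (fun y => bar (f y)) x = -bar (hilbert S f x) := by
  have h1 : hilbert S (fun y => e₃ * bar (f y)) x = -(hilbert S f x * e₃) :=
    ((h.hasPV.mul_right e₃).neg.congr fun y => by
      rw [e₃_mul_bar, mul_neg, mul_assoc]).hilbert_eq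
  rw [hilbertBar, h1, bar, mul_neg, mul_assoc]

end

section
variable {I : Set ℝ} {ξ : ℝ → Plane → Cl} {𝔞 : ℝ → Plane → ℝ} {t : ℝ}

theorem Wave.vel_smooth (W : Wave I ξ 𝔞) : CSlab 2 I (dt I ξ) :=
  W.smooth.dt W.convI W.neI (by norm_num)

theorem Wave.acc_smooth (W : Wave I ξ 𝔞) : CSlab 1 I (dt I (dt I ξ)) :=
  W.vel_smooth.dt W.convI W.neI (by norm_num)

theorem Wave.vel_re (W : Wave I ξ 𝔞) (ht : t ∈ I) (x : Plane) : (dt I ξ t x).re = 0 :=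
  dt_re W.convI W.neI (W.smooth.of_le (by norm_num)) W.sol.isVector ht x

theorem Wave.acc_re (W : Wave I ξ 𝔞) (ht : t ∈ I) (x : Plane) : (dt I (dt I ξ) t x).re = 0 :=
  dt_re W.convI W.neI (W.vel_smooth.of_le (by norm_num)) (fun _ hs _ => W.vel_re hs _) ht x

theorem Wave.farInt_vel (W : Wave I ξ 𝔞) (ht : t ∈ I) (x : Plane) : FarInt (dt I ξ t) x := by
  obtain ⟨J, c, M, H, htJ, -, -, -, h, -⟩ := W.exists_flow ht
  exact h.farInt htJ x

theorem Wave.farInt_acc (W : Wave I ξ 𝔞) (ht : t ∈ I) (x : Plane) :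
    FarInt (dt I (dt I ξ) t) x := by
  obtain ⟨J, c, M, H, htJ, -, -, -, -, h⟩ := W.exists_flow ht
  exact h.farInt htJ x

theorem Wave.farInt_vert (W : Wave I ξ 𝔞) (ht : t ∈ I) (x : Plane) :
    FarInt (vert (height ξ t)) x := by
  obtain ⟨J, c, M, H, htJ, -, h, -, -, -⟩ := W.exists_flow ht
  exact h.farInt htJ x

/-- Densities `T u` with `T` linear: in the coordinates `k` and in Lagrangian coordinates the layer
potential has the same value. -/
theorem Wave.hilbert_zeta_vel (W : Wave I ξ 𝔞) (K : IsCoordChange I ξ) (ht : t ∈ I)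
    (T : Cl →L[ℝ] Cl) {F : Plane → Cl} (hF : ∀ y, F (kPlane ξ t y) = T (dt I ξ t y)) (x : Plane) :
    HilbertExists (zeta ξ t) F (kPlane ξ t x) ∧
      hilbert (zeta ξ t) F (kPlane ξ t x) = hilbert (ξ t) (fun y => T (dt I ξ t y)) x :=
  W.hilbert_zeta K ht hF (((W.vel_smooth.clm T).slice ht).of_le (by norm_num))
    ((W.farInt_vel ht x).clm (W.vel_smooth.slice ht).continuous T)

theorem Wave.hilbert_zeta_acc (W : Wave I ξ 𝔞) (K : IsCoordChange I ξ) (ht : t ∈ I)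
    (T : Cl →L[ℝ] Cl) {F : Plane → Cl} (hF : ∀ y, F (kPlane ξ t y) = T (dt I (dt I ξ) t y))
    (x : Plane) :
    HilbertExists (zeta ξ t) F (kPlane ξ t x) ∧
      hilbert (zeta ξ t) F (kPlane ξ t x) = hilbert (ξ t) (fun y => T (dt I (dt I ξ) t y)) x :=
  W.hilbert_zeta K ht hF ((W.acc_smooth.clm T).slice ht)
    ((W.farInt_acc ht x).clm (W.acc_smooth.slice ht).continuous T)

theorem Wave.hilbert_zeta_vert (W : Wave I ξ 𝔞) (K : IsCoordChange I ξ) (ht : t ∈ I) (x : Plane) :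
    HilbertExists (zeta ξ t) (vert (zh ξ t)) (kPlane ξ t x) ∧
      hilbert (zeta ξ t) (vert (zh ξ t)) (kPlane ξ t x) = heightPot ξ t x :=
  W.hilbert_zeta K ht (fun y => pull_kPlane K ht (fun s => vert (height ξ s)) y)
    (((W.smooth.clm vertL).slice ht).of_le (by norm_num)) (W.farInt_vert ht x)

theorem Wave.vertL_smooth (W : Wave I ξ 𝔞) : CSlab 3 I (fun s => vert (height ξ s)) :=
  W.smooth.clm vertL

theorem Wave.matD_vert_zh (W : Wave I ξ 𝔞) (K : IsCoordChange I ξ) (ht : t ∈ I) (x : Plane) :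
    matD I ξ (fun s => vert (zh ξ s)) t (kPlane ξ t x) = vertL (dt I ξ t x) :=
  (W.matD_pull K ht (W.vertL_smooth.of_le (by norm_num)) x).trans
    (dt_vert_height W.convI W.neI (W.smooth.of_le (by norm_num)) ht x)

theorem Wave.matD_zh (W : Wave I ξ 𝔞) (K : IsCoordChange I ξ) (ht : t ∈ I) (x : Plane) :
    matD I ξ (zh ξ) t (kPlane ξ t x) = (dt I ξ t x).imK :=
  (W.matD_pull K ht ((W.smooth.of_le (by norm_num)).clm imKL) x).trans
    (dt_clm W.convI W.neI (W.smooth.of_le (by norm_num)) ht x imKL)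

theorem Wave.matD_vel (W : Wave I ξ 𝔞) (K : IsCoordChange I ξ) (ht : t ∈ I) (x : Plane) :
    matD I ξ (vel I ξ) t (kPlane ξ t x) = dt I (dt I ξ) t x :=
  W.matD_pull K ht (W.vel_smooth.of_le (by norm_num)) x

theorem Wave.pd_differentiable (W : Wave I ξ 𝔞) (ht : t ∈ I) : Differentiable ℝ (ξ t) :=
  (W.smooth.slice ht).differentiable (by norm_num)

theorem aCoef_kPlane (K : IsCoordChange I ξ) (ht : t ∈ I) (𝔞 : ℝ → Plane → ℝ) (x : Plane) :
    aCoef ξ 𝔞 t (kPlane ξ t x) = 𝔞 t x * jacobian (kPlane ξ t) x := by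
  rw [aCoef, kInv_kPlane K ht]

theorem IsCoordChange.differentiable (K : IsCoordChange I ξ) (ht : t ∈ I) :
    Differentiable ℝ (kPlane ξ t) := (K t ht).2.1.differentiable (by norm_num)

theorem Wave.differentiable_pull (W : Wave I ξ 𝔞) (K : IsCoordChange I ξ) (ht : t ∈ I)
    {V : Type*} [NormedAddCommGroup V] [NormedSpace ℝ V]
    {f : ℝ → Plane → V} (hf : CSlab 1 I f) : Differentiable ℝ (pull ξ f t) :=
  fun η => (W.diffAt_pull K ht hf η).differentiableAt ht

theorem Wave.smooth_one (W : Wave I ξ 𝔞) : CSlab 1 I ξ := W.smooth.of_le (by norm_num)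

/-- `(A 𝒩 × ∇) 𝔷 e₃` is minus the horizontal part of the acceleration. -/
theorem Wave.crossNabla_vert (W : Wave I ξ 𝔞) (K : IsCoordChange I ξ) (ht : t ∈ I) (x : Plane) :
    crossNabla (zeta ξ t) (aCoef ξ 𝔞 t) (vert (zh ξ t)) (kPlane ξ t x) =
      -horL (dt I (dt I ξ) t x) := by
  rw [crossNabla_chart (Z := zeta ξ t) (F := vert (zh ξ t)) (S := ξ t) (f := vert (height ξ t)) (K.differentiable ht x)
    (W.differentiable_pull K ht W.smooth_one _)
    (W.differentiable_pull K ht (W.vertL_smooth.of_le (by norm_num)) _)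
    (fun y => (pull_kPlane K ht ξ y).symm)
    (fun y => (pull_kPlane K ht (fun s => vert (height ξ s)) y).symm) _ _
    (aCoef_kPlane K ht 𝔞 x), W.pd_vert ht, W.pd_vert ht]
  have hm := W.sol.momentum t ht x
  have h0 := W.pd_re ht 0 x
  have h1 := W.pd_re ht 1 x
  have e : dt I (dt I ξ) t x = 𝔞 t x • normal (ξ t) x - e₃ := by rw [← hm]; abel
  rw [e]
  ext <;> simp [normal, cross_re, cross_imI, cross_imJ, cross_imK, h0, h1] <;>
    first | ring1 | (right; ring1)

theorem Wave.integralsExist (W : Wave I ξ 𝔞) (K : IsCoordChange I ξ) (ht : t ∈ I) (η : Plane) :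
    IntegralsExist I ξ 𝔞 t η := by
  obtain ⟨x, rfl⟩ := (K t ht).1.2 η
  have hv := W.farInt_vel ht (kPlane ξ t x)
  obtain ⟨J, c, M, H, htJ, -⟩ := W.exists_flow ht
  have hp : ∀ y, pull ξ (dt I ξ) t (kPlane ξ t y) = dt I ξ t y := pull_kPlane K ht _
  have hq : ∀ y, pull ξ (dt I (dt I ξ)) t (kPlane ξ t y) = dt I (dt I ξ) t y := pull_kPlane K ht _
  refine ⟨H.hilbertExists htJ ((W.vel_smooth.slice ht).of_le (by norm_num)) hv,
    W.hilbertExists_vert ht _, hilbertExists_coe (W.hilbertExists_vert ht _),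
    (W.hilbert_zeta_vert K ht x).1, hilbertExists_coe (W.hilbert_zeta_vert K ht x).1,
    (W.hilbert_zeta_vel K ht vertL (W.matD_vert_zh K ht) x).1,
    hilbertExists_coe (f := matD I ξ (zh ξ) t)
      (W.hilbert_zeta_vel K ht vertL (fun y => by rw [vert_eq, W.matD_zh K ht]; rfl) x).1,
    (W.hilbert_zeta_vel K ht (ContinuousLinearMap.id ℝ Cl) hp x).1,
    (W.hilbert_zeta_acc K ht (ContinuousLinearMap.id ℝ Cl) (W.matD_vel K ht) x).1,
    hilbertExists_coe (f := fun y => (vel I ξ t y).imK)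
      (W.hilbert_zeta_vel K ht vertL
        (fun y => congrArg (fun σ : Cl => σ.imK • e₃) (hp y)) x).1,
    (W.hilbert_zeta_vel K ht barL
      (fun y => (congrArg bar (hp y)).trans (barL_apply _).symm) x).1,
    (W.hilbert_zeta_vel K ht ((mulL e₃).comp barL)
      (fun y => (congrArg (fun σ => e₃ * bar σ) (hp y)).trans (by simp [barL_apply])) x).1,
    (W.hilbert_zeta_acc K ht barL
      (fun y => (congrArg bar (hq y)).trans (barL_apply _).symm) x).1,
    (W.hilbert_zeta_acc K ht ((mulL e₃).comp barL)
      (fun y => (congrArg (fun σ => e₃ * bar σ) (hq y)).trans (by simp [barL_apply])) x).1,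
    (W.hilbert_zeta_acc K ht (-horL) (W.crossNabla_vert K ht) x).1⟩

/-- The difference `Λ = (I + H) z e₃ - K z e₃` of the surface and the horizontal plane. -/
def lagLam (ξ : ℝ → Plane → Cl) (t : ℝ) (x : Plane) : Cl :=
  vert (height ξ t) x + horL (heightPot ξ t x)

theorem Wave.lagLam_smooth (W : Wave I ξ 𝔞) : CSlab 1 I (lagLam ξ) :=
  ContDiffOn.add (W.vertL_smooth.of_le (by norm_num)) (W.heightPot_smooth.clm horL)

theorem Wave.kMap_eq_sub (W : Wave I ξ 𝔞) (ht : t ∈ I) (x : Plane) :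
    kMap ξ t x = ξ t x - lagLam ξ t x := by
  rw [W.kMap_eq ht, lagLam, vert_eq, height, horL_apply (ξ t x)]
  abel

theorem Wave.hilbert_eq_pull (W : Wave I ξ 𝔞) (K : IsCoordChange I ξ) (ht : t ∈ I) (η : Plane) :
    hilbert (zeta ξ t) (vert (zh ξ t)) η = pull ξ (heightPot ξ) t η := by
  obtain ⟨x, rfl⟩ := (K t ht).1.2 η
  rw [pull_kPlane K ht, (W.hilbert_zeta_vert K ht x).2]

theorem Wave.doubleLayer_eq_pull (W : Wave I ξ 𝔞) (K : IsCoordChange I ξ) (ht : t ∈ I) (η : Plane) :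
    doubleLayer (zeta ξ t) (zh ξ t) η = pull ξ (fun s y => imKL (heightPot ξ s y)) t η := by
  obtain ⟨x, rfl⟩ := (K t ht).1.2 η
  rw [pull_kPlane K ht, doubleLayer_eq (W.hilbert_zeta_vert K ht x).1,
    (W.hilbert_zeta_vert K ht x).2, imKL_apply]

theorem Wave.lam_eq_pull (W : Wave I ξ 𝔞) (K : IsCoordChange I ξ) (ht : t ∈ I) (η : Plane) : lam ξ t η = pull ξ (lagLam ξ) t η := by
  rw [lam, W.hilbert_eq_pull K ht, W.doubleLayer_eq_pull K ht, pull, pull, pull, lagLam,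
    horL_apply, imKL_apply, add_sub_assoc]
  rfl

theorem Wave.hilbert_vel_eq_pull (W : Wave I ξ 𝔞) (K : IsCoordChange I ξ) (ht : t ∈ I) (η : Plane) :
    hilbert (zeta ξ t) (vel I ξ t) η = pull ξ (dt I ξ) t η := by
  obtain ⟨x, rfl⟩ := (K t ht).1.2 η
  rw [pull_kPlane K ht,
    (W.hilbert_zeta_vel K ht (ContinuousLinearMap.id ℝ Cl) (F := vel I ξ t)
      (pull_kPlane K ht (dt I ξ)) x).2]
  exact W.sol.analytic t ht x

theorem Wave.derivativesExist (W : Wave I ξ 𝔞) (K : IsCoordChange I ξ) (ht : t ∈ I) (η : Plane) : DerivativesExist I ξ t η := by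
  refine ⟨(W.kPlane_smooth.hasFDerivWithinAt ht η).differentiableWithinAt,
    W.diffAt_pull K ht W.smooth_one η, W.diffAt_pull K ht (W.vel_smooth.of_le (by norm_num)) η,
    (W.diffAt_pull K ht W.lagLam_smooth η).congr ht fun s hs y => W.lam_eq_pull K hs y,
    (W.diffAt_pull K ht W.heightPot_smooth η).congr ht fun s hs y => W.hilbert_eq_pull K hs y,
    (W.diffAt_pull K ht (W.heightPot_smooth.clm imKL) η).congr ht
      fun s hs y => W.doubleLayer_eq_pull K hs y,
    (W.diffAt_pull K ht (W.vel_smooth.of_le (by norm_num)) η).congr ht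
      fun s hs y => W.hilbert_vel_eq_pull K hs y⟩

end

/-! ### Verification of the formulas -/

theorem crossCross_chart {k : Plane → Plane} {Z S f F : Plane → Cl} {x : Plane}
    (hk : DifferentiableAt ℝ k x) (hZ : DifferentiableAt ℝ Z (k x))
    (hF : DifferentiableAt ℝ F (k x)) (hS : ∀ y, S y = Z (k y)) (hf : ∀ y, f y = F (k y)) :
    cross (pd 1 S x) (pd 0 f x) - cross (pd 0 S x) (pd 1 f x) =
      jacobian k x • (cross (pd 1 Z (k x)) (pd 0 F (k x)) - cross (pd 0 Z (k x)) (pd 1 F (k x))) := by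
  obtain rfl : S = fun y => Z (k y) := funext hS
  obtain rfl : f = fun y => F (k y) := funext hf
  unfold jacobian
  simp only [pd_comp_chart hk hZ, pd_comp_chart hk hF]
  ext <;> simp [cross_re, cross_imI, cross_imJ, cross_imK] <;> ring

section
variable {I : Set ℝ} {ξ : ℝ → Plane → Cl} {𝔞 : ℝ → Plane → ℝ} {t : ℝ}

/-- `b` is the material velocity of the horizontal coordinates `k`. -/
theorem Wave.bCoef_kPlane (W : Wave I ξ 𝔞) (K : IsCoordChange I ξ) (ht : t ∈ I) (x : Plane) :
    bCoef I ξ t (kPlane ξ t x) = toPlane (horL (dt I ξ t x) - horL (dt I (heightPot ξ) t x)) := by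
  rw [bCoef, kInv_kPlane K ht]
  have h1 : HasDerivWithinAt (fun s => kPlane ξ s x)
      (toPlaneL (horL (dt I ξ t x) - horL (dt I (heightPot ξ) t x))) I t := by
    have h2 := ((horL.hasFDerivAt.comp_hasDerivWithinAt t
      (W.smooth_one.hasDerivWithinAt W.convI W.neI ht x)).sub
      (horL.hasFDerivAt.comp_hasDerivWithinAt t
      (W.heightPot_smooth.hasDerivWithinAt W.convI W.neI ht x)))
    refine (toPlaneL.hasFDerivAt.comp_hasDerivWithinAt t h2).congr (fun s hs => ?_) ?_
    · rw [kPlane_eq, W.kMap_eq hs]; rfl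
    · rw [kPlane_eq, W.kMap_eq ht]; rfl
  rw [← toPlaneL_apply]
  exact h1.derivWithin (uniqueDiffOn_convex W.convI W.neI t ht)

theorem Wave.dt_heightPot_re (W : Wave I ξ 𝔞) (ht : t ∈ I) (x : Plane) :
    (dt I (heightPot ξ) t x).re = 0 :=
  dt_re W.convI W.neI W.heightPot_smooth (fun _ hs _ => W.heightPot_re hs _) ht x

/-- The right side of the formula for `b` in Lagrangian coordinates. -/
theorem Wave.bFormula_eq (W : Wave I ξ 𝔞) (K : IsCoordChange I ξ) (ht : t ∈ I) (x : Plane) :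
    bFormula I ξ t (kPlane ξ t x) = horL (dt I ξ t x) - horL (dt I (heightPot ξ) t x) := by
  have hp : ∀ y, vel I ξ t (kPlane ξ t y) = dt I ξ t y := pull_kPlane K ht (dt I ξ)
  have hV := W.hilbert_zeta_vel K ht (ContinuousLinearMap.id ℝ Cl) (F := vel I ξ t) hp x
  have hV3 := W.hilbert_zeta_vel K ht vertL (F := fun y => vertL (vel I ξ t y))
    (fun y => by rw [hp]) x
  have hvel : hilbert (zeta ξ t) (vel I ξ t) (kPlane ξ t x) = dt I ξ t x :=
    hV.2.trans (W.sol.analytic t ht x)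
  have e0 : ∀ η, matD I ξ (fun s => vert (zh ξ s)) t η = vertL (vel I ξ t η) := fun η => by
    obtain ⟨y, rfl⟩ := (K t ht).1.2 η
    rw [W.matD_vert_zh K ht, hp]
  have e1 : ∀ η, matD I ξ (zh ξ) t η = (vel I ξ t η).imK := fun η => by
    obtain ⟨y, rfl⟩ := (K t ht).1.2 η
    rw [W.matD_zh K ht, hp]
  have hre : ∀ η, (vel I ξ t η).re = 0 := fun η => W.vel_re ht _
  have hH : commH I ξ (fun s => vert (zh ξ s)) t (kPlane ξ t x) = dt I (heightPot ξ) t x -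
      hilbert (zeta ξ t) (fun y => vertL (vel I ξ t y)) (kPlane ξ t x) := by
    rw [commH, funext e0, matD_congr (f := pull ξ (heightPot ξ)) ht
      (fun s hs y => W.hilbert_eq_pull K hs y), W.matD_pull K ht W.heightPot_smooth]
  have hK : commK I ξ (zh ξ) t (kPlane ξ t x) = (dt I (heightPot ξ) t x).imK -
      doubleLayer (zeta ξ t) (fun y => (vel I ξ t y).imK) (kPlane ξ t x) := by
    rw [commK, funext e1, matD_congr (f := pull ξ (fun s y => imKL (heightPot ξ s y))) ht
      (fun s hs y => W.doubleLayer_eq_pull K hs y), W.matD_pull K ht (W.heightPot_smooth.clm imKL),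
      dt_clm W.convI W.neI W.heightPot_smooth ht]
    rfl
  rw [bFormula, hH, hK, hilbert_bar hre hV.1 hV3.1, hilbertBar_bar hV.1, hvel,
    bar_eq_of_vector (W.vel_re ht x), horL_apply, horL_apply, vertL_apply, sub_smul]
  module

@[simp] theorem e₁_re : e₁.re = 0 := rfl
@[simp] theorem e₁_imI : e₁.imI = 1 := rfl
@[simp] theorem e₁_imJ : e₁.imJ = 0 := rfl
@[simp] theorem e₁_imK : e₁.imK = 0 := rfl
@[simp] theorem e₂_re : e₂.re = 0 := rfl
@[simp] theorem e₂_imI : e₂.imI = 0 := rfl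
@[simp] theorem e₂_imJ : e₂.imJ = 1 := rfl
@[simp] theorem e₂_imK : e₂.imK = 0 := rfl

theorem Wave.b_formula (W : Wave I ξ 𝔞) (K : IsCoordChange I ξ) (ht : t ∈ I) (η : Plane) :
    bCoef I ξ t η 0 • e₁ + bCoef I ξ t η 1 • e₂ = bFormula I ξ t η := by
  obtain ⟨x, rfl⟩ := (K t ht).1.2 η
  rw [W.bFormula_eq K ht, W.bCoef_kPlane K ht]
  ext <;> simp [toPlane, W.vel_re ht, W.dt_heightPot_re ht]

theorem Wave.pd_kMap (W : Wave I ξ 𝔞) (ht : t ∈ I) (x : Plane) (i : Fin 2) :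
    pd i (kMap ξ t) x = pd i (ξ t) x - pd i (lagLam ξ t) x := by
  rw [show kMap ξ t = fun y => ξ t y - lagLam ξ t y from funext (W.kMap_eq_sub ht)]
  exact pd_sub ((W.smooth_one.slice ht).differentiable (by norm_num) x)
    ((W.lagLam_smooth.slice ht).differentiable (by norm_num) x) i

theorem Wave.pd_lagLam (W : Wave I ξ 𝔞) (ht : t ∈ I) (x : Plane) (i : Fin 2) :
    pd i (lagLam ξ t) x = vertL (pd i (ξ t) x) + horL (pd i (heightPot ξ t) x) := by
  have hG := (W.heightPot_smooth.slice ht).differentiable (by norm_num) x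
  rw [← W.pd_vert ht, ← pd_comp_clm horL hG]
  exact pd_add ((W.vertL_smooth.slice ht).differentiable (by norm_num) x)
    (horL.differentiableAt.comp x hG) i

theorem Wave.pd_heightPot_re (W : Wave I ξ 𝔞) (ht : t ∈ I) (x : Plane) (i : Fin 2) :
    (pd i (heightPot ξ t) x).re = 0 :=
  pd_re_eq_zero ((W.heightPot_smooth.slice ht).differentiable (by norm_num))
    (W.heightPot_re ht) i x

theorem Wave.jacobian_eq (W : Wave I ξ 𝔞) (ht : t ∈ I) (x : Plane) :
    jacobian (kPlane ξ t) x =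
      (cross (pd 0 (ξ t) x - pd 0 (lagLam ξ t) x) (pd 1 (ξ t) x - pd 1 (lagLam ξ t) x)).imK := by
  have h : ∀ i, pd i (kPlane ξ t) x = toPlane (pd i (ξ t) x - pd i (lagLam ξ t) x) := fun i => by
    rw [← W.pd_kMap ht, ← toPlaneL_apply,
      show kPlane ξ t = fun y => toPlaneL (kMap ξ t y) from funext (kPlane_eq ξ t)]
    exact pd_comp_clm toPlaneL ((W.kMap_smooth.slice ht).differentiable (by norm_num) x) i
  rw [jacobian, h, h]
  simp [toPlane, cross_imK]

/-- The right side of the formula for `(A - 1) e₃` in Lagrangian coordinates. -/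
theorem Wave.aFormula_eq (W : Wave I ξ 𝔞) (K : IsCoordChange I ξ) (ht : t ∈ I) (x : Plane) :
    aFormula I ξ 𝔞 t (kPlane ξ t x) = vertL (dt I (dt I ξ) t x) +
      𝔞 t x • (pd 1 (ξ t) x * pd 0 (heightPot ξ t) x - pd 0 (ξ t) x * pd 1 (heightPot ξ t) x) -
      𝔞 t x • (cross (pd 1 (ξ t) x) (vertL (pd 0 (heightPot ξ t) x)) -
        cross (pd 0 (ξ t) x) (vertL (pd 1 (heightPot ξ t) x))) +
      𝔞 t x • cross (pd 0 (lagLam ξ t) x) (pd 1 (lagLam ξ t) x) := by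
  have hp : ∀ y, acc I ξ t (kPlane ξ t y) = dt I (dt I ξ) t y := pull_kPlane K ht (dt I (dt I ξ))
  have hre : ∀ η, (acc I ξ t η).re = 0 := fun η => W.acc_re ht _
  have hV := W.hilbert_zeta_acc K ht (ContinuousLinearMap.id ℝ Cl) (F := acc I ξ t) hp x
  have hV3 := W.hilbert_zeta_acc K ht vertL (F := fun y => vertL (acc I ξ t y))
    (fun y => by rw [hp]) x
  have e0 : ∀ η, matD I ξ (vel I ξ) t η = acc I ξ t η := fun η => by
    obtain ⟨y, rfl⟩ := (K t ht).1.2 η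
    rw [W.matD_vel K ht, hp]
  have hU : commH I ξ (vel I ξ) t (kPlane ξ t x) = dt I (dt I ξ) t x -
      hilbert (zeta ξ t) (acc I ξ t) (kPlane ξ t x) := by
    rw [commH, matD_congr (f := pull ξ (dt I ξ)) ht
      (fun s hs y => W.hilbert_vel_eq_pull K hs y),
      W.matD_pull K ht (W.vel_smooth.of_le (by norm_num)), funext e0]
  have hdk := K.differentiable ht x
  have hdZ : DifferentiableAt ℝ (zeta ξ t) (kPlane ξ t x) := W.differentiable_pull K ht W.smooth_one _
  have hS : ∀ y, ξ t y = zeta ξ t (kPlane ξ t y) := fun y => (pull_kPlane K ht ξ y).symm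
  have e1 : ∀ η, crossNabla (zeta ξ t) (aCoef ξ 𝔞 t) (vert (zh ξ t)) η = -horL (acc I ξ t η) :=
    fun η => by
      obtain ⟨y, rfl⟩ := (K t ht).1.2 η
      rw [W.crossNabla_vert K ht, hp]
  have e2 : hilbert (zeta ξ t) (fun η => -horL (acc I ξ t η)) (kPlane ξ t x) =
      -(hilbert (zeta ξ t) (acc I ξ t) (kPlane ξ t x) -
        hilbert (zeta ξ t) (fun η => vertL (acc I ξ t η)) (kPlane ξ t x)) :=
    ((hV.1.hasPV.sub hV3.1.hasPV).neg.congr fun y => by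
      rw [horL_apply, vertL_apply]; noncomm_ring).hilbert_eq
  have hN : commN ξ 𝔞 (fun s => vert (zh ξ s)) t (kPlane ξ t x) =
      𝔞 t x • (pd 1 (ξ t) x * pd 0 (heightPot ξ t) x - pd 0 (ξ t) x * pd 1 (heightPot ξ t) x) +
      (hilbert (zeta ξ t) (acc I ξ t) (kPlane ξ t x) -
        hilbert (zeta ξ t) (fun η => vertL (acc I ξ t η)) (kPlane ξ t x)) := by
    rw [commN, funext e1, e2, funext (W.hilbert_eq_pull K ht),
      crossNabla_chart (S := ξ t) (f := heightPot ξ t) hdk hdZ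
        (W.differentiable_pull K ht W.heightPot_smooth _) hS
        (fun y => (pull_kPlane K ht (heightPot ξ) y).symm) _ _ (aCoef_kPlane K ht 𝔞 x), sub_neg_eq_add]
  have hC : aCoef ξ 𝔞 t (kPlane ξ t x) •
      (cross (pd 1 (zeta ξ t) (kPlane ξ t x))
        (pd 0 (vert (doubleLayer (zeta ξ t) (zh ξ t))) (kPlane ξ t x)) -
      cross (pd 0 (zeta ξ t) (kPlane ξ t x))
        (pd 1 (vert (doubleLayer (zeta ξ t) (zh ξ t))) (kPlane ξ t x))) =
      𝔞 t x • (cross (pd 1 (ξ t) x) (vertL (pd 0 (heightPot ξ t) x)) -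
        cross (pd 0 (ξ t) x) (vertL (pd 1 (heightPot ξ t) x))) := by
    have hG := (W.heightPot_smooth.slice ht).differentiable (by norm_num) x
    have e3 : vert (doubleLayer (zeta ξ t) (zh ξ t)) =
        pull ξ (fun s y => vertL (heightPot ξ s y)) t :=
      funext fun η => by rw [vert_eq, W.doubleLayer_eq_pull K ht]; rfl
    rw [e3, aCoef_kPlane K ht, mul_smul, ← pd_comp_clm vertL hG, ← pd_comp_clm vertL hG]
    congr 1
    exact (crossCross_chart hdk hdZ
      (W.differentiable_pull K ht (W.heightPot_smooth.clm vertL) _) hS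
      (fun y => (pull_kPlane K ht (fun s y => vertL (heightPot ξ s y)) y).symm)).symm
  have hL : aCoef ξ 𝔞 t (kPlane ξ t x) •
      cross (pd 0 (lam ξ t) (kPlane ξ t x)) (pd 1 (lam ξ t) (kPlane ξ t x)) =
      𝔞 t x • cross (pd 0 (lagLam ξ t) x) (pd 1 (lagLam ξ t) x) := by
    rw [funext (W.lam_eq_pull K ht), aCoef_kPlane K ht, mul_smul]
    congr 1
    exact (normal_chart hdk (W.differentiable_pull K ht W.lagLam_smooth _)
      (fun y => (pull_kPlane K ht (lagLam ξ) y).symm)).symm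
  have hb : bar (dt I (dt I ξ) t x - hilbert (zeta ξ t) (acc I ξ t) (kPlane ξ t x)) =
      dt I (dt I ξ) t x - (2 : ℝ) • vertL (dt I (dt I ξ) t x) -
        bar (hilbert (zeta ξ t) (acc I ξ t) (kPlane ξ t x)) := by
    rw [← bar_eq_of_vector (W.acc_re ht x), ← barL_apply, ← barL_apply, ← barL_apply, map_sub]
  rw [aFormula, hilbert_bar hre hV.1 hV3.1, hilbertBar_bar hV.1, hU, hN, hL, ← hC, hb]
  module

/-- The formula for `A`. The scalar part of the right side vanishes by
`Wave.re_crossNabla_heightPot`. -/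
theorem Wave.a_formula (W : Wave I ξ 𝔞) (K : IsCoordChange I ξ) (ht : t ∈ I) (η : Plane) :
    (aCoef ξ 𝔞 t η - 1) • e₃ = aFormula I ξ 𝔞 t η := by
  obtain ⟨x, rfl⟩ := (K t ht).1.2 η
  rw [W.aFormula_eq K ht, aCoef_kPlane K ht, W.jacobian_eq ht, W.pd_lagLam ht, W.pd_lagLam ht]
  have hm := W.sol.momentum t ht x
  have e : dt I (dt I ξ) t x = 𝔞 t x • normal (ξ t) x - e₃ := by rw [← hm]; abel
  have hs := W.re_crossNabla_heightPot ht x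
  have a0 := W.pd_re ht 0 x
  have a1 := W.pd_re ht 1 x
  have g0 := W.pd_heightPot_re ht x 0
  have g1 := W.pd_heightPot_re ht x 1
  rw [e, normal]
  generalize pd 0 (ξ t) x = A at *
  generalize pd 1 (ξ t) x = B at *
  generalize pd 0 (heightPot ξ t) x = C at *
  generalize pd 1 (heightPot ξ t) x = D at *
  ext
  · simp only [Quaternion.re_sub, Quaternion.re_mul, a0, a1, g0, g1] at hs
    simp [cross_re, a0, a1, g0, g1]
    right; linarith
  all_goals simp [cross_re, cross_imI, cross_imJ, cross_imK, a0, a1, g0, g1]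
  all_goals ring

end

/-! ### Bounds for principal values of quadratic type -/

section
variable {W X : Type*} [NormedAddCommGroup W] [NormedSpace ℝ W] [CompleteSpace W]
  [NormedAddCommGroup X] [NormedSpace ℝ X] [CompleteSpace X]

/-- The principal value of `∫ Φ` with singularity at `x` exists and is equal to `L`. -/
def PVal (x : Plane) (Φ : Plane → W) (L : W) : Prop :=
  (∀ r : ℝ, 0 < r → IntegrableOn Φ (Metric.ball x r)ᶜ) ∧
    Tendsto (fun r => ∫ y in (Metric.ball x r)ᶜ, Φ y) (𝓝[>] 0) (𝓝 L)

theorem HasPV.pval {S g : Plane → Cl} {x : Plane} {L : Cl} (h : HasPV S g x L) :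
    PVal x (fun y => kernelK (S y - S x) * g y) L := h

theorem PVal.clm {x : Plane} {Φ : Plane → W} {L : W} (h : PVal x Φ L) (T : W →L[ℝ] X) :
    PVal x (fun y => T (Φ y)) (T L) := by
  refine ⟨fun r hr => T.integrable_comp (h.1 r hr), ?_⟩
  refine ((T.continuous.tendsto L).comp h.2).congr' ?_
  filter_upwards [self_mem_nhdsWithin] with r hr
  exact (T.integral_comp_comm (h.1 r hr)).symm

theorem PVal.add {x : Plane} {Φ Ψ : Plane → W} {L M : W} (h : PVal x Φ L) (h' : PVal x Ψ M) :
    PVal x (fun y => Φ y + Ψ y) (L + M) := by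
  refine ⟨fun r hr => (h.1 r hr).add (h'.1 r hr), ?_⟩
  refine (h.2.add h'.2).congr' ?_
  filter_upwards [self_mem_nhdsWithin] with r hr
  exact (integral_add (h.1 r hr) (h'.1 r hr)).symm

theorem PVal.norm_le {x : Plane} {Φ : Plane → W} {L : W} {B : ℝ} {F : Plane → ℝ} (h : PVal x Φ L)
    (hB : 0 ≤ B) (hnear : ∀ y, y ≠ x → ‖y - x‖ < 1 → ‖Φ y‖ ≤ B * ‖y - x‖⁻¹)
    (hF : IntegrableOn F (Metric.ball x 1)ᶜ) (hfar : ∀ y, 1 ≤ ‖y - x‖ → ‖Φ y‖ ≤ F y) :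
    ‖L‖ ≤ B * (2 * discArea) + ∫ y in (Metric.ball x 1)ᶜ, F y := by
  classical
  have hms := (measurableSet_ball (x := x) (ε := (1 : ℝ)))
  have hmp : MeasurePreserving (fun y : Plane => y - x) volume volume :=
    measurePreserving_sub_right volume x
  have hemb : MeasurableEmbedding (fun y : Plane => y - x) := measurableEmbedding_subRight x
  have hpre : (fun y : Plane => y - x) ⁻¹' Metric.ball 0 1 = Metric.ball x 1 := by
    ext y; simp [dist_eq_norm]
  have hi : IntegrableOn (fun y => B * ‖y - x‖⁻¹) (Metric.ball x 1) := by
    refine Integrable.const_mul ?_ B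
    have := (hmp.integrableOn_comp_preimage hemb).2 (integrableOn_norm_inv_ball 1)
    rwa [hpre] at this
  have hv : ∫ y in Metric.ball x 1, B * ‖y - x‖⁻¹ = B * (2 * discArea) := by
    rw [integral_const_mul, ← hpre, hmp.setIntegral_preimage_emb hemb (fun h : Plane => ‖h‖⁻¹),
      integral_norm_inv_ball zero_le_one, mul_one]
  set H : Plane → ℝ := fun y => (Metric.ball x 1).indicator (fun y => B * ‖y - x‖⁻¹) y +
    (Metric.ball x 1)ᶜ.indicator F y with hH
  have hHi : Integrable H :=
    (hi.integrable_indicator hms).add (hF.integrable_indicator hms.compl)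
  have hHv : ∫ y, H y = B * (2 * discArea) + ∫ y in (Metric.ball x 1)ᶜ, F y := by
    rw [← hv, ← integral_indicator hms, ← integral_indicator hms.compl]
    exact integral_add (hi.integrable_indicator hms) (hF.integrable_indicator hms.compl)
  have hH0 : ∀ y, 0 ≤ H y := fun y => by
    by_cases hy : y ∈ Metric.ball x 1
    · simp only [hH, Set.indicator_of_mem hy, Set.indicator_of_notMem (Set.notMem_compl_iff.2 hy)]
      positivity
    · simp only [hH, Set.indicator_of_notMem hy, Set.indicator_of_mem (Set.mem_compl hy), zero_add]
      refine (norm_nonneg (Φ y)).trans (hfar y ?_)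
      simpa [dist_eq_norm] using hy
  rw [← hHv]
  refine le_of_tendsto h.2.norm ?_
  filter_upwards [self_mem_nhdsWithin] with r hr
  refine (norm_integral_le_of_norm_le hHi.integrableOn ?_).trans
    (setIntegral_le_integral hHi (Eventually.of_forall hH0))
  refine (ae_restrict_iff' measurableSet_ball.compl).2 (Eventually.of_forall fun y hyr => ?_)
  have hyx : y ≠ x := by
    rintro rfl; simp at hyr; exact absurd hr (not_lt.2 hyr)
  by_cases hy : y ∈ Metric.ball x 1
  · simp only [hH, Set.indicator_of_mem hy, Set.indicator_of_notMem (Set.notMem_compl_iff.2 hy),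
      add_zero]
    exact hnear y hyx (by simpa [dist_eq_norm] using hy)
  · simp only [hH, Set.indicator_of_notMem hy, Set.indicator_of_mem (Set.mem_compl hy), zero_add]
    exact hfar y (by simpa [dist_eq_norm] using hy)

end

/-- A principal value is quadratically small, if its integrand is of size `ε² / |h|` near the
singularity and is dominated by `ε |h|⁻²` times functions of size `ε` in `L²` away from it. -/
theorem exists_pval_bound : ∃ D : ℝ, 0 ≤ D ∧ ∀ {W : Type} [NormedAddCommGroup W] [NormedSpace ℝ W]
    [CompleteSpace W] {x : Plane} {Φ : Plane → W} {L : W} {B ε : ℝ} {n : ℕ}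
    {f : Fin n → Plane → Cl}, PVal x Φ L → 0 ≤ B → 0 ≤ ε →
    (∀ i, AEStronglyMeasurable (f i) volume) →
    (∀ i, eLpNorm (f i) 2 volume ≤ ENNReal.ofReal ε) →
    (∀ y, y ≠ x → ‖y - x‖ < 1 → ‖Φ y‖ ≤ B * ε ^ 2 * ‖y - x‖⁻¹) →
    (∀ y, 1 ≤ ‖y - x‖ → ‖Φ y‖ ≤ B * ε * ((‖y - x‖ ^ 2)⁻¹ * ∑ i, ‖f i y‖)) →
    ‖L‖ ≤ (1 + n) * D * B * ε ^ 2 := by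
  obtain ⟨C, a, hC, ha, h⟩ := integrableOn_far (p := 2) (by norm_num) (by norm_num)
  obtain ⟨D, hD⟩ : ∃ D, D = C * ((1 + (1 : ℝ)⁻¹) ^ 2 * (1 + 1) ^ (-a)) := ⟨_, rfl⟩
  have hD0 : 0 ≤ D := by rw [hD]; positivity
  have hA := discArea_nonneg
  refine ⟨D + 2 * discArea, by positivity, ?_⟩
  intro W _ _ _ x Φ L B ε n f hΦ hB hε hm hf hnear hfar
  have hi : ∀ i, IntegrableOn (fun y => (‖y - x‖ ^ 2)⁻¹ * ‖f i y‖) (Metric.ball x 1)ᶜ ∧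
      ∫ y in (Metric.ball x 1)ᶜ, (‖y - x‖ ^ 2)⁻¹ * ‖f i y‖ ≤ D * ε := fun i => by
    obtain ⟨h1, h2⟩ := h ε hε (f i) (hm i) (hf i) x 1 one_pos
    exact ⟨h1, h2.trans_eq (by rw [hD]; ring)⟩
  have key := hΦ.norm_le (B := B * ε ^ 2)
    (F := fun y => B * ε * ∑ i, (‖y - x‖ ^ 2)⁻¹ * ‖f i y‖) (by positivity) hnear
    ((integrable_finset_sum _ fun i _ => (hi i).1).const_mul _)
    (fun y hy => (hfar y hy).trans_eq (by rw [Finset.mul_sum]))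
  rw [integral_const_mul, integral_finset_sum _ fun i _ => (hi i).1] at key
  have h3 : ∑ i, ∫ y in (Metric.ball x 1)ᶜ, (‖y - x‖ ^ 2)⁻¹ * ‖f i y‖ ≤ n * (D * ε) := by
    refine (Finset.sum_le_sum fun i _ => (hi i).2).trans_eq ?_
    simp
  have h4 : B * ε * ∑ i, ∫ y in (Metric.ball x 1)ᶜ, (‖y - x‖ ^ 2)⁻¹ * ‖f i y‖ ≤
      B * ε * (n * (D * ε)) := by gcongr
  have hn : (0 : ℝ) ≤ n := by positivity
  have h5 : 0 ≤ B * ε ^ 2 * D := by positivity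
  have h6 : 0 ≤ n * (2 * discArea) * (B * ε ^ 2) := by positivity
  calc ‖L‖ ≤ B * ε ^ 2 * (2 * discArea) + B * ε * (n * (D * ε)) := by linarith
    _ ≤ (1 + n) * (D + 2 * discArea) * B * ε ^ 2 := by nlinarith

/-- Integrability at infinity in one chart follows from integrability in another one with
comparable distances. -/
theorem FarInt.of_chart {k : Plane → Plane} {g G : Plane → Cl} {x : Plane} {m n : ℝ} (h : Chart k)
    (hm : 0 < m) (hn : 0 < n) (hG : FarInt G (k x)) (hg : ∀ y, g y = jacobian k y • G (k y))
    (hlow : ∀ y, m * ‖y - x‖ ≤ ‖k y - k x‖) (hup : ∀ y, ‖k y - k x‖ ≤ n * ‖y - x‖)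
    (hgc : Continuous g) : FarInt g x := by
  intro ρ hρ
  have hd := h.smooth.differentiable (by norm_num)
  set U : Set Plane := {y | m * ρ ≤ ‖k y - k x‖} with hU
  have hms : MeasurableSet U :=
    (isClosed_le continuous_const (h.smooth.continuous.sub continuous_const).norm).measurableSet
  have h1 := hG (m * ρ) (by positivity)
  rw [← h.image_compl_ball, integrableOn_image_iff_integrableOn_abs_det_fderiv_smul volume hms
    (fun y _ => (hd y).hasFDerivAt.hasFDerivWithinAt) h.bij.1.injOn] at h1
  have hsub : (Metric.ball x ρ)ᶜ ⊆ U := fun y hy => by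
    have : ρ ≤ ‖y - x‖ := by simpa [dist_eq_norm] using hy
    exact (mul_le_mul_of_nonneg_left this hm.le).trans (hlow y)
  refine ((h1.mono_set hsub).const_mul (n ^ 2)).mono' (aestronglyMeasurable_weight hgc).restrict ?_
  refine (ae_restrict_iff' measurableSet_ball.compl).2 (Eventually.of_forall fun y hy => ?_)
  have hy1 : ρ ≤ ‖y - x‖ := by simpa [dist_eq_norm] using hy
  have hy0 : 0 < ‖y - x‖ := hρ.trans_le hy1
  have hk0 : 0 < ‖k y - k x‖ := (mul_pos hm hy0).trans_le (hlow y)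
  have hJ := h.pos y
  rw [Real.norm_of_nonneg (by positivity), det_fderiv_eq_jacobian, hg y, norm_smul,
    Real.norm_of_nonneg hJ.le, abs_of_pos hJ, smul_eq_mul]
  have e : (‖y - x‖ ^ 2)⁻¹ ≤ n ^ 2 * (‖k y - k x‖ ^ 2)⁻¹ := by
    rw [← div_eq_mul_inv, le_div_iff₀ (by positivity), inv_mul_le_iff₀ (by positivity)]
    calc ‖k y - k x‖ ^ 2 ≤ (n * ‖y - x‖) ^ 2 := by gcongr; exact hup y
      _ = ‖y - x‖ ^ 2 * n ^ 2 := by ring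
  calc (‖y - x‖ ^ 2)⁻¹ * (jacobian k y * ‖G (k y)‖)
      ≤ n ^ 2 * (‖k y - k x‖ ^ 2)⁻¹ * (jacobian k y * ‖G (k y)‖) := by gcongr
    _ = _ := by ring

/-! ### Surfaces close to the horizontal plane -/

/-- The inclusion of the horizontal plane. -/
def inclL : Plane →L[ℝ] Cl :=
  (EuclideanSpace.proj 0).smulRight e₁ + (EuclideanSpace.proj 1).smulRight e₂

theorem inclL_apply (v : Plane) : inclL v = v 0 • e₁ + v 1 • e₂ := rfl

theorem norm_inclL (v : Plane) : ‖inclL v‖ = ‖v‖ := by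
  have h : ‖inclL v‖ ^ 2 = ‖v‖ ^ 2 := by
    rw [norm_sq_eq, EuclideanSpace.norm_sq_eq, inclL_apply]
    simp
  exact (sq_eq_sq₀ (norm_nonneg _) (norm_nonneg _)).1 h

/-- `ζ = P + λ` is a surface whose deviation `λ` from the horizontal plane has first derivatives
which are bounded by `ε` and `ε`-Lipschitz. -/
structure SmallGraph (Z l : Plane → Cl) (ε : ℝ) : Prop where
  eq : ∀ y, Z y = inclL y + l y
  re : ∀ y, (l y).re = 0
  diff : Differentiable ℝ l
  slope : ∀ i y, ‖pd i l y‖ ≤ ε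
  lip : ∀ i x y, ‖pd i l x - pd i l y‖ ≤ ε * ‖x - y‖
  nonneg : 0 ≤ ε
  small : ε ≤ 1 / 4

section
variable {Z l : Plane → Cl} {ε : ℝ} {x y : Plane}

theorem SmallGraph.norm_deviation_le (H : SmallGraph Z l ε) (x y : Plane) :
    ‖l y - l x‖ ≤ 2 * ε * ‖y - x‖ :=
  convex_univ.norm_image_sub_le_of_norm_fderiv_le (𝕜 := ℝ) (fun z _ => H.diff z)
    (fun z _ => norm_fderiv_le fun i => H.slope i z) (Set.mem_univ _) (Set.mem_univ _)

theorem SmallGraph.norm_taylor_le (H : SmallGraph Z l ε) (x y : Plane) :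
    ‖l y - l x - fderiv ℝ l y (y - x)‖ ≤ 2 * ε * ‖y - x‖ ^ 2 := by
  have h1 : ∀ z ∈ segment ℝ x y, ‖fderiv ℝ l z - fderiv ℝ l y‖ ≤ 2 * ε * ‖y - x‖ := by
    intro z hz
    have hzy : ‖z - y‖ ≤ ‖y - x‖ := by
      have := norm_sub_le_of_mem_segment (segment_symm ℝ x y ▸ hz)
      rwa [norm_sub_rev x y] at this
    refine ContinuousLinearMap.opNorm_le_bound _ (by have := H.nonneg; positivity) fun v => ?_
    have e : (fderiv ℝ l z - fderiv ℝ l y) v =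
        v 0 • (pd 0 l z - pd 0 l y) + v 1 • (pd 1 l z - pd 1 l y) := by
      rw [ContinuousLinearMap.sub_apply, fderiv_apply_eq, fderiv_apply_eq]; module
    rw [e]
    refine (norm_add_le _ _).trans ?_
    rw [norm_smul, norm_smul]
    have a0 : ‖v 0‖ ≤ ‖v‖ := PiLp.norm_apply_le v 0
    have a1 : ‖v 1‖ ≤ ‖v‖ := PiLp.norm_apply_le v 1
    have b0 := (H.lip 0 z y).trans (mul_le_mul_of_nonneg_left hzy H.nonneg)
    have b1 := (H.lip 1 z y).trans (mul_le_mul_of_nonneg_left hzy H.nonneg)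
    calc _ ≤ ‖v‖ * (ε * ‖y - x‖) + ‖v‖ * (ε * ‖y - x‖) := by gcongr
      _ = _ := by ring
  have h2 := (convex_segment x y).norm_image_sub_le_of_norm_hasFDerivWithin_le'
    (𝕜 := ℝ) (f := l) (f' := fderiv ℝ l) (φ := fderiv ℝ l y) (C := 2 * ε * ‖y - x‖)
    (fun z _ => (H.diff z).hasFDerivAt.hasFDerivWithinAt) h1 (left_mem_segment ℝ x y)
    (right_mem_segment ℝ x y)
  calc _ ≤ _ := h2
    _ = _ := by ring

theorem SmallGraph.differentiable (H : SmallGraph Z l ε) : Differentiable ℝ Z := by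
  rw [show Z = fun y => inclL y + l y from funext H.eq]
  exact inclL.differentiable.add H.diff

theorem SmallGraph.sub_eq (H : SmallGraph Z l ε) (x y : Plane) :
    Z y - Z x = inclL (y - x) + (l y - l x) := by
  rw [H.eq, H.eq, map_sub]; abel

theorem SmallGraph.chord (H : SmallGraph Z l ε) (x y : Plane) :
    1 / 2 * ‖y - x‖ ≤ ‖Z y - Z x‖ := by
  have h1 := H.norm_deviation_le x y
  have h2 := norm_sub_le (Z y - Z x) (l y - l x)
  rw [H.sub_eq, add_sub_cancel_right, norm_inclL] at h2
  rw [H.sub_eq]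
  nlinarith [H.small, norm_nonneg (y - x)]

theorem SmallGraph.norm_surface_sub_le (H : SmallGraph Z l ε) (x y : Plane) :
    ‖Z y - Z x‖ ≤ 2 * ‖y - x‖ := by
  have h1 := H.norm_deviation_le x y
  have h2 := norm_add_le (inclL (y - x)) (l y - l x)
  rw [norm_inclL] at h2
  rw [H.sub_eq]
  nlinarith [H.small, norm_nonneg (y - x)]

theorem SmallGraph.pd_eq (H : SmallGraph Z l ε) (i : Fin 2) (y : Plane) :
    pd i Z y = inclL (unitVec i) + pd i l y := by
  rw [show Z = fun y => inclL y + l y from funext H.eq]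
  exact (inclL.hasFDerivAt.add (H.diff y).hasFDerivAt).pd i

theorem SmallGraph.norm_pd_le (H : SmallGraph Z l ε) (i : Fin 2) (y : Plane) :
    ‖pd i Z y‖ ≤ 2 := by
  rw [H.pd_eq]
  refine (norm_add_le _ _).trans ?_
  rw [norm_inclL, norm_unitVec]
  linarith [H.slope i y, H.small]

theorem SmallGraph.norm_normal_le (H : SmallGraph Z l ε) (y : Plane) : ‖normal Z y‖ ≤ 4 := by
  refine (norm_cross_le _ _).trans ?_
  have h0 := H.norm_pd_le 0 y
  have h1 := H.norm_pd_le 1 y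
  calc _ ≤ (2 : ℝ) * 2 := by gcongr
    _ = 4 := by norm_num

theorem SmallGraph.pd_re (H : SmallGraph Z l ε) (i : Fin 2) (y : Plane) : (pd i Z y).re = 0 := by
  refine pd_re_eq_zero H.differentiable (fun y => ?_) i y
  rw [H.eq, inclL_apply]
  simp [H.re]

theorem SmallGraph.pd_imK (H : SmallGraph Z l ε) (i : Fin 2) (y : Plane) :
    (pd i Z y).imK = (pd i l y).imK := by
  rw [H.pd_eq, inclL_apply]; fin_cases i <;> simp [unitVec]

theorem SmallGraph.norm_tang_le (H : SmallGraph Z l ε) (y : Plane) :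
    ‖tang Z y‖ ≤ 2 * (‖pd 0 l y‖ + ‖pd 1 l y‖) := by
  rw [tang, H.pd_imK, H.pd_imK]
  refine (norm_sub_le _ _).trans ?_
  rw [norm_smul, norm_smul]
  have a0 : ‖(pd 0 l y).imK‖ ≤ ‖pd 0 l y‖ := abs_imK_le _
  have a1 : ‖(pd 1 l y).imK‖ ≤ ‖pd 1 l y‖ := abs_imK_le _
  calc _ ≤ ‖pd 0 l y‖ * 2 + ‖pd 1 l y‖ * 2 := by
        gcongr
        · exact H.norm_pd_le 1 y
        · exact H.norm_pd_le 0 y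
    _ = _ := by ring

theorem inner_cross_combination (a b : Cl) (p q : ℝ) (ha : a.re = 0) (hb : b.re = 0) :
    inner ℝ (p • a + q • b) (cross a b) = 0 := by
  rw [inner_eq]
  simp [cross_re, cross_imI, cross_imJ, cross_imK]
  ring

/-- The distance of `ζ(x)` from the tangent plane at `ζ(y)`. -/
theorem SmallGraph.abs_inner_normal_le (H : SmallGraph Z l ε) (x y : Plane) :
    |inner ℝ (Z y - Z x) (normal Z y)| ≤ 16 * ε * ‖y - x‖ ∧
      |inner ℝ (Z y - Z x) (normal Z y)| ≤ 8 * ε * ‖y - x‖ ^ 2 := by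
  obtain ⟨R, hR⟩ : ∃ R, R = l y - l x - fderiv ℝ l y (y - x) := ⟨_, rfl⟩
  have e1 : Z y - Z x = fderiv ℝ Z y (y - x) + R := by
    have : fderiv ℝ Z y = inclL + fderiv ℝ l y := by
      rw [show Z = fun y => inclL y + l y from funext H.eq]
      exact (inclL.hasFDerivAt.add (H.diff y).hasFDerivAt).fderiv
    rw [this, hR, H.sub_eq, ContinuousLinearMap.add_apply]; abel
  have e2 : inner ℝ (Z y - Z x) (normal Z y) = inner ℝ R (normal Z y) := by
    rw [e1, inner_add_left, fderiv_apply_eq, normal,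
      inner_cross_combination _ _ _ _ (H.pd_re 0 y) (H.pd_re 1 y), zero_add]
  have h4 := H.norm_normal_le y
  have h5 : |inner ℝ R (normal Z y)| ≤ ‖R‖ * 4 :=
    (abs_real_inner_le_norm _ _).trans (by gcongr)
  have h6 : ‖R‖ ≤ 4 * ε * ‖y - x‖ := by
    rw [hR]
    refine (norm_sub_le _ _).trans ?_
    have a := H.norm_deviation_le x y
    have b := (fderiv ℝ l y).le_of_opNorm_le (norm_fderiv_le fun i => H.slope i y) (y - x)
    linarith
  have h7 : ‖R‖ ≤ 2 * ε * ‖y - x‖ ^ 2 := hR ▸ H.norm_taylor_le x y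
  rw [e2]
  constructor <;> linarith

theorem norm_kernelK_le (σ : Cl) : ‖kernelK σ‖ ≤ (‖σ‖ ^ 2)⁻¹ := by
  rw [← regK_zero]; exact norm_regK_le 0 σ

theorem SmallGraph.norm_kernel_le (H : SmallGraph Z l ε) (hy : y ≠ x) :
    ‖kernelK (Z y - Z x)‖ ≤ 4 * (‖y - x‖ ^ 2)⁻¹ := by
  refine (norm_kernelK_le _).trans ?_
  have h0 : 0 < ‖y - x‖ := norm_pos_iff.2 (sub_ne_zero.2 hy)
  have h1 := H.chord x y
  have h2 : (1 / 2 * ‖y - x‖) ^ 2 ≤ ‖Z y - Z x‖ ^ 2 := by gcongr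
  calc (‖Z y - Z x‖ ^ 2)⁻¹ ≤ ((1 / 2 * ‖y - x‖) ^ 2)⁻¹ := by gcongr
    _ = _ := by rw [mul_pow, mul_inv]; norm_num

theorem SmallGraph.abs_inner_kernel_le (H : SmallGraph Z l ε) (hy : y ≠ x) :
    |inner ℝ (kernelK (Z y - Z x)) (normal Z y)| ≤
      8 * (‖y - x‖ ^ 3)⁻¹ * |inner ℝ (Z y - Z x) (normal Z y)| := by
  have h0 : 0 < ‖y - x‖ := norm_pos_iff.2 (sub_ne_zero.2 hy)
  have h1 := H.chord x y
  rw [kernelK, real_inner_smul_left, abs_mul]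
  gcongr
  have hpi := Real.pi_gt_three
  have h2 : (1 / 2 * ‖y - x‖) ^ 3 ≤ ‖Z y - Z x‖ ^ 3 := by gcongr
  have h3 : |(2 / (4 * Real.pi))| ≤ 1 := by
    rw [abs_of_pos (by positivity), div_le_one (by positivity)]; linarith
  rw [abs_mul, abs_neg, abs_of_nonneg (by positivity : (0 : ℝ) ≤ (‖Z y - Z x‖ ^ 3)⁻¹)]
  calc _ ≤ 1 * ((1 / 2 * ‖y - x‖) ^ 3)⁻¹ := by gcongr
    _ = _ := by rw [mul_pow, mul_inv]; norm_num

theorem SmallGraph.inner_kernel_near (H : SmallGraph Z l ε) (hy : y ≠ x) :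
    |inner ℝ (kernelK (Z y - Z x)) (normal Z y)| ≤ 64 * ε * ‖y - x‖⁻¹ := by
  have h0 : 0 < ‖y - x‖ := norm_pos_iff.2 (sub_ne_zero.2 hy)
  refine (H.abs_inner_kernel_le hy).trans ?_
  calc _ ≤ 8 * (‖y - x‖ ^ 3)⁻¹ * (8 * ε * ‖y - x‖ ^ 2) := by
        gcongr; exact (H.abs_inner_normal_le x y).2
    _ = _ := by field_simp; ring

theorem SmallGraph.inner_kernel_far (H : SmallGraph Z l ε) (hy : y ≠ x) :
    |inner ℝ (kernelK (Z y - Z x)) (normal Z y)| ≤ 128 * ε * (‖y - x‖ ^ 2)⁻¹ := by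
  have h0 : 0 < ‖y - x‖ := norm_pos_iff.2 (sub_ne_zero.2 hy)
  refine (H.abs_inner_kernel_le hy).trans ?_
  calc _ ≤ 8 * (‖y - x‖ ^ 3)⁻¹ * (16 * ε * ‖y - x‖) := by
        gcongr; exact (H.abs_inner_normal_le x y).1
    _ = _ := by field_simp; ring

end

/-! ### The quadratic structure of the integrands -/

theorem tang_eq_normal (S : Plane → Cl) (y : Plane) (h0 : (pd 0 S y).re = 0)
    (h1 : (pd 1 S y).re = 0) :
    tang S y = (normal S y).imJ • e₁ - (normal S y).imI • e₂ := by
  ext <;> simp [tang, normal, cross_imI, cross_imJ, h0, h1] <;> ring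

/-- The horizontal part of `K N v + K (d × τ) e₃`, after subtraction of a multiple of
`Re (K τ)`, where `τ = N × e₃`. -/
theorem horizontal_identity {κ N u v τ : Cl} (hκ : κ.re = 0) (hN : N.re = 0) (hv : v.re = 0)
    (hτ : τ = N.imJ • e₁ - N.imI • e₂) :
    toPlaneL (κ * (N * horL v + cross (v - u) τ * e₃)) +
        (κ * τ).re • toPlaneL (cross e₃ u) =
      toPlaneL (-(inner ℝ κ N) • v - (κ * τ).re • cross e₃ (v - u) +
        κ * (cross (v - u) τ * e₃)) := by
  rw [hτ, toPlaneL_apply, toPlaneL_apply, toPlaneL_apply, inner_eq]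
  ext i
  fin_cases i <;>
    simp [toPlane, cross_re, cross_imI, cross_imJ, cross_imK, hκ, hN, hv] <;> ring

/-- The vertical part of `K N w' + K ((w + e₃) × τ) e₃`, where `w' + e₃ = s N` and `τ = N × e₃`. -/
theorem vertical_identity {κ N w w' τ : Cl} {s : ℝ} (hκ : κ.re = 0) (hN : N.re = 0)
    (hw' : w' = s • N - e₃) (hτ : τ = N.imJ • e₁ - N.imI • e₂) :
    (κ * (N * w')).imK + (κ * cross (w + e₃) τ).re =
      -(inner ℝ κ N) * w'.imK + (κ * cross (w - w') τ).re := by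
  rw [hτ, hw', inner_eq]
  simp [cross_re, cross_imI, cross_imJ, cross_imK, hκ, hN]
  ring

/-- The vertical part of `(N × ∇) ℋ(𝔷 e₃)`, under the integral sign. -/
theorem re_mul_cross_antisymm {a b κ τ : Cl} (ha : a.re = 0) (hb : b.re = 0) (hκ : κ.re = 0) :
    (b * (κ * (cross a τ * e₃)) - a * (κ * (cross b τ * e₃))).imK =
      (κ * cross (cross a b) τ).re := by
  simp [cross_re, cross_imI, cross_imJ, cross_imK, ha, hb, hκ]
  ring

/-! ### The wave as a surface close to the horizontal plane -/

theorem norm_toPlaneL_le (σ : Cl) : ‖toPlaneL σ‖ ≤ ‖σ‖ := by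
  have h : ‖toPlaneL σ‖ ^ 2 ≤ ‖σ‖ ^ 2 := by
    rw [norm_sq_eq, EuclideanSpace.norm_sq_eq, toPlaneL_apply]
    simp only [toPlane, Fin.sum_univ_two, Real.norm_eq_abs, sq_abs]
    simp
    nlinarith [sq_nonneg σ.re, sq_nonneg σ.imK]
  exact (sq_le_sq₀ (norm_nonneg _) (norm_nonneg _)).1 h

theorem cross_smul (r : ℝ) (σ τ : Cl) : cross σ (r • τ) = r • cross σ τ := by
  ext <;> simp <;> ring

theorem smul_cross (r : ℝ) (σ τ : Cl) : cross (r • σ) τ = r • cross σ τ := by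
  ext <;> simp <;> ring

theorem FarInt.neg {g : Plane → Cl} {x : Plane} (h : FarInt g x) : FarInt (fun y => -g y) x :=
  fun ρ hρ => by simpa only [norm_neg] using h ρ hρ

section
variable {I : Set ℝ} {ξ : ℝ → Plane → Cl} {𝔞 : ℝ → Plane → ℝ} {t ε : ℝ}

theorem Wave.lagLam_re (W : Wave I ξ 𝔞) (ht : t ∈ I) (x : Plane) : (lagLam ξ t x).re = 0 := by
  simp [lagLam, vert_eq, W.heightPot_re ht]

theorem Wave.smallGraph (W : Wave I ξ 𝔞) (K : IsCoordChange I ξ) (ht : t ∈ I) (hε : 0 ≤ ε)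
    (hε' : ε ≤ 1 / 4) (hs : WaveSizeLE I ξ t ε) : SmallGraph (zeta ξ t) (lam ξ t) ε where
  eq := fun η => by
    obtain ⟨x, rfl⟩ := (K t ht).1.2 η
    rw [W.lam_eq_pull K ht, pull_kPlane K ht]
    refine (pull_kPlane K ht ξ x).trans ?_
    rw [eq_comm, ← eq_sub_iff_add_eq, ← W.kMap_eq_sub ht, inclL_apply, kPlane]
    ext <;> simp [toPlane, W.kMap_re ht, W.kMap_imK ht]
  re := fun η => by rw [W.lam_eq_pull K ht]; exact W.lagLam_re ht _
  diff := by
    rw [funext (W.lam_eq_pull K ht)]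
    exact W.differentiable_pull K ht W.lagLam_smooth
  slope := fun i y => (hs.slope i).1 y
  lip := fun i x y => (hs.slope i).2.1 x y
  nonneg := hε
  small := hε'

theorem SizeLE.continuous {f : Plane → Cl} (h : SizeLE ε f) : Continuous f := by
  have : LipschitzWith (Real.toNNReal ε) f := LipschitzWith.of_dist_le_mul fun x y => by
    rw [dist_eq_norm, dist_eq_norm]
    exact (h.2.1 x y).trans (mul_le_mul_of_nonneg_right (Real.le_coe_toNNReal ε) (norm_nonneg _))
  exact this.continuous

theorem SizeLE.norm_pd_le {f : Plane → Cl} (h : SizeLE ε f) (hε : 0 ≤ ε) (i : Fin 2) (y : Plane) :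
    ‖pd i f y‖ ≤ ε := by
  refine (WaterWave.norm_pd_le i f y).trans ?_
  have h1 : LipschitzWith ⟨ε, hε⟩ f := LipschitzWith.of_dist_le_mul fun x y => by
    rw [dist_eq_norm, dist_eq_norm]; exact h.2.1 x y
  exact norm_fderiv_le_of_lipschitz ℝ h1

theorem Wave.normal_smooth (W : Wave I ξ 𝔞) (ht : t ∈ I) : ContDiff ℝ 1 (normal (ξ t)) :=
  ((CSlab.normal W.convI W.neI W.smooth (m := 2) (by norm_num)).slice ht).of_le (by norm_num)

theorem Wave.tang_smooth (W : Wave I ξ 𝔞) (ht : t ∈ I) : ContDiff ℝ 1 (tang (ξ t)) :=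
  (W.contDiff_tang ht).of_le (by norm_num)

theorem Wave.zeta_eq (W : Wave I ξ 𝔞) (K : IsCoordChange I ξ) (ht : t ∈ I) (y : Plane) :
    DifferentiableAt ℝ (zeta ξ t) (kPlane ξ t y) ∧ ∀ y, ξ t y = zeta ξ t (kPlane ξ t y) :=
  ⟨W.differentiable_pull K ht W.smooth_one _, fun y => (pull_kPlane K ht ξ y).symm⟩

theorem Wave.normal_zeta (W : Wave I ξ 𝔞) (K : IsCoordChange I ξ) (ht : t ∈ I) (y : Plane) :
    normal (ξ t) y = jacobian (kPlane ξ t) y • normal (zeta ξ t) (kPlane ξ t y) :=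
  normal_chart (K.differentiable ht y) (W.zeta_eq K ht y).1 (W.zeta_eq K ht y).2

theorem Wave.tang_zeta (W : Wave I ξ 𝔞) (K : IsCoordChange I ξ) (ht : t ∈ I) (y : Plane) :
    tang (ξ t) y = jacobian (kPlane ξ t) y • tang (zeta ξ t) (kPlane ξ t y) :=
  tang_chart (K.differentiable ht y) (W.zeta_eq K ht y).1 (W.zeta_eq K ht y).2

theorem Wave.hasPV_zeta (W : Wave I ξ 𝔞) (K : IsCoordChange I ξ) (ht : t ∈ I) {g G : Plane → Cl}
    {x : Plane} {L : Cl} (h : HasPV (ξ t) g x L) (hg : ContDiff ℝ 1 g) (hfar : FarInt g x)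
    (hG : ∀ y, g y = jacobian (kPlane ξ t) y • G (kPlane ξ t y)) :
    HasPV (zeta ξ t) G (kPlane ξ t x) L := by
  obtain ⟨J, c, M, H, htJ, -⟩ := W.exists_flow ht
  exact h.to_chart (K.chart ht) ((W.smooth.slice ht).of_le (by norm_num)) hg H.c_pos
    (H.chord t htJ x) hfar (fun _ => rfl) hG

theorem Wave.exists_hasPV_tang_zeta (W : Wave I ξ 𝔞) (K : IsCoordChange I ξ) (ht : t ∈ I)
    (x : Plane) : ∃ L, HasPV (zeta ξ t) (tang (zeta ξ t)) (kPlane ξ t x) L ∧ L.re = 0 := by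
  obtain ⟨L, hL, h0⟩ := W.exists_hasPV_tang ht x
  exact ⟨L, W.hasPV_zeta K ht hL (W.tang_smooth ht) (W.farInt_tang ht x) (W.tang_zeta K ht), h0⟩

theorem Wave.farInt_normal_mul (W : Wave I ξ 𝔞) (ht : t ∈ I) {f : Plane → Cl} {x : Plane}
    (hf : Continuous f) (hfar : FarInt f x) : FarInt (fun y => normal (ξ t) y * f y) x := by
  obtain ⟨J, c, M, H, htJ, -⟩ := W.exists_flow ht
  refine hfar.mono ((W.normal_smooth ht).continuous.mul hf) (C := M * M) fun y => ?_
  rw [norm_mul]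
  exact mul_le_mul_of_nonneg_right (norm_normal_le (H.slope _ htJ) y) (norm_nonneg _)

/-- The horizontal velocity `b` as a principal value over `ζ`. -/
theorem Wave.hasPV_velocity_zeta (W : Wave I ξ 𝔞) (K : IsCoordChange I ξ) (ht : t ∈ I)
    (x : Plane) :
    HasPV (zeta ξ t) (fun η => normal (zeta ξ t) η * horL (vel I ξ t η) +
      cross (vel I ξ t η - dt I ξ t x) (tang (zeta ξ t) η) * e₃) (kPlane ξ t x)
      (dt I ξ t x - dt I (heightPot ξ) t x) := by
  obtain ⟨J, c, M, H, htJ, -⟩ := W.exists_flow ht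
  have hu : ContDiff ℝ 1 (dt I ξ t) := (W.vel_smooth.slice ht).of_le (by norm_num)
  have hh : ContDiff ℝ 1 (fun y => horL (dt I ξ t y)) := horL.contDiff.comp hu
  have h1 := (H.hilbertExists htJ hu (W.farInt_vel ht x)).hasPV
  rw [W.sol.analytic t ht x] at h1
  have hp : ∀ y, vel I ξ t (kPlane ξ t y) = dt I ξ t y := pull_kPlane K ht (dt I ξ)
  have hc : ContDiff ℝ 1 (fun y => cross (dt I ξ t y - dt I ξ t x) (tang (ξ t) y) * e₃) :=
    ((hu.sub contDiff_const).cross (W.tang_smooth ht)).mul contDiff_const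
  refine W.hasPV_zeta K ht (g := fun y => normal (ξ t) y * horL (dt I ξ t y) +
      cross (dt I ξ t y - dt I ξ t x) (tang (ξ t) y) * e₃)
    ((h1.sub (W.hasPV_dt_heightPot ht x)).congr fun y => ?_)
    (((W.normal_smooth ht).mul hh).add hc)
    (FarInt.add (W.farInt_normal_mul ht hh.continuous ((W.farInt_vel ht x).clm hu.continuous horL))
      ((W.farInt_tang ht x).mono hc.continuous (C := 2 * M) fun y => ?_)
      ((W.normal_smooth ht).mul hh).continuous hc.continuous) fun y => ?_
  · rw [horL_apply, vertL_apply]; noncomm_ring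
  · rw [norm_mul, norm_e₃, mul_one]
    refine (norm_cross_le _ _).trans (mul_le_mul_of_nonneg_right ?_ (norm_nonneg _))
    refine (norm_sub_le _ _).trans ?_
    linarith [H.vel t htJ x, H.vel t htJ y]
  · rw [hp, W.normal_zeta K ht, W.tang_zeta K ht, cross_smul, smul_mul_assoc, smul_mul_assoc,
      smul_add]

theorem Wave.hasPV_pd_heightPot_zeta (W : Wave I ξ 𝔞) (K : IsCoordChange I ξ) (ht : t ∈ I)
    (x : Plane) (i : Fin 2) :
    HasPV (zeta ξ t) (fun η => cross (pd i (ξ t) x) (tang (zeta ξ t) η) * e₃) (kPlane ξ t x)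
      (pd i (heightPot ξ t) x) := by
  have hc : ContDiff ℝ 1 (fun y => cross (pd i (ξ t) x) (tang (ξ t) y) * e₃) :=
    (contDiff_const.cross (W.tang_smooth ht)).mul contDiff_const
  refine W.hasPV_zeta K ht (W.hasPV_pd_heightPot ht x i) hc
    ((W.farInt_tang ht x).mono hc.continuous (C := ‖pd i (ξ t) x‖) fun y => ?_) fun y => ?_
  · rw [norm_mul, norm_e₃, mul_one]; exact norm_cross_le _ _
  · rw [W.tang_zeta K ht, cross_smul, smul_mul_assoc]

theorem aestronglyMeasurable_pd (i : Fin 2) (f : Plane → Cl) :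
    AEStronglyMeasurable (pd i f) volume := by
  letI : MeasurableSpace Cl := borel Cl
  haveI : BorelSpace Cl := ⟨rfl⟩
  exact (measurable_fderiv_apply_const ℝ f (unitVec i)).aestronglyMeasurable

theorem Wave.farInt_crossT_zeta (W : Wave I ξ 𝔞) (K : IsCoordChange I ξ) (ht : t ∈ I)
    (hε : 0 ≤ ε) (hε' : ε ≤ 1 / 4) (hs : WaveSizeLE I ξ t ε) (a : Cl) (η : Plane) :
    FarInt (fun y => crossT (zeta ξ t) (vel I ξ t y - a) (vel I ξ t) y) η := by
  intro ρ hρ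
  have H := W.smallGraph K ht hε hε' hs
  obtain ⟨C, a', -, -, h⟩ := integrableOn_far (p := 2) (by norm_num) (by norm_num)
  have h1 : ∀ i, IntegrableOn (fun y => (‖y - η‖ ^ 2)⁻¹ * ‖pd i (vel I ξ t) y‖)
      (Metric.ball η ρ)ᶜ := fun i =>
    (h ε hε _ (aestronglyMeasurable_pd i _) (hs.velocityDeriv i) η ρ hρ).1
  have hpz : ∀ i, Continuous (pd i (zeta ξ t)) := fun i => by
    rw [funext (H.pd_eq i)]; exact continuous_const.add (hs.slope i).continuous
  have hcr : ∀ i, Continuous fun y => cross (vel I ξ t y - a) (pd i (zeta ξ t) y) := fun i =>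
    crossL.isBoundedBilinearMap.continuous.comp
      ((hs.velocity.continuous.sub continuous_const).prodMk (hpz i))
  refine (((h1 0).add (h1 1)).const_mul ((ε + ‖a‖) * 2)).mono'
    (AEStronglyMeasurable.mul ?_ ?_).restrict (Eventually.of_forall fun y => ?_)
  · exact (((continuous_id.sub continuous_const).norm.pow 2).measurable.inv).aestronglyMeasurable
  · exact (((hcr 1).aestronglyMeasurable.mul (aestronglyMeasurable_pd 0 _)).sub
      ((hcr 0).aestronglyMeasurable.mul (aestronglyMeasurable_pd 1 _))).norm
  · rw [Real.norm_of_nonneg (by positivity), Pi.add_apply, ← mul_add]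
    have h2 : ‖vel I ξ t y - a‖ ≤ ε + ‖a‖ := (norm_sub_le _ _).trans (by
      have := hs.velocity.1 y; gcongr)
    calc _ ≤ (‖y - η‖ ^ 2)⁻¹ * ((ε + ‖a‖) *
          2 * (‖pd 0 (vel I ξ t) y‖ + ‖pd 1 (vel I ξ t) y‖)) := by
          gcongr
          exact (norm_crossT_le (H.norm_pd_le · y)).trans (by gcongr)
      _ = _ := by ring

theorem Wave.crossT_zeta (W : Wave I ξ 𝔞) (K : IsCoordChange I ξ) (ht : t ∈ I) (a : Cl)
    (y : Plane) : crossT (ξ t) a (dt I ξ t) y =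
      jacobian (kPlane ξ t) y • crossT (zeta ξ t) a (vel I ξ t) (kPlane ξ t y) :=
  crossT_chart (K.differentiable ht y) (W.zeta_eq K ht y).1
    (W.differentiable_pull K ht (W.vel_smooth.of_le (by norm_num)) _) (W.zeta_eq K ht y).2
    (fun y => (pull_kPlane K ht (dt I ξ) y).symm) a

theorem Wave.farInt_crossT (W : Wave I ξ 𝔞) (K : IsCoordChange I ξ) (ht : t ∈ I)
    (hε : 0 ≤ ε) (hε' : ε ≤ 1 / 4) (hs : WaveSizeLE I ξ t ε) (x : Plane)
    (hc : Continuous fun y => crossT (ξ t) (dt I ξ t y - dt I ξ t x) (dt I ξ t) y) :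
    FarInt (fun y => crossT (ξ t) (dt I ξ t y - dt I ξ t x) (dt I ξ t) y) x := by
  obtain ⟨J, c, M, H, htJ, -⟩ := W.exists_flow ht
  have HS := W.smallGraph K ht hε hε' hs
  have hM := H.M_nonneg
  have hz := (W.zeta_eq K ht x).2
  refine (W.farInt_crossT_zeta K ht hε hε' hs (dt I ξ t x) (kPlane ξ t x)).of_chart (K.chart ht)
    (m := c / 2) (n := 4 * M + 1) (by have := H.c_pos; positivity) (by positivity)
    (fun y => ?_) (fun y => ?_) (fun y => ?_) hc
  · rw [W.crossT_zeta K ht,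
      show vel I ξ t (kPlane ξ t y) = dt I ξ t y from pull_kPlane K ht (dt I ξ) y]
  · have h1 := H.chord t htJ x y
    have h2 := HS.norm_surface_sub_le (kPlane ξ t x) (kPlane ξ t y)
    rw [← hz, ← hz] at h2
    linarith
  · have h1 := HS.chord (kPlane ξ t x) (kPlane ξ t y)
    rw [← hz, ← hz] at h1
    have h2 : ‖ξ t y - ξ t x‖ ≤ 2 * M * ‖y - x‖ :=
      convex_univ.norm_image_sub_le_of_norm_fderiv_le (𝕜 := ℝ)
        (fun z _ => W.pd_differentiable ht z)
        (fun z _ => norm_fderiv_le fun i => H.slope t htJ i z) (Set.mem_univ _) (Set.mem_univ _)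
    nlinarith [norm_nonneg (y - x)]

/-- The acceleration as a principal value over `ζ`, obtained by differentiation of
`ξ_t = H ξ_t` in time. -/
theorem Wave.hasPV_acceleration_zeta (W : Wave I ξ 𝔞) (K : IsCoordChange I ξ) (ht : t ∈ I)
    (hε : 0 ≤ ε) (hε' : ε ≤ 1 / 4) (hs : WaveSizeLE I ξ t ε) (x : Plane) :
    HasPV (zeta ξ t) (fun η => normal (zeta ξ t) η * acc I ξ t η -
      crossT (zeta ξ t) (vel I ξ t η - dt I ξ t x) (vel I ξ t) η) (kPlane ξ t x)
      (dt I (dt I ξ) t x) := by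
  have hu : ContDiff ℝ 2 (dt I ξ t) := W.vel_smooth.slice ht
  have hu1 : ContDiff ℝ 1 (fun y => dt I ξ t y - dt I ξ t x) :=
    (hu.of_le (by norm_num)).sub contDiff_const
  have hw : ContDiff ℝ 1 (dt I (dt I ξ) t) := W.acc_smooth.slice ht
  have hpu : ∀ i, ContDiff ℝ 1 (pd i (dt I ξ t)) := fun i => hu.pd (by norm_num) i
  have hpx : ∀ i, ContDiff ℝ 1 (pd i (ξ t)) := fun i => (W.smooth.slice ht).pd (by norm_num) i
  have hc : ContDiff ℝ 1 (fun y => crossT (ξ t) (dt I ξ t y - dt I ξ t x) (dt I ξ t) y) :=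
    ((hu1.cross (hpx 1)).mul (hpu 0)).sub ((hu1.cross (hpx 0)).mul (hpu 1))
  have hfar := W.farInt_crossT K ht hε hε' hs x hc.continuous
  have hA := admissible_vel W.convI W.neI W.sol W.reg
  have hdis : ∀ y, displ I ξ (t, x) (1, 0) y = dt I ξ t y - dt I ξ t x := fun y => by
    simp [displ]
  have h1 := hA.hasPV W.convI W.neI ht x (v := (1, 0)) (by simp) (by simpa only [hdis] using hfar)
  rw [← (hA.cslab_hilbert W.convI W.neI).dt_eq W.convI W.neI ht,
    show dt I (fun t x => hilbert (ξ t) (dt I ξ t) x) t x = dt I (dt I ξ) t x from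
      derivWithin_congr (fun s hs => W.sol.analytic s hs x) (W.sol.analytic t ht x)] at h1
  simp only [hdis, one_smul] at h1
  refine W.hasPV_zeta K ht h1 (((W.normal_smooth ht).mul hw).sub hc) ?_ fun y => ?_
  · exact (FarInt.add (g := fun y => -crossT (ξ t) (dt I ξ t y - dt I ξ t x) (dt I ξ t) y)
      (W.farInt_normal_mul ht hw.continuous (W.farInt_acc ht x)) hfar.neg
      ((W.normal_smooth ht).mul hw).continuous hc.continuous.neg).mono
      (((W.normal_smooth ht).mul hw).sub hc).continuous (C := 1)
      fun y => by rw [one_mul, sub_eq_add_neg]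
  · rw [W.crossT_zeta K ht, W.normal_zeta K ht,
      show vel I ξ t (kPlane ξ t y) = dt I ξ t y from pull_kPlane K ht (dt I ξ) y,
      show acc I ξ t (kPlane ξ t y) = dt I (dt I ξ) t y from pull_kPlane K ht (dt I (dt I ξ)) y,
      smul_mul_assoc, smul_sub]

end

/-! ### Quadratic smallness of `b` and `A - 1` -/

section
variable {I : Set ℝ} {ξ : ℝ → Plane → Cl} {𝔞 : ℝ → Plane → ℝ} {t ε : ℝ}

theorem SizeLE.norm_sub_le_two {f : Plane → Cl} (h : SizeLE ε f) (x y : Plane) :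
    ‖f y - f x‖ ≤ 2 * ε :=
  (norm_sub_le _ _).trans (by linarith [h.1 x, h.1 y])

theorem SmallGraph.norm_tang_le_const {Z l : Plane → Cl} (H : SmallGraph Z l ε) (y : Plane) :
    ‖tang Z y‖ ≤ 4 * ε :=
  (H.norm_tang_le y).trans (by linarith [H.slope 0 y, H.slope 1 y])

/-- `|K| |d| |τ|` near the singularity, for a tangential field `τ` and an increment `d` of a
Lipschitz function. -/
theorem SmallGraph.near_product {Z l f : Plane → Cl} {x y : Plane} (H : SmallGraph Z l ε)
    (hf : SizeLE ε f) (hy : y ≠ x) {τ : ℝ} (hτ0 : 0 ≤ τ) (hτ : τ ≤ 4 * ε) :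
    ‖kernelK (Z y - Z x)‖ * (‖f y - f x‖ * τ) ≤ 16 * ε ^ 2 * ‖y - x‖⁻¹ := by
  have h0 : 0 < ‖y - x‖ := norm_pos_iff.2 (sub_ne_zero.2 hy)
  have hε := H.nonneg
  calc _ ≤ 4 * (‖y - x‖ ^ 2)⁻¹ * (ε * ‖y - x‖ * (4 * ε)) := by
        gcongr
        · exact H.norm_kernel_le hy
        · exact hf.2.1 y x
    _ = _ := by field_simp; ring

theorem SmallGraph.far_product {Z l f : Plane → Cl} {x y : Plane} (H : SmallGraph Z l ε)
    (hf : SizeLE ε f) (hy : y ≠ x) {τ : ℝ} (hτ0 : 0 ≤ τ) :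
    ‖kernelK (Z y - Z x)‖ * (‖f y - f x‖ * τ) ≤ 8 * ε * ((‖y - x‖ ^ 2)⁻¹ * τ) := by
  have hε := H.nonneg
  calc _ ≤ 4 * (‖y - x‖ ^ 2)⁻¹ * (2 * ε * τ) := by
        gcongr
        · exact H.norm_kernel_le hy
        · exact hf.norm_sub_le_two x y
    _ = _ := by ring

theorem ne_of_one_le {x y : Plane} (h : 1 ≤ ‖y - x‖) : y ≠ x := by
  rintro rfl; simp at h; linarith

theorem SizeLE.near_inner {Z l f : Plane → Cl} {x y : Plane} (hf : SizeLE ε f)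
    (H : SmallGraph Z l ε) (hy : y ≠ x) :
    |inner ℝ (kernelK (Z y - Z x)) (normal Z y)| * ‖f y‖ ≤ 64 * ε ^ 2 * ‖y - x‖⁻¹ := by
  have hε := H.nonneg
  calc _ ≤ 64 * ε * ‖y - x‖⁻¹ * ε := by
        gcongr
        · exact H.inner_kernel_near hy
        · exact hf.1 y
    _ = _ := by ring

theorem SmallGraph.far_inner {Z l f : Plane → Cl} {x y : Plane}
    (H : SmallGraph Z l ε) (hy : y ≠ x) :
    |inner ℝ (kernelK (Z y - Z x)) (normal Z y)| * ‖f y‖ ≤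
      128 * ε * ((‖y - x‖ ^ 2)⁻¹ * ‖f y‖) := by
  calc _ ≤ 128 * ε * (‖y - x‖ ^ 2)⁻¹ * ‖f y‖ := by
        gcongr
        exact H.inner_kernel_far hy
    _ = _ := by ring

theorem Wave.zeta_kernel_re (W : Wave I ξ 𝔞) (ht : t ∈ I) (x y : Plane) :
    (kernelK (zeta ξ t y - zeta ξ t x)).re = 0 :=
  kernelK_re (by
    rw [Quaternion.re_sub]
    exact (congrArg₂ (· - ·) (W.sol.isVector t ht _) (W.sol.isVector t ht _)).trans (sub_zero 0))

theorem SmallGraph.tang_eq {Z l : Plane → Cl} (H : SmallGraph Z l ε) (y : Plane) :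
    tang Z y = (normal Z y).imJ • e₁ - (normal Z y).imI • e₂ :=
  tang_eq_normal Z y (H.pd_re 0 y) (H.pd_re 1 y)

/-- A multiple of the vanishing integral of `Re (K τ)` makes the integrand of `b` quadratic. -/
theorem exists_bCoef_bound : ∃ C : ℝ, 0 ≤ C ∧ ∀ {I : Set ℝ} {ξ : ℝ → Plane → Cl}
    {𝔞 : ℝ → Plane → ℝ} {t ε : ℝ}, Wave I ξ 𝔞 → IsCoordChange I ξ → t ∈ I → 0 ≤ ε → ε ≤ 1 / 4 →
    WaveSizeLE I ξ t ε → ∀ x, ‖bCoef I ξ t (kPlane ξ t x)‖ ≤ C * ε ^ 2 := by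
  obtain ⟨D, hD, key⟩ := exists_pval_bound
  refine ⟨(1 + (3 : ℕ)) * D * 128, by positivity, ?_⟩
  intro I ξ 𝔞 t ε W K ht hε hε' hs x
  have H := W.smallGraph K ht hε hε' hs
  obtain ⟨L, hL, hL0⟩ := W.exists_hasPV_tang_zeta K ht x
  set η := kPlane ξ t x with hη
  have hvx : vel I ξ t η = dt I ξ t x := pull_kPlane K ht (dt I ξ) x
  have h1 := W.hasPV_velocity_zeta K ht x
  rw [← hvx] at h1
  have h2 := (h1.pval.clm toPlaneL).add
    (hL.pval.clm (reL.smulRight (toPlaneL (cross e₃ (vel I ξ t η)))))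
  have hval : toPlaneL (vel I ξ t η - dt I (heightPot ξ) t x) +
      (reL.smulRight (toPlaneL (cross e₃ (vel I ξ t η)))) L = bCoef I ξ t η := by
    rw [W.bCoef_kPlane K ht, hvx, ContinuousLinearMap.smulRight_apply, reL_apply, hL0, zero_smul,
      add_zero, toPlaneL_apply]
    ext i; fin_cases i <;> simp [toPlane]
  rw [hval] at h2
  have hid : ∀ y, ‖toPlaneL (kernelK (zeta ξ t y - zeta ξ t η) *
        (normal (zeta ξ t) y * horL (vel I ξ t y) +
          cross (vel I ξ t y - vel I ξ t η) (tang (zeta ξ t) y) * e₃)) +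
      (reL.smulRight (toPlaneL (cross e₃ (vel I ξ t η))))
        (kernelK (zeta ξ t y - zeta ξ t η) * tang (zeta ξ t) y)‖ ≤
      |inner ℝ (kernelK (zeta ξ t y - zeta ξ t η)) (normal (zeta ξ t) y)| * ‖vel I ξ t y‖ +
      2 * (‖kernelK (zeta ξ t y - zeta ξ t η)‖ *
        (‖vel I ξ t y - vel I ξ t η‖ * ‖tang (zeta ξ t) y‖)) := fun y => by
    rw [ContinuousLinearMap.smulRight_apply, reL_apply,
      horizontal_identity (u := vel I ξ t η) (v := vel I ξ t y) (W.zeta_kernel_re ht η y) rfl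
        (W.vel_re ht _) (H.tang_eq y)]
    refine (norm_toPlaneL_le _).trans ((norm_add_le _ _).trans ?_)
    have a1 := norm_sub_le
      (-(inner ℝ (kernelK (zeta ξ t y - zeta ξ t η)) (normal (zeta ξ t) y)) • vel I ξ t y)
      ((kernelK (zeta ξ t y - zeta ξ t η) * tang (zeta ξ t) y).re •
        cross e₃ (vel I ξ t y - vel I ξ t η))
    rw [norm_smul, norm_smul, norm_neg, Real.norm_eq_abs, Real.norm_eq_abs] at a1
    have a2 : |(kernelK (zeta ξ t y - zeta ξ t η) * tang (zeta ξ t) y).re| ≤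
        ‖kernelK (zeta ξ t y - zeta ξ t η)‖ * ‖tang (zeta ξ t) y‖ :=
      (abs_re_le _).trans (norm_mul _ _).le
    have a3 : ‖cross e₃ (vel I ξ t y - vel I ξ t η)‖ ≤ ‖vel I ξ t y - vel I ξ t η‖ := by
      simpa [norm_e₃] using norm_cross_le e₃ (vel I ξ t y - vel I ξ t η)
    have a4 : ‖kernelK (zeta ξ t y - zeta ξ t η) *
        (cross (vel I ξ t y - vel I ξ t η) (tang (zeta ξ t) y) * e₃)‖ ≤
        ‖kernelK (zeta ξ t y - zeta ξ t η)‖ *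
          (‖vel I ξ t y - vel I ξ t η‖ * ‖tang (zeta ξ t) y‖) := by
      rw [norm_mul, norm_mul, norm_e₃, mul_one]
      gcongr; exact norm_cross_le _ _
    have a5 : |(kernelK (zeta ξ t y - zeta ξ t η) * tang (zeta ξ t) y).re| *
        ‖cross e₃ (vel I ξ t y - vel I ξ t η)‖ ≤
        ‖kernelK (zeta ξ t y - zeta ξ t η)‖ * ‖tang (zeta ξ t) y‖ *
          ‖vel I ξ t y - vel I ξ t η‖ := by gcongr
    linarith
  refine key (n := 3) (B := 128) (f := ![vel I ξ t, pd 0 (lam ξ t), pd 1 (lam ξ t)]) h2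
    (by norm_num) hε ?_ ?_ (fun y hy h1 => (hid y).trans ?_) (fun y hy => (hid y).trans ?_)
  · intro i; fin_cases i
    · exact hs.velocity.continuous.aestronglyMeasurable
    · exact aestronglyMeasurable_pd 0 _
    · exact aestronglyMeasurable_pd 1 _
  · intro i; fin_cases i
    · exact hs.velocity.2.2
    · exact (hs.slope 0).2.2
    · exact (hs.slope 1).2.2
  · have b1 := hs.velocity.near_inner H hy
    have b2 := H.near_product hs.velocity hy (norm_nonneg _) (H.norm_tang_le_const y)
    have b3 : 0 ≤ ε ^ 2 * ‖y - η‖⁻¹ := by positivity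
    linarith
  · have hyη := ne_of_one_le hy
    have b1 := H.far_inner (f := vel I ξ t) hyη
    have b2 := H.far_product hs.velocity hyη (norm_nonneg (tang (zeta ξ t) y))
    have b3 := H.norm_tang_le y
    have b4 : 8 * ε * ((‖y - η‖ ^ 2)⁻¹ * ‖tang (zeta ξ t) y‖) ≤
        8 * ε * ((‖y - η‖ ^ 2)⁻¹ * (2 * (‖pd 0 (lam ξ t) y‖ + ‖pd 1 (lam ξ t) y‖))) := by gcongr
    have b5 : 0 ≤ ε * ((‖y - η‖ ^ 2)⁻¹ * (‖pd 0 (lam ξ t) y‖ + ‖pd 1 (lam ξ t) y‖)) := by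
      positivity
    have hsum : ∑ i, ‖(![vel I ξ t, pd 0 (lam ξ t), pd 1 (lam ξ t)] : Fin 3 → Plane → Cl) i y‖ =
        ‖vel I ξ t y‖ + (‖pd 0 (lam ξ t) y‖ + ‖pd 1 (lam ξ t) y‖) := by
      rw [Fin.sum_univ_three, add_assoc]; rfl
    rw [hsum]
    linarith

/-- With `m = (λ_α × λ_β)₃`, the quantity `A - 1 - A m` is a principal value with quadratic integrand:
the vertical part of the formula for `A`, with the acceleration and the derivatives of `ℋ(𝔷 e₃)`
expressed as principal values. -/
theorem exists_aCoef_remainder_bound : ∃ C : ℝ, 0 ≤ C ∧ ∀ {I : Set ℝ} {ξ : ℝ → Plane → Cl}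
    {𝔞 : ℝ → Plane → ℝ} {t ε : ℝ}, Wave I ξ 𝔞 → IsCoordChange I ξ → t ∈ I → 0 ≤ ε → ε ≤ 1 / 4 →
    WaveSizeLE I ξ t ε → ∀ x, |aCoef ξ 𝔞 t (kPlane ξ t x) - 1 -
      aCoef ξ 𝔞 t (kPlane ξ t x) * (normal (lam ξ t) (kPlane ξ t x)).imK| ≤ C * ε ^ 2 := by
  obtain ⟨D, hD, key⟩ := exists_pval_bound
  refine ⟨(1 + (5 : ℕ)) * D * 128, by positivity, ?_⟩
  intro I ξ 𝔞 t ε W K ht hε hε' hs x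
  have H := W.smallGraph K ht hε hε' hs
  have hN0 := W.pd_re ht 0 x
  have hN1 := W.pd_re ht 1 x
  have hmom := W.sol.momentum t ht x
  have haf := congrArg (fun σ : Cl => σ.imK)
    ((W.a_formula K ht (kPlane ξ t x)).trans (W.aFormula_eq K ht x))
  have hL : aCoef ξ 𝔞 t (kPlane ξ t x) • normal (lam ξ t) (kPlane ξ t x) =
      𝔞 t x • cross (pd 0 (lagLam ξ t) x) (pd 1 (lagLam ξ t) x) := by
    rw [funext (W.lam_eq_pull K ht), aCoef_kPlane K ht, mul_smul]
    congr 1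
    exact (normal_chart (K.differentiable ht x) (W.differentiable_pull K ht W.lagLam_smooth _)
      (fun y => (pull_kPlane K ht (lagLam ξ) y).symm)).symm
  have hvx : vel I ξ t (kPlane ξ t x) = dt I ξ t x := pull_kPlane K ht (dt I ξ) x
  have hwx : acc I ξ t (kPlane ξ t x) = dt I (dt I ξ) t x := pull_kPlane K ht (dt I (dt I ξ)) x
  have h1 := W.hasPV_acceleration_zeta K ht hε hε' hs x
  have hG := W.hasPV_pd_heightPot_zeta K ht x
  rw [← hL, ← hwx] at haf
  rw [← hvx, ← hwx] at h1
  rw [← hwx] at hmom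
  -- the normal at `ζ(y)` is parallel to `w(y) + e₃`
  have hpar : ∀ η, ∃ s : ℝ, acc I ξ t η = s • normal (zeta ξ t) η - e₃ := fun η => by
    obtain ⟨y, rfl⟩ := (K t ht).1.2 η
    refine ⟨𝔞 t y * jacobian (kPlane ξ t) y, ?_⟩
    rw [mul_smul, ← W.normal_zeta K ht, ← W.sol.momentum t ht y, add_sub_cancel_right]
    exact pull_kPlane K ht (dt I (dt I ξ)) y
  set η := kPlane ξ t x with hη
  have h2 := (h1.pval.clm imKL).add
    (((hG 0).pval.clm (𝔞 t x • imKL.comp (mulL (pd 1 (ξ t) x)))).add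
      ((hG 1).pval.clm (-(𝔞 t x) • imKL.comp (mulL (pd 0 (ξ t) x)))))
  have hval : imKL (acc I ξ t η) +
      ((𝔞 t x • imKL.comp (mulL (pd 1 (ξ t) x))) (pd 0 (heightPot ξ t) x) +
        (-(𝔞 t x) • imKL.comp (mulL (pd 0 (ξ t) x))) (pd 1 (heightPot ξ t) x)) =
      aCoef ξ 𝔞 t η - 1 - aCoef ξ 𝔞 t η * (normal (lam ξ t) η).imK := by
    simp [cross_imK] at haf
    simp
    linarith
  rw [hval] at h2
  have hid : ∀ y, ‖imKL (kernelK (zeta ξ t y - zeta ξ t η) *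
        (normal (zeta ξ t) y * acc I ξ t y -
          crossT (zeta ξ t) (vel I ξ t y - vel I ξ t η) (vel I ξ t) y)) +
      ((𝔞 t x • imKL.comp (mulL (pd 1 (ξ t) x))) (kernelK (zeta ξ t y - zeta ξ t η) *
          (cross (pd 0 (ξ t) x) (tang (zeta ξ t) y) * e₃)) +
        (-(𝔞 t x) • imKL.comp (mulL (pd 0 (ξ t) x))) (kernelK (zeta ξ t y - zeta ξ t η) *
          (cross (pd 1 (ξ t) x) (tang (zeta ξ t) y) * e₃)))‖ ≤
      |inner ℝ (kernelK (zeta ξ t y - zeta ξ t η)) (normal (zeta ξ t) y)| * ‖acc I ξ t y‖ +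
      ‖kernelK (zeta ξ t y - zeta ξ t η)‖ * (‖vel I ξ t y - vel I ξ t η‖ *
        (2 * (‖pd 0 (vel I ξ t) y‖ + ‖pd 1 (vel I ξ t) y‖))) +
      ‖kernelK (zeta ξ t y - zeta ξ t η)‖ *
        (‖acc I ξ t y - acc I ξ t η‖ * ‖tang (zeta ξ t) y‖) := fun y => by
    have hκ := W.zeta_kernel_re ht η y
    obtain ⟨κ, hκe⟩ : ∃ κ, κ = kernelK (zeta ξ t y - zeta ξ t η) := ⟨_, rfl⟩
    rw [← hκe] at hκ ⊢
    obtain ⟨τ, hτ⟩ : ∃ τ, τ = tang (zeta ξ t) y := ⟨_, rfl⟩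
    rw [← hτ]
    obtain ⟨T, hT⟩ : ∃ T, T = crossT (zeta ξ t) (vel I ξ t y - vel I ξ t η) (vel I ξ t) y :=
      ⟨_, rfl⟩
    rw [← hT]
    obtain ⟨s, hsy⟩ := hpar y
    have e1 := vertical_identity (w := acc I ξ t η) hκ (N := normal (zeta ξ t) y) rfl hsy
      (hτ.trans (H.tang_eq y))
    have e2 := re_mul_cross_antisymm (τ := τ) hN0 hN1 hκ
    have e3 : (κ * cross (acc I ξ t η + e₃) τ).re = 𝔞 t x *
        (κ * cross (cross (pd 0 (ξ t) x) (pd 1 (ξ t) x)) τ).re := by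
      rw [hmom, normal, smul_cross, mul_smul_comm, Quaternion.re_smul, smul_eq_mul]
    have e4 : imKL (κ * (normal (zeta ξ t) y * acc I ξ t y - T)) +
        ((𝔞 t x • imKL.comp (mulL (pd 1 (ξ t) x))) (κ * (cross (pd 0 (ξ t) x) τ * e₃)) +
        (-(𝔞 t x) • imKL.comp (mulL (pd 0 (ξ t) x))) (κ * (cross (pd 1 (ξ t) x) τ * e₃))) =
        -(inner ℝ κ (normal (zeta ξ t) y)) * (acc I ξ t y).imK +
          (κ * cross (acc I ξ t η - acc I ξ t y) τ).re - (κ * T).imK := by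
      rw [← e1, e3, ← e2]
      simp only [mul_sub, map_sub, imKL_apply, ContinuousLinearMap.smul_apply,
        ContinuousLinearMap.comp_apply, mulL_apply, smul_eq_mul, Quaternion.imK_sub]
      ring
    rw [e4, Real.norm_eq_abs]
    refine (abs_sub _ _).trans ((add_le_add_left (abs_add_le _ _) _).trans ?_)
    rw [abs_mul, abs_neg]
    have a1 : |inner ℝ κ (normal (zeta ξ t) y)| * |(acc I ξ t y).imK| ≤
        |inner ℝ κ (normal (zeta ξ t) y)| * ‖acc I ξ t y‖ := by
      gcongr; exact abs_imK_le _
    have a2 : |(κ * cross (acc I ξ t η - acc I ξ t y) τ).re| ≤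
        ‖κ‖ * (‖acc I ξ t y - acc I ξ t η‖ * ‖τ‖) := by
      refine (abs_re_le _).trans ?_
      rw [norm_mul, norm_sub_rev (acc I ξ t y)]
      gcongr; exact norm_cross_le _ _
    have a3 : |(κ * T).imK| ≤ ‖κ‖ * (‖vel I ξ t y - vel I ξ t η‖ *
        (2 * (‖pd 0 (vel I ξ t) y‖ + ‖pd 1 (vel I ξ t) y‖))) := by
      refine (abs_imK_le _).trans ?_
      rw [norm_mul]
      gcongr
      exact (hT ▸ norm_crossT_le (H.norm_pd_le · y)).trans_eq (by ring)
    linarith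
  rw [← Real.norm_eq_abs]
  refine key (n := 5) (B := 128) (f := ![acc I ξ t, pd 0 (vel I ξ t), pd 1 (vel I ξ t),
      pd 0 (lam ξ t), pd 1 (lam ξ t)]) h2
    (by norm_num) hε ?_ ?_ (fun y hy h1 => (hid y).trans ?_) (fun y hy => (hid y).trans ?_)
  · intro i; fin_cases i
    · exact hs.acceleration.continuous.aestronglyMeasurable
    · exact aestronglyMeasurable_pd 0 _
    · exact aestronglyMeasurable_pd 1 _
    · exact aestronglyMeasurable_pd 0 _
    · exact aestronglyMeasurable_pd 1 _
  · intro i; fin_cases i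
    · exact hs.acceleration.2.2
    · exact hs.velocityDeriv 0
    · exact hs.velocityDeriv 1
    · exact (hs.slope 0).2.2
    · exact (hs.slope 1).2.2
  · have b1 := hs.acceleration.near_inner H hy
    have b2 := H.near_product hs.acceleration hy (norm_nonneg _) (H.norm_tang_le_const y)
    have b4 := H.near_product hs.velocity hy
      (τ := 2 * (‖pd 0 (vel I ξ t) y‖ + ‖pd 1 (vel I ξ t) y‖)) (by positivity)
      (by linarith [hs.velocity.norm_pd_le hε 0 y, hs.velocity.norm_pd_le hε 1 y])
    have b3 : 0 ≤ ε ^ 2 * ‖y - η‖⁻¹ := by positivity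
    linarith
  · have hyη := ne_of_one_le hy
    have b1 := H.far_inner (f := acc I ξ t) hyη
    have b2 := H.far_product hs.acceleration hyη (norm_nonneg (tang (zeta ξ t) y))
    have b3 := H.norm_tang_le y
    have b4 : 8 * ε * ((‖y - η‖ ^ 2)⁻¹ * ‖tang (zeta ξ t) y‖) ≤
        8 * ε * ((‖y - η‖ ^ 2)⁻¹ * (2 * (‖pd 0 (lam ξ t) y‖ + ‖pd 1 (lam ξ t) y‖))) := by gcongr
    have b6 := H.far_product hs.velocity hyη
      (τ := 2 * (‖pd 0 (vel I ξ t) y‖ + ‖pd 1 (vel I ξ t) y‖)) (by positivity)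
    have b5 : 0 ≤ ε * ((‖y - η‖ ^ 2)⁻¹ * (‖pd 0 (lam ξ t) y‖ + ‖pd 1 (lam ξ t) y‖)) := by
      positivity
    have b7 : 0 ≤ ε * ((‖y - η‖ ^ 2)⁻¹ * (‖pd 0 (vel I ξ t) y‖ + ‖pd 1 (vel I ξ t) y‖)) := by
      positivity
    have hsum : ∑ i, ‖(![acc I ξ t, pd 0 (vel I ξ t), pd 1 (vel I ξ t), pd 0 (lam ξ t),
          pd 1 (lam ξ t)] : Fin 5 → Plane → Cl) i y‖ =
        ‖acc I ξ t y‖ + (‖pd 0 (vel I ξ t) y‖ + ‖pd 1 (vel I ξ t) y‖) +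
          (‖pd 0 (lam ξ t) y‖ + ‖pd 1 (lam ξ t) y‖) := by
      rw [Fin.sum_univ_five, add_assoc, add_assoc (‖_‖ : ℝ)]; rfl
    rw [hsum]
    linarith

/-- `b` and `A - 1` are quadratically small. -/
theorem exists_quadratic_bound : ∃ C : ℝ, 0 < C ∧ ∀ {I : Set ℝ} {ξ : ℝ → Plane → Cl}
    {𝔞 : ℝ → Plane → ℝ} {t ε : ℝ}, Wave I ξ 𝔞 → IsCoordChange I ξ → t ∈ I → 0 ≤ ε → ε ≤ 1 / 4 →
    WaveSizeLE I ξ t ε → ∀ η, ‖bCoef I ξ t η‖ ≤ C * ε ^ 2 ∧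
      |aCoef ξ 𝔞 t η - 1| ≤ C * ε ^ 2 := by
  obtain ⟨C₁, hC₁, h₁⟩ := exists_bCoef_bound
  obtain ⟨C₂, hC₂, h₂⟩ := exists_aCoef_remainder_bound
  refine ⟨C₁ + 2 * (C₂ + 1), by positivity, ?_⟩
  intro I ξ 𝔞 t ε W K ht hε hε' hs η
  obtain ⟨x, rfl⟩ := (K t ht).1.2 η
  have a1 := h₁ W K ht hε hε' hs x
  have a2 := h₂ W K ht hε hε' hs x
  have he : 0 ≤ ε ^ 2 := sq_nonneg ε
  refine ⟨a1.trans (by nlinarith), ?_⟩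
  have hn : |(normal (lam ξ t) (kPlane ξ t x)).imK| ≤ ε ^ 2 := by
    refine (abs_imK_le _).trans ((norm_cross_le _ _).trans ?_)
    have s0 := (hs.slope 0).1 (kPlane ξ t x)
    have s1 := (hs.slope 1).1 (kPlane ξ t x)
    rw [sq]; gcongr
  set A := aCoef ξ 𝔞 t (kPlane ξ t x)
  set m := (normal (lam ξ t) (kPlane ξ t x)).imK
  -- `(A - 1) (1 - m) = r + m`, where `|m| ≤ ε² ≤ 1/2`
  have hm2 : |m| ≤ 1 / 2 := hn.trans (by nlinarith)
  have e : |(A - 1) * (1 - m)| ≤ (C₂ + 1) * ε ^ 2 := by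
    rw [show (A - 1) * (1 - m) = (A - 1 - A * m) + m by ring]
    refine (abs_add_le _ _).trans ?_
    linarith
  rw [abs_mul] at e
  have h1m : 1 / 2 ≤ |1 - m| := by
    have := le_abs_self (1 - m)
    have := le_abs_self m
    linarith
  nlinarith [abs_nonneg (A - 1), mul_nonneg hC₁ he]

end

end WaterWave

end

theorem mainTheorem4 :
    -- the formulas
    (∀ (I : Set ℝ) (ξ : ℝ → WaterWave.Plane → WaterWave.Cl) (𝔞 : ℝ → WaterWave.Plane → ℝ),
      Convex ℝ I → (interior I).Nonempty →
      WaterWave.IsSolution I ξ 𝔞 → WaterWave.IsRegular I ξ → WaterWave.IsCoordChange I ξ →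
      ∀ t ∈ I, ∀ x : WaterWave.Plane,
        (WaterWave.kMap ξ t x).re = 0 ∧ (WaterWave.kMap ξ t x).imK = 0 ∧
        WaterWave.IntegralsExist I ξ 𝔞 t x ∧ WaterWave.DerivativesExist I ξ t x ∧
        WaterWave.bCoef I ξ t x 0 • WaterWave.e₁ + WaterWave.bCoef I ξ t x 1 • WaterWave.e₂
          = WaterWave.bFormula I ξ t x ∧
        (WaterWave.aCoef ξ 𝔞 t x - 1) • WaterWave.e₃ = WaterWave.aFormula I ξ 𝔞 t x) ∧
    -- `b` and `A - 1` are of quadratic and higher order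
    (∃ C ε₀ : ℝ, 0 < C ∧ 0 < ε₀ ∧
      ∀ (I : Set ℝ) (ξ : ℝ → WaterWave.Plane → WaterWave.Cl) (𝔞 : ℝ → WaterWave.Plane → ℝ),
        Convex ℝ I → (interior I).Nonempty →
        WaterWave.IsSolution I ξ 𝔞 → WaterWave.IsRegular I ξ → WaterWave.IsCoordChange I ξ →
        ∀ t ∈ I, ∀ ε : ℝ, 0 ≤ ε → ε ≤ ε₀ → WaterWave.WaveSizeLE I ξ t ε →
          ∀ x : WaterWave.Plane,
            ‖WaterWave.bCoef I ξ t x‖ ≤ C * ε ^ 2 ∧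
            |WaterWave.aCoef ξ 𝔞 t x - 1| ≤ C * ε ^ 2) := by
  refine ⟨fun I ξ 𝔞 hI hI' hs hr K t ht x => ?_, ?_⟩
  · have W : WaterWave.Wave I ξ 𝔞 := ⟨hI, hI', hs, hr⟩
    exact ⟨W.kMap_re ht x, W.kMap_imK ht x, W.integralsExist K ht x, W.derivativesExist K ht x,
      W.b_formula K ht x, W.a_formula K ht x⟩
  · obtain ⟨C, hC, h⟩ := WaterWave.exists_quadratic_bound
    exact ⟨C, 1 / 4, hC, by norm_num, fun I ξ 𝔞 hI hI' hs hr K t ht ε hε hε' hw x =>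
      h ⟨hI, hI', hs, hr⟩ K ht hε hε' hw x⟩
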